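/- Let $\mathbb F$ be a field of characteristic $0$. Variables indexed by $1,\dots,r$ are even ($p_i=0$) and those indexed by $r+1,\dots,r+s$ are odd ($p_i=1$); $\mathbb F[\lambda]$, $\mathbb F[\partial]$ denote the supercommutative polynomial algebras in $r$ even and $s$ odd variables and $\mathbb F[[y]]$ the corresponding algebra of formal power series. A \emph{Lie conformal superalgebra} of type $(r,s)$ is a $\mathbb Z/2$-graded $\mathbb F[\partial]$-bimodule $R$ with $a\partial_i=(-1)^{p_ip(a)}\partial_ia$ and a $\mathbb Z/2$-graded bilinear $\lambda$-bracket $R\times R\to\mathbb F[\lambda]\otimes R$ such that $[(\partial_ia)_\lambda b]=-\lambda_i[a_\lambda b]$, $[a_\lambda(b\partial_i)]=[a_\lambda b](\partial_i+\lambda_i)$, $[b_\lambda a]=-(-1)^{p(a)p(b)}[a_{-\lambda-\partial}b]$ and $[a_\lambda[b_\mu c]]=[[a_\lambda b]_{\lambda+\mu}c]+(-1)^{p(a)p(b)}[b_\mu[a_\lambda c]]$. Its \emph{annihilation algebra} is $\mathcal A(R)=\tilde R/\sum_i(\partial_i+\partial_{y_i})\tilde R$, where $\tilde R=R\otimes\mathbb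 F[[y]]$ and $\partial_{y_i}(af)=(-1)^{p_ip(a)}a\,\partial_{y_i}f$, with bracket $[fa,bg]=(f[a_{\partial_y}b])g$ ($\partial_y$ acting on $f$ from the right); it carries the finest linear topology for which all maps $\mathbb F[[y]]\to\mathcal A(R)$, $f\mapsto af$, are continuous, and the operators $\partial_{y_i}$ act on it. A \emph{$\mathbb Z$-grading} of $R$ is a decomposition $R=\bigoplus_dR_d$ into $\mathbb Z/2$-graded subspaces such that, with $\deg(\lambda_ia)=\deg a-2$, one has $\deg(\partial_ia)=\deg a-2$ and $\deg[a_\lambda b]=\deg a+\deg b$; the \emph{induced grading} of $\mathcal A(R)$ is $\deg(a\,y_K)=\deg a+2\ell(K)$, where $\ell(K)$ is the number of factors of the monomial $y_K$. A linearly compact Lie superalgebra $L$ has a \emph{$D$-conformal structure over $R$} if (1) $L\cong\mathcal A(R)$; (2) $R$ is $\mathbb Z$-graded; (3) the induced $\mathbb Z$-gradation $\mathcal A(R)=\prod_j\mathcal A(R)_j$ has depth at most $3$; (4) $\mathcal A(R)_{-1}$ and $\mathcal A(R)_{-3}$ are purely odd; (5) $\operatorname{ad}:\mathcal A(R)_{-2}\to\operatorname{Der}\mathcal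 A(R)$ is injective with image $D=\langle\partial_{y_1},\dots,\partial_{y_{r+s}}\rangle$. Let $RW(4,4)$ be the free $\mathbb F[\partial]$-module on even generators $a_1,\dots,a_4$ and odd generators $a_5,\dots,a_8$ of degree $-2$, with $[{a_i}_\lambda a_j]=(\partial_i+\lambda_i)a_j+a_i\lambda_j$ extended by the first two identities above. Put $\nu_1=\partial_6\partial_7\partial_8$, $\nu_2=-\partial_5\partial_7\partial_8$, $\nu_3=\partial_5\partial_6\partial_8$, $\nu_4=-\partial_5\partial_6\partial_7$, $\nu_5=\dots=\nu_8=0$, $B=\sum_{i=1}^4\partial_i\partial_{i+4}$, $C=\sum_{i=1}^4(\partial_ia_{i+4}+\partial_{i+4}a_i)$, $$\alpha_i=\partial_iBC-2\nu_iC+\partial_i\sum_{k=1}^4\nu_ka_{k+4}\qquad(i=1,\dots,8),$$ and let $RE(4,4)$ be the $\mathbb F[\partial]$-submodule of $RW(4,4)$ generated by $\alpha_1,\dots,\alpha_8$. \textbf{Statement.} With the operations inherited from $RW(4,4)$, $RE(4,4)$ is a Lie conformal superalgebra of type $(4,4)$, and the Lie superalgebra $\mathcal A(RE(4,4))$ is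 linearly compact and has a $D$-conformal structure over $RE(4,4)$. More precisely, $RE(4,4)$ is $\mathbb Z$-graded by the degree inherited from $RW(4,4)$, for which $\deg\alpha_i=-10$; the induced gradation of $\mathcal A(RE(4,4))$ has depth exactly $2$; its components of degrees $-1$ and $-3$ vanish; and $\operatorname{ad}:\mathcal A(RE(4,4))_{-2}\to\operatorname{Der}\mathcal A(RE(4,4))$ is injective with image $\langle\partial_{y_1},\dots,\partial_{y_8}\rangle$. -/

import Mathlib

open scoped TensorProduct

noncomputable section

namespace ConformalSuper

/-! ## Supercommuting variables

`Var r s` indexes `r` even variables (`Sum.inl`) and `s` odd variables (`Sum.inr`). -/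

/-- Index set of `r` even and `s` odd variables. -/
abbrev Var (r s : ℕ) := Fin r ⊕ Fin s

/-- Parity of a variable. -/
def varParity {r s : ℕ} : Var r s → ZMod 2
  | Sum.inl _ => 0
  | Sum.inr _ => 1

/-- The Koszul sign `(-1) ^ (p q)`. -/
def koszul (p q : ZMod 2) : ℤ := if p = 1 ∧ q = 1 then -1 else 1

/-- Monomials `x^e x_S`: exponents of the even variables, and the set of odd variables occurring.
The odd variables are multiplied in increasing order. -/
abbrev Mon (r s : ℕ) := (Fin r →₀ ℕ) × Finset (Fin s)

/-- The monomial `1`. -/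
def monOne {r s : ℕ} : Mon r s := (0, ∅)

/-- Parity of a monomial. -/
def monParity {r s : ℕ} (m : Mon r s) : ZMod 2 := (m.2.card : ZMod 2)

/-- Number of factors of a monomial. -/
def monLength {r s : ℕ} (m : Mon r s) : ℕ := m.1.degree + m.2.card

/-- `x_j x_S = oddSign j S • x_{S ∪ {j}}` for odd variables. -/
def oddSign {s : ℕ} (j : Fin s) (S : Finset (Fin s)) : ℤ :=
  if j ∈ S then 0 else (-1) ^ (S.filter (· < j)).card

/-- `x_i x^m = varSign i m • x^(varMul i m)`. -/
def varMul {r s : ℕ} : Var r s → Mon r s → Mon r s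
  | Sum.inl i, m => (m.1 + Finsupp.single i 1, m.2)
  | Sum.inr j, m => (m.1, insert j m.2)

/-- `x_i x^m = varSign i m • x^(varMul i m)`. -/
def varSign {r s : ℕ} : Var r s → Mon r s → ℤ
  | Sum.inl _, _ => 1
  | Sum.inr j, m => oddSign j m.2

/-- Evaluation of the monomial `x^m` at a family of operators (even factors first, then the odd
ones in increasing order). -/
def monOp {r s : ℕ} {A : Type*} [Ring A] (T : Var r s → A) (m : Mon r s) : A :=
  ((List.finRange r).map fun i => T (Sum.inl i) ^ m.1 i).prod *
    ((List.finRange s).map fun j => if j ∈ m.2 then T (Sum.inr j) else 1).prod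

/-- `F[x] ⊗ V`, where `F[x] = F[x_1, …, x_r] ⊗ Λ(x_{r+1}, …, x_{r+s})`; the element
`x^m ⊗ v` is `Finsupp.single m v`. -/
abbrev Poly (r s : ℕ) (V : Type*) [Zero V] := Mon r s →₀ V

section Poly

variable (F : Type*) [Field F] (r s : ℕ) (V : Type*) [AddCommGroup V] [Module F V]

/-- Left multiplication by the variable `x_i` on `F[x] ⊗ V`. -/
def mulVar (i : Var r s) : Module.End F (Poly r s V) :=
  Finsupp.lsum F fun m => varSign i m • Finsupp.lsingle (varMul i m)

/-- An operator `T` of parity `p` on `V` acting on `F[x] ⊗ V`: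
`T (x^m ⊗ v) = (-1)^(p p(m)) x^m ⊗ T v`. -/
def coeffAct (p : ZMod 2) (T : Module.End F V) : Module.End F (Poly r s V) :=
  Finsupp.lsum F fun m => koszul p (monParity m) • (Finsupp.lsingle m).comp T

end Poly

/-! ## Lie conformal superalgebras of type `(r, s)` -/

/-- The operations of a Lie conformal superalgebra: a parity, left actions of the `∂_i` and a
`λ`-bracket `R ⊗ R → F[λ] ⊗ R`. (The right action is `a ∂_i = (-1)^(p_i p(a)) ∂_i a`.) -/
structure ConformalData (F : Type*) [Field F] (r s : ℕ)
    (R : Type*) [AddCommGroup R] [Module F R] where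
  /-- even and odd part -/
  par : ZMod 2 → Submodule F R
  /-- the action of `∂_i` -/
  D : Var r s → Module.End F R
  /-- the `λ`-bracket -/
  bracket : R →ₗ[F] R →ₗ[F] Poly r s R

namespace ConformalData

variable {F : Type*} [Field F] {r s : ℕ} {R : Type*} [AddCommGroup R] [Module F R]
variable (S : ConformalData F r s R)

/-- The action of `∂_i` on `F[λ] ⊗ R`. -/
def DPoly (i : Var r s) : Module.End F (Poly r s R) := coeffAct F r s R (varParity i) (S.D i)

/-- The substitution `P(λ) ⊗ a ↦ P(-λ-∂) a`. -/
def substNeg : Poly r s R →ₗ[F] Poly r s R :=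
  Finsupp.lsum F fun m =>
    (monOp (fun i => -(mulVar F r s R i + S.DPoly i)) m).comp (Finsupp.lsingle monOne)

/-- Multiplication by `λ_i` on `F[λ] ⊗ F[μ] ⊗ R`. -/
def lam (F : Type*) [Field F] (r s : ℕ) (R : Type*) [AddCommGroup R] [Module F R]
    (i : Var r s) : Module.End F (Poly r s (Poly r s R)) := mulVar F r s (Poly r s R) i

/-- Multiplication by `μ_i` on `F[λ] ⊗ F[μ] ⊗ R`. -/
def mu (F : Type*) [Field F] (r s : ℕ) (R : Type*) [AddCommGroup R] [Module F R]
    (i : Var r s) : Module.End F (Poly r s (Poly r s R)) :=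
  coeffAct F r s (Poly r s R) (varParity i) (mulVar F r s R i)

/-- `[a_λ [b_μ c]]` in `F[λ] ⊗ F[μ] ⊗ R`, for `a` of parity `p`
(with `[a_λ (μ^m d)] = (-1)^(p p(m)) μ^m [a_λ d]`). -/
def jacLeft (p : ZMod 2) (a b c : R) : Poly r s (Poly r s R) :=
  (S.bracket b c).sum fun m d => koszul p (monParity m) •
    monOp (mu F r s R) m
      (Finsupp.mapRange.linearMap (Finsupp.lsingle (R := F) (monOne : Mon r s)) (S.bracket a d))

/-- `[[a_λ b]_{λ+μ} c]` in `F[λ] ⊗ F[μ] ⊗ R`. -/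
def jacMid (a b c : R) : Poly r s (Poly r s R) :=
  (S.bracket a b).sum fun m d => monOp (lam F r s R) m
    ((S.bracket d c).sum fun n e =>
      monOp (fun i => lam F r s R i + mu F r s R i) n
        (Finsupp.single monOne (Finsupp.single monOne e)))

/-- `[b_μ [a_λ c]]` in `F[λ] ⊗ F[μ] ⊗ R`, for `b` of parity `q`. -/
def jacRight (q : ZMod 2) (a b c : R) : Poly r s (Poly r s R) :=
  (S.bracket a c).sum fun m d => koszul q (monParity m) • Finsupp.single m (S.bracket b d)

/-- `S` is the structure inherited from `T` by the subspace `N`. -/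
structure IsInherited {N : Submodule F R} (S : ConformalData F r s N)
    (T : ConformalData F r s R) : Prop where
  par : ∀ p (a : N), a ∈ S.par p ↔ (a : R) ∈ T.par p
  D : ∀ i (a : N), (S.D i a : R) = T.D i a
  bracket : ∀ (a b : N) m, (S.bracket a b m : R) = T.bracket a b m

end ConformalData

/-- A Lie conformal superalgebra of type `(r, s)` with underlying space `R`. -/
structure LieConformalSuperalgebra (F : Type*) [Field F] (r s : ℕ)
    (R : Type*) [AddCommGroup R] [Module F R] extends ConformalData F r s R where
  par_isCompl : IsCompl (par 0) (par 1)
  D_comm : ∀ i j a, D i (D j a) = koszul (varParity i) (varParity j) • D j (D i a)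
  D_odd_sq : ∀ j a, D (Sum.inr j) (D (Sum.inr j) a) = 0
  D_par : ∀ i p, ∀ a ∈ par p, D i a ∈ par (p + varParity i)
  bracket_par : ∀ p q, ∀ a ∈ par p, ∀ b ∈ par q, ∀ m,
    bracket a b m ∈ par (p + q + monParity m)
  /-- `[(∂_i a)_λ b] = -λ_i [a_λ b]` -/
  bracket_D_left : ∀ i a b, bracket (D i a) b = -mulVar F r s R i (bracket a b)
  /-- `[a_λ (b ∂_i)] = [a_λ b] (∂_i + λ_i)`, written with left actions -/
  bracket_D_right : ∀ i p, ∀ a ∈ par p, ∀ b, bracket a (D i b) =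
    koszul (varParity i) p •
      (toConformalData.DPoly i (bracket a b) + mulVar F r s R i (bracket a b))
  /-- `[b_λ a] = -(-1)^(p(a) p(b)) [a_{-λ-∂} b]` -/
  skew : ∀ p q, ∀ a ∈ par p, ∀ b ∈ par q,
    bracket b a = -(koszul p q • toConformalData.substNeg (bracket a b))
  /-- `[a_λ [b_μ c]] = [[a_λ b]_{λ+μ} c] + (-1)^(p(a) p(b)) [b_μ [a_λ c]]` -/
  jacobi : ∀ p q, ∀ a ∈ par p, ∀ b ∈ par q, ∀ c,
    toConformalData.jacLeft p a b c =
      toConformalData.jacMid a b c + koszul p q • toConformalData.jacRight q a b c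

/-! ## Formal power series in `r` even and `s` odd variables -/

/-- `F[[y]] = F[[y_1, …, y_r]] ⊗ Λ(y_{r+1}, …, y_{r+s})`; the series `∑_S f_S y_S` is the
function `S ↦ f_S`. -/
abbrev Series (F : Type*) (r s : ℕ) := Finset (Fin s) → MvPowerSeries (Fin r) F

section Series

variable {F : Type*} [Field F] {r s : ℕ}

/-- The monomial `y^m`. -/
def seriesMon (F : Type*) [Field F] {r s : ℕ} (m : Mon r s) : Series F r s :=
  Pi.single m.2 (MvPowerSeries.monomial m.1 1)

/-- The partial derivatives `∂_{y_i}` (left derivations). -/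
def seriesD : Var r s → Module.End F (Series F r s)
  | Sum.inl i => LinearMap.pi fun T =>
      (MvPowerSeries.pderiv F i).toLinearMap.comp (LinearMap.proj T)
  | Sum.inr j => LinearMap.pi fun T => oddSign j T • LinearMap.proj (insert j T)

/-- `y_T y_U = crossSign T U • y_{T ∪ U}` for disjoint `T`, `U`. -/
def crossSign {s : ℕ} (T U : Finset (Fin s)) : ℤ :=
  ∏ t ∈ T, ∏ u ∈ U, if u < t then -1 else 1

/-- The product of `F[[y]]`. -/
def seriesMul (f g : Series F r s) : Series F r s :=
  fun U => ∑ T ∈ U.powerset, crossSign T (U \ T) • (f T * g (U \ T))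

/-- The homogeneous component of parity `p`. -/
def seriesPart (p : ZMod 2) : Module.End F (Series F r s) :=
  LinearMap.pi fun T => if (T.card : ZMod 2) = p then LinearMap.proj T else 0

/-- `f` has no monomials with fewer than `n` factors. -/
def seriesOrderGE (n : ℕ) (f : Series F r s) : Prop :=
  ∀ m : Mon r s, monLength m < n → MvPowerSeries.coeff m.1 (f m.2) = 0

end Series

/-! ## Helper facts -/

set_option linter.unusedSimpArgs false

theorem koszul_comm (p q : ZMod 2) : koszul p q = koszul q p := by
  simp only [koszul, and_comm]

theorem koszul_add_right (p q t : ZMod 2) : koszul p (q + t) = koszul p q * koszul p t := by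
  revert p q t; decide

theorem koszul_mul_self (p q : ZMod 2) : koszul p q * koszul p q = 1 := by
  revert p q; decide

theorem koszul_zero_left (q : ZMod 2) : koszul 0 q = 1 := by
  revert q; decide

theorem koszul_one_natCast (n : ℕ) : koszul 1 (n : ZMod 2) = (-1) ^ n := by
  induction n with
  | zero => decide
  | succ n ih =>
    rw [Nat.cast_succ, koszul_add_right, ih, pow_succ]; rfl

theorem zmod2_cases (p : ZMod 2) : p = 0 ∨ p = 1 := by
  revert p; decide

theorem monParity_varMul {r s : ℕ} (i : Var r s) (m : Mon r s) (h : varSign i m ≠ 0) :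
    monParity (varMul i m) = varParity i + monParity m := by
  rcases i with i | j
  · simp [monParity, varMul, varParity]
  · have hj : j ∉ m.2 := by
      intro hj; apply h; simp [varSign, oddSign, hj]
    simp [monParity, varMul, varParity, Finset.card_insert_of_notMem hj, add_comm]

section MonOp

variable {r s : ℕ} {A : Type*} [Ring A] (T : Var r s → A)

theorem even_insert (hc : ∀ i j, T i * T j = koszul (varParity i) (varParity j) • (T j * T i))
    (i : Fin r) (e : Fin r →₀ ℕ) (l : List (Fin r)) (hl : l.Nodup) :
    (l.map fun k => T (Sum.inl k) ^ (e + Finsupp.single i (1 : ℕ) : Fin r →₀ ℕ) k).prod =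
      if i ∈ l then T (Sum.inl i) * (l.map fun k => T (Sum.inl k) ^ e k).prod
      else (l.map fun k => T (Sum.inl k) ^ e k).prod := by
  induction l with
  | nil => simp
  | cons k l ih =>
    rw [List.nodup_cons] at hl
    rw [List.map_cons, List.prod_cons, ih hl.2, List.map_cons, List.prod_cons]
    by_cases hk : k = i
    · subst hk
      simp [hl.1, pow_succ', mul_assoc]
    · have hcm : Commute (T (Sum.inl i)) (T (Sum.inl k) ^ e k) := by
        apply Commute.pow_right
        have := hc (Sum.inl i) (Sum.inl k)
        rwa [varParity, koszul_zero_left, one_smul] at this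
      have hk' : i ≠ k := fun h => hk h.symm
      by_cases hi : i ∈ l
      · simp only [hi, if_true, List.mem_cons, or_true, Finsupp.add_apply,
          Finsupp.single_apply, hk', if_false, add_zero]
        rw [← mul_assoc, ← mul_assoc, hcm.eq]
      · simp [hi, hk']

theorem odd_insert (hc : ∀ i j, T i * T j = koszul (varParity i) (varParity j) • (T j * T i))
    (h0 : ∀ j, T (Sum.inr j) * T (Sum.inr j) = 0)
    (j : Fin s) (S : Finset (Fin s)) (l : List (Fin s)) (hl : l.Pairwise (· < ·)) (hj : j ∈ l) :
    T (Sum.inr j) * (l.map fun k => if k ∈ S then T (Sum.inr k) else 1).prod =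
      (if j ∈ S then 0 else (-1 : ℤ) ^ (S.filter fun k => k < j ∧ k ∈ l).card) •
        (l.map fun k => if k ∈ insert j S then T (Sum.inr k) else 1).prod := by
  induction l with
  | nil => simp at hj
  | cons k l ih =>
    rw [List.pairwise_cons] at hl
    have hkl : k ∉ l := fun h => lt_irrefl _ (hl.1 k h)
    rw [List.map_cons, List.prod_cons, List.map_cons, List.prod_cons]
    by_cases hk : j = k
    · subst hk
      by_cases hS : j ∈ S
      · simp only [hS, if_true, zero_smul]
        rw [← mul_assoc, h0, zero_mul]
      · have hf : (S.filter fun x => x < j ∧ x ∈ j :: l) = ∅ := by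
          apply Finset.filter_eq_empty_iff.mpr
          rintro x - ⟨h1, h2⟩
          rcases List.mem_cons.mp h2 with rfl | h2
          · exact lt_irrefl _ h1
          · exact lt_asymm h1 (hl.1 x h2)
        simp only [hS, if_false, hf, Finset.card_empty, pow_zero, one_smul, one_mul,
          Finset.mem_insert_self, if_true]
        congr 2
        apply List.map_congr_left
        intro x hx
        have : x ≠ j := by rintro rfl; exact hkl hx
        simp [this]
    · have hjl : j ∈ l := (List.mem_cons.mp hj).resolve_left hk
      have hkj : k < j := hl.1 j hjl
      have hk' : k ≠ j := fun h => hk h.symm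
      by_cases hkS : k ∈ S
      · have hsw : T (Sum.inr j) * T (Sum.inr k) = -(T (Sum.inr k) * T (Sum.inr j)) := by
          have := hc (Sum.inr j) (Sum.inr k)
          simpa [varParity, koszul] using this
        have hf : (S.filter fun x => x < j ∧ x ∈ k :: l) =
            insert k (S.filter fun x => x < j ∧ x ∈ l) := by
          ext x
          simp only [Finset.mem_filter, List.mem_cons, Finset.mem_insert]
          constructor
          · rintro ⟨h1, h2, rfl | h3⟩
            · exact Or.inl rfl
            · exact Or.inr ⟨h1, h2, h3⟩
          · rintro (rfl | ⟨h1, h2, h3⟩)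
            · exact ⟨hkS, hkj, Or.inl rfl⟩
            · exact ⟨h1, h2, Or.inr h3⟩
        have hn : k ∉ S.filter fun x => x < j ∧ x ∈ l := by simp [hkl]
        simp only [hkS, if_true, Finset.mem_insert, or_true]
        rw [← mul_assoc, hsw, neg_mul, mul_assoc, ih hl.2 hjl, hf, Finset.card_insert_of_notMem hn]
        by_cases hS : j ∈ S
        · simp [hS]
        · simp only [hS, if_false, pow_succ, mul_neg, mul_one, neg_smul, mul_smul_comm,
            Finset.mem_insert]
      · have hf : (S.filter fun x => x < j ∧ x ∈ k :: l) = S.filter fun x => x < j ∧ x ∈ l := by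
          apply Finset.filter_congr
          intro x hx
          have : x ≠ k := by rintro rfl; exact hkS hx
          simp [this]
        simp only [hkS, if_false, Finset.mem_insert, hk', or_self, one_mul, hf]
        rw [ih hl.2 hjl]
        simp only [Finset.mem_insert]

/-- Multiplying an evaluated monomial by one more operator. -/
theorem monOp_varMul
    (hc : ∀ i j, T i * T j = koszul (varParity i) (varParity j) • (T j * T i))
    (h0 : ∀ j, T (Sum.inr j) * T (Sum.inr j) = 0) (i : Var r s) (m : Mon r s) :
    T i * monOp T m = varSign i m • monOp T (varMul i m) := by
  rcases i with i | j
  · simp only [varSign, one_smul, monOp, varMul]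
    rw [even_insert T hc i m.1 _ (List.nodup_finRange r), if_pos (List.mem_finRange i), mul_assoc]
    rfl
  · simp only [varSign, monOp, varMul, oddSign]
    have hcm : Commute (T (Sum.inr j)) ((List.finRange r).map
        fun k => T (Sum.inl k) ^ m.1 k).prod := by
      apply Commute.list_prod_right
      intro x hx
      obtain ⟨k, -, rfl⟩ := List.mem_map.mp hx
      apply Commute.pow_right
      have := hc (Sum.inr j) (Sum.inl k)
      rwa [varParity, varParity, koszul_comm, koszul_zero_left, one_smul] at this
    rw [← mul_assoc, hcm.eq, mul_assoc,
      odd_insert T hc h0 j m.2 _ (List.pairwise_lt_finRange s) (List.mem_finRange j)]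
    simp only [List.mem_finRange, and_true, mul_smul_comm]
    rfl

/-- An operator supercommuting with every `T_i` supercommutes with monomials in the `T_i`. -/
theorem monOp_superComm (p : ZMod 2) (X : A)
    (hX : ∀ i, X * T i = koszul p (varParity i) • (T i * X)) (m : Mon r s) :
    X * monOp T m = koszul p (monParity m) • (monOp T m * X) := by
  have hE : Commute X ((List.finRange r).map fun k => T (Sum.inl k) ^ m.1 k).prod := by
    apply Commute.list_prod_right
    intro x hx
    obtain ⟨k, -, rfl⟩ := List.mem_map.mp hx
    apply Commute.pow_right
    have := hX (Sum.inl k)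
    rwa [varParity, koszul_comm, koszul_zero_left, one_smul] at this
  have hO : ∀ l : List (Fin s), l.Nodup →
      X * (l.map fun k => if k ∈ m.2 then T (Sum.inr k) else 1).prod =
        koszul p ((m.2.filter (· ∈ l)).card : ZMod 2) •
          ((l.map fun k => if k ∈ m.2 then T (Sum.inr k) else 1).prod * X) := by
    intro l
    induction l with
    | nil => intro _; simp [koszul_comm p 0, koszul_zero_left]
    | cons k l ih =>
      intro hl
      rw [List.nodup_cons] at hl
      rw [List.map_cons, List.prod_cons]
      by_cases hk : k ∈ m.2
      · have hf : (m.2.filter (· ∈ k :: l)) = insert k (m.2.filter (· ∈ l)) := by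
          ext x
          simp only [Finset.mem_filter, List.mem_cons, Finset.mem_insert]
          constructor
          · rintro ⟨h1, rfl | h3⟩
            · exact Or.inl rfl
            · exact Or.inr ⟨h1, h3⟩
          · rintro (rfl | ⟨h1, h3⟩)
            · exact ⟨hk, Or.inl rfl⟩
            · exact ⟨h1, Or.inr h3⟩
        have hn : k ∉ m.2.filter (· ∈ l) := by simp [hl.1]
        simp only [hk, if_true]
        rw [← mul_assoc, hX, smul_mul_assoc, mul_assoc, ih hl.2, hf,
          Finset.card_insert_of_notMem hn, Nat.cast_succ, koszul_add_right, varParity,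
          mul_smul_comm, smul_smul, mul_comm (koszul p 1), mul_assoc]
      · have hf : (m.2.filter (· ∈ k :: l)) = m.2.filter (· ∈ l) := by
          apply Finset.filter_congr
          intro x hx
          have : x ≠ k := by rintro rfl; exact hk hx
          simp [this]
        simp only [hk, if_false, one_mul, hf]
        exact ih hl.2
  have := hO _ (List.nodup_finRange s)
  simp only [List.mem_finRange, Finset.filter_true] at this
  simp only [monOp, monParity]
  rw [← mul_assoc, hE.eq, mul_assoc, this, mul_smul_comm, mul_assoc]

end MonOp

section SeriesFacts

variable {F : Type*} [Field F] {r s : ℕ}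

theorem seriesD_inl (i : Fin r) (f : Series F r s) (T : Finset (Fin s)) :
    seriesD (Sum.inl i) f T = MvPowerSeries.pderiv F i (f T) := rfl

theorem seriesD_inr (j : Fin s) (f : Series F r s) (T : Finset (Fin s)) :
    seriesD (Sum.inr j) f T = oddSign j T • f (insert j T) := rfl

theorem seriesPart_apply (p : ZMod 2) (f : Series F r s) (T : Finset (Fin s)) :
    seriesPart p f T = if (T.card : ZMod 2) = p then f T else 0 := by
  simp only [seriesPart, LinearMap.pi_apply]
  split_ifs <;> rfl

theorem seriesMul_add_left (f f' g : Series F r s) :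
    seriesMul (f + f') g = seriesMul f g + seriesMul f' g := by
  funext U
  simp [seriesMul, add_mul, Finset.sum_add_distrib]

theorem seriesMul_add_right (f g g' : Series F r s) :
    seriesMul f (g + g') = seriesMul f g + seriesMul f g' := by
  funext U
  simp [seriesMul, mul_add, Finset.sum_add_distrib]

theorem seriesMul_smul_left (c : F) (f g : Series F r s) :
    seriesMul (c • f) g = c • seriesMul f g := by
  funext U
  simp only [seriesMul, Pi.smul_apply, Finset.smul_sum]
  refine Finset.sum_congr rfl fun T _ => ?_
  rw [smul_mul_assoc, smul_comm]

theorem seriesMul_smul_right (c : F) (f g : Series F r s) :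
    seriesMul f (c • g) = c • seriesMul f g := by
  funext U
  simp only [seriesMul, Pi.smul_apply, Finset.smul_sum]
  refine Finset.sum_congr rfl fun T _ => ?_
  rw [mul_smul_comm, smul_comm]

theorem seriesD_part (i : Var r s) (p : ZMod 2) (f : Series F r s) :
    seriesD i (seriesPart p f) = seriesPart (p + varParity i) (seriesD i f) := by
  funext T
  rcases i with i | j
  · simp only [seriesD_inl, seriesPart_apply, varParity, add_zero]
    split_ifs <;> simp
  · simp only [seriesD_inr, seriesPart_apply, varParity, oddSign]
    by_cases hj : j ∈ T
    · simp [hj]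
    · simp only [hj, if_false, Finset.card_insert_of_notMem hj, Nat.cast_add, Nat.cast_one]
      have : ((T.card : ZMod 2) + 1 = p) ↔ ((T.card : ZMod 2) = p + 1) := by
        generalize (T.card : ZMod 2) = q
        revert p q; decide
      simp only [this]
      split_ifs <;> simp

theorem seriesD_odd_sq (j : Fin s) :
    seriesD (F := F) (r := r) (Sum.inr j) * seriesD (Sum.inr j) = 0 := by
  refine LinearMap.ext fun f => funext fun T => ?_
  simp [Module.End.mul_apply, seriesD_inr, oddSign]

theorem pderiv_comm' (i j : Fin r) (f : MvPowerSeries (Fin r) F) :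
    MvPowerSeries.pderiv F i (MvPowerSeries.pderiv F j f) =
      MvPowerSeries.pderiv F j (MvPowerSeries.pderiv F i f) := by
  ext n
  simp only [MvPowerSeries.coeff_pderiv, Finsupp.add_apply, Finsupp.single_apply]
  rw [add_right_comm]
  by_cases h : i = j
  · subst h; rfl
  · have h' : j ≠ i := fun e => h e.symm
    simp [h, h']
    ring

theorem oddSign_swap (j k : Fin s) (T : Finset (Fin s)) :
    oddSign j T * oddSign k (insert j T) = -(oddSign k T * oddSign j (insert k T)) := by
  have key : ∀ j k : Fin s, j < k → oddSign j T * oddSign k (insert j T) =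
      -(oddSign k T * oddSign j (insert k T)) := by
    intro j k h
    have h1 : j ≠ k := h.ne
    by_cases hj : j ∈ T
    · simp [oddSign, hj]
    by_cases hk : k ∈ T
    · simp [oddSign, hk]
    simp only [oddSign, hj, hk, Finset.mem_insert, h1, h1.symm, or_self, if_false]
    rw [Finset.filter_insert, if_pos h, Finset.filter_insert, if_neg (not_lt.mpr h.le),
      Finset.card_insert_of_notMem (by simp [hj])]
    ring
  rcases lt_trichotomy j k with h | rfl | h
  · exact key j k h
  · simp [oddSign]
  · rw [key k j h, neg_neg]

theorem seriesD_comm (i j : Var r s) :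
    seriesD (F := F) i * seriesD j =
      koszul (varParity i) (varParity j) • (seriesD j * seriesD i) := by
  refine LinearMap.ext fun f => funext fun T => ?_
  rcases i with i | i <;> rcases j with j | j
  · simp only [Module.End.mul_apply, LinearMap.smul_apply, seriesD_inl, Pi.smul_apply,
      varParity, koszul_zero_left, one_smul]
    exact pderiv_comm' _ _ _
  · simp only [Module.End.mul_apply, LinearMap.smul_apply, seriesD_inl, seriesD_inr,
      Pi.smul_apply, varParity, koszul_zero_left, one_smul, map_zsmul]
  · simp only [Module.End.mul_apply, LinearMap.smul_apply, seriesD_inl, seriesD_inr,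
      Pi.smul_apply, varParity, koszul_comm 1 0, koszul_zero_left, one_smul, map_zsmul]
  · simp only [Module.End.mul_apply, LinearMap.smul_apply, seriesD_inr,
      Pi.smul_apply, varParity, smul_smul, Finset.insert_comm j i T]
    rw [oddSign_swap]
    simp [koszul]

theorem oddSign_eq (j : Fin s) (S : Finset (Fin s)) (hj : j ∉ S) :
    oddSign j S = ∏ k ∈ S, if k < j then -1 else 1 := by
  rw [oddSign, if_neg hj, Finset.prod_ite]
  simp

theorem oddSign_mul_self (j : Fin s) (S : Finset (Fin s)) (hj : j ∉ S) :
    oddSign j S * oddSign j S = 1 := by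
  rw [oddSign, if_neg hj, ← pow_add, ← two_mul, pow_mul]; simp

theorem crossSign_insert_left (j : Fin s) (T U : Finset (Fin s)) (hj : j ∉ T) (hU : j ∉ U) :
    crossSign (insert j T) U = oddSign j U * crossSign T U := by
  rw [crossSign, Finset.prod_insert hj, oddSign_eq j U hU, crossSign]

theorem crossSign_insert_right (j : Fin s) (T U : Finset (Fin s)) (hj : j ∉ U) (hT : j ∉ T) :
    crossSign T (insert j U) = (-1) ^ T.card * oddSign j T * crossSign T U := by
  have h : ∏ t ∈ T, (if j < t then (-1 : ℤ) else 1) = (-1) ^ T.card * oddSign j T := by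
    rw [oddSign_eq j T hT, ← Finset.prod_const, ← Finset.prod_mul_distrib]
    refine Finset.prod_congr rfl fun t ht => ?_
    rcases lt_trichotomy j t with h | rfl | h
    · simp [h, not_lt.mpr h.le]
    · exact absurd ht hT
    · simp [h, not_lt.mpr h.le]
  simp only [crossSign]
  rw [← h, ← Finset.prod_mul_distrib]
  exact Finset.prod_congr rfl fun t _ => Finset.prod_insert hj

theorem oddSign_split (j : Fin s) (T U : Finset (Fin s)) (hj : j ∉ U) (hT : T ⊆ U) :
    oddSign j U = oddSign j T * oddSign j (U \ T) := by
  rw [oddSign_eq j U hj, oddSign_eq j T (fun h => hj (hT h)),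
    oddSign_eq j _ (fun h => hj (Finset.mem_sdiff.mp h).1), mul_comm, Finset.prod_sdiff hT]

/-- Super Leibniz rule. -/
theorem seriesD_mul (i : Var r s) (p : ZMod 2) (f g : Series F r s) :
    seriesD i (seriesMul (seriesPart p f) g) = seriesMul (seriesD i (seriesPart p f)) g +
      koszul (varParity i) p • seriesMul (seriesPart p f) (seriesD i g) := by
  funext U
  rcases i with i | j
  · simp only [seriesD_inl, seriesMul, Pi.add_apply, varParity, koszul_zero_left,
      one_smul, map_sum, map_zsmul, ← Finset.sum_add_distrib, ← smul_add]
    refine Finset.sum_congr rfl fun T _ => ?_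
    rw [Derivation.leibniz]
    simp only [smul_eq_mul]
    congr 1
    ring
  · simp only [Pi.add_apply, Pi.smul_apply, varParity]
    rw [seriesD_inr]
    by_cases hj : j ∈ U
    · obtain ⟨U, hU, rfl⟩ : ∃ W, j ∉ W ∧ U = insert j W :=
        ⟨U.erase j, Finset.notMem_erase j U, (Finset.insert_erase hj).symm⟩
      have h0 : oddSign j (insert j U) = 0 := by simp [oddSign]
      rw [h0, zero_smul]
      simp only [seriesMul]
      rw [Finset.sum_powerset_insert hU, Finset.sum_powerset_insert hU, ← Finset.sum_add_distrib,
        ← Finset.sum_add_distrib, Finset.smul_sum, ← Finset.sum_add_distrib]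
      symm
      refine Finset.sum_eq_zero fun T hT => ?_
      rw [Finset.mem_powerset] at hT
      have hjT : j ∉ T := fun h => hU (hT h)
      have hjV : j ∉ U \ T := fun h => hU (Finset.mem_sdiff.mp h).1
      have e1 : insert j U \ T = insert j (U \ T) := Finset.insert_sdiff_of_notMem _ hjT
      have e2 : insert j U \ insert j T = U \ T := by
        rw [Finset.insert_sdiff_insert, Finset.sdiff_insert_of_notMem hU]
      have z1 : oddSign j (insert j T) = 0 := by simp [oddSign]
      have z2 : oddSign j (insert j (U \ T)) = 0 := by simp [oddSign]
      rw [e1, e2]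
      simp only [seriesD_inr, z1, z2, zero_smul, zero_mul, mul_zero, smul_zero, add_zero,
        zero_add, smul_mul_assoc, mul_smul_comm, smul_smul]
      rw [crossSign_insert_left j T _ hjT hjV, crossSign_insert_right j T _ hjV hjT,
        seriesPart_apply]
      split_ifs with hp
      · rw [← hp, koszul_one_natCast, Finset.card_insert_of_notMem hjT, ← add_smul]
        have h1 := oddSign_mul_self j T hjT
        have h2 := oddSign_mul_self j _ hjV
        have : (-1 : ℤ) ^ T.card * oddSign j T * crossSign T (U \ T) * oddSign j T +
            (-1) ^ (T.card + 1) * (oddSign j (U \ T) * crossSign T (U \ T) *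
              oddSign j (U \ T)) = 0 := by
          rw [pow_succ]
          linear_combination ((-1 : ℤ) ^ T.card * crossSign T (U \ T)) * h1 -
            ((-1 : ℤ) ^ T.card * crossSign T (U \ T)) * h2
        rw [this, zero_smul]
      · simp
    · simp only [seriesMul]
      rw [Finset.sum_powerset_insert hj, ← Finset.sum_add_distrib, Finset.smul_sum,
        Finset.smul_sum, ← Finset.sum_add_distrib]
      refine Finset.sum_congr rfl fun T hT => ?_
      rw [Finset.mem_powerset] at hT
      have hjT : j ∉ T := fun h => hj (hT h)
      have hjV : j ∉ U \ T := fun h => hj (Finset.mem_sdiff.mp h).1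
      have e1 : insert j U \ T = insert j (U \ T) := Finset.insert_sdiff_of_notMem _ hjT
      have e2 : insert j U \ insert j T = U \ T := by
        rw [Finset.insert_sdiff_insert, Finset.sdiff_insert_of_notMem hj]
      have h1 := oddSign_mul_self j T hjT
      have h2 := oddSign_mul_self j _ hjV
      rw [e1, e2]
      simp only [seriesD_inr, smul_mul_assoc, mul_smul_comm, smul_smul, smul_add]
      rw [crossSign_insert_left j T _ hjT hjV, crossSign_insert_right j T _ hjV hjT,
        oddSign_split j T U hj hT, add_comm]
      congr 1
      · congr 1
        linear_combination (oddSign j T * crossSign T (U \ T)) * h2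
      · rw [seriesPart_apply]
        split_ifs with hp
        · rw [← hp, koszul_one_natCast]
          congr 1
          linear_combination ((-1 : ℤ) ^ T.card * oddSign j (U \ T) * crossSign T (U \ T)) * h1
        · simp

/-- `f ↦ (-1)^(t p(f)) f`. -/
def seriesTwist (t : ZMod 2) : Module.End F (Series F r s) :=
  seriesPart 0 + koszul t 1 • seriesPart 1

theorem seriesPart_add (f : Series F r s) : seriesPart 0 f + seriesPart 1 f = f := by
  funext T
  simp only [Pi.add_apply, seriesPart_apply]
  rcases zmod2_cases (T.card : ZMod 2) with h | h <;> simp [h]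

theorem seriesTwist_part (t p : ZMod 2) (f : Series F r s) :
    seriesTwist t (seriesPart p f) = koszul t p • seriesPart p f := by
  funext T
  simp only [seriesTwist, LinearMap.add_apply, LinearMap.smul_apply, Pi.add_apply, Pi.smul_apply,
    seriesPart_apply]
  rcases zmod2_cases (T.card : ZMod 2) with h | h <;> rcases zmod2_cases p with rfl | rfl <;>
    simp [h, koszul]

theorem seriesTwist_D (t : ZMod 2) (i : Var r s) :
    seriesTwist (F := F) t * seriesD i = koszul t (varParity i) • (seriesD i * seriesTwist t) := by
  refine LinearMap.ext fun f => ?_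
  simp only [Module.End.mul_apply, LinearMap.smul_apply]
  have h : ∀ p, seriesTwist t (seriesD i (seriesPart p f)) =
      koszul t (varParity i) • seriesD i (seriesTwist t (seriesPart p f)) := by
    intro p
    rw [seriesD_part, seriesTwist_part, seriesTwist_part, ← seriesD_part, map_zsmul, smul_smul,
      koszul_add_right, mul_comm]
  rw [← seriesPart_add f]
  simp only [map_add, smul_add, h]

theorem seriesD_mul' (i : Var r s) (f g : Series F r s) :
    seriesD i (seriesMul f g) = seriesMul (seriesD i f) g +
      seriesMul (seriesTwist (varParity i) f) (seriesD i g) := by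
  have hz : ∀ (n : ℤ) (f g : Series F r s), seriesMul (n • f) g = n • seriesMul f g := by
    intro n f g
    rw [← Int.cast_smul_eq_zsmul F, seriesMul_smul_left, Int.cast_smul_eq_zsmul]
  rw [← seriesPart_add f]
  simp only [map_add, seriesMul_add_left, seriesD_mul, seriesTwist_part, hz]
  abel

end SeriesFacts

namespace LieConformalSuperalgebra

variable {F : Type*} [Field F] {r s : ℕ} {R : Type*} [AddCommGroup R] [Module F R]
variable (S : LieConformalSuperalgebra F r s R)

/-- `a ↦ (-1)^(t p(a)) a`. -/
def twist (t : ZMod 2) : Module.End F R :=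
  (S.par 0).projection (S.par 1) S.par_isCompl +
    koszul t 1 • (S.par 1).projection (S.par 0) S.par_isCompl.symm

theorem twist_of_mem (t : ZMod 2) {p : ZMod 2} {a : R} (ha : a ∈ S.par p) :
    S.twist t a = koszul t p • a := by
  rcases zmod2_cases p with rfl | rfl
  · simp only [twist, LinearMap.add_apply, LinearMap.smul_apply]
    rw [Submodule.projection_apply_of_mem_left _ ha,
      (Submodule.projection_apply_eq_zero_iff S.par_isCompl.symm).mpr ha]
    simp [koszul]
  · simp only [twist, LinearMap.add_apply, LinearMap.smul_apply]
    rw [Submodule.projection_apply_of_mem_left _ ha,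
      (Submodule.projection_apply_eq_zero_iff S.par_isCompl).mpr ha]
    simp

theorem hom_induction {P : R → Prop} (hom : ∀ p, ∀ a ∈ S.par p, P a)
    (add : ∀ a b, P a → P b → P (a + b)) (a : R) : P a := by
  have h := Submodule.projection_add_projection_eq_self S.par_isCompl a
  rw [← h]
  exact add _ _ (hom 0 _ (Submodule.projection_apply_mem _ _))
    (hom 1 _ (Submodule.projection_apply_mem _ _))

theorem twist_D (t : ZMod 2) (i : Var r s) (a : R) :
    S.twist t (S.D i a) = koszul t (varParity i) • S.D i (S.twist t a) := by
  induction a using S.hom_induction with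
  | hom p a ha =>
    rw [S.twist_of_mem t ha, S.twist_of_mem t (S.D_par i p a ha), map_zsmul, smul_smul,
      koszul_add_right, mul_comm]
  | add a b ha hb => simp only [map_add, smul_add, ha, hb]

theorem twist_twist (t u : ZMod 2) (a : R) : S.twist t (S.twist u a) = S.twist (t + u) a := by
  induction a using S.hom_induction with
  | hom p a ha =>
    rw [S.twist_of_mem u ha, map_zsmul, S.twist_of_mem t ha, S.twist_of_mem _ ha, smul_smul,
      koszul_comm (t + u), koszul_add_right, koszul_comm p t, koszul_comm p u, mul_comm]
  | add a b ha hb => simp only [map_add, ha, hb]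

theorem twist_zero (a : R) : S.twist 0 a = a := by
  induction a using S.hom_induction with
  | hom p a ha => rw [S.twist_of_mem 0 ha, koszul_zero_left, one_smul]
  | add a b ha hb => simp only [map_add, ha, hb]

theorem twist_self (t : ZMod 2) (a : R) : S.twist t (S.twist t a) = a := by
  rw [twist_twist, CharTwo.add_self_eq_zero, twist_zero]

theorem coeffAct_single (V : Type*) [AddCommGroup V] [Module F V] (p : ZMod 2)
    (T : Module.End F V) (m : Mon r s) (v : V) :
    coeffAct F r s V p T (Finsupp.single m v) =
      koszul p (monParity m) • Finsupp.single m (T v) := by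
  simp [coeffAct]

theorem coeffAct_apply (V : Type*) [AddCommGroup V] [Module F V] (p : ZMod 2)
    (T : Module.End F V) (P : Poly r s V) (m : Mon r s) :
    coeffAct F r s V p T P m = koszul p (monParity m) • T (P m) := by
  classical
  induction P using Finsupp.induction_linear with
  | zero => simp
  | add f g hf hg => simp [hf, hg]
  | single n v =>
    rw [coeffAct_single, Finsupp.smul_apply]
    by_cases h : n = m
    · subst h; simp
    · simp [h]

theorem bracket_twist (t : ZMod 2) (a b : R) :
    S.bracket (S.twist t a) (S.twist t b) =
      coeffAct F r s R t (S.twist t) (S.bracket a b) := by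
  induction a using S.hom_induction with
  | hom p a ha =>
    induction b using S.hom_induction with
    | hom q b hb =>
      ext1 m
      rw [coeffAct_apply, S.twist_of_mem t ha, S.twist_of_mem t hb,
        S.twist_of_mem t (S.bracket_par p q a ha b hb m)]
      simp only [map_zsmul, LinearMap.smul_apply, Finsupp.smul_apply, smul_smul]
      congr 1
      simp only [koszul_add_right]
      linear_combination -(koszul t p * koszul t q) * koszul_mul_self t (monParity m)
    | add b b' h h' => simp only [map_add, h, h']
  | add a a' h h' => simp only [map_add, LinearMap.add_apply, h, h']

theorem bracket_D_right' (i : Var r s) (a b : R) :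
    S.bracket a (S.D i b) = S.DPoly i (S.bracket (S.twist (varParity i) a) b) +
      mulVar F r s R i (S.bracket (S.twist (varParity i) a) b) := by
  induction a using S.hom_induction with
  | hom p a ha =>
    rw [S.bracket_D_right i p a ha b, S.twist_of_mem _ ha]
    simp only [map_zsmul, LinearMap.smul_apply, smul_add]
  | add a a' h h' =>
    simp only [map_add, LinearMap.add_apply, h, h']
    abel

/-! ## The annihilation algebra

Elements of `R̃ = R ⊗ F[[y]]` are written `a y_K = a ⊗ y_K`, so that
`y_K a = (-1)^(p(a) p_K) a ⊗ y_K`. -/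

/-- The action `a ⊗ f ↦ (-1)^(p_i p(a)) a ⊗ ∂_{y_i} f` of `∂_{y_i}` on `R ⊗ F[[y]]`. -/
def affDy (i : Var r s) : Module.End F (R ⊗[F] Series F r s) :=
  TensorProduct.map (S.twist (varParity i)) (seriesD i)

/-- The action of `∂_i + ∂_{y_i}` on `R ⊗ F[[y]]`. -/
def affD (i : Var r s) : Module.End F (R ⊗[F] Series F r s) :=
  TensorProduct.map (S.D i) LinearMap.id + S.affDy i

/-- The subspace `(∂ + ∂_y) R̃`. -/
def affRel : Submodule F (R ⊗[F] Series F r s) := ⨆ i, LinearMap.range (S.affD i)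

/-- For `f`, `g` in `F[[y]]`, the map
`λ^m ⊗ c ↦ (-1)^(p(m) p(c)) c ⊗ (∂_y^m f) g`, the evaluation of `λ` at derivatives of `f`. -/
def evalAt (f g : Series F r s) : Poly r s R →ₗ[F] R ⊗[F] Series F r s :=
  Finsupp.lsum F fun m =>
    ((TensorProduct.mk F R (Series F r s)).flip (seriesMul (monOp seriesD m f) g)).comp
      (S.twist (monParity m))

/-- The bracket `[(a f)_λ (b g)]` at `λ = 0`, with `f` split into homogeneous components. If
`[a_λ b] = ∑ λ^m c_m` and `f` is homogeneous, then `a f = (-1)^(p(a) p(f)) f a`, and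
`[f a, b g] = (f [a_{∂_y} b]) g = ∑ (f ∂_y^m) c_m g`, where `f ∂_y^m = (-1)^(p(m) p(f)) ∂_y^m f`.
Moving `c_m` to the left gives `[a f, b g] = (-1)^(p(f) p(b)) ∑ (-1)^(p(m) p(c_m)) c_m (∂_y^m f) g`,
because `p(c_m) = p(a) + p(b) + p(m)`. -/
def affBracketPure (a : R) (f : Series F r s) (b : R) (g : Series F r s) : R ⊗[F] Series F r s :=
  ∑ p : ZMod 2, S.evalAt (seriesPart p f) g (S.bracket a (S.twist p b))

theorem evalAt_single (f g : Series F r s) (m : Mon r s) (c : R) :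
    S.evalAt f g (Finsupp.single m c) =
      S.twist (monParity m) c ⊗ₜ[F] seriesMul (monOp seriesD m f) g := by
  simp [evalAt]

theorem evalAt_add_left (f f' g : Series F r s) :
    S.evalAt (f + f') g = S.evalAt f g + S.evalAt f' g := by
  refine Finsupp.lhom_ext fun m c => ?_
  simp only [LinearMap.add_apply, evalAt_single, map_add, seriesMul_add_left, TensorProduct.tmul_add]

theorem evalAt_add_right (f g g' : Series F r s) :
    S.evalAt f (g + g') = S.evalAt f g + S.evalAt f g' := by
  refine Finsupp.lhom_ext fun m c => ?_
  simp only [LinearMap.add_apply, evalAt_single, seriesMul_add_right, TensorProduct.tmul_add]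

theorem evalAt_smul_left (k : F) (f g : Series F r s) :
    S.evalAt (k • f) g = k • S.evalAt f g := by
  refine Finsupp.lhom_ext fun m c => ?_
  simp only [LinearMap.smul_apply, evalAt_single, map_smul, seriesMul_smul_left,
    TensorProduct.tmul_smul]

theorem evalAt_smul_right (k : F) (f g : Series F r s) :
    S.evalAt f (k • g) = k • S.evalAt f g := by
  refine Finsupp.lhom_ext fun m c => ?_
  simp only [LinearMap.smul_apply, evalAt_single, seriesMul_smul_right, TensorProduct.tmul_smul]

/-- The bracket of `R ⊗ F[[y]]` at `λ = 0`. -/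
def affBracket : (R ⊗[F] Series F r s) →ₗ[F] (R ⊗[F] Series F r s) →ₗ[F] R ⊗[F] Series F r s :=
  TensorProduct.lift <| LinearMap.mk₂ F
    (fun a f => TensorProduct.lift <| LinearMap.mk₂ F (fun b g => S.affBracketPure a f b g)
      (fun b b' g => by simp [affBracketPure, Finset.sum_add_distrib])
      (fun k b g => by simp only [affBracketPure, map_smul, Finset.smul_sum])
      (fun b g g' => by
        simp only [affBracketPure, evalAt_add_right, LinearMap.add_apply, Finset.sum_add_distrib])
      (fun k b g => by
        simp only [affBracketPure, evalAt_smul_right, LinearMap.smul_apply, Finset.smul_sum]))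
    (fun a a' f => by
      ext b g
      simp [affBracketPure, Finset.sum_add_distrib])
    (fun k a f => by
      ext b g
      simp [affBracketPure, Finset.smul_sum])
    (fun a f f' => by
      ext b g
      simp [affBracketPure, evalAt_add_left, Finset.sum_add_distrib])
    (fun k a f => by
      ext b g
      simp [affBracketPure, evalAt_smul_left, Finset.smul_sum])

theorem affBracket_tmul (a : R) (f : Series F r s) (b : R) (g : Series F r s) :
    S.affBracket (a ⊗ₜ f) (b ⊗ₜ g) = S.affBracketPure a f b g := rfl

theorem seriesMul_zsmul_left (n : ℤ) (f g : Series F r s) :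
    seriesMul (n • f) g = n • seriesMul f g := by
  rw [← Int.cast_smul_eq_zsmul F, seriesMul_smul_left, Int.cast_smul_eq_zsmul]

theorem tmul_zsmul' (n : ℤ) (a : R) (f : Series F r s) :
    a ⊗ₜ[F] (n • f) = n • (a ⊗ₜ[F] f) := by
  rw [← Int.cast_smul_eq_zsmul F, TensorProduct.tmul_smul, Int.cast_smul_eq_zsmul]

theorem evalAt_zsmul_left (n : ℤ) (f g : Series F r s) :
    S.evalAt (n • f) g = n • S.evalAt f g := by
  refine LinearMap.ext fun P => ?_
  rw [← Int.cast_smul_eq_zsmul F, evalAt_smul_left, LinearMap.smul_apply, LinearMap.smul_apply,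
    Int.cast_smul_eq_zsmul]

theorem evalAt_mulVar_single (f g : Series F r s) (i : Var r s) (m : Mon r s) (c : R) :
    S.evalAt f g (mulVar F r s R i (Finsupp.single m c)) =
      S.twist (monParity m) (S.twist (varParity i) c) ⊗ₜ[F]
        seriesMul (seriesD i (monOp seriesD m f)) g := by
  have h := monOp_varMul (seriesD (F := F) (r := r) (s := s)) seriesD_comm seriesD_odd_sq i m
  have h' : seriesD i (monOp seriesD m f) = varSign i m • monOp seriesD (varMul i m) f := by
    rw [← Module.End.mul_apply, h]; rfl
  have e : mulVar F r s R i (Finsupp.single m c) = varSign i m • Finsupp.single (varMul i m) c := by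
    simp [mulVar]
  rw [h', e, map_zsmul, evalAt_single, seriesMul_zsmul_left, tmul_zsmul', twist_twist]
  by_cases hs : varSign i m = 0
  · rw [hs, zero_smul, zero_smul]
  · rw [monParity_varMul i m hs, add_comm]

theorem evalAt_mulVar (f g : Series F r s) (i : Var r s) (P : Poly r s R) :
    S.evalAt f g (mulVar F r s R i P) =
      S.evalAt (seriesD i f) g (coeffAct F r s R (varParity i) (S.twist (varParity i)) P) := by
  induction P using Finsupp.induction_linear with
  | zero => simp
  | add P Q hP hQ => simp only [map_add, hP, hQ]
  | single m c =>
    have h := monOp_superComm (seriesD (F := F) (r := r) (s := s)) (varParity i) (seriesD i)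
      (seriesD_comm i) m
    have h' : seriesD i (monOp seriesD m f) =
        koszul (varParity i) (monParity m) • monOp seriesD m (seriesD i f) := by
      rw [← Module.End.mul_apply, h]; rfl
    rw [evalAt_mulVar_single, h', coeffAct_single, map_zsmul, evalAt_single, seriesMul_zsmul_left,
      tmul_zsmul']

theorem evalAt_DPoly (f g : Series F r s) (i : Var r s) (P : Poly r s R) :
    S.evalAt f g (S.DPoly i P) =
      TensorProduct.map (S.D i) LinearMap.id (S.evalAt f g P) := by
  induction P using Finsupp.induction_linear with
  | zero => simp
  | add P Q hP hQ => simp only [map_add, hP, hQ]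
  | single m c =>
    rw [ConformalData.DPoly, coeffAct_single, map_zsmul, evalAt_single, evalAt_single,
      TensorProduct.map_tmul, twist_D, LinearMap.id_apply, ← Int.cast_smul_eq_zsmul F,
      ← Int.cast_smul_eq_zsmul F, ← TensorProduct.smul_tmul', smul_smul, ← Int.cast_mul,
      koszul_comm (monParity m), koszul_mul_self, Int.cast_one, one_smul]

theorem evalAt_leibniz (f g : Series F r s) (i : Var r s) (P : Poly r s R) :
    S.evalAt f g (mulVar F r s R i P) = S.affDy i (S.evalAt f g P) -
      S.evalAt (seriesTwist (varParity i) f) (seriesD i g)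
        (coeffAct F r s R (varParity i) (S.twist (varParity i)) P) := by
  induction P using Finsupp.induction_linear with
  | zero => simp
  | add P Q hP hQ => simp only [map_add, hP, hQ]; abel
  | single m c =>
    have h := monOp_superComm (seriesD (F := F) (r := r) (s := s)) (varParity i)
      (seriesTwist (varParity i)) (seriesTwist_D (varParity i)) m
    have h' : seriesTwist (varParity i) (monOp seriesD m f) =
        koszul (varParity i) (monParity m) • monOp seriesD m (seriesTwist (varParity i) f) := by
      rw [← Module.End.mul_apply, h]; rfl
    rw [evalAt_mulVar_single, coeffAct_single, map_zsmul, evalAt_single, evalAt_single, affDy,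
      TensorProduct.map_tmul, seriesD_mul', h', seriesMul_zsmul_left, TensorProduct.tmul_add,
      tmul_zsmul', twist_twist, twist_twist, add_comm (monParity m)]
    abel

theorem affBracket_affD_left (i : Var r s) (x y : R ⊗[F] Series F r s) :
    S.affBracket (S.affD i x) y = 0 := by
  induction x using TensorProduct.induction_on with
  | zero => simp
  | add x x' h h' => simp only [map_add, LinearMap.add_apply, h, h', add_zero]
  | tmul a f =>
    induction y using TensorProduct.induction_on with
    | zero => simp
    | add y y' h h' => simp only [map_add, h, h', add_zero]
    | tmul b g =>
      simp only [affD, affDy, LinearMap.add_apply, TensorProduct.map_tmul, LinearMap.id_apply,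
        map_add, affBracket_tmul, affBracketPure]
      have e : ∀ p, S.evalAt (seriesPart p f) g (S.bracket (S.D i a) (S.twist p b)) =
          -S.evalAt (seriesPart (p + varParity i) (seriesD i f)) g
            (S.bracket (S.twist (varParity i) a) (S.twist (p + varParity i) b)) := by
        intro p
        rw [S.bracket_D_left, map_neg, evalAt_mulVar, ← bracket_twist, seriesD_part, twist_twist,
          add_comm (varParity i) p]
      simp only [e]
      rw [Finset.sum_neg_distrib, neg_add_eq_zero]
      exact Fintype.sum_equiv (Equiv.addRight (varParity i)) _ _ fun p => rfl

theorem affBracket_affD_right (i : Var r s) (x y : R ⊗[F] Series F r s) :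
    S.affBracket x (S.affD i y) ∈ S.affRel := by
  induction x using TensorProduct.induction_on with
  | zero => simp
  | add x x' h h' =>
    simp only [map_add, LinearMap.add_apply]
    exact add_mem h h'
  | tmul a f =>
    induction y using TensorProduct.induction_on with
    | zero => simp
    | add y y' h h' =>
      simp only [map_add]
      exact add_mem h h'
    | tmul b g =>
      have key : S.affBracket (a ⊗ₜ f) (S.affD i (b ⊗ₜ g)) =
          S.affD i (∑ p : ZMod 2, koszul p (varParity i) • S.evalAt (seriesPart p f) g
            (S.bracket (S.twist (varParity i) a) (S.twist p b))) := by
        simp only [affD, affDy, LinearMap.add_apply, TensorProduct.map_tmul, LinearMap.id_apply,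
          map_add, affBracket_tmul, affBracketPure]
        rw [← Finset.sum_add_distrib, map_sum, map_sum, ← Finset.sum_add_distrib]
        refine Finset.sum_congr rfl fun p _ => ?_
        rw [twist_D, map_zsmul, map_zsmul, bracket_D_right', map_add, evalAt_DPoly, evalAt_leibniz,
          ← bracket_twist, twist_self, seriesTwist_part, evalAt_zsmul_left, twist_twist,
          twist_twist, add_comm (varParity i) p, map_zsmul, map_zsmul, LinearMap.smul_apply,
          koszul_comm (varParity i) p, smul_add, smul_sub, smul_smul, koszul_mul_self, one_smul,
          affDy]
        abel
      rw [key]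
      exact (le_iSup (fun i => LinearMap.range (S.affD i)) i) ⟨_, rfl⟩

theorem affDy_affD (i j : Var r s) (x : R ⊗[F] Series F r s) :
    S.affDy i (S.affD j x) = koszul (varParity i) (varParity j) • S.affD j (S.affDy i x) := by
  induction x using TensorProduct.induction_on with
  | zero => simp
  | add x x' h h' => simp only [map_add, smul_add, h, h']
  | tmul a f =>
    have h : seriesD i (seriesD j f) =
        koszul (varParity i) (varParity j) • seriesD j (seriesD i f) := by
      rw [← Module.End.mul_apply, seriesD_comm]; rfl
    simp only [affD, affDy, LinearMap.add_apply, TensorProduct.map_tmul, LinearMap.id_apply,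
      map_add, smul_add]
    rw [twist_D, twist_twist, twist_twist, h, tmul_zsmul', add_comm (varParity i)]
    congr 1

/-- The annihilation algebra `A(R) = R̃ / (∂ + ∂_y) R̃`. -/
def Ann : Type _ := (R ⊗[F] Series F r s) ⧸ S.affRel

instance : AddCommGroup S.Ann := inferInstanceAs (AddCommGroup (_ ⧸ S.affRel))

instance : Module F S.Ann := inferInstanceAs (Module F (_ ⧸ S.affRel))

/-- The projection `R̃ → A(R)`. -/
def annMk : R ⊗[F] Series F r s →ₗ[F] S.Ann := S.affRel.mkQ

theorem annMk_eq_zero {x : R ⊗[F] Series F r s} (hx : x ∈ S.affRel) : S.annMk x = 0 :=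
  (Submodule.Quotient.mk_eq_zero _).mpr hx

theorem affRel_le_ker {V : Type*} [AddCommGroup V] [Module F V]
    (T : R ⊗[F] Series F r s →ₗ[F] V) (h : ∀ i x, T (S.affD i x) = 0) :
    S.affRel ≤ LinearMap.ker T := by
  refine iSup_le fun i => ?_
  rintro _ ⟨x, rfl⟩
  exact h i x

/-- The bracket of `A(R)`. -/
def annBracket : S.Ann →ₗ[F] S.Ann →ₗ[F] S.Ann :=
  S.affRel.liftQ
    (LinearMap.flip (S.affRel.liftQ (S.affBracket.compr₂ S.annMk).flip
      (S.affRel_le_ker _ fun i y => LinearMap.ext fun x =>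
        S.annMk_eq_zero (S.affBracket_affD_right i x y))))
    (S.affRel_le_ker _ fun i x => by
      refine LinearMap.ext fun y => ?_
      obtain ⟨y, rfl⟩ := S.affRel.mkQ_surjective y
      change S.annMk (S.affBracket (S.affD i x) y) = 0
      rw [affBracket_affD_left, map_zero])

theorem annBracket_mk (x y : R ⊗[F] Series F r s) :
    S.annBracket (S.annMk x) (S.annMk y) = S.annMk (S.affBracket x y) := rfl

/-- The derivation `∂_{y_i}` of `A(R)`. -/
def annDy (i : Var r s) : Module.End F S.Ann :=
  S.affRel.mapQ S.affRel (S.affDy i) (by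
    refine iSup_le fun j => ?_
    rintro _ ⟨x, rfl⟩
    change S.affDy i (S.affD j x) ∈ S.affRel
    rw [affDy_affD]
    exact zsmul_mem ((le_iSup (fun i => LinearMap.range (S.affD i)) j) ⟨_, rfl⟩) _)

theorem annDy_mk (i : Var r s) (x : R ⊗[F] Series F r s) :
    S.annDy i (S.annMk x) = S.annMk (S.affDy i x) := rfl

end LieConformalSuperalgebra

/-! ## Linearly compact Lie superalgebras -/

/-- A superspace with a bilinear bracket. -/
structure SuperBracket (F : Type*) [Field F] (L : Type*) [AddCommGroup L] [Module F L] where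
  /-- even and odd part -/
  par : ZMod 2 → Submodule F L
  /-- the bracket; `bracket x` is `ad x` -/
  bracket : L →ₗ[F] L →ₗ[F] L

namespace SuperBracket

/-- The axioms of a Lie superalgebra. -/
structure IsLieSuperalgebra {F : Type*} [Field F] {L : Type*} [AddCommGroup L] [Module F L]
    (A : SuperBracket F L) : Prop where
  par_isCompl : IsCompl (A.par 0) (A.par 1)
  bracket_par : ∀ p q, ∀ x ∈ A.par p, ∀ y ∈ A.par q, A.bracket x y ∈ A.par (p + q)
  skew : ∀ p q, ∀ x ∈ A.par p, ∀ y ∈ A.par q, A.bracket x y = -(koszul p q • A.bracket y x)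
  jacobi : ∀ p q, ∀ x ∈ A.par p, ∀ y ∈ A.par q, ∀ z,
    A.bracket x (A.bracket y z) =
      A.bracket (A.bracket x y) z + koszul p q • A.bracket y (A.bracket x z)

/-- A linearly compact Lie superalgebra: a Lie superalgebra with a topology for which the bracket
is continuous and which is, as a topological superspace, a product of discrete one-dimensional
superspaces (equivalently, of discrete finite-dimensional ones). -/
def IsLinearlyCompact.{u, v} {F : Type u} [Field F] {L : Type v} [AddCommGroup L] [Module F L]
    [TopologicalSpace L] (A : SuperBracket F L) : Prop :=
  A.IsLieSuperalgebra ∧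
  Continuous (fun z : L × L => A.bracket z.1 z.2) ∧
  letI : TopologicalSpace F := ⊥
  ∃ (ι : Type v) (q : ι → ZMod 2) (e : L ≃ₗ[F] (ι → F)),
    Continuous e ∧ Continuous e.symm ∧ ∀ p x, x ∈ A.par p ↔ ∀ k, q k ≠ p → e x k = 0

variable {F : Type*} [Field F] {L M : Type*} [AddCommGroup L] [Module F L] [AddCommGroup M]
  [Module F M]

/-- Isomorphism of topological Lie superalgebras. -/
def Isomorphic [TopologicalSpace L] [TopologicalSpace M] (A : SuperBracket F L)
    (B : SuperBracket F M) : Prop :=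
  ∃ e : L ≃ₗ[F] M, Continuous e ∧ Continuous e.symm ∧
    (∀ p x, x ∈ A.par p ↔ e x ∈ B.par p) ∧ ∀ x y, e (A.bracket x y) = B.bracket (e x) (e y)

/-- The superderivations of parity `p`. -/
def derPar (A : SuperBracket F L) (p : ZMod 2) : Submodule F (Module.End F L) where
  carrier := {T | (∀ q, ∀ x ∈ A.par q, T x ∈ A.par (p + q)) ∧
    ∀ q, ∀ x ∈ A.par q, ∀ y,
      T (A.bracket x y) = A.bracket (T x) y + koszul p q • A.bracket x (T y)}
  zero_mem' := ⟨fun q x _ => zero_mem _, fun q x _ y => by simp⟩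
  add_mem' := by
    rintro T T' ⟨h1, h2⟩ ⟨h1', h2'⟩
    refine ⟨fun q x hx => add_mem (h1 q x hx) (h1' q x hx), fun q x hx y => ?_⟩
    simp only [LinearMap.add_apply, h2 q x hx, h2' q x hx, map_add, smul_add]
    abel
  smul_mem' := by
    rintro c T ⟨h1, h2⟩
    refine ⟨fun q x hx => Submodule.smul_mem _ c (h1 q x hx), fun q x hx y => ?_⟩
    simp only [LinearMap.smul_apply, h2 q x hx, map_smul, smul_add]
    rw [smul_comm c]

/-- `Der A`, the space of superderivations. -/
def der (A : SuperBracket F L) : Submodule F (Module.End F L) := A.derPar 0 ⊔ A.derPar 1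

/-- `A = ∏_j g_j` as a `ℤ`-graded topological algebra. -/
def IsProductGrading [TopologicalSpace L] (A : SuperBracket F L) (g : ℤ → Submodule F L) : Prop :=
  (∀ i j, ∀ x ∈ g i, ∀ y ∈ g j, A.bracket x y ∈ g (i + j)) ∧
  ∃ e : L ≃ₗ[F] (∀ j, g j), Continuous e ∧ Continuous e.symm ∧
    ∀ j (x : g j), e x = Pi.single j x

end SuperBracket

namespace LieConformalSuperalgebra

variable {F : Type*} [Field F] {r s : ℕ} {R : Type*} [AddCommGroup R] [Module F R]
variable (S : LieConformalSuperalgebra F r s R)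

/-- The annihilation algebra `A(R)`, with the parity `p(a y_K) = p(a) + p_K`. -/
def ann : SuperBracket F S.Ann where
  par p := Submodule.span F {z | ∃ q, ∃ a ∈ S.par q, ∃ f,
    z = S.annMk (a ⊗ₜ seriesPart (p - q) f)}
  bracket := S.annBracket

/-- The open subspaces of `A(R)`: those containing, for every `a` in `R`, the classes of `a f` for
all `f` of sufficiently high order. -/
def IsOpenSubspace (U : Submodule F S.Ann) : Prop :=
  ∀ a : R, ∃ n : ℕ, ∀ f : Series F r s, seriesOrderGE n f → S.annMk (a ⊗ₜ f) ∈ U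

/-- The topology of `A(R)`: the finest linear topology for which all maps
`F[[y]] → A(R)`, `f ↦ a f`, are continuous. -/
instance : TopologicalSpace S.Ann where
  IsOpen s := ∀ x ∈ s, ∃ U : Submodule F S.Ann, S.IsOpenSubspace U ∧ ∀ u ∈ U, x + u ∈ s
  isOpen_univ := fun x _ => ⟨⊤, fun _ => ⟨0, fun _ _ => Submodule.mem_top⟩, fun _ _ => trivial⟩
  isOpen_inter := by
    rintro s t hs ht x ⟨hxs, hxt⟩
    obtain ⟨U, hU, hUs⟩ := hs x hxs
    obtain ⟨V, hV, hVt⟩ := ht x hxt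
    refine ⟨U ⊓ V, fun a => ?_, fun u hu => ⟨hUs u hu.1, hVt u hu.2⟩⟩
    obtain ⟨n, hn⟩ := hU a
    obtain ⟨k, hk⟩ := hV a
    exact ⟨max n k, fun f hf =>
      ⟨hn f fun m hm => hf m (lt_of_lt_of_le hm (le_max_left _ _)),
        hk f fun m hm => hf m (lt_of_lt_of_le hm (le_max_right _ _))⟩⟩
  isOpen_sUnion := by
    rintro s hs x ⟨t, ht, hxt⟩
    obtain ⟨U, hU, hUt⟩ := hs t ht x hxt
    exact ⟨U, hU, fun u hu => ⟨t, ht, hUt u hu⟩⟩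

/-! ## Gradings and `D`-conformal structures -/

/-- `G` is a `ℤ`-grading of the Lie conformal superalgebra `R`. The grading of `F[λ] ⊗ R` is
`deg (λ^m a) = deg a - 2 |m|`, so the last condition says `deg [a_λ b] = deg a + deg b`. -/
structure IsGrading (G : ℤ → Submodule F R) : Prop where
  isInternal : DirectSum.IsInternal G
  super : ∀ d, G d = (G d ⊓ S.par 0) ⊔ (G d ⊓ S.par 1)
  deg_D : ∀ i d, ∀ a ∈ G d, S.D i a ∈ G (d - 2)
  deg_bracket : ∀ d e, ∀ a ∈ G d, ∀ b ∈ G e, ∀ m,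
    S.bracket a b m ∈ G (d + e + 2 * (monLength m : ℤ))

/-- The induced grading of `A(R)`: `deg (a y_K) = deg a + 2 ℓ(K)`. -/
def annGrading (G : ℤ → Submodule F R) (j : ℤ) : Submodule F S.Ann :=
  Submodule.span F {z | ∃ d, ∃ a ∈ G d, ∃ m : Mon r s, d + 2 * (monLength m : ℤ) = j ∧
    z = S.annMk (a ⊗ₜ seriesMon F m)}

/-- The conditions on the grading of `R` in a `D`-conformal structure. -/
structure IsDConformalGrading (G : ℤ → Submodule F R) : Prop where
  isGrading : S.IsGrading G
  /-- the induced grading is a grading of `A(R)` -/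
  ann_isProductGrading : S.ann.IsProductGrading (S.annGrading G)
  /-- it has depth at most 3 -/
  depth : ∀ j < -3, S.annGrading G j = ⊥
  odd_neg_one : S.annGrading G (-1) ≤ S.ann.par 1
  odd_neg_three : S.annGrading G (-3) ≤ S.ann.par 1
  /-- `ad` maps `A(R)_{-2}` to `Der A(R)` -/
  ad_mem_der : ∀ x ∈ S.annGrading G (-2), S.ann.bracket x ∈ S.ann.der
  ad_injective : ∀ x ∈ S.annGrading G (-2), S.ann.bracket x = 0 → x = 0
  /-- the image is `D = ⟨∂_{y_1}, …, ∂_{y_{r+s}}⟩` -/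
  ad_image : (S.annGrading G (-2)).map S.ann.bracket = Submodule.span F (Set.range S.annDy)

/-- The linearly compact Lie superalgebra `A` has a `D`-conformal structure over `R`. -/
def HasDConformalStructure {L : Type*} [AddCommGroup L] [Module F L] [TopologicalSpace L]
    (A : SuperBracket F L) (S : LieConformalSuperalgebra F r s R) : Prop :=
  A.IsLinearlyCompact ∧ A.Isomorphic S.ann ∧ ∃ G, S.IsDConformalGrading G

end LieConformalSuperalgebra

/-! ## `RW(r, s)` and `RE(4, 4)` -/

section RW

variable (F : Type*) [Field F] (r s : ℕ)

/-- The space of `RW(r, s)`: the free `F[∂]`-module `F[∂] ⊗ ⟨a_1, …, a_{r+s}⟩`. -/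
abbrev RWSpace := Poly r s (Var r s → F)

variable {r s}

/-- The generator `a_i`. -/
def rwGen (i : Var r s) : RWSpace F r s := Finsupp.single monOne (Pi.single i 1)

/-- The action of `∂_i`. -/
def rwD (i : Var r s) : Module.End F (RWSpace F r s) := mulVar F r s (Var r s → F) i

variable (r s)

/-- The parity `p(∂^m a_i) = p(m) + p_i`. -/
def rwPar (p : ZMod 2) : Submodule F (RWSpace F r s) where
  carrier := {P | ∀ m i, monParity m + varParity i ≠ p → P m i = 0}
  zero_mem' := fun _ _ _ => rfl
  add_mem' := fun {P Q} hP hQ m i h => by simp [hP m i h, hQ m i h]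
  smul_mem' := fun c P hP m i h => by simp [hP m i h]

/-- The degree `deg (∂^m a_i) = -2 - 2 |m|`. -/
def rwGrading (d : ℤ) : Submodule F (RWSpace F r s) where
  carrier := {P | ∀ m, -2 - 2 * (monLength m : ℤ) ≠ d → P m = 0}
  zero_mem' := fun _ _ => rfl
  add_mem' := fun {P Q} hP hQ m h => by simp [hP m h, hQ m h]
  smul_mem' := fun c P hP m h => by simp [hP m h]

variable {r s}

/-- `[a_i _λ a_j] = (∂_i + λ_i) a_j + a_i λ_j`, where `a_i λ_j = (-1)^(p_i p_j) λ_j a_i`. -/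
def rwGenBracket (i j : Var r s) : Poly r s (RWSpace F r s) :=
  Finsupp.single monOne (rwD F i (rwGen F j)) +
    Finsupp.single (varMul i monOne) (rwGen F j) +
    koszul (varParity i) (varParity j) • Finsupp.single (varMul j monOne) (rwGen F i)

variable (r s)

/-- The `λ`-bracket of `RW(r, s)`, the extension by sesquilinearity:
`[(∂^m a_i)_λ (∂^n a_j)] = (-1)^(p(n) p_i) (-λ)^m (∂ + λ)^n [a_i _λ a_j]`. -/
def rwBracket :
    RWSpace F r s →ₗ[F] RWSpace F r s →ₗ[F] Poly r s (RWSpace F r s) :=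
  Finsupp.lsum F fun m => Fintype.linearCombination F fun i =>
    Finsupp.lsum F fun n => Fintype.linearCombination F fun j =>
      koszul (monParity n) (varParity i) •
        monOp (fun k => -mulVar F r s (RWSpace F r s) k) m
          (monOp (fun k => coeffAct F r s (RWSpace F r s) (varParity k) (rwD F k) +
            mulVar F r s (RWSpace F r s) k) n (rwGenBracket F i j))

/-- `RW(r, s)`. -/
def RW : ConformalData F r s (RWSpace F r s) where
  par := rwPar F r s
  D := rwD F
  bracket := rwBracket F r s

end RW

section RE

variable (F : Type*) [Field F]

/-- `B_{∂∂} = ∑_{i ≤ 4} ∂_i ∂_{i+4}`; the indices `1, …, 4` are `inl 0, …, inl 3` and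
`5, …, 8` are `inr 0, …, inr 3`. -/
def reB : Module.End F (RWSpace F 4 4) :=
  ∑ i : Fin 4, rwD F (Sum.inl i) * rwD F (Sum.inr i)

/-- `C_{∂a} = ∑_{i ≤ 4} (∂_i a_{i+4} + ∂_{i+4} a_i)`. -/
def reC : RWSpace F 4 4 :=
  ∑ i : Fin 4, (rwD F (Sum.inl i) (rwGen F (Sum.inr i)) + rwD F (Sum.inr i) (rwGen F (Sum.inl i)))

/-- `ν_1 = ∂_6 ∂_7 ∂_8`, `ν_2 = -∂_5 ∂_7 ∂_8`, `ν_3 = ∂_5 ∂_6 ∂_8`, `ν_4 = -∂_5 ∂_6 ∂_7` and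
`ν_5 = ν_6 = ν_7 = ν_8 = 0`. -/
def reNu : Var 4 4 → Module.End F (RWSpace F 4 4)
  | Sum.inl i =>
    ![rwD F (Sum.inr 1) * rwD F (Sum.inr 2) * rwD F (Sum.inr 3),
      -(rwD F (Sum.inr 0) * rwD F (Sum.inr 2) * rwD F (Sum.inr 3)),
      rwD F (Sum.inr 0) * rwD F (Sum.inr 1) * rwD F (Sum.inr 3),
      -(rwD F (Sum.inr 0) * rwD F (Sum.inr 1) * rwD F (Sum.inr 2))] i
  | Sum.inr _ => 0

/-- `B_{νa} = ∑_{i ≤ 4} ν_i a_{i+4}`. -/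
def reBNu : RWSpace F 4 4 := ∑ i : Fin 4, reNu F (Sum.inl i) (rwGen F (Sum.inr i))

/-- `α_i = ∂_i B_{∂∂} C_{∂a} - 2 ν_i C_{∂a} + ∂_i B_{νa}`. -/
def reAlpha (i : Var 4 4) : RWSpace F 4 4 :=
  rwD F i (reB F (reC F)) - (2 : F) • reNu F i (reC F) + rwD F i (reBNu F)

/-- The space of `RE(4, 4)`: the `F[∂]`-submodule of `RW(4, 4)` generated by the `α_i`. -/
def RESpace : Submodule F (RWSpace F 4 4) :=
  Submodule.span F (Set.range fun z : Mon 4 4 × Var 4 4 => monOp (rwD F) z.1 (reAlpha F z.2))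

/-- The grading of `RE(4, 4)` induced by `deg a_i = -2`; thus `deg α_i = -10`. -/
def reGrading (d : ℤ) : Submodule F (RESpace F) :=
  (rwGrading F 4 4 d).comap (RESpace F).subtype

end RE

end ConformalSuper

end

open scoped TensorProduct

noncomputable section

namespace ConformalSuper

/-! ## Monomials -/

/-! The annihilation algebra of RE(4,4) is realised as a Lie superalgebra of formal vector fields,
and these fields turn out to be parametrised freely by eight power series in the four even
variables.

For RW(r,s) the class of `Q(∂) a_k ⊗ f` corresponds, up to signs, to the vector field `(Q(-∂_y) f)
∂_{y_k}`. The map `toVF` kills the relations `∂ + ∂_y` and carries the bracket to the bracket of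
vector fields (`toVF_affBracket`). That RW(r,s) is a Lie conformal superalgebra needs checking on
the `a_i` only, because skew-symmetry and the Jacobi identity propagate along the action of `∂`
(`skew_of_generators`, `jacobi_of_generators`).

Among the fields in 4|4 variables consider `vfE`, those all of whose iterated partial derivatives
have linear part in the matrix superalgebra `linE`. Closure of `linE` under the matrix bracket gives
closure of `vfE` (`vfBracket_mem_prolong`). Two facts carry the proof. All fields of `α_i ⊗ f` lie
in `vfE` (`toVF_alpha_mem`), by identities between the operators `∂_i`, `B` and `ν_i`. And `vfE` is
rigid: a field in it that vanishes when the odd variables are set to zero is zero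
(`eq_zero_of_mem_vfE`), because the relations of `linE` determine the derivatives in odd directions
by those in even directions.

Rigidity characterises RE(4,4). In the field of `Q ⊗ g y_5 y_6 y_7 y_8`, restricted to odd variables
zero, only the monomials of `Q` containing `∂_5 ∂_6 ∂_7 ∂_8` are visible, and there `α_i`
contributes a nonzero multiple of `a_i`. If the fields of a homogeneous `Q` lie in `vfE`,
subtracting suitable even derivatives of the `α_i` makes the visible part vanish, hence everything
(`mem_reEven_of_reMem`). So RE(4,4) is spanned by even derivatives of the `α_i` and contains every
homogeneous element acting through `vfE`. Closure under the λ-bracket follows from closure of `vfE`,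
once the coefficients of the powers of `λ` are extracted (`coeff_mem_of_evalAt`,
`rwBracket_mem_of_reMem`).

The same leading terms show that each element of the annihilation algebra is uniquely `∑ α_k g_k y_5
y_6 y_7 y_8` with `g_k` a series in the even variables, and that the `g_k` are, up to nonzero
scalars, the coefficients of its field at odd variables zero (`coord_bijective`). Hence the passage
to fields is injective, the Lie axioms are inherited, and the topology is the product topology of
the coefficients. Since `α_k y^e y_5 y_6 y_7 y_8` has degree `-10 + 2(|e| + 4) = 2|e| - 2`, degree
`j` consists of the fields with coefficients homogeneous of degree `(j + 2)/2`. This gives depth 2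
and no odd degrees; degree `-2` consists of the constant fields, which act as the `∂_{y_k}`, and
testing them against linear fields shows that `ad` is injective there. -/

theorem mon_induction {r s : ℕ} {P : Mon r s → Prop} (one : P monOne)
    (mul : ∀ i m, varSign i m ≠ 0 → P m → P (varMul i m)) (m : Mon r s) : P m := by
  obtain ⟨e, S⟩ := m
  have hS : P (0, S) := by
    induction S using Finset.induction_on with
    | empty => exact one
    | insert j S hj ih =>
      refine mul (Sum.inr j) (0, S) ?_ ih
      simp [varSign, oddSign, hj]
  suffices h : ∀ n : ℕ, ∀ e : Fin r →₀ ℕ, e.degree = n → P (e, S) from h _ e rfl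
  intro n
  induction n with
  | zero =>
    intro e he
    rw [Finsupp.degree_eq_zero_iff] at he
    rwa [he]
  | succ n ih =>
    intro e he
    have hne : e ≠ 0 := by
      rintro rfl
      simp at he
    obtain ⟨i, hi⟩ := Finsupp.ne_iff.mp hne
    have hle : Finsupp.single i 1 ≤ e := by
      rw [Finsupp.single_le_iff]
      exact Nat.one_le_iff_ne_zero.mpr hi
    have hd : e - Finsupp.single i 1 + Finsupp.single i 1 = e := tsub_add_cancel_of_le hle
    have := mul (Sum.inl i) (e - Finsupp.single i 1, S) (by simp [varSign]) (ih _ (by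
      have h2 := congrArg Finsupp.degree hd
      simp only [map_add, Finsupp.degree_single] at h2
      omega))
    simpa only [varMul, hd] using this

theorem varSign_mul_self {r s : ℕ} (i : Var r s) (m : Mon r s) (h : varSign i m ≠ 0) :
    varSign i m * varSign i m = 1 := by
  rcases i with i | j
  · simp [varSign]
  · refine oddSign_mul_self j m.2 fun hj => h ?_
    simp [varSign, oddSign, hj]

theorem monLength_varMul {r s : ℕ} (i : Var r s) (m : Mon r s) (h : varSign i m ≠ 0) :
    monLength (varMul i m) = monLength m + 1 := by
  rcases i with i | j
  · simp [monLength, varMul]; omega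
  · have hj : j ∉ m.2 := by
      intro hj; apply h; simp [varSign, oddSign, hj]
    simp [monLength, varMul, Finset.card_insert_of_notMem hj]; omega

theorem monOp_monOne {r s : ℕ} {A : Type*} [Ring A] (T : Var r s → A) : monOp T monOne = 1 := by
  simp [monOp, monOne]

/-- A nonzero sign is its own inverse, so `monOp_varMul` can be solved for the longer monomial. This
is the recursion used in inductions along `mon_induction`. -/
theorem monOp_varMul' {r s : ℕ} {A : Type*} [Ring A] (T : Var r s → A)
    (hc : ∀ i j, T i * T j = koszul (varParity i) (varParity j) • (T j * T i))
    (h0 : ∀ j, T (Sum.inr j) * T (Sum.inr j) = 0) (i : Var r s) (m : Mon r s)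
    (h : varSign i m ≠ 0) :
    monOp T (varMul i m) = varSign i m • (T i * monOp T m) := by
  rw [monOp_varMul T hc h0, smul_smul, varSign_mul_self i m h, one_smul]

theorem varSign_monOne {r s : ℕ} (i : Var r s) : varSign i (monOne : Mon r s) = 1 := by
  rcases i with i | j <;> simp [varSign, oddSign, monOne]

theorem monParity_monOne {r s : ℕ} : monParity (monOne : Mon r s) = 0 := by
  simp [monParity, monOne]

theorem koszul_zero_right (q : ZMod 2) : koszul q 0 = 1 := by
  revert q; decide

theorem koszul_add_left (p q t : ZMod 2) : koszul (p + q) t = koszul p t * koszul q t := by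
  revert p q t; decide

theorem koszul_ne_zero (p q : ZMod 2) : koszul p q ≠ 0 := by
  revert p q; decide

theorem koszul_one_one : koszul 1 1 = -1 := by decide

/-! ## Taylor expansion and products of formal power series -/

section Series

variable {F : Type*} [Field F] {r s : ℕ}

/-- The constant term. -/
def constTerm : Series F r s →ₗ[F] F :=
  (MvPowerSeries.coeff (0 : Fin r →₀ ℕ)).comp (LinearMap.proj ∅)

theorem constTerm_apply (f : Series F r s) : constTerm f = MvPowerSeries.coeff 0 (f ∅) := rfl

theorem seriesD_comm_apply (i j : Var r s) (f : Series F r s) :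
    seriesD i (seriesD j f) =
      koszul (varParity i) (varParity j) • seriesD j (seriesD i f) := by
  rw [← Module.End.mul_apply, seriesD_comm]; rfl

/-- The scalar is a product of factorials and a sign, nonzero in characteristic 0. Its exact value
is never needed. -/
theorem constTerm_monOp [CharZero F] (m : Mon r s) : ∃ u : F, u ≠ 0 ∧ ∀ f : Series F r s,
    constTerm (monOp seriesD m f) = u * MvPowerSeries.coeff m.1 (f m.2) := by
  induction m using mon_induction with
  | one => exact ⟨1, one_ne_zero, fun f => by rw [monOp_monOne, one_mul]; rfl⟩
  | mul i m h ih =>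
    obtain ⟨u, hu, ih⟩ := ih
    -- The new derivative is moved to the innermost place, so that the induction hypothesis applies
    -- to the series `seriesD i f`.
    have key : ∀ f : Series F r s, monOp seriesD (varMul i m) f =
        (varSign i m * koszul (varParity i) (monParity m)) • monOp seriesD m (seriesD i f) := by
      intro f
      rw [monOp_varMul' _ seriesD_comm seriesD_odd_sq i m h,
        monOp_superComm (seriesD (F := F) (r := r) (s := s)) (varParity i) (seriesD i)
        (seriesD_comm i) m, smul_smul]
      rfl
    have hz : ((varSign i m * koszul (varParity i) (monParity m) : ℤ) : F) ≠ 0 := by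
      exact_mod_cast mul_ne_zero h (koszul_ne_zero _ _)
    set z := varSign i m * koszul (varParity i) (monParity m)
    rcases i with i | j
    · refine ⟨z * u * (m.1 i + 1), ?_, fun f => ?_⟩
      · exact mul_ne_zero (mul_ne_zero hz hu) (Nat.cast_add_one_ne_zero _)
      · rw [key, map_zsmul, ih, seriesD_inl, MvPowerSeries.coeff_pderiv, zsmul_eq_mul]
        simp only [varMul]
        ring
    · have hj : j ∉ m.2 := by
        intro hj; apply h; simp [varSign, oddSign, hj]
      refine ⟨z * u * (oddSign j m.2 : ℤ), ?_, fun f => ?_⟩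
      · refine mul_ne_zero (mul_ne_zero hz hu) ?_
        exact_mod_cast h
      · rw [key, map_zsmul, ih, seriesD_inr, map_zsmul, zsmul_eq_mul, zsmul_eq_mul]
        simp only [varMul]
        ring

theorem monOp_mem {V : Type*} [AddCommGroup V] [Module F V] (T : Var r s → Module.End F V)
    (W : Submodule F V) (hc : ∀ i j, T i * T j = koszul (varParity i) (varParity j) • (T j * T i))
    (h0 : ∀ j, T (Sum.inr j) * T (Sum.inr j) = 0)
    (hW : ∀ i, ∀ v ∈ W, T i v ∈ W) (m : Mon r s) {v : V} (hv : v ∈ W) : monOp T m v ∈ W := by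
  induction m using mon_induction with
  | one => rwa [monOp_monOne]
  | mul i m h ih =>
    rw [monOp_varMul' T hc h0 i m h]
    exact zsmul_mem (hW i _ ih) _

/-- Taylor's principle. -/
theorem taylor [CharZero F] (W : Submodule F (Series F r s))
    (hD : ∀ i, ∀ f ∈ W, seriesD i f ∈ W) (h0 : ∀ f ∈ W, constTerm f = 0) {f : Series F r s}
    (hf : f ∈ W) : f = 0 := by
  funext T
  refine MvPowerSeries.ext fun e => ?_
  obtain ⟨u, hu, h⟩ := constTerm_monOp (F := F) ((e, T) : Mon r s)
  have h1 := h f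
  rw [h0 _ (monOp_mem _ W seriesD_comm seriesD_odd_sq hD _ hf)] at h1
  rcases mul_eq_zero.mp h1.symm with h2 | h2
  · exact absurd h2 hu
  · simpa using h2

/-- Taylor's principle for a spanning set. -/
theorem taylor_span [CharZero F] (W : Set (Series F r s))
    (hD : ∀ i, ∀ f ∈ W, seriesD i f ∈ Submodule.span F W) (h0 : ∀ f ∈ W, constTerm f = 0)
    {f : Series F r s} (hf : f ∈ W) : f = 0 := by
  refine taylor (Submodule.span F W) (fun i f hf => ?_) (fun f hf => ?_)
    (Submodule.subset_span hf)
  · have : Submodule.span F W ≤ (Submodule.span F W).comap (seriesD i) :=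
      Submodule.span_le.mpr fun g hg => hD i g hg
    exact this hf
  · have : Submodule.span F W ≤ LinearMap.ker (constTerm (F := F) (r := r) (s := s)) :=
      Submodule.span_le.mpr fun g hg => h0 g hg
    exact this hf

/-- The product of `F[[y]]` as a bilinear map. -/
def serMul : Series F r s →ₗ[F] Series F r s →ₗ[F] Series F r s :=
  LinearMap.mk₂ F seriesMul seriesMul_add_left seriesMul_smul_left seriesMul_add_right
    seriesMul_smul_right

theorem serMul_apply (f g : Series F r s) : serMul f g = seriesMul f g := rfl

theorem constTerm_serMul (f g : Series F r s) :
    constTerm (serMul f g) = constTerm f * constTerm g := by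
  rw [serMul_apply, constTerm_apply, constTerm_apply, constTerm_apply, seriesMul]
  simp [crossSign]

theorem seriesTwist_apply (t : ZMod 2) (f : Series F r s) (T : Finset (Fin s)) :
    seriesTwist t f T = koszul t (T.card : ZMod 2) • f T := by
  simp only [seriesTwist, LinearMap.add_apply, LinearMap.smul_apply, Pi.add_apply, Pi.smul_apply,
    seriesPart_apply]
  rcases zmod2_cases (T.card : ZMod 2) with h | h <;> simp [h, koszul_zero_right]

theorem seriesTwist_twist (t u : ZMod 2) (f : Series F r s) :
    seriesTwist t (seriesTwist u f) = seriesTwist (t + u) f := by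
  funext T
  simp only [seriesTwist_apply, smul_smul, koszul_add_left]

theorem seriesTwist_zero (f : Series F r s) : seriesTwist 0 f = f := by
  funext T
  simp only [seriesTwist_apply, koszul_zero_left, one_smul]

theorem constTerm_twist (t : ZMod 2) (f : Series F r s) :
    constTerm (seriesTwist t f) = constTerm f := by
  rw [constTerm_apply, seriesTwist_apply]
  simp [koszul_zero_right, constTerm_apply]

theorem seriesTwist_mul (t : ZMod 2) (f g : Series F r s) :
    seriesTwist t (serMul f g) = serMul (seriesTwist t f) (seriesTwist t g) := by
  funext U
  simp only [seriesTwist_apply, serMul_apply, seriesMul, Finset.smul_sum]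
  refine Finset.sum_congr rfl fun T hT => ?_
  rw [Finset.mem_powerset] at hT
  have hcard : ((U.card : ℕ) : ZMod 2) = T.card + (U \ T).card := by
    rw [← Nat.cast_add, add_comm, Finset.card_sdiff_add_card_eq_card hT]
  rw [hcard, koszul_add_right, smul_mul_smul_comm, smul_comm]

theorem seriesTwist_D_apply (t : ZMod 2) (i : Var r s) (f : Series F r s) :
    seriesTwist t (seriesD i f) = koszul t (varParity i) • seriesD i (seriesTwist t f) := by
  rw [← Module.End.mul_apply, seriesTwist_D]; rfl

theorem seriesD_serMul (i : Var r s) (f g : Series F r s) :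
    seriesD i (serMul f g) = serMul (seriesD i f) g +
      serMul (seriesTwist (varParity i) f) (seriesD i g) := seriesD_mul' i f g

/-- By the Leibniz rule a derivative of an associator is a sum of associators, and associators have
zero constant term; Taylor's principle then makes them vanish, without any bookkeeping of the signs
`crossSign`. -/
theorem serMul_assoc [CharZero F] (f g h : Series F r s) :
    serMul (serMul f g) h = serMul f (serMul g h) := by
  rw [← sub_eq_zero]
  refine taylor_span {k | ∃ f g h : Series F r s,
    k = serMul (serMul f g) h - serMul f (serMul g h)} ?_ ?_ ⟨f, g, h, rfl⟩
  · rintro i _ ⟨f, g, h, rfl⟩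
    have e : seriesD i (serMul (serMul f g) h - serMul f (serMul g h)) =
        (serMul (serMul (seriesD i f) g) h - serMul (seriesD i f) (serMul g h)) +
        (serMul (serMul (seriesTwist (varParity i) f) (seriesD i g)) h -
          serMul (seriesTwist (varParity i) f) (serMul (seriesD i g) h)) +
        (serMul (serMul (seriesTwist (varParity i) f) (seriesTwist (varParity i) g)) (seriesD i h) -
          serMul (seriesTwist (varParity i) f)
            (serMul (seriesTwist (varParity i) g) (seriesD i h))) := by
      simp only [map_sub, seriesD_serMul, map_add, LinearMap.add_apply, seriesTwist_mul]
      abel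
    rw [e]
    exact add_mem (add_mem (Submodule.subset_span ⟨_, _, _, rfl⟩)
      (Submodule.subset_span ⟨_, _, _, rfl⟩)) (Submodule.subset_span ⟨_, _, _, rfl⟩)
  · rintro _ ⟨f, g, h, rfl⟩
    simp only [map_sub, constTerm_serMul]
    ring

/-- Same method as for associativity. The parity is quantified inside the spanning set because an
odd derivative of `f` changes it. -/
theorem serMul_comm [CharZero F] (p : ZMod 2) (f g : Series F r s) :
    serMul (seriesPart p f) g = serMul (seriesTwist p g) (seriesPart p f) := by
  rw [← sub_eq_zero]
  refine taylor_span {k | ∃ p : ZMod 2, ∃ f g : Series F r s,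
    k = serMul (seriesPart p f) g - serMul (seriesTwist p g) (seriesPart p f)} ?_ ?_ ⟨p, f, g, rfl⟩
  · rintro i _ ⟨p, f, g, rfl⟩
    have e : seriesD i (serMul (seriesPart p f) g - serMul (seriesTwist p g) (seriesPart p f)) =
        (serMul (seriesPart (p + varParity i) (seriesD i f)) g -
          serMul (seriesTwist (p + varParity i) g) (seriesPart (p + varParity i) (seriesD i f))) +
        koszul (varParity i) p • (serMul (seriesPart p f) (seriesD i g) -
          serMul (seriesTwist p (seriesD i g)) (seriesPart p f)) := by
      simp only [map_sub, seriesD_serMul, seriesTwist_part, seriesTwist_twist, seriesD_part,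
        map_zsmul, LinearMap.smul_apply, seriesTwist_D_apply, smul_sub, smul_smul,
        koszul_comm p (varParity i), koszul_mul_self, one_smul, add_comm (varParity i) p]
      abel
    rw [e]
    refine add_mem (Submodule.subset_span ⟨_, _, _, rfl⟩) (zsmul_mem (Submodule.subset_span ?_) _)
    exact ⟨_, _, _, rfl⟩
  · rintro _ ⟨p, f, g, rfl⟩
    simp only [map_sub, constTerm_serMul, constTerm_twist]
    ring

theorem seriesPart_mul_homog (p q : ZMod 2) (f g : Series F r s) :
    seriesPart (p + q) (serMul (seriesPart p f) (seriesPart q g)) =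
      serMul (seriesPart p f) (seriesPart q g) := by
  funext U
  rw [seriesPart_apply]
  split_ifs with h
  · rfl
  · rw [serMul_apply, seriesMul]
    symm
    refine Finset.sum_eq_zero fun T hT => ?_
    rw [Finset.mem_powerset] at hT
    have hcard : ((U.card : ℕ) : ZMod 2) = T.card + (U \ T).card := by
      rw [← Nat.cast_add, add_comm, Finset.card_sdiff_add_card_eq_card hT]
    rw [seriesPart_apply, seriesPart_apply]
    split_ifs with h1 h2
    · exact absurd (by rw [hcard, h1, h2]) h
    all_goals simp

theorem seriesPart_part_ne {p q : ZMod 2} (h : p ≠ q) (f : Series F r s) :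
    seriesPart p (seriesPart q f) = 0 := by
  funext T
  simp only [seriesPart_apply]
  split_ifs with h1 h2
  · exact absurd (h1.symm.trans h2) h
  all_goals rfl

end Series

/-! ## Operators on `F[x] ⊗ V` -/

section Poly

variable {F : Type*} [Field F] {r s : ℕ} {V : Type*} [AddCommGroup V] [Module F V]

theorem mulVar_single (i : Var r s) (m : Mon r s) (v : V) :
    mulVar F r s V i (Finsupp.single m v) = varSign i m • Finsupp.single (varMul i m) v := by
  simp [mulVar]

theorem coeffAct_single' (p : ZMod 2) (T : Module.End F V) (m : Mon r s) (v : V) :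
    coeffAct F r s V p T (Finsupp.single m v) =
      koszul p (monParity m) • Finsupp.single m (T v) :=
  LieConformalSuperalgebra.coeffAct_single V p T m v

theorem coeffAct_one (p : ZMod 2) (T : Module.End F V) (v : V) :
    coeffAct F r s V p T (Finsupp.single monOne v) = Finsupp.single monOne (T v) := by
  rw [coeffAct_single', monParity_monOne, koszul_zero_right, one_smul]

theorem varSign_swap (i j : Var r s) (m : Mon r s) :
    varSign j m * varSign i (varMul j m) =
      koszul (varParity i) (varParity j) * (varSign i m * varSign j (varMul i m)) := by
  rcases i with i | i <;> rcases j with j | j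
  · simp [varSign, varParity, koszul_zero_left]
  · simp [varSign, varMul, varParity, koszul_zero_left]
  · simp [varSign, varMul, varParity, koszul_zero_right]
  · simp [varSign, varMul, varParity, koszul_one_one, oddSign_swap j i]

theorem varMul_swap (i j : Var r s) (m : Mon r s) :
    varMul i (varMul j m) = varMul j (varMul i m) := by
  rcases i with i | i <;> rcases j with j | j <;>
    simp [varMul, add_right_comm, Finset.insert_comm]

variable (F r s V) in
theorem mulVar_comm (i j : Var r s) :
    mulVar F r s V i * mulVar F r s V j =
      koszul (varParity i) (varParity j) • (mulVar F r s V j * mulVar F r s V i) := by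
  refine Finsupp.lhom_ext fun m v => ?_
  simp only [Module.End.mul_apply, LinearMap.smul_apply, mulVar_single, map_zsmul, smul_smul]
  rw [varMul_swap, varSign_swap]

variable (F r s V) in
theorem mulVar_odd_sq (j : Fin s) :
    mulVar F r s V (Sum.inr j) * mulVar F r s V (Sum.inr j) = 0 := by
  refine Finsupp.lhom_ext fun m v => ?_
  simp only [Module.End.mul_apply, mulVar_single, map_zsmul, smul_smul, LinearMap.zero_apply]
  simp [varSign, varMul, oddSign]

theorem coeffAct_mul (p q : ZMod 2) (T U : Module.End F V) :
    coeffAct F r s V p T * coeffAct F r s V q U = coeffAct F r s V (p + q) (T * U) := by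
  refine Finsupp.lhom_ext fun m v => ?_
  simp only [Module.End.mul_apply, coeffAct_single', map_zsmul, smul_smul, koszul_add_left]
  rw [mul_comm]

theorem coeffAct_comm {p q : ZMod 2} {T U : Module.End F V} {c : ℤ} (h : T * U = c • (U * T)) :
    coeffAct F r s V p T * coeffAct F r s V q U =
      c • (coeffAct F r s V q U * coeffAct F r s V p T) := by
  rw [coeffAct_mul, coeffAct_mul, add_comm q p, h]
  refine Finsupp.lhom_ext fun m v => ?_
  simp only [LinearMap.smul_apply, coeffAct_single', Finsupp.smul_single, smul_comm c]

theorem coeffAct_zero (p : ZMod 2) : coeffAct F r s V p 0 = 0 := by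
  refine Finsupp.lhom_ext fun m v => ?_
  simp [coeffAct_single']

theorem coeffAct_mulVar (p : ZMod 2) (T : Module.End F V) (i : Var r s) :
    coeffAct F r s V p T * mulVar F r s V i =
      koszul p (varParity i) • (mulVar F r s V i * coeffAct F r s V p T) := by
  refine Finsupp.lhom_ext fun m v => ?_
  simp only [Module.End.mul_apply, LinearMap.smul_apply, mulVar_single, coeffAct_single', map_zsmul,
    smul_smul]
  by_cases h : varSign i m = 0
  · simp [h]
  · rw [monParity_varMul i m h, koszul_add_right]
    congr 1
    ring

theorem mulVar_coeffAct (p : ZMod 2) (T : Module.End F V) (i : Var r s) :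
    mulVar F r s V i * coeffAct F r s V p T =
      koszul (varParity i) p • (coeffAct F r s V p T * mulVar F r s V i) := by
  rw [coeffAct_mulVar, smul_smul, koszul_comm, koszul_mul_self, one_smul]

theorem monOp_mulVar_one (m : Mon r s) (v : V) :
    monOp (mulVar F r s V) m (Finsupp.single monOne v) = Finsupp.single m v := by
  induction m using mon_induction with
  | one => rw [monOp_monOne]; rfl
  | mul i m h ih =>
    rw [monOp_varMul' _ (mulVar_comm F r s V) (mulVar_odd_sq F r s V) i m h, LinearMap.smul_apply,
      Module.End.mul_apply, ih, mulVar_single, smul_smul, varSign_mul_self i m h, one_smul]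

theorem single_varMul (i : Var r s) (m : Mon r s) (h : varSign i m ≠ 0) (v : V) :
    Finsupp.single (varMul i m) v = varSign i m • mulVar F r s V i (Finsupp.single m v) := by
  rw [mulVar_single, smul_smul, varSign_mul_self i m h, one_smul]

theorem single_monVar (i : Var r s) (v : V) :
    Finsupp.single (varMul i monOne) v = mulVar F r s V i (Finsupp.single monOne v) := by
  rw [mulVar_single, varSign_monOne, one_smul]

/-- A family of supercommuting operators with vanishing odd squares. -/
structure SuperCommuting {A : Type*} [Ring A] (T : Var r s → A) : Prop where
  comm : ∀ i j, T i * T j = koszul (varParity i) (varParity j) • (T j * T i)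
  odd_sq : ∀ j, T (Sum.inr j) * T (Sum.inr j) = 0

/-- The mixed terms of an odd square cancel by anticommutation. This covers the sums `∂ + λ` and `λ
+ μ`. -/
theorem SuperCommuting.add {A : Type*} [Ring A] {T U : Var r s → A} (hT : SuperCommuting T)
    (hU : SuperCommuting U)
    (h : ∀ i j, T i * U j = koszul (varParity i) (varParity j) • (U j * T i)) :
    SuperCommuting fun i => T i + U i where
  comm i j := by
    have h2 : U i * T j = koszul (varParity i) (varParity j) • (T j * U i) := by
      rw [h, smul_smul, koszul_comm, koszul_mul_self, one_smul]
    rw [add_mul, mul_add, mul_add, add_mul, mul_add, mul_add, hT.comm i j, hU.comm i j, h i j, h2]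
    simp only [smul_add]
    abel
  odd_sq j := by
    have h1 := h (Sum.inr j) (Sum.inr j)
    simp only [varParity, koszul_one_one, neg_smul, one_smul] at h1
    rw [add_mul, mul_add, mul_add, hT.odd_sq, hU.odd_sq, h1]
    abel

theorem SuperCommuting.neg {A : Type*} [Ring A] {T : Var r s → A} (hT : SuperCommuting T) :
    SuperCommuting fun i => -T i where
  comm i j := by simp only [neg_mul, mul_neg, neg_neg, hT.comm i j]
  odd_sq j := by simp only [neg_mul, mul_neg, neg_neg, hT.odd_sq j]

theorem superCommuting_mulVar : SuperCommuting (mulVar F r s V) :=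
  ⟨mulVar_comm F r s V, mulVar_odd_sq F r s V⟩

theorem superCommuting_seriesD : SuperCommuting (seriesD (F := F) (r := r) (s := s)) :=
  ⟨seriesD_comm, seriesD_odd_sq⟩

theorem SuperCommuting.coeffAct {T : Var r s → Module.End F V} (hT : SuperCommuting T) :
    SuperCommuting fun i => coeffAct F r s V (varParity i) (T i) where
  comm i j := coeffAct_comm (hT.comm i j)
  odd_sq j := by rw [coeffAct_mul, hT.odd_sq, coeffAct_zero]

theorem SuperCommuting.monOp_varMul {A : Type*} [Ring A] {T : Var r s → A}
    (hT : SuperCommuting T) (i : Var r s) (m : Mon r s) :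
    T i * monOp T m = varSign i m • monOp T (varMul i m) :=
  ConformalSuper.monOp_varMul T hT.comm hT.odd_sq i m

theorem monOp_comm_apply {T : Var r s → Module.End F V} (p : ZMod 2) (X : Module.End F V)
    (hX : ∀ i, X * T i = koszul p (varParity i) • (T i * X)) (m : Mon r s) (v : V) :
    monOp T m (X v) = koszul p (monParity m) • X (monOp T m v) := by
  have h := congrArg (fun Z : Module.End F V => Z v) (monOp_superComm T p X hX m)
  simp only [Module.End.mul_apply, LinearMap.smul_apply] at h
  rw [h, smul_smul, koszul_mul_self, one_smul]

/-- `F[x] ⊗ V` for an abelian group `V`. -/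
abbrev PolyG (r s : ℕ) (V : Type*) [AddCommGroup V] := Poly r s V

theorem superComm_neg {V : Type*} [AddCommGroup V] [Module F V] {X T : Module.End F V} {c : ℤ}
    (h : X * T = c • (T * X)) : X * (-T) = c • ((-T) * X) := by
  refine LinearMap.ext fun v => ?_
  have := congrArg (fun Z : Module.End F V => Z v) h
  simp only [Module.End.mul_apply, LinearMap.smul_apply, LinearMap.neg_apply, map_neg,
    smul_neg] at this ⊢
  rw [this]

theorem superComm_add {V : Type*} [AddCommGroup V] [Module F V] {X T U : Module.End F V} {c : ℤ}
    (h : X * T = c • (T * X)) (h' : X * U = c • (U * X)) : X * (T + U) = c • ((T + U) * X) := by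
  rw [mul_add, add_mul, smul_add, h, h']

theorem superComm_add_left {V : Type*} [AddCommGroup V] [Module F V] {X Y T : Module.End F V}
    {c : ℤ} (h : X * T = c • (T * X)) (h' : Y * T = c • (T * Y)) :
    (X + Y) * T = c • (T * (X + Y)) := by
  rw [mul_add, add_mul, smul_add, h, h']

end Poly

/-! ## Sesquilinear brackets -/

namespace ConformalData

variable {F : Type*} [Field F] {r s : ℕ} {R : Type*} [AddCommGroup R] [Module F R]

/-- The axioms of a Lie conformal superalgebra other than skew-symmetry and the Jacobi identity. -/
structure IsSesquilinear (S : ConformalData F r s R) : Prop where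
  par_isCompl : IsCompl (S.par 0) (S.par 1)
  D_super : SuperCommuting S.D
  D_par : ∀ i p, ∀ a ∈ S.par p, S.D i a ∈ S.par (p + varParity i)
  bracket_par : ∀ p q, ∀ a ∈ S.par p, ∀ b ∈ S.par q, ∀ m,
    S.bracket a b m ∈ S.par (p + q + monParity m)
  bracket_D_left : ∀ i a b, S.bracket (S.D i a) b = -mulVar F r s R i (S.bracket a b)
  bracket_D_right : ∀ i p, ∀ a ∈ S.par p, ∀ b, S.bracket a (S.D i b) =
    koszul (varParity i) p • (S.DPoly i (S.bracket a b) + mulVar F r s R i (S.bracket a b))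

/-- A family of homogeneous generators of the `F[∂]`-module underlying `S`. -/
structure Generates (S : ConformalData F r s R) {ι : Type*} (g : ι → R) (π : ι → ZMod 2) :
    Prop where
  par : ∀ i, g i ∈ S.par (π i)
  span : ∀ p, ∀ a ∈ S.par p,
    a ∈ Submodule.span F {b | ∃ m i, monParity m + π i = p ∧ b = monOp S.D m (g i)}

variable {S : ConformalData F r s R}

theorem superCommuting_DPoly (hD : SuperCommuting S.D) : SuperCommuting S.DPoly := hD.coeffAct

theorem superCommuting_neg (hD : SuperCommuting S.D) :
    SuperCommuting fun i => -(mulVar F r s R i + S.DPoly i) :=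
  (superCommuting_mulVar.add (superCommuting_DPoly hD) fun i _ => mulVar_coeffAct _ _ i).neg

theorem D_monOp (hD : SuperCommuting S.D) (i : Var r s) (m : Mon r s) (h : varSign i m ≠ 0) (a : R) :
    monOp S.D (varMul i m) a = varSign i m • S.D i (monOp S.D m a) := by
  rw [monOp_varMul' _ hD.comm hD.odd_sq i m h]; rfl

theorem Generates.monOp_par (hS : S.IsSesquilinear) {ι : Type*} {g : ι → R} {π : ι → ZMod 2}
    (hg : S.Generates g π) (m : Mon r s) (i : ι) : monOp S.D m (g i) ∈ S.par (monParity m + π i) := by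
  induction m using mon_induction with
  | one => rw [monOp_monOne, monParity_monOne, zero_add]; exact hg.par i
  | mul k m h ih =>
    rw [D_monOp hS.D_super k m h, monParity_varMul k m h, add_assoc, add_comm]
    exact zsmul_mem (hS.D_par k _ _ ih) _

/-- A property of homogeneous elements stable under linear combinations and the `∂_i` holds if
it holds for homogeneous generators. -/
theorem Generates.induction (hS : S.IsSesquilinear) {ι : Type*} {g : ι → R} {π : ι → ZMod 2}
    (hg : S.Generates g π) {C : ZMod 2 → R → Prop} (gen : ∀ i, C (π i) (g i))
    (D : ∀ k p a, a ∈ S.par p → C p a → C (varParity k + p) (S.D k a)) (zero : ∀ p, C p 0)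
    (add : ∀ p a b, C p a → C p b → C p (a + b)) (smul : ∀ p (c : F) a, C p a → C p (c • a))
    {p : ZMod 2} {a : R} (ha : a ∈ S.par p) : C p a := by
  refine Submodule.span_induction ?_ (zero p) (fun a b _ _ => add p a b)
    (fun c a _ => smul p c a) (hg.span p a ha)
  rintro _ ⟨m, i, rfl, rfl⟩
  clear ha
  induction m using mon_induction with
  | one => rw [monOp_monOne, monParity_monOne, zero_add]; exact gen i
  | mul k m h ih =>
    rw [D_monOp hS.D_super k m h, monParity_varMul k m h, add_assoc, ← Int.cast_smul_eq_zsmul F]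
    exact smul _ _ _ (D k _ _ (hg.monOp_par hS m i) ih)

theorem substNeg_single (m : Mon r s) (c : R) : S.substNeg (Finsupp.single m c) =
    monOp (fun i => -(mulVar F r s R i + S.DPoly i)) m (Finsupp.single monOne c) := by
  simp [substNeg]

/-- The substitution is multiplicative in `λ` because the operators `-λ_i - ∂_i` satisfy the same
commutation relations as the variables `λ_i`. -/
theorem substNeg_mulVar (hD : SuperCommuting S.D) (i : Var r s) (X : Poly r s R) :
    S.substNeg (mulVar F r s R i X) =
      -(mulVar F r s R i (S.substNeg X) + S.DPoly i (S.substNeg X)) := by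
  induction X using Finsupp.induction_linear with
  | zero => simp
  | add X Y hX hY => simp only [map_add, hX, hY]; abel
  | single m c =>
    have h := congrArg (fun Z : Module.End F (Poly r s R) => Z (Finsupp.single monOne c))
      ((superCommuting_neg hD).monOp_varMul i m)
    simp only [Module.End.mul_apply, LinearMap.smul_apply, LinearMap.neg_apply,
      LinearMap.add_apply] at h
    rw [mulVar_single, map_zsmul, substNeg_single, substNeg_single, ← h]

theorem substNeg_DPoly (hD : SuperCommuting S.D) (i : Var r s) (X : Poly r s R) :
    S.substNeg (S.DPoly i X) = S.DPoly i (S.substNeg X) := by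
  induction X using Finsupp.induction_linear with
  | zero => simp
  | add X Y hX hY => simp only [map_add, hX, hY]
  | single m c =>
    rw [DPoly, coeffAct_single', map_zsmul, substNeg_single, substNeg_single,
      ← coeffAct_one (r := r) (s := s) (varParity i), monOp_comm_apply (varParity i)
      (coeffAct F r s R (varParity i) (S.D i)), smul_smul, koszul_mul_self, one_smul]
    intro j
    exact superComm_neg (superComm_add (coeffAct_mulVar (varParity i) (S.D i) j)
      ((superCommuting_DPoly hD).comm i j))

/-- Substituting `-λ - ∂` for `λ` exchanges the factors `-λ_k` and `λ_k + ∂_k` that a derivative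
produces in the two arguments. So the identity is stable under `∂_k` in either argument, and two
nested inductions reduce it to generators. -/
theorem skew_of_generators (hS : S.IsSesquilinear) {ι : Type*} {g : ι → R} {π : ι → ZMod 2}
    (hg : S.Generates g π) (h : ∀ i j, S.bracket (g j) (g i) =
      -(koszul (π i) (π j) • S.substNeg (S.bracket (g i) (g j)))) (p q : ZMod 2) (a : R)
    (ha : a ∈ S.par p) (b : R) (hb : b ∈ S.par q) :
    S.bracket b a = -(koszul p q • S.substNeg (S.bracket a b)) := by
  refine hg.induction hS (C := fun p a => S.bracket b a =
      -(koszul p q • S.substNeg (S.bracket a b))) (fun i => ?_) ?_ (by simp) ?_ ?_ ha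
  · refine hg.induction hS (C := fun q b => S.bracket b (g i) =
      -(koszul (π i) q • S.substNeg (S.bracket (g i) b))) (fun j => h i j) ?_ (by simp) ?_ ?_ hb
    · intro k q b hb ih
      rw [hS.bracket_D_left, hS.bracket_D_right k _ _ (hg.par i), ih]
      simp only [map_add, map_neg, map_zsmul, substNeg_mulVar hS.D_super, substNeg_DPoly hS.D_super,
        koszul_add_right, koszul_comm (varParity k), smul_add, smul_neg, smul_smul]
      -- Only an identity between Koszul signs is left; it is checked in each combination of
      -- parities.
      rcases zmod2_cases (varParity k) with hk | hk <;>
      rcases zmod2_cases (π i) with hi | hi <;>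
      simp only [hk, hi, koszul_zero_left, koszul_zero_right, koszul_one_one,
        mul_one, mul_neg, one_mul, neg_mul, neg_neg] <;> abel
    · intro q P Q hP hQ
      simp only [map_add, LinearMap.add_apply, hP, hQ, smul_add]; abel
    · intro q c P hP
      simp only [map_smul, LinearMap.smul_apply, hP, smul_neg, smul_comm _ c]
  · intro k p a ha ih
    rw [hS.bracket_D_left, hS.bracket_D_right k _ _ hb, ih]
    simp only [map_neg, map_zsmul, substNeg_mulVar hS.D_super, koszul_add_left, smul_add, smul_neg,
      smul_smul, neg_neg]
    abel
  · intro q P Q hP hQ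
    simp only [map_add, LinearMap.add_apply, hP, hQ, smul_add]; abel
  · intro q c P hP
    simp only [map_smul, LinearMap.smul_apply, hP, smul_neg, smul_comm _ c]

end ConformalData

/-! ## `RW(r, s)` -/

section RW

variable (F : Type*) [Field F] {r s : ℕ}

/-- The basis element `∂^m a_i`. -/
def rwBasis (m : Mon r s) (i : Var r s) : RWSpace F r s := Finsupp.single m (Pi.single i 1)

theorem rwBasis_monOne (i : Var r s) : rwBasis F monOne i = rwGen F i := rfl

theorem rwBasis_varMul (k : Var r s) (m : Mon r s) (h : varSign k m ≠ 0) (i : Var r s) :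
    rwBasis F (varMul k m) i = varSign k m • rwD F k (rwBasis F m i) :=
  single_varMul k m h _

theorem rwD_basis (k : Var r s) (m : Mon r s) (i : Var r s) :
    rwD F k (rwBasis F m i) = varSign k m • rwBasis F (varMul k m) i :=
  mulVar_single k m _

variable {F}

theorem single_eq_sum_rwBasis (m : Mon r s) (v : Var r s → F) :
    Finsupp.single m v = ∑ i, v i • rwBasis F m i := by
  simp only [rwBasis, Finsupp.smul_single]
  rw [← Finsupp.single_finsetSum]
  congr 1
  funext k
  simp [Finset.sum_apply, Pi.single_apply]

theorem rw_span (P : RWSpace F r s) :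
    P ∈ Submodule.span F (Set.range fun z : Mon r s × Var r s => rwBasis F z.1 z.2) := by
  induction P using Finsupp.induction_linear with
  | zero => exact zero_mem _
  | add P Q hP hQ => exact add_mem hP hQ
  | single m v =>
    rw [single_eq_sum_rwBasis]
    exact sum_mem fun i _ => Submodule.smul_mem _ _ (Submodule.subset_span ⟨(m, i), rfl⟩)

theorem rwBasis_apply (m n : Mon r s) (i k : Var r s) :
    rwBasis F m i n k = if m = n ∧ i = k then 1 else 0 := by
  classical
  rw [rwBasis, Finsupp.single_apply]
  by_cases h : m = n
  · simp [h, Pi.single_apply, eq_comm]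
  · simp [h]

theorem rwPar_basis (m : Mon r s) (i : Var r s) :
    rwBasis F m i ∈ rwPar F r s (monParity m + varParity i) := by
  intro n k h
  rw [rwBasis_apply, if_neg]
  rintro ⟨rfl, rfl⟩
  exact h rfl

theorem rwPar_span {p : ZMod 2} {P : RWSpace F r s} (hP : P ∈ rwPar F r s p) :
    P ∈ Submodule.span F {Q | ∃ m i, monParity m + varParity i = p ∧ Q = rwBasis F m i} := by
  have : P = ∑ m ∈ P.support, ∑ i, P m i • rwBasis F m i := by
    conv_lhs => rw [← Finsupp.sum_single P]
    exact Finset.sum_congr rfl fun m _ => single_eq_sum_rwBasis m (P m)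
  rw [this]
  refine sum_mem fun m _ => sum_mem fun i _ => ?_
  by_cases h : monParity m + varParity i = p
  · exact Submodule.smul_mem _ _ (Submodule.subset_span ⟨m, i, h, rfl⟩)
  · rw [hP m i h, zero_smul]
    exact zero_mem _

theorem rwPar_induction {p : ZMod 2} {C : RWSpace F r s → Prop}
    (basis : ∀ m i, monParity m + varParity i = p → C (rwBasis F m i)) (zero : C 0)
    (add : ∀ P Q, C P → C Q → C (P + Q)) (smul : ∀ (c : F) P, C P → C (c • P))
    {P : RWSpace F r s} (hP : P ∈ rwPar F r s p) : C P := by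
  refine Submodule.span_induction ?_ zero (fun P Q _ _ => add P Q) (fun c P _ => smul c P)
    (rwPar_span hP)
  rintro _ ⟨m, i, h, rfl⟩
  exact basis m i h

theorem rw_induction {C : RWSpace F r s → Prop}
    (basis : ∀ m i, C (rwBasis F m i)) (zero : C 0)
    (add : ∀ P Q, C P → C Q → C (P + Q)) (smul : ∀ (c : F) P, C P → C (c • P))
    (P : RWSpace F r s) : C P := by
  refine Submodule.span_induction ?_ zero (fun P Q _ _ => add P Q) (fun c P _ => smul c P)
    (rw_span P)
  rintro _ ⟨⟨m, i⟩, rfl⟩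
  exact basis m i

theorem rwD_par (i : Var r s) (p : ZMod 2) (a : RWSpace F r s) (ha : a ∈ rwPar F r s p) :
    rwD F i a ∈ rwPar F r s (p + varParity i) := by
  refine rwPar_induction (C := fun a => rwD F i a ∈ rwPar F r s (p + varParity i)) ?_ ?_ ?_ ?_ ha
  · intro m k h
    rw [rwD_basis]
    by_cases hs : varSign i m = 0
    · rw [hs, zero_smul]; exact zero_mem _
    · have := rwPar_basis (F := F) (varMul i m) k
      rw [monParity_varMul i m hs, add_assoc, h, add_comm] at this
      exact zsmul_mem this _
  · simp
  · intro P Q hP hQ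
    rw [map_add]; exact add_mem hP hQ
  · intro c P hP
    rw [map_smul]; exact Submodule.smul_mem _ _ hP

theorem rwPar_isCompl : IsCompl (rwPar F r s 0) (rwPar F r s 1) := by
  constructor
  · rw [Submodule.disjoint_def]
    intro P h0 h1
    ext m k
    rcases zmod2_cases (monParity m + varParity k) with h | h
    · exact h1 m k (by rw [h]; decide)
    · exact h0 m k (by rw [h]; decide)
  · rw [codisjoint_iff, eq_top_iff]
    intro P _
    refine rw_induction (C := fun P => P ∈ rwPar F r s 0 ⊔ rwPar F r s 1) ?_ (zero_mem _)
      (fun _ _ => add_mem) (fun c _ => Submodule.smul_mem _ c) P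
    intro m i
    have := rwPar_basis (F := F) m i
    rcases zmod2_cases (monParity m + varParity i) with h | h <;> rw [h] at this
    · exact Submodule.mem_sup_left this
    · exact Submodule.mem_sup_right this

/-- The operator `∂_i` on `F[λ] ⊗ RW(r, s)`. -/
abbrev rwDP (F : Type*) [Field F] {r s : ℕ} (i : Var r s) : Module.End F (PolyG r s (RWSpace F r s)) :=
  coeffAct F r s (RWSpace F r s) (varParity i) (rwD F i)

/-- The operator `λ_i` on `F[λ] ⊗ RW(r, s)`. -/
abbrev rwLam (F : Type*) [Field F] {r s : ℕ} (i : Var r s) :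
    Module.End F (PolyG r s (RWSpace F r s)) :=
  mulVar F r s (RWSpace F r s) i

theorem superCommuting_rwD : SuperCommuting (rwD F (r := r) (s := s)) := superCommuting_mulVar

theorem superCommuting_rwDP : SuperCommuting (rwDP F (r := r) (s := s)) :=
  superCommuting_rwD.coeffAct

theorem superCommuting_rwLam : SuperCommuting (rwLam F (r := r) (s := s)) := superCommuting_mulVar

theorem superCommuting_rwDP_lam :
    SuperCommuting fun i : Var r s => rwDP F i + rwLam F i :=
  superCommuting_rwDP.add superCommuting_rwLam fun _ j => coeffAct_mulVar _ _ j

/-- The bracket `[a_i _λ a_j]`. -/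
def rwGenBr (F : Type*) [Field F] {r s : ℕ} (i j : Var r s) : PolyG r s (RWSpace F r s) :=
  rwDP F i (Finsupp.single monOne (rwGen F j)) + rwLam F i (Finsupp.single monOne (rwGen F j)) +
      koszul (varParity i) (varParity j) • rwLam F j (Finsupp.single monOne (rwGen F i))

theorem rwGenBracket_eq (i j : Var r s) : rwGenBracket F i j = rwGenBr F i j := by
  rw [rwGenBracket, rwGenBr, coeffAct_one, rwLam, rwLam, ← single_monVar (F := F),
    ← single_monVar (F := F)]

theorem rwBracket_basis (m n : Mon r s) (i j : Var r s) :
    (RW F r s).bracket (rwBasis F m i) (rwBasis F n j) =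
      koszul (monParity n) (varParity i) •
        monOp (fun k => -rwLam F k) m
          (monOp (fun k => rwDP F k + rwLam F k) n (rwGenBr F i j)) := by
  rw [← rwGenBracket_eq]
  simp [RW, rwBracket, rwBasis, Fintype.linearCombination_apply_single]

/-- The outer factor of the bracket of basis elements is `(-λ)^m`, and the `-λ_k` supercommute, so
one more factor just lengthens the monomial. -/
theorem rwBracket_D_left (k : Var r s) (a b : RWSpace F r s) :
    (RW F r s).bracket (rwD F k a) b = -rwLam F k ((RW F r s).bracket a b) := by
  refine rw_induction (C := fun a => (RW F r s).bracket (rwD F k a) b =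
    -rwLam F k ((RW F r s).bracket a b)) (fun m i => ?_) (by simp) ?_ ?_ a
  · refine rw_induction (C := fun b => (RW F r s).bracket (rwD F k (rwBasis F m i)) b =
      -rwLam F k ((RW F r s).bracket (rwBasis F m i) b)) (fun n j => ?_) (by simp) ?_ ?_ b
    · have h := congrArg (fun Z : Module.End F (PolyG r s (RWSpace F r s)) => Z (monOp (fun k => rwDP F k + rwLam F k) n (rwGenBr F i j)))
        ((superCommuting_rwLam (F := F) (r := r) (s := s)).neg.monOp_varMul k m)
      simp only [Module.End.mul_apply, LinearMap.smul_apply, LinearMap.neg_apply] at h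
      rw [rwD_basis, map_zsmul, LinearMap.smul_apply, rwBracket_basis, rwBracket_basis, map_zsmul,
        smul_comm, ← h, smul_neg]
    · intro P Q hP hQ
      simp only [map_add, hP, hQ]; abel
    · intro c P hP
      simp only [map_smul, hP, smul_neg]
  · intro P Q hP hQ
    simp only [map_add, LinearMap.add_apply, hP, hQ]; abel
  · intro c P hP
    simp only [map_smul, LinearMap.smul_apply, hP, smul_neg]

/-- The factor `∂_k + λ_k` has to cross `(-λ)^m`, which costs the parity of `m`; the sign built into
the definition accounts for the parity of `a_i`. Together they give the parity of the first
argument. -/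
theorem rwBracket_D_right (k : Var r s) (p : ZMod 2) (a : RWSpace F r s) (ha : a ∈ rwPar F r s p)
    (b : RWSpace F r s) :
    (RW F r s).bracket a (rwD F k b) = koszul (varParity k) p •
      (rwDP F k ((RW F r s).bracket a b) + rwLam F k ((RW F r s).bracket a b)) := by
  refine rwPar_induction (C := fun a => (RW F r s).bracket a (rwD F k b) = koszul (varParity k) p •
      (rwDP F k ((RW F r s).bracket a b) + rwLam F k ((RW F r s).bracket a b)))
    (fun m i hp => ?_) (by simp) ?_ ?_ ha
  · refine rw_induction (C := fun b => (RW F r s).bracket (rwBasis F m i) (rwD F k b) =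
      koszul (varParity k) p • (rwDP F k ((RW F r s).bracket (rwBasis F m i) b) +
        rwLam F k ((RW F r s).bracket (rwBasis F m i) b)))
      (fun n j => ?_) (by simp) ?_ ?_ b
    · have h := congrArg (fun Z : Module.End F (PolyG r s (RWSpace F r s)) => Z (rwGenBr F i j))
        ((superCommuting_rwDP_lam (F := F) (r := r) (s := s)).monOp_varMul k n)
      simp only [Module.End.mul_apply, LinearMap.smul_apply] at h
      have h2 := monOp_comm_apply (T := fun k => -rwLam F (r := r) (s := s) k) (varParity k)
        (rwDP F k + rwLam F k) (fun i => by
          exact superComm_neg (superComm_add_left (coeffAct_mulVar (varParity k) (rwD F k) i)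
            (mulVar_comm F r s (RWSpace F r s) k i)))
        m (monOp (fun k => rwDP F k + rwLam F k) n (rwGenBr F i j))
      rw [← LinearMap.add_apply, rwD_basis, map_zsmul, rwBracket_basis, rwBracket_basis, map_zsmul]
      -- If an odd `∂_k` already occurs in `∂^n`, the left side is zero and `varMul k n` has the
      -- wrong parity. The vanishing of the right side is then shown separately.
      by_cases hs : varSign k n = 0
      · rw [hs, zero_smul] at h
        rw [hs, zero_smul, ← smul_comm]
        have h3 : (rwDP F k + rwLam F k) (monOp (fun k => -rwLam F k) m
          ((monOp (fun k => rwDP F k + rwLam F k) n) (rwGenBr F i j))) = 0 := by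
          have := congrArg (fun z => koszul (varParity k) (monParity m) • z) h2
          simp only [smul_smul, koszul_mul_self, one_smul] at this
          rw [← this, h, map_zero, smul_zero]
        rw [h3, smul_zero, smul_zero]
      · rw [monParity_varMul k n hs, smul_comm, ← map_zsmul (monOp (fun k => -rwLam F k) m), ← h,
          h2, smul_smul, smul_smul, ← hp]
        congr 1
        simp only [koszul_add_right, koszul_add_left]
        ring
    · intro P Q hP hQ
      simp only [map_add, hP, hQ, smul_add]; abel
    · intro c P hP
      simp only [map_smul, hP, smul_add, smul_comm c]
  · intro P Q hP hQ
    simp only [map_add, LinearMap.add_apply, hP, hQ, smul_add]; abel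
  · intro c P hP
    simp only [map_smul, LinearMap.smul_apply, hP, smul_add, smul_comm c]

theorem rwBracket_gen (i j : Var r s) :
    (RW F r s).bracket (rwGen F i) (rwGen F j) = rwGenBr F i j := by
  rw [← rwBasis_monOne, ← rwBasis_monOne, rwBracket_basis, monOp_monOne, monOp_monOne,
    monParity_monOne, koszul_zero_left, one_smul]
  rfl

theorem rwGen_par (i : Var r s) : rwGen F i ∈ rwPar F r s (varParity i) := by
  have := rwPar_basis (F := F) monOne i
  rwa [monParity_monOne, zero_add] at this

/-- Elements of parity `p` of `F[λ] ⊗ RW(r, s)`. -/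
def rwPolyPar (F : Type*) [Field F] (r s : ℕ) (p : ZMod 2) :
    Submodule F (PolyG r s (RWSpace F r s)) where
  carrier := {X | ∀ m, X m ∈ rwPar F r s (p + monParity m)}
  zero_mem' := fun _ => zero_mem _
  add_mem' := fun hX hY m => add_mem (hX m) (hY m)
  smul_mem' := fun c _ hX m => Submodule.smul_mem _ c (hX m)

theorem rwPolyPar_single {p : ZMod 2} (m : Mon r s) {a : RWSpace F r s}
    (ha : a ∈ rwPar F r s (p + monParity m)) :
    Finsupp.single m a ∈ rwPolyPar F r s p := by
  classical
  intro n
  rw [Finsupp.single_apply]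
  split_ifs with h
  · rwa [← h]
  · exact zero_mem _

theorem rwPolyPar_lam (i : Var r s) {p : ZMod 2} {X : PolyG r s (RWSpace F r s)}
    (hX : X ∈ rwPolyPar F r s p) : rwLam F i X ∈ rwPolyPar F r s (p + varParity i) := by
  rw [← Finsupp.sum_single X, Finsupp.sum, map_sum (rwLam F i)]
  refine sum_mem fun m _ => ?_
  rw [mulVar_single]
  by_cases hs : varSign i m = 0
  · rw [hs, zero_smul]; exact zero_mem _
  · suffices h : X m ∈ rwPar F r s (p + varParity i + monParity (varMul i m)) from
      zsmul_mem (rwPolyPar_single (varMul i m) h) _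
    rw [monParity_varMul i m hs, show p + varParity i + (varParity i + monParity m) =
      p + monParity m + (varParity i + varParity i) by ring, CharTwo.add_self_eq_zero, add_zero]
    exact hX m

theorem rwPolyPar_DP (i : Var r s) {p : ZMod 2} {X : PolyG r s (RWSpace F r s)}
    (hX : X ∈ rwPolyPar F r s p) : rwDP F i X ∈ rwPolyPar F r s (p + varParity i) := by
  intro m
  rw [LieConformalSuperalgebra.coeffAct_apply]
  refine zsmul_mem ?_ _
  have := rwD_par i _ _ (hX m)
  rwa [add_right_comm] at this

theorem rwBracket_par (p q : ZMod 2) (a : RWSpace F r s) (ha : a ∈ rwPar F r s p)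
    (b : RWSpace F r s) (hb : b ∈ rwPar F r s q) :
    (RW F r s).bracket a b ∈ rwPolyPar F r s (p + q) := by
  refine rwPar_induction (C := fun a => (RW F r s).bracket a b ∈ rwPolyPar F r s (p + q))
    (fun m i hp => ?_) (by simp) ?_ ?_ ha
  · refine rwPar_induction (C := fun b => (RW F r s).bracket (rwBasis F m i) b ∈
      rwPolyPar F r s (p + q)) (fun n j hq => ?_) (by simp) ?_ ?_ hb
    · clear ha hb
      subst hp hq
      induction m using mon_induction with
      | one =>
        induction n using mon_induction with
        | one =>
          rw [rwBasis_monOne, rwBasis_monOne, rwBracket_gen, rwGenBr, monParity_monOne,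
            zero_add, zero_add]
          have h : ∀ k, Finsupp.single monOne (rwGen F k) ∈ rwPolyPar F r s (varParity k) :=
            fun k => rwPolyPar_single _ (by
              rw [monParity_monOne, add_zero]; exact rwGen_par k)
          have e : varParity i + varParity j = varParity j + varParity i := add_comm _ _
          refine add_mem (add_mem ?_ ?_) (zsmul_mem ?_ _)
          · rw [e]; exact rwPolyPar_DP i (h j)
          · rw [e]; exact rwPolyPar_lam i (h j)
          · exact rwPolyPar_lam j (h i)
        | mul k n h ih =>
          rw [rwBasis_varMul _ _ _ h, map_zsmul, rwBracket_D_right k _ _ (rwPar_basis _ _),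
            monParity_varMul k n h]
          refine zsmul_mem (zsmul_mem ?_ _) _
          have e : monParity (monOne : Mon r s) + varParity i +
            (varParity k + monParity n + varParity j) =
            monParity (monOne : Mon r s) + varParity i + (monParity n + varParity j) +
              varParity k := by ring
          rw [e]
          exact add_mem (rwPolyPar_DP k ih) (rwPolyPar_lam k ih)
      | mul k m h ih =>
        rw [rwBasis_varMul _ _ _ h, map_zsmul, LinearMap.smul_apply, rwBracket_D_left,
            monParity_varMul k m h]
        refine zsmul_mem (neg_mem ?_) _
        have e : varParity k + monParity m + varParity i +
            (monParity n + varParity j) =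
            monParity m + varParity i + (monParity n + varParity j) +
              varParity k := by ring
        rw [e]
        exact rwPolyPar_lam k ih
    · intro P Q hP hQ
      rw [map_add]; exact add_mem hP hQ
    · intro c P hP
      rw [map_smul]; exact Submodule.smul_mem _ _ hP
  · intro P Q hP hQ
    rw [map_add]; exact add_mem hP hQ
  · intro c P hP
    rw [map_smul]; exact Submodule.smul_mem _ _ hP

theorem rw_isSesquilinear : (RW F r s).IsSesquilinear where
  par_isCompl := rwPar_isCompl
  D_super := superCommuting_rwD
  D_par := rwD_par
  bracket_par p q a ha b hb := rwBracket_par p q a ha b hb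
  bracket_D_left := rwBracket_D_left
  bracket_D_right := rwBracket_D_right

theorem rw_monOp (m : Mon r s) (i : Var r s) : monOp (rwD F) m (rwGen F i) = rwBasis F m i :=
  monOp_mulVar_one m _

theorem rw_generates : (RW F r s).Generates (rwGen F) varParity where
  par := rwGen_par
  span p a ha := by
    refine Submodule.span_mono ?_ (rwPar_span ha)
    rintro _ ⟨m, i, h, rfl⟩
    exact ⟨m, i, h, (rw_monOp m i).symm⟩

/-- The substitution sends `(∂_i + λ_i) a_j` to `-λ_i a_j` and `λ_j a_i` to `-(∂_j + λ_j) a_i`, so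
the two halves of the bracket change roles. -/
theorem rw_skew_gen (i j : Var r s) : (RW F r s).bracket (rwGen F j) (rwGen F i) =
    -(koszul (varParity i) (varParity j) •
      (RW F r s).substNeg ((RW F r s).bracket (rwGen F i) (rwGen F j))) := by
  have h1 : ∀ c, (RW F r s).substNeg (Finsupp.single monOne c) = Finsupp.single monOne c := by
    intro c
    rw [ConformalData.substNeg_single, monOp_monOne]
    rfl
  have e : ∀ i j, (RW F r s).bracket (rwGen F i) (rwGen F j) =
    (RW F r s).DPoly i (Finsupp.single monOne (rwGen F j)) +
    mulVar F r s (RWSpace F r s) i (Finsupp.single monOne (rwGen F j)) +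
      koszul (varParity i) (varParity j) •
        mulVar F r s (RWSpace F r s) j (Finsupp.single monOne (rwGen F i)) :=
    fun i j => (rwBracket_gen i j).trans (by rfl)
  simp only [e, map_add, map_zsmul, ConformalData.substNeg_mulVar rw_isSesquilinear.D_super,
    ConformalData.substNeg_DPoly rw_isSesquilinear.D_super, h1, koszul_comm (varParity j) (varParity i)]
  simp only [smul_add, smul_neg, smul_smul, koszul_mul_self, one_smul]
  abel

end RW

/-! ## The Jacobi identity -/

namespace ConformalData

variable {F : Type*} [Field F] {r s : ℕ} {R : Type*} [AddCommGroup R] [Module F R]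
  (S : ConformalData F r s R)

/-- The action of `∂_i` on `F[λ] ⊗ F[μ] ⊗ R`. -/
def DPoly₂ (i : Var r s) : Module.End F (Poly r s (PolyG r s R)) :=
  coeffAct F r s (PolyG r s R) (varParity i) (S.DPoly i)

/-- The inclusion of `F[λ] ⊗ R` into `F[λ] ⊗ F[μ] ⊗ R`. -/
def inclLam (F : Type*) [Field F] (r s : ℕ) (R : Type*) [AddCommGroup R] [Module F R] :
    Poly r s R →ₗ[F] Poly r s (PolyG r s R) :=
  Finsupp.mapRange.linearMap (Finsupp.lsingle (R := F) (monOne : Mon r s))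

/-- The substitution `P(λ) ⊗ c ↦ P(λ + μ) ⊗ c`. -/
def substAdd (F : Type*) [Field F] (r s : ℕ) (R : Type*) [AddCommGroup R] [Module F R] :
    Poly r s R →ₗ[F] Poly r s (PolyG r s R) :=
  Finsupp.lsum F fun n => (monOp (fun i => lam F r s R i + mu F r s R i) n).comp
    ((Finsupp.lsingle monOne).comp (Finsupp.lsingle monOne))

/-- `P(μ) ⊗ d ↦ [a_λ (P(μ) ⊗ d)]`. -/
def jacL (p : ZMod 2) (a : R) : Poly r s R →ₗ[F] Poly r s (PolyG r s R) :=
  Finsupp.lsum F fun m => koszul p (monParity m) •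
    (monOp (mu F r s R) m).comp ((inclLam F r s R).comp (S.bracket a))

/-- `P(λ) ⊗ d ↦ [(P(λ) ⊗ d)_{λ+μ} c]`. -/
def jacM (c : R) : Poly r s R →ₗ[F] Poly r s (PolyG r s R) :=
  Finsupp.lsum F fun m =>
    (monOp (lam F r s R) m).comp ((substAdd F r s R).comp (S.bracket.flip c))

/-- `P(λ) ⊗ d ↦ [b_μ (P(λ) ⊗ d)]`. -/
def jacR (q : ZMod 2) (b : R) : Poly r s R →ₗ[F] Poly r s (PolyG r s R) :=
  Finsupp.lsum F fun m => koszul q (monParity m) • (Finsupp.lsingle m).comp (S.bracket b)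

theorem jacLeft_eq (p : ZMod 2) (a b c : R) : S.jacLeft p a b c = S.jacL p a (S.bracket b c) := rfl

theorem jacMid_eq (a b c : R) : S.jacMid a b c = S.jacM c (S.bracket a b) := rfl

theorem jacRight_eq (q : ZMod 2) (a b c : R) :
    S.jacRight q a b c = S.jacR q b (S.bracket a c) := rfl

theorem jacL_single (p : ZMod 2) (a : R) (m : Mon r s) (d : R) :
    S.jacL p a (Finsupp.single m d) = koszul p (monParity m) •
      monOp (mu F r s R) m (inclLam F r s R (S.bracket a d)) := by
  simp [jacL]

theorem jacM_single (c : R) (m : Mon r s) (d : R) :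
    S.jacM c (Finsupp.single m d) =
      monOp (lam F r s R) m (substAdd F r s R (S.bracket d c)) := by
  simp [jacM]

theorem jacR_single (q : ZMod 2) (b : R) (m : Mon r s) (d : R) :
    S.jacR q b (Finsupp.single m d) = koszul q (monParity m) • Finsupp.single m (S.bracket b d) := by
  simp [jacR]

theorem substAdd_single (n : Mon r s) (e : R) :
    substAdd F r s R (Finsupp.single n e) = monOp (fun i => lam F r s R i + mu F r s R i) n
      (Finsupp.single monOne (Finsupp.single monOne e)) := by
  simp [substAdd]

theorem inclLam_single (m : Mon r s) (d : R) :
    inclLam F r s R (Finsupp.single m d) = Finsupp.single m (Finsupp.single monOne d) := by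
  simp [inclLam]

theorem superCommuting_lam : SuperCommuting (lam F r s R) := superCommuting_mulVar

theorem superCommuting_mu : SuperCommuting (mu F r s R) := superCommuting_mulVar.coeffAct

theorem lam_mu (i j : Var r s) : lam F r s R i * mu F r s R j =
    koszul (varParity i) (varParity j) • (mu F r s R j * lam F r s R i) := mulVar_coeffAct _ _ i

theorem mu_lam (i j : Var r s) : mu F r s R i * lam F r s R j =
    koszul (varParity i) (varParity j) • (lam F r s R j * mu F r s R i) := coeffAct_mulVar _ _ j

theorem superCommuting_lam_mu : SuperCommuting fun i => lam F r s R i + mu F r s R i :=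
  superCommuting_lam.add superCommuting_mu lam_mu

variable {S}

theorem DPoly₂_lam (i j : Var r s) : S.DPoly₂ i * lam F r s R j =
    koszul (varParity i) (varParity j) • (lam F r s R j * S.DPoly₂ i) := coeffAct_mulVar _ _ j

theorem DPoly₂_mu (i j : Var r s) : S.DPoly₂ i * mu F r s R j =
    koszul (varParity i) (varParity j) • (mu F r s R j * S.DPoly₂ i) :=
  coeffAct_comm (coeffAct_mulVar _ _ j)

theorem DPoly₂_comm (hD : SuperCommuting S.D) (i j : Var r s) : S.DPoly₂ i * S.DPoly₂ j =
    koszul (varParity i) (varParity j) • (S.DPoly₂ j * S.DPoly₂ i) :=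
  coeffAct_comm ((superCommuting_DPoly hD).comm i j)

theorem inclLam_mulVar (i : Var r s) (X : Poly r s R) :
    inclLam F r s R (mulVar F r s R i X) = lam F r s R i (inclLam F r s R X) := by
  induction X using Finsupp.induction_linear with
  | zero => simp
  | add X Y hX hY => simp only [map_add, hX, hY]
  | single m c =>
    rw [mulVar_single, map_zsmul, inclLam_single, inclLam_single, lam, mulVar_single]

theorem inclLam_DPoly (i : Var r s) (X : Poly r s R) :
    inclLam F r s R (S.DPoly i X) = S.DPoly₂ i (inclLam F r s R X) := by
  induction X using Finsupp.induction_linear with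
  | zero => simp
  | add X Y hX hY => simp only [map_add, hX, hY]
  | single m c =>
    rw [DPoly, coeffAct_single', map_zsmul, inclLam_single, inclLam_single, DPoly₂,
      coeffAct_single', DPoly, coeffAct_one]

theorem substAdd_mulVar (i : Var r s) (X : Poly r s R) :
    substAdd F r s R (mulVar F r s R i X) =
      lam F r s R i (substAdd F r s R X) + mu F r s R i (substAdd F r s R X) := by
  induction X using Finsupp.induction_linear with
  | zero => simp
  | add X Y hX hY => simp only [map_add, hX, hY]; abel
  | single m c =>
    have h := congrArg (fun Z : Module.End F (Poly r s (PolyG r s R)) =>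
      Z (Finsupp.single monOne (Finsupp.single monOne c)))
      ((superCommuting_lam_mu (F := F) (R := R)).monOp_varMul i m)
    simp only [Module.End.mul_apply, LinearMap.smul_apply, LinearMap.add_apply] at h
    rw [mulVar_single, map_zsmul, substAdd_single, substAdd_single, ← h]

theorem substAdd_DPoly (i : Var r s) (X : Poly r s R) :
    substAdd F r s R (S.DPoly i X) = S.DPoly₂ i (substAdd F r s R X) := by
  induction X using Finsupp.induction_linear with
  | zero => simp
  | add X Y hX hY => simp only [map_add, hX, hY]
  | single m c =>
    rw [DPoly, coeffAct_single', map_zsmul, substAdd_single, substAdd_single,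
      ← coeffAct_one (r := r) (s := s) (varParity i) (S.D i), ← DPoly,
      ← coeffAct_one (r := r) (s := s) (varParity i) (S.DPoly i), ← DPoly₂,
      monOp_comm_apply (varParity i) (S.DPoly₂ i), smul_smul, koszul_mul_self, one_smul]
    exact fun j => superComm_add (DPoly₂_lam i j) (DPoly₂_mu i j)

/-- This and the following rules describe how the three Jacobi terms react when the inner bracket is
multiplied by a variable or hit by `∂_i`, or when the remaining argument is differentiated. They
make the Jacobi identity stable under `∂_i` in every argument. -/
theorem jacL_mulVar (p : ZMod 2) (a : R) (i : Var r s) (X : Poly r s R) :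
    S.jacL p a (mulVar F r s R i X) =
      koszul p (varParity i) • mu F r s R i (S.jacL p a X) := by
  induction X using Finsupp.induction_linear with
  | zero => simp
  | add X Y hX hY => simp only [map_add, hX, hY, smul_add]
  | single m d =>
    have h := congrArg (fun Z : Module.End F (Poly r s (PolyG r s R)) =>
      Z (inclLam F r s R (S.bracket a d)))
      ((superCommuting_mu (F := F) (R := R)).monOp_varMul i m)
    simp only [Module.End.mul_apply, LinearMap.smul_apply] at h
    rw [mulVar_single, map_zsmul, jacL_single, jacL_single, map_zsmul, h, smul_smul, smul_smul,
      smul_smul]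
    by_cases hs : varSign i m = 0
    · rw [hs, zero_mul, mul_zero]
    · rw [monParity_varMul i m hs, koszul_add_right]
      congr 1
      ring

theorem jacL_DPoly (hS : S.IsSesquilinear) (p : ZMod 2) (a : R) (ha : a ∈ S.par p) (i : Var r s)
    (X : Poly r s R) : S.jacL p a (S.DPoly i X) = koszul (varParity i) p •
      (S.DPoly₂ i (S.jacL p a X) + lam F r s R i (S.jacL p a X)) := by
  induction X using Finsupp.induction_linear with
  | zero => simp
  | add X Y hX hY => simp only [map_add, hX, hY, smul_add]; abel
  | single m d =>
    have h := monOp_comm_apply (T := mu F r s R) (varParity i) (S.DPoly₂ i + lam F r s R i)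
      (fun j => superComm_add_left (DPoly₂_mu i j) (lam_mu i j)) m
      (inclLam F r s R (S.bracket a d))
    simp only [LinearMap.add_apply] at h
    rw [DPoly, coeffAct_single', map_zsmul, jacL_single, jacL_single,
      hS.bracket_D_right i p a ha, map_zsmul, map_add, inclLam_DPoly, inclLam_mulVar, map_zsmul, h]
    simp only [map_zsmul, smul_add, smul_smul]
    congr 2 <;> linear_combination (koszul p (monParity m) * koszul (varParity i) p) *
      koszul_mul_self (varParity i) (monParity m)

theorem jacL_D (hS : S.IsSesquilinear) (p : ZMod 2) (a : R) (i : Var r s) (X : Poly r s R) :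
    S.jacL (varParity i + p) (S.D i a) X = -lam F r s R i (S.jacL p a X) := by
  induction X using Finsupp.induction_linear with
  | zero => simp
  | add X Y hX hY => simp only [map_add, hX, hY]; abel
  | single m d =>
    have h := monOp_comm_apply (T := mu F r s R) (varParity i) (lam F r s R i)
      (fun j => lam_mu i j) m (inclLam F r s R (S.bracket a d))
    rw [jacL_single, jacL_single, hS.bracket_D_left, map_neg, inclLam_mulVar, map_neg, h]
    simp only [map_zsmul, smul_neg, smul_smul, neg_inj]
    congr 1
    rw [koszul_add_left]
    linear_combination (koszul p (monParity m)) * koszul_mul_self (varParity i) (monParity m)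

theorem jacM_mulVar (c : R) (i : Var r s) (X : Poly r s R) :
    S.jacM c (mulVar F r s R i X) = lam F r s R i (S.jacM c X) := by
  induction X using Finsupp.induction_linear with
  | zero => simp
  | add X Y hX hY => simp only [map_add, hX, hY]
  | single m d =>
    have h := congrArg (fun Z : Module.End F (Poly r s (PolyG r s R)) =>
      Z (substAdd F r s R (S.bracket d c)))
      ((superCommuting_lam (F := F) (R := R)).monOp_varMul i m)
    simp only [Module.End.mul_apply, LinearMap.smul_apply] at h
    rw [mulVar_single, map_zsmul, jacM_single, jacM_single, h]

/-- The inner bracket is the left argument of a bracket taken at `λ + μ`, so `∂_i` becomes `-(λ_i +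
μ_i)`. -/
theorem jacM_DPoly (hS : S.IsSesquilinear) (c : R) (i : Var r s) (X : Poly r s R) :
    S.jacM c (S.DPoly i X) =
      -(lam F r s R i (S.jacM c X) + mu F r s R i (S.jacM c X)) := by
  induction X using Finsupp.induction_linear with
  | zero => simp
  | add X Y hX hY => simp only [map_add, hX, hY]; abel
  | single m d =>
    have h := monOp_comm_apply (T := lam F r s R) (varParity i) (lam F r s R i + mu F r s R i)
      (fun j => superComm_add_left (superCommuting_lam.comm i j) (mu_lam i j)) m
      (substAdd F r s R (S.bracket d c))
    simp only [LinearMap.add_apply] at h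
    rw [DPoly, coeffAct_single', map_zsmul, jacM_single, jacM_single, hS.bracket_D_left, map_neg,
      substAdd_mulVar, map_neg, h, smul_neg, smul_smul, koszul_mul_self, one_smul]

/-- Homogeneity of `X` is needed because `∂_i` crosses its coefficients. The coefficient at `m` has
parity `p + p(m)`, and crossing `λ^m` cancels the contribution of `m`. -/
theorem jacM_D (hS : S.IsSesquilinear) (p : ZMod 2) (c : R) (i : Var r s) (X : Poly r s R)
    (hX : ∀ m, X m ∈ S.par (p + monParity m)) :
    S.jacM (S.D i c) X = koszul (varParity i) p •
      (S.DPoly₂ i (S.jacM c X) + lam F r s R i (S.jacM c X) + mu F r s R i (S.jacM c X)) := by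
  rw [← Finsupp.sum_single X, Finsupp.sum]
  simp only [map_sum, ← Finset.sum_add_distrib, Finset.smul_sum]
  refine Finset.sum_congr rfl fun m _ => ?_
  have h := monOp_comm_apply (T := lam F r s R) (varParity i)
      (S.DPoly₂ i + (lam F r s R i + mu F r s R i))
      (fun j => superComm_add_left (DPoly₂_lam i j)
        (superComm_add_left (superCommuting_lam.comm i j) (mu_lam i j))) m
      (substAdd F r s R (S.bracket (X m) c))
  simp only [LinearMap.add_apply] at h
  rw [jacM_single, jacM_single, hS.bracket_D_right i _ _ (hX m), map_zsmul, map_add,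
    substAdd_DPoly, substAdd_mulVar, map_zsmul, h, smul_smul, koszul_add_right, mul_assoc,
    koszul_mul_self, mul_one, add_assoc]

theorem jacR_mulVar (q : ZMod 2) (b : R) (i : Var r s) (X : Poly r s R) :
    S.jacR q b (mulVar F r s R i X) =
      koszul q (varParity i) • lam F r s R i (S.jacR q b X) := by
  induction X using Finsupp.induction_linear with
  | zero => simp
  | add X Y hX hY => simp only [map_add, hX, hY, smul_add]
  | single m d =>
    rw [mulVar_single, map_zsmul, jacR_single, jacR_single, map_zsmul, lam, mulVar_single,
      smul_smul, smul_smul, smul_smul]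
    by_cases hs : varSign i m = 0
    · rw [hs, zero_mul, mul_zero]
    · rw [monParity_varMul i m hs, koszul_add_right]
      congr 1
      ring

theorem jacR_DPoly (hS : S.IsSesquilinear) (q : ZMod 2) (b : R) (hb : b ∈ S.par q) (i : Var r s)
    (X : Poly r s R) : S.jacR q b (S.DPoly i X) = koszul (varParity i) q •
      (S.DPoly₂ i (S.jacR q b X) + mu F r s R i (S.jacR q b X)) := by
  induction X using Finsupp.induction_linear with
  | zero => simp
  | add X Y hX hY => simp only [map_add, hX, hY, smul_add]; abel
  | single m d =>
    rw [DPoly, coeffAct_single', map_zsmul, jacR_single, jacR_single,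
      hS.bracket_D_right i q b hb, map_zsmul, map_zsmul, DPoly₂, coeffAct_single', mu,
      coeffAct_single']
    simp only [smul_add, smul_smul, ← Finsupp.smul_single, Finsupp.single_add]
    congr 2 <;> ring

theorem jacR_D (hS : S.IsSesquilinear) (q : ZMod 2) (b : R) (i : Var r s) (X : Poly r s R) :
    S.jacR (varParity i + q) (S.D i b) X = -mu F r s R i (S.jacR q b X) := by
  induction X using Finsupp.induction_linear with
  | zero => simp
  | add X Y hX hY => simp only [map_add, hX, hY]; abel
  | single m d =>
    rw [jacR_single, jacR_single, hS.bracket_D_left, map_zsmul, mu, coeffAct_single']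
    simp only [smul_smul, Finsupp.single_neg, smul_neg, neg_inj, koszul_add_left]
    congr 1
    ring

theorem jacL_add (p : ZMod 2) (a b : R) : S.jacL p (a + b) = S.jacL p a + S.jacL p b := by
  refine Finsupp.lhom_ext fun m d => ?_
  simp only [LinearMap.add_apply, jacL_single, map_add, smul_add]

theorem jacL_smul (p : ZMod 2) (k : F) (a : R) : S.jacL p (k • a) = k • S.jacL p a := by
  refine Finsupp.lhom_ext fun m d => ?_
  simp only [LinearMap.smul_apply, jacL_single, map_smul, smul_comm k]

theorem jacL_zero (p : ZMod 2) : S.jacL p 0 = 0 := by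
  simpa using jacL_smul (S := S) p 0 0

theorem jacR_add (p : ZMod 2) (a b : R) : S.jacR p (a + b) = S.jacR p a + S.jacR p b := by
  refine Finsupp.lhom_ext fun m d => ?_
  simp only [LinearMap.add_apply, jacR_single, map_add, smul_add, Finsupp.single_add]

theorem jacR_smul (p : ZMod 2) (k : F) (a : R) : S.jacR p (k • a) = k • S.jacR p a := by
  refine Finsupp.lhom_ext fun m d => ?_
  simp only [LinearMap.smul_apply, jacR_single, map_smul, smul_comm k, ← Finsupp.smul_single]

theorem jacR_zero (p : ZMod 2) : S.jacR p 0 = 0 := by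
  simpa using jacR_smul (S := S) p 0 0

theorem jacM_add (a b : R) : S.jacM (a + b) = S.jacM a + S.jacM b := by
  refine Finsupp.lhom_ext fun m d => ?_
  simp only [LinearMap.add_apply, jacM_single, map_add]

theorem jacM_smul (k : F) (a : R) : S.jacM (k • a) = k • S.jacM a := by
  refine Finsupp.lhom_ext fun m d => ?_
  simp only [LinearMap.smul_apply, jacM_single, map_smul]

theorem jacM_zero : S.jacM 0 = 0 := by
  simpa using jacM_smul (S := S) 0 0

/-- Differentiating `a`, `b` or `c` acts on all three terms alike: by `-λ_k`, `-μ_k`, or `∂_k + λ_k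
+ μ_k` with matching signs. Three nested inductions therefore leave only triples of generators. -/
theorem jacobi_of_generators (hS : S.IsSesquilinear) {ι : Type*} {g : ι → R} {π : ι → ZMod 2}
    (hg : S.Generates g π) (h : ∀ i j k, S.jacLeft (π i) (g i) (g j) (g k) =
      S.jacMid (g i) (g j) (g k) + koszul (π i) (π j) • S.jacRight (π j) (g i) (g j) (g k))
    (p q : ZMod 2) (a : R) (ha : a ∈ S.par p) (b : R) (hb : b ∈ S.par q) (c : R) :
    S.jacLeft p a b c = S.jacMid a b c + koszul p q • S.jacRight q a b c := by
  simp only [jacLeft_eq, jacMid_eq, jacRight_eq] at h ⊢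
  have main : ∀ t, ∀ c ∈ S.par t, S.jacL p a (S.bracket b c) =
      S.jacM c (S.bracket a b) + koszul p q • S.jacR q b (S.bracket a c) := by
    intro t c hc
    refine hg.induction hS (C := fun p a => S.jacL p a (S.bracket b c) =
      S.jacM c (S.bracket a b) + koszul p q • S.jacR q b (S.bracket a c)) (fun i => ?_) ?_
      (by simp [jacL_zero]) ?_ ?_ ha
    · refine hg.induction hS (C := fun q b => S.jacL (π i) (g i) (S.bracket b c) =
        S.jacM c (S.bracket (g i) b) + koszul (π i) q • S.jacR q b (S.bracket (g i) c))
        (fun j => ?_) ?_ (by simp [jacR_zero]) ?_ ?_ hb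
      · refine hg.induction hS (C := fun _ c => S.jacL (π i) (g i) (S.bracket (g j) c) =
          S.jacM c (S.bracket (g i) (g j)) +
            koszul (π i) (π j) • S.jacR (π j) (g j) (S.bracket (g i) c))
          (fun k => h i j k) ?_ (by simp [jacM_zero]) ?_ ?_ hc
        · intro k t c _ ih
          rw [hS.bracket_D_right k _ _ (hg.par j), hS.bracket_D_right k _ _ (hg.par i),
            jacM_D hS (π i + π j) c k _ (hS.bracket_par _ _ _ (hg.par i) _ (hg.par j))]
          simp only [map_add, map_zsmul, jacL_DPoly hS _ _ (hg.par i), jacL_mulVar,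
            jacR_DPoly hS _ _ (hg.par j), jacR_mulVar, ih, koszul_add_right,
            koszul_comm _ (varParity k), smul_add, smul_smul]
          -- The terms agree up to Koszul signs, compared in the eight parity cases.
          rcases zmod2_cases (varParity k) with hk | hk <;>
          rcases zmod2_cases (π i) with hi | hi <;> rcases zmod2_cases (π j) with hj | hj <;>
          simp only [hk, hi, hj, koszul_zero_left, koszul_zero_right, koszul_one_one,
            mul_one, mul_neg, one_mul, neg_mul, neg_neg, neg_smul, one_smul] <;> abel
        · intro q P Q hP hQ
          simp only [map_add, jacM_add, LinearMap.add_apply, hP, hQ, smul_add]; abel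
        · intro q c P hP
          simp only [map_smul, jacM_smul, LinearMap.smul_apply, hP, smul_add, smul_comm _ c]
      · intro k q b hb ih
        rw [hS.bracket_D_left, hS.bracket_D_right k _ _ (hg.par i), jacR_D hS]
        simp only [map_add, map_neg, map_zsmul, jacL_mulVar, jacM_mulVar, jacM_DPoly hS, ih,
          koszul_add_right, koszul_comm _ (varParity k), smul_add, smul_neg, smul_smul, neg_add]
        abel
      · intro q P Q hP hQ
        simp only [map_add, jacR_add, LinearMap.add_apply, hP, hQ, smul_add]; abel
      · intro q c P hP
        simp only [map_smul, jacR_smul, LinearMap.smul_apply, hP, smul_add, smul_comm _ c]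
    · intro k p a ha ih
      rw [hS.bracket_D_left, hS.bracket_D_left, jacL_D hS]
      simp only [map_add, map_neg, map_zsmul, jacM_mulVar, jacR_mulVar, ih, koszul_add_left,
        koszul_comm _ (varParity k), smul_neg, smul_smul, neg_add]
      rw [mul_right_comm, koszul_mul_self, one_mul]
    · intro q P Q hP hQ
      simp only [map_add, jacL_add, LinearMap.add_apply, hP, hQ, smul_add]; abel
    · intro q c P hP
      simp only [map_smul, jacL_smul, LinearMap.smul_apply, hP, smul_add, smul_comm _ c]
  -- The third argument is arbitrary, so it is split into its even and odd parts.
  have hc : c ∈ S.par 0 ⊔ S.par 1 := by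
    rw [hS.par_isCompl.sup_eq_top]; trivial
  obtain ⟨c₀, h₀, c₁, h₁, rfl⟩ := Submodule.mem_sup.mp hc
  simp only [map_add, jacM_add, LinearMap.add_apply, main 0 c₀ h₀, main 1 c₁ h₁, smul_add]
  abel

end ConformalData

/-! ### The Jacobi identity for RW(r,s) -/

section RW

variable {F : Type*} [Field F] {r s : ℕ}

open ConformalData

theorem rwBracket_gen_eq (i j : Var r s) : (RW F r s).bracket (rwGen F i) (rwGen F j) =
    (RW F r s).DPoly i (Finsupp.single monOne (rwGen F j)) +
    mulVar F r s (RWSpace F r s) i (Finsupp.single monOne (rwGen F j)) +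
      koszul (varParity i) (varParity j) •
        mulVar F r s (RWSpace F r s) j (Finsupp.single monOne (rwGen F i)) :=
  rwBracket_gen i j

/-- All terms become words of two operators among `∂`, `λ`, `μ`, applied to one of the generators
`a_i`, `a_j`, `a_k`. After sorting the operators only signs have to be compared. -/
theorem rw_jacobi_gen (i j k : Var r s) :
    (RW F r s).jacLeft (varParity i) (rwGen F i) (rwGen F j) (rwGen F k) =
      (RW F r s).jacMid (rwGen F i) (rwGen F j) (rwGen F k) +
        koszul (varParity i) (varParity j) •
          (RW F r s).jacRight (varParity j) (rwGen F i) (rwGen F j) (rwGen F k) := by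
  have hS := rw_isSesquilinear (F := F) (r := r) (s := s)
  have hL : ∀ p a d, (RW F r s).jacL p a (Finsupp.single monOne d) =
      inclLam F r s (RWSpace F r s) ((RW F r s).bracket a d) := by
    intro p a d
    rw [jacL_single, monParity_monOne, koszul_zero_right, one_smul, monOp_monOne]; rfl
  have hM : ∀ c d, (RW F r s).jacM c (Finsupp.single monOne d) =
      substAdd F r s (RWSpace F r s) ((RW F r s).bracket d c) := by
    intro c d
    rw [jacM_single, monOp_monOne]; rfl
  have hR : ∀ q b d, (RW F r s).jacR q b (Finsupp.single monOne d) =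
      Finsupp.single monOne ((RW F r s).bracket b d) := by
    intro q b d
    rw [jacR_single, monParity_monOne, koszul_zero_right, one_smul]
  have hRD : ∀ (x : Var r s) (X : PolyG r s (RWSpace F r s)),
      (Finsupp.single monOne ((RW F r s).DPoly x X) : Poly r s (PolyG r s (RWSpace F r s))) =
        (RW F r s).DPoly₂ x (Finsupp.single monOne X) := by
    intro x X
    rw [DPoly₂, coeffAct_one]
  have hRl : ∀ (x : Var r s) (X : PolyG r s (RWSpace F r s)),
      (Finsupp.single monOne (mulVar F r s (RWSpace F r s) x X) :
        Poly r s (PolyG r s (RWSpace F r s))) =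
        mu F r s (RWSpace F r s) x (Finsupp.single monOne X) := by
    intro x X
    rw [mu, coeffAct_one]
  have hK : ∀ d, substAdd F r s (RWSpace F r s) (Finsupp.single monOne d) =
      Finsupp.single monOne (Finsupp.single monOne d) := by
    intro d
    rw [substAdd_single, monOp_monOne]; rfl
  set e : Var r s → Poly r s (PolyG r s (RWSpace F r s)) :=
    fun x => Finsupp.single monOne (Finsupp.single monOne (rwGen F x)) with he
  have he' : ∀ x, Finsupp.single monOne (Finsupp.single monOne (rwGen F x)) = e x := fun _ => rfl
  have sw : ∀ (x y : Var r s) (A B : Var r s → Module.End F (Poly r s (PolyG r s (RWSpace F r s))))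
      (_ : ∀ x y, A x * B y = koszul (varParity x) (varParity y) • (B y * A x)) (v),
      A x (B y v) = koszul (varParity x) (varParity y) • B y (A x v) := by
    intro x y A B h v
    have := congrArg (fun Z : Module.End F (Poly r s (PolyG r s (RWSpace F r s))) => Z v) (h x y)
    exact this
  have sw' : ∀ (x y : Var r s) (A B : Var r s → Module.End F (Poly r s (PolyG r s (RWSpace F r s))))
      (_ : ∀ x y, A x * B y = koszul (varParity x) (varParity y) • (B y * A x)) (v),
      B y (A x v) = koszul (varParity x) (varParity y) • A x (B y v) := by
    intro x y A B h v
    rw [sw x y A B h, smul_smul, koszul_mul_self, one_smul]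
  have DL : ∀ x y v, _ := fun x y v => sw x y _ _ (DPoly₂_lam (S := RW F r s)) v
  have DM : ∀ x y v, _ := fun x y v => sw x y _ _ (DPoly₂_mu (S := RW F r s)) v
  have DD : ∀ x y v, _ := fun x y v => sw x y _ _ (DPoly₂_comm hS.D_super) v
  have LL : ∀ x y v, _ := fun x y v => sw x y _ _ (superCommuting_lam (F := F) (R := RWSpace F r s)).comm v
  have MM : ∀ x y v, _ := fun x y v => sw x y _ _ (superCommuting_mu (F := F) (R := RWSpace F r s)).comm v
  have LM : ∀ x y v, _ := fun x y v => sw x y _ _ (lam_mu (F := F) (R := RWSpace F r s)) v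
  have LD : ∀ x y v, _ := fun x y v => sw' x y _ _ (DPoly₂_lam (S := RW F r s)) v
  have MD : ∀ x y v, _ := fun x y v => sw' x y _ _ (DPoly₂_mu (S := RW F r s)) v
  have ML : ∀ x y v, _ := fun x y v => sw' x y _ _ (lam_mu (F := F) (R := RWSpace F r s)) v
  -- The exchange rules are instantiated only at index pairs that move `i` before `j` before `k`.
  -- This fixes a normal order and prevents the rewriting from looping.
  simp only [jacLeft_eq, jacMid_eq, jacRight_eq, rwBracket_gen_eq, map_add, map_zsmul, smul_add,
    jacL_DPoly hS _ _ (rwGen_par _), jacL_mulVar, jacM_DPoly hS, jacM_mulVar,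
    jacR_DPoly hS _ _ (rwGen_par _), jacR_mulVar, hL, hM, hR, inclLam_DPoly, inclLam_mulVar,
    substAdd_DPoly, substAdd_mulVar, inclLam_single, hK, Finsupp.single_add, hRD, hRl,
    ← Finsupp.smul_single, smul_smul, neg_add, he', DL j i, DM j i, DD j i, LL j i, MM j i, LM j i,
    LD i j, MD i j, ML i j,
    DL k i, DM k i, DD k i, LL k i, MM k i, LM k i, LD i k, MD i k, ML i k,
    DL k j, DM k j, DD k j, LL k j, MM k j, LM k j, LD j k, MD j k, ML j k]
  rcases zmod2_cases (varParity i) with hi | hi <;>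
  rcases zmod2_cases (varParity j) with hj | hj <;>
  rcases zmod2_cases (varParity k) with hk | hk <;>
  simp only [hk, hi, hj, koszul_zero_left, koszul_zero_right, koszul_one_one,
            mul_one, mul_neg, one_mul, neg_mul, neg_neg, neg_smul, one_smul] <;> abel

variable (F r s) in
/-- `RW(r, s)` is a Lie conformal superalgebra. -/
def rwLie : LieConformalSuperalgebra F r s (RWSpace F r s) where
  toConformalData := RW F r s
  par_isCompl := rwPar_isCompl
  D_comm i j a := by
    have := congrArg (fun Z : Module.End F (RWSpace F r s) => Z a)
      ((rw_isSesquilinear (F := F) (r := r) (s := s)).D_super.comm i j)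
    exact this
  D_odd_sq j a := by
    have := congrArg (fun Z : Module.End F (RWSpace F r s) => Z a)
      ((rw_isSesquilinear (F := F) (r := r) (s := s)).D_super.odd_sq j)
    exact this
  D_par := rwD_par
  bracket_par := rw_isSesquilinear.bracket_par
  bracket_D_left := rwBracket_D_left
  bracket_D_right := rwBracket_D_right
  skew := skew_of_generators rw_isSesquilinear rw_generates rw_skew_gen
  jacobi := jacobi_of_generators rw_isSesquilinear rw_generates rw_jacobi_gen

end RW

/-! ## Vector fields -/

section VF

variable {F : Type*} [Field F] {r s : ℕ}

/-- Power series of parity `p`. -/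
def serPar (F : Type*) [Field F] (r s : ℕ) (p : ZMod 2) : Submodule F (Series F r s) where
  carrier := {f | ∀ T : Finset (Fin s), (T.card : ZMod 2) ≠ p → f T = 0}
  zero_mem' := fun _ _ => rfl
  add_mem' := fun {f g} hf hg T h => by simp [hf T h, hg T h]
  smul_mem' := fun c f hf T h => by simp [hf T h]

theorem seriesPart_of_mem {p : ZMod 2} {f : Series F r s} (hf : f ∈ serPar F r s p) :
    seriesPart p f = f := by
  funext T
  rw [seriesPart_apply]
  split_ifs with h
  · rfl
  · exact (hf T h).symm

theorem seriesPart_mem (p : ZMod 2) (f : Series F r s) : seriesPart p f ∈ serPar F r s p := by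
  intro T h
  rw [seriesPart_apply, if_neg h]

theorem seriesPart_of_mem_ne {p q : ZMod 2} (h : q ≠ p) {f : Series F r s}
    (hf : f ∈ serPar F r s p) : seriesPart q f = 0 := by
  rw [← seriesPart_of_mem hf, seriesPart_part_ne h]

theorem seriesTwist_of_mem (t : ZMod 2) {p : ZMod 2} {f : Series F r s}
    (hf : f ∈ serPar F r s p) : seriesTwist t f = koszul t p • f := by
  rw [← seriesPart_of_mem hf, seriesTwist_part]

theorem seriesD_par (i : Var r s) {p : ZMod 2} {f : Series F r s} (hf : f ∈ serPar F r s p) :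
    seriesD i f ∈ serPar F r s (p + varParity i) := by
  rw [← seriesPart_of_mem hf, seriesD_part]
  exact seriesPart_mem _ _

theorem serMul_par {p q : ZMod 2} {f g : Series F r s} (hf : f ∈ serPar F r s p)
    (hg : g ∈ serPar F r s q) : serMul f g ∈ serPar F r s (p + q) := by
  rw [← seriesPart_of_mem hf, ← seriesPart_of_mem hg, ← seriesPart_mul_homog]
  exact seriesPart_mem _ _

theorem serMul_comm_of_mem [CharZero F] {p : ZMod 2} {f : Series F r s} (hf : f ∈ serPar F r s p)
    (g : Series F r s) : serMul f g = serMul (seriesTwist p g) f := by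
  rw [← seriesPart_of_mem hf, serMul_comm]

theorem serMul_comm_mem [CharZero F] {p q : ZMod 2} {f g : Series F r s} (hf : f ∈ serPar F r s p)
    (hg : g ∈ serPar F r s q) : serMul f g = koszul p q • serMul g f := by
  rw [serMul_comm_of_mem hf, seriesTwist_of_mem p hg, map_zsmul, LinearMap.smul_apply]

theorem serMul_left_comm [CharZero F] {p q : ZMod 2} {f g : Series F r s} (hf : f ∈ serPar F r s p)
    (hg : g ∈ serPar F r s q) (h : Series F r s) :
    serMul f (serMul g h) = koszul p q • serMul g (serMul f h) := by
  rw [← serMul_assoc, serMul_comm_mem hf hg, map_zsmul, LinearMap.smul_apply, serMul_assoc]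

theorem series_parts (f : Series F r s) : f = seriesPart 0 f + seriesPart 1 f :=
  (seriesPart_add f).symm

/-- Vector fields `∑ v_k ∂_{y_k}`. -/
abbrev VF (F : Type*) (r s : ℕ) [Field F] := Var r s → Series F r s

/-- Vector fields of parity `p`. -/
def vfPar (F : Type*) [Field F] (r s : ℕ) (p : ZMod 2) : Submodule F (VF F r s) where
  carrier := {v | ∀ k, v k ∈ serPar F r s (p + varParity k)}
  zero_mem' := fun _ => zero_mem _
  add_mem' := fun hf hg k => add_mem (hf k) (hg k)
  smul_mem' := fun c _ hf k => Submodule.smul_mem _ c (hf k)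

/-- The component of parity `p` of a vector field. -/
def vfPart (p : ZMod 2) : VF F r s →ₗ[F] VF F r s :=
  LinearMap.pi fun k => (seriesPart (p + varParity k)).comp (LinearMap.proj k)

theorem vfPart_apply (p : ZMod 2) (v : VF F r s) (k : Var r s) :
    vfPart p v k = seriesPart (p + varParity k) (v k) := rfl

theorem vfPart_mem (p : ZMod 2) (v : VF F r s) : vfPart p v ∈ vfPar F r s p :=
  fun _ => seriesPart_mem _ _

theorem vfPart_of_mem {p : ZMod 2} {v : VF F r s} (hv : v ∈ vfPar F r s p) : vfPart p v = v :=
  funext fun k => seriesPart_of_mem (hv k)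

theorem vfPart_of_mem_ne {p q : ZMod 2} (h : q ≠ p) {v : VF F r s} (hv : v ∈ vfPar F r s p) :
    vfPart q v = 0 :=
  funext fun k => seriesPart_of_mem_ne (fun e => h (add_right_cancel e)) (hv k)

theorem vf_parts (v : VF F r s) : v = vfPart 0 v + vfPart 1 v := by
  funext k
  rw [Pi.add_apply, vfPart_apply, vfPart_apply]
  rcases zmod2_cases (varParity k) with h | h
  · rw [h, add_zero, add_zero, seriesPart_add]
  · rw [h, zero_add, show (1 : ZMod 2) + 1 = 0 by decide, add_comm, seriesPart_add]

/-- The action of a vector field on functions. -/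
def lieDer : VF F r s →ₗ[F] Series F r s →ₗ[F] Series F r s :=
  ∑ k, (LinearMap.lcomp F (Series F r s) (seriesD k)).comp (serMul.comp (LinearMap.proj k))

theorem lieDer_apply (v : VF F r s) (f : Series F r s) :
    lieDer v f = ∑ k, serMul (v k) (seriesD k f) := by
  simp [lieDer, LinearMap.sum_apply]

theorem lieDer_par {p q : ZMod 2} {v : VF F r s} {f : Series F r s} (hv : v ∈ vfPar F r s p)
    (hf : f ∈ serPar F r s q) : lieDer v f ∈ serPar F r s (p + q) := by
  rw [lieDer_apply]
  refine sum_mem fun k _ => ?_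
  have := serMul_par (hv k) (seriesD_par k hf)
  rwa [show p + varParity k + (q + varParity k) = p + q + (varParity k + varParity k) by ring,
    CharTwo.add_self_eq_zero, add_zero] at this

/-- The coefficient `v_k` has parity `p + p_k`, and `∂_k` contributes another `p_k`; in crossing `f`
only `p` remains. -/
theorem lieDer_serMul [CharZero F] {p : ZMod 2} {v : VF F r s} (hv : v ∈ vfPar F r s p)
    (f g : Series F r s) :
    lieDer v (serMul f g) = serMul (lieDer v f) g + serMul (seriesTwist p f) (lieDer v g) := by
  simp only [lieDer_apply, map_sum, LinearMap.sum_apply, ← Finset.sum_add_distrib]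
  refine Finset.sum_congr rfl fun k _ => ?_
  rw [seriesD_serMul, map_add, serMul_assoc, ← serMul_assoc (v k) (seriesTwist _ f),
    serMul_comm_of_mem (hv k) (seriesTwist (varParity k) f), seriesTwist_twist, add_assoc, CharTwo.add_self_eq_zero, add_zero,
    serMul_assoc]

/-- The bracket of vector fields. -/
def vfBracket : VF F r s →ₗ[F] VF F r s →ₗ[F] VF F r s :=
  LinearMap.mk₂ F (fun v w l => lieDer v (w l) -
      ∑ p : ZMod 2, ∑ q : ZMod 2, koszul p q • lieDer (vfPart q w) (vfPart p v l))
    (fun v v' w => by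
      funext l
      simp only [map_add, LinearMap.add_apply, Pi.add_apply, smul_add, Finset.sum_add_distrib]
      abel)
    (fun c v w => by
      funext l
      simp only [map_smul, LinearMap.smul_apply, Pi.smul_apply, smul_comm _ c, ← Finset.smul_sum,
        smul_sub])
    (fun v w w' => by
      funext l
      simp only [map_add, LinearMap.add_apply, Pi.add_apply, smul_add, Finset.sum_add_distrib]
      abel)
    (fun c v w => by
      funext l
      simp only [map_smul, LinearMap.smul_apply, Pi.smul_apply, smul_comm _ c, ← Finset.smul_sum,
        smul_sub])

/-- For homogeneous fields a single pair of parity components survives in the definition, leaving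
the usual supercommutator. -/
theorem vfBracket_apply {p q : ZMod 2} {v w : VF F r s} (hv : v ∈ vfPar F r s p)
    (hw : w ∈ vfPar F r s q) (l : Var r s) :
    vfBracket v w l = lieDer v (w l) - koszul p q • lieDer w (v l) := by
  have e : vfBracket v w l = lieDer v (w l) -
      ∑ p : ZMod 2, ∑ q : ZMod 2, koszul p q • lieDer (vfPart q w) (vfPart p v l) := rfl
  rw [e, Finset.sum_eq_single p, Finset.sum_eq_single q, vfPart_of_mem hv, vfPart_of_mem hw]
  · intro b _ hb
    rw [vfPart_of_mem_ne hb hw]; simp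
  · simp
  · intro b _ hb
    rw [vfPart_of_mem_ne hb hv]; simp
  · simp

theorem vfBracket_par {p q : ZMod 2} {v w : VF F r s} (hv : v ∈ vfPar F r s p)
    (hw : w ∈ vfPar F r s q) : vfBracket v w ∈ vfPar F r s (p + q) := by
  intro l
  rw [vfBracket_apply hv hw]
  refine sub_mem ?_ (zsmul_mem ?_ _)
  · rw [add_assoc]; exact lieDer_par hv (hw l)
  · rw [add_comm p, add_assoc]; exact lieDer_par hw (hv l)

theorem vfBracket_skew {p q : ZMod 2} {v w : VF F r s} (hv : v ∈ vfPar F r s p)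
    (hw : w ∈ vfPar F r s q) : vfBracket v w = -(koszul p q • vfBracket w v) := by
  funext l
  rw [Pi.neg_apply, Pi.smul_apply, vfBracket_apply hv hw, vfBracket_apply hw hv, smul_sub,
    smul_smul, koszul_comm q p, koszul_mul_self, one_smul]
  abel

/-- The second-order parts of the two compositions cancel because both the coefficients and the
partial derivatives supercommute. -/
theorem lieDer_vfBracket [CharZero F] {p q : ZMod 2} {v w : VF F r s} (hv : v ∈ vfPar F r s p)
    (hw : w ∈ vfPar F r s q) (f : Series F r s) : lieDer (vfBracket v w) f =
      lieDer v (lieDer w f) - koszul p q • lieDer w (lieDer v f) := by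
  -- A composition of two fields splits into a first-order and a second-order part.
  have key : ∀ {p q : ZMod 2} {v w : VF F r s} (_ : v ∈ vfPar F r s p) (_ : w ∈ vfPar F r s q),
      lieDer v (lieDer w f) = ∑ k, serMul (lieDer v (w k)) (seriesD k f) +
        ∑ k, ∑ j, koszul p (q + varParity k) • serMul (w k) (serMul (v j) (seriesD j (seriesD k f))) := by
    intro p q v w hv hw
    rw [lieDer_apply w, map_sum, ← Finset.sum_add_distrib]
    refine Finset.sum_congr rfl fun k _ => ?_
    rw [lieDer_serMul hv, seriesTwist_of_mem p (hw k), lieDer_apply v (seriesD k f)]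
    simp only [map_zsmul, LinearMap.smul_apply, map_sum, Finset.smul_sum]
  rw [key hv hw, key hw hv, smul_add, lieDer_apply]
  have e1 : ∑ k, serMul (vfBracket v w k) (seriesD k f) =
      ∑ k, serMul (lieDer v (w k)) (seriesD k f) -
        koszul p q • ∑ k, serMul (lieDer w (v k)) (seriesD k f) := by
    rw [Finset.smul_sum, ← Finset.sum_sub_distrib]
    refine Finset.sum_congr rfl fun k _ => ?_
    rw [vfBracket_apply hv hw, map_sub, LinearMap.sub_apply, map_zsmul, LinearMap.smul_apply]
  have e2 : ∑ k, ∑ j, koszul p (q + varParity k) •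
        serMul (w k) (serMul (v j) (seriesD j (seriesD k f))) =
      koszul p q • ∑ k, ∑ j, koszul q (p + varParity k) •
        serMul (v k) (serMul (w j) (seriesD j (seriesD k f))) := by
    rw [Finset.sum_comm]
    simp only [Finset.smul_sum]
    refine Finset.sum_congr rfl fun j _ => Finset.sum_congr rfl fun k _ => ?_
    rw [serMul_left_comm (hw k) (hv j), seriesD_comm_apply j k]
    simp only [map_zsmul, smul_smul]
    congr 1
    simp only [koszul_add_left, koszul_add_right, koszul_comm q p, koszul_comm (varParity k) p,
      koszul_comm (varParity j) (varParity k)]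
    linear_combination (koszul p q * koszul p q * koszul q (varParity j)) *
      (koszul p (varParity k) * koszul p (varParity k) *
        koszul_mul_self (varParity k) (varParity j) + koszul_mul_self p (varParity k))
  rw [e1, e2]
  abel

/-- By `lieDer_vfBracket` each component is an expression in iterated Lie derivatives, and the
identity becomes the one for supercommutators of operators. -/
theorem vfBracket_jacobi [CharZero F] {p q : ZMod 2} {v w : VF F r s} (hv : v ∈ vfPar F r s p)
    (hw : w ∈ vfPar F r s q) (z : VF F r s) : vfBracket v (vfBracket w z) =
      vfBracket (vfBracket v w) z + koszul p q • vfBracket w (vfBracket v z) := by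
  have main : ∀ t, ∀ z ∈ vfPar F r s t, vfBracket v (vfBracket w z) =
      vfBracket (vfBracket v w) z + koszul p q • vfBracket w (vfBracket v z) := by
    intro t z hz
    funext l
    rw [Pi.add_apply, Pi.smul_apply, vfBracket_apply hv (vfBracket_par hw hz),
      vfBracket_apply (vfBracket_par hv hw) hz, vfBracket_apply hw (vfBracket_par hv hz),
      vfBracket_apply hw hz, vfBracket_apply hv hz, vfBracket_apply hv hw,
      lieDer_vfBracket hw hz, lieDer_vfBracket hv hz, lieDer_vfBracket hv hw]
    simp only [map_sub, map_zsmul, smul_sub, smul_smul, koszul_add_left, koszul_add_right,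
      koszul_comm q p]
    rcases zmod2_cases p with hi | hi <;>
    rcases zmod2_cases q with hj | hj <;>
    rcases zmod2_cases t with hk | hk <;>
    simp only [hk, hi, hj, koszul_zero_left, koszul_zero_right, koszul_one_one,
            mul_one, mul_neg, one_mul, neg_mul, neg_neg, neg_smul, one_smul] <;> abel
  rw [vf_parts z]
  simp only [map_add, smul_add, main 0 _ (vfPart_mem 0 z), main 1 _ (vfPart_mem 1 z)]
  abel

end VF

/-! ## Vector fields attached to elements of `RW(r, s)` -/

section Symbol

variable {F : Type*} [Field F] {r s : ℕ}

/-- The operators `-∂_{y_i}`. -/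
def negD (F : Type*) [Field F] {r s : ℕ} (i : Var r s) : Module.End F (Series F r s) :=
  -(seriesD i : Module.End F (Series F r s))

theorem negD_apply (i : Var r s) (f : Series F r s) : negD F i f = -seriesD i f := rfl

theorem superCommuting_negD (F : Type*) [Field F] {r s : ℕ} :
    SuperCommuting (negD F (r := r) (s := s)) :=
  superCommuting_seriesD.neg

/-- `Q = ∑ Q_k(∂) a_k ↦ Q_k(-∂_y)`. -/
def rwEval (F : Type*) [Field F] {r s : ℕ} (k : Var r s) : RWSpace F r s →ₗ[F] Module.End F (Series F r s) :=
  Finsupp.lsum F fun m =>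
    (LinearMap.toSpanSingleton F (Module.End F (Series F r s)) (monOp (negD F) m)).comp
      (LinearMap.proj k)

theorem rwEval_single (k : Var r s) (m : Mon r s) (v : Var r s → F) :
    rwEval F k (Finsupp.single m v) = v k • monOp (negD F) m := by
  simp [rwEval]

theorem rwEval_gen (k i : Var r s) : rwEval F k (rwGen F i) = if k = i then 1 else 0 := by
  rw [rwGen, rwEval_single, monOp_monOne, Pi.single_apply]
  split_ifs <;> simp

theorem rwEval_D (k i : Var r s) (Q : RWSpace F r s) :
    rwEval F k (rwD F i Q) = negD F i * rwEval F k Q := by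
  induction Q using Finsupp.induction_linear with
  | zero => simp
  | add P Q hP hQ => simp only [map_add, hP, hQ, mul_add]
  | single m v =>
    rw [rwD, mulVar_single, map_zsmul, rwEval_single, rwEval_single, mul_smul_comm,
      (superCommuting_negD F).monOp_varMul, smul_comm]

theorem rwEval_monOp (k : Var r s) (m : Mon r s) (Q : RWSpace F r s) :
    rwEval F k (monOp (rwD F) m Q) = monOp (negD F) m * rwEval F k Q := by
  induction m using mon_induction with
  | one => rw [monOp_monOne, monOp_monOne, one_mul]; rfl
  | mul i m h ih =>
    rw [monOp_varMul' _ superCommuting_rwD.comm superCommuting_rwD.odd_sq i m h,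
      monOp_varMul' _ (superCommuting_negD F).comm (superCommuting_negD F).odd_sq i m h,
      LinearMap.smul_apply, map_zsmul, Module.End.mul_apply, rwEval_D, ih, smul_mul_assoc,
      mul_assoc]

theorem monOp_negD_par (m : Mon r s) {q : ZMod 2} {f : Series F r s} (hf : f ∈ serPar F r s q) :
    monOp (negD F) m f ∈ serPar F r s (monParity m + q) := by
  induction m using mon_induction with
  | one => rw [monOp_monOne, monParity_monOne, zero_add]; exact hf
  | mul i m h ih =>
    rw [monOp_varMul' _ (superCommuting_negD F).comm (superCommuting_negD F).odd_sq i m h,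
      monParity_varMul i m h]
    have e : varParity i + monParity m + q = monParity m + q + varParity i := by ring
    rw [e]
    exact zsmul_mem (neg_mem (seriesD_par i ih)) _

theorem rwEval_par {p : ZMod 2} {Q : RWSpace F r s} (hQ : Q ∈ rwPar F r s p) (k : Var r s)
    {q : ZMod 2} {f : Series F r s} (hf : f ∈ serPar F r s q) :
    rwEval F k Q f ∈ serPar F r s (p + varParity k + q) := by
  refine rwPar_induction (C := fun Q => rwEval F k Q f ∈ serPar F r s (p + varParity k + q))
    (fun m i h => ?_) (by simp) ?_ ?_ hQ
  · rw [rwBasis, rwEval_single, Pi.single_apply]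
    split_ifs with hk
    · rw [one_smul]
      subst hk
      have := monOp_negD_par m hf
      rwa [← h, add_assoc (monParity m), CharTwo.add_self_eq_zero, add_zero]
    · rw [zero_smul]; exact zero_mem _
  · intro P Q hP hQ
    rw [map_add]; exact add_mem hP hQ
  · intro c P hP
    rw [map_smul]; exact Submodule.smul_mem _ _ hP

theorem seriesD_rwEval {p : ZMod 2} {Q : RWSpace F r s} (hQ : Q ∈ rwPar F r s p) (i k : Var r s)
    (f : Series F r s) : rwEval F k Q (seriesD i f) =
      koszul (varParity i) (p + varParity k) • seriesD i (rwEval F k Q f) := by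
  refine rwPar_induction (C := fun Q => rwEval F k Q (seriesD i f) =
      koszul (varParity i) (p + varParity k) • seriesD i (rwEval F k Q f))
    (fun m j h => ?_) (by simp) ?_ ?_ hQ
  · rw [rwBasis, rwEval_single, Pi.single_apply]
    split_ifs with hk
    · subst hk
      rw [one_smul, ← h, add_assoc (monParity m), CharTwo.add_self_eq_zero, add_zero,
        monOp_comm_apply (T := negD F)]
      exact fun j => superComm_neg (seriesD_comm i j)
    · simp
  · intro P Q hP hQ
    simp only [map_add, LinearMap.add_apply, hP, hQ, smul_add]
  · intro c P hP
    simp only [map_smul, LinearMap.smul_apply, hP, smul_comm c]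

/-- The vector field attached to an element of `RW(r, s) ⊗ F[[y]]`. -/
def toVF : RWSpace F r s ⊗[F] Series F r s →ₗ[F] VF F r s :=
  LinearMap.pi fun k => -TensorProduct.lift
    ((LinearMap.lcomp F (Series F r s) (seriesTwist (varParity k))).comp (rwEval F k))

/-- The twist is the sign for moving the series to the left of `a_k`. With the overall minus sign
the map respects brackets. -/
theorem toVF_tmul (Q : RWSpace F r s) (f : Series F r s) (k : Var r s) :
    toVF (Q ⊗ₜ f) k = -rwEval F k Q (seriesTwist (varParity k) f) := rfl

theorem toVF_par {p q : ZMod 2} {Q : RWSpace F r s} (hQ : Q ∈ rwPar F r s p)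
    {f : Series F r s} (hf : f ∈ serPar F r s q) : toVF (Q ⊗ₜ f) ∈ vfPar F r s (p + q) := by
  intro k
  rw [toVF_tmul, seriesTwist_of_mem _ hf, map_zsmul, add_right_comm]
  exact neg_mem (zsmul_mem (rwEval_par hQ k hf) _)

theorem toVF_affDy (i : Var r s) (x : RWSpace F r s ⊗[F] Series F r s) (k : Var r s) :
    toVF ((rwLie F r s).affDy i x) k = seriesD i (toVF x k) := by
  induction x using TensorProduct.induction_on with
  | zero => simp
  | add x y hx hy => simp only [map_add, Pi.add_apply, hx, hy]
  | tmul Q f =>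
    induction Q using (rwLie F r s).hom_induction with
    | add P Q hP hQ => simp only [TensorProduct.add_tmul, map_add, Pi.add_apply, hP, hQ]
    | hom p Q hQ =>
      rw [LieConformalSuperalgebra.affDy, TensorProduct.map_tmul,
        (rwLie F r s).twist_of_mem _ hQ, toVF_tmul, toVF_tmul, seriesTwist_D_apply, map_zsmul,
        map_zsmul, LinearMap.smul_apply, seriesD_rwEval hQ, map_neg, smul_smul, smul_smul, koszul_add_right,
        koszul_comm (varParity k)]
      rw [show koszul (varParity i) (varParity k) * koszul (varParity i) p *
        (koszul (varParity i) p * koszul (varParity i) (varParity k)) =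
        (koszul (varParity i) (varParity k) * koszul (varParity i) (varParity k)) *
        (koszul (varParity i) p * koszul (varParity i) p) by ring, koszul_mul_self,
        koszul_mul_self, one_mul, one_smul]

theorem toVF_D (i : Var r s) (Q : RWSpace F r s) (f : Series F r s) (k : Var r s) :
    toVF (rwD F i Q ⊗ₜ f) k = -seriesD i (toVF (Q ⊗ₜ f) k) := by
  rw [toVF_tmul, toVF_tmul, rwEval_D, Module.End.mul_apply, negD_apply, map_neg]

/-- On fields `∂_i` acts as `-∂_{y_i}` and the second summand as `∂_{y_i}`, so the two halves
cancel. -/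
theorem toVF_affD (i : Var r s) (x : RWSpace F r s ⊗[F] Series F r s) :
    toVF ((rwLie F r s).affD i x) = 0 := by
  funext k
  rw [LieConformalSuperalgebra.affD, LinearMap.add_apply, map_add, Pi.add_apply, toVF_affDy]
  induction x using TensorProduct.induction_on with
  | zero => simp
  | add x y hx hy =>
    simp only [map_add, Pi.add_apply] at hx hy ⊢
    have := congrArg₂ (· + ·) hx hy
    simp only [Pi.zero_apply, add_zero] at this
    rw [Pi.zero_apply, ← this]; abel
  | tmul Q f =>
    rw [TensorProduct.map_tmul]
    have : toVF ((rwLie F r s).D i Q ⊗ₜ[F] (LinearMap.id : Module.End F (Series F r s)) f) k =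
        -seriesD i (toVF (Q ⊗ₜ f) k) :=
      toVF_D i Q f k
    rw [this]; simp

theorem toVF_affRel {x : RWSpace F r s ⊗[F] Series F r s} (hx : x ∈ (rwLie F r s).affRel) :
    toVF x = 0 := (rwLie F r s).affRel_le_ker toVF toVF_affD hx

end Symbol

/-! ### Reduction to generators in `R ⊗ F[[y]]` -/

namespace LieConformalSuperalgebra

variable {F : Type*} [Field F] {r s : ℕ} {R : Type*} [AddCommGroup R] [Module F R]
variable (S : LieConformalSuperalgebra F r s R)

theorem zsmul_tmul' (n : ℤ) (a : R) (f : Series F r s) :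
    (n • a) ⊗ₜ[F] f = n • (a ⊗ₜ[F] f) := by
  rw [← Int.cast_smul_eq_zsmul F, ← TensorProduct.smul_tmul', Int.cast_smul_eq_zsmul]

theorem affBracket_affRel_left {x : R ⊗[F] Series F r s} (hx : x ∈ S.affRel) :
    S.affBracket x = 0 :=
  LinearMap.mem_ker.mp (S.affRel_le_ker S.affBracket
    (fun i x => LinearMap.ext fun y => S.affBracket_affD_left i x y) hx)

theorem affBracket_affRel_right (x : R ⊗[F] Series F r s) {y : R ⊗[F] Series F r s}
    (hy : y ∈ S.affRel) : S.affBracket x y ∈ S.affRel := by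
  have : S.affRel ≤ S.affRel.comap (S.affBracket x) := by
    refine iSup_le fun i => ?_
    rintro _ ⟨z, rfl⟩
    exact S.affBracket_affD_right i x z
  exact this hy

theorem isSesquilinear : S.toConformalData.IsSesquilinear where
  par_isCompl := S.par_isCompl
  D_super := ⟨fun i j => LinearMap.ext fun a => S.D_comm i j a,
    fun j => LinearMap.ext fun a => S.D_odd_sq j a⟩
  D_par := S.D_par
  bracket_par := S.bracket_par
  bracket_D_left := S.bracket_D_left
  bracket_D_right := S.bracket_D_right

/-- Modulo `affRel`, elements of `R ⊗ F[[y]]` are sums of elements `g_i ⊗ f` with generators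
`g_i`. -/
theorem aff_induction {ι : Type*} {g : ι → R} {π : ι → ZMod 2}
    (hg : S.toConformalData.Generates g π) {C : R ⊗[F] Series F r s → Prop}
    (rel : ∀ x ∈ S.affRel, C x) (add : ∀ x y, C x → C y → C (x + y))
    (gen : ∀ i q, ∀ f ∈ serPar F r s q, C (g i ⊗ₜ f)) (x : R ⊗[F] Series F r s) : C x := by
  have hz : C 0 := rel 0 (zero_mem _)
  have gen' : ∀ i f, C (g i ⊗ₜ f) := by
    intro i f
    rw [series_parts f, TensorProduct.tmul_add]
    exact add _ _ (gen i 0 _ (seriesPart_mem 0 f)) (gen i 1 _ (seriesPart_mem 1 f))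
  induction x using TensorProduct.induction_on with
  | zero => exact hz
  | add x y hx hy => exact add _ _ hx hy
  | tmul a f =>
    induction a using S.hom_induction with
    | add a b ha hb => rw [TensorProduct.add_tmul]; exact add _ _ ha hb
    | hom p a ha =>
      revert f
      refine hg.induction S.isSesquilinear (C := fun _ a => ∀ f, C (a ⊗ₜ f)) gen' ?_ ?_ ?_ ?_ ha
      · intro k p a ha ih f
        -- Modulo the relations the derivative moves from `a` to the series, and the induction
        -- hypothesis holds for every series.
        have e : S.D k a ⊗ₜ f = S.affD k (a ⊗ₜ f) +
            a ⊗ₜ[F] (-(koszul (varParity k) p • seriesD k f)) := by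
          rw [affD, affDy, LinearMap.add_apply, TensorProduct.map_tmul, TensorProduct.map_tmul,
            S.twist_of_mem _ ha, TensorProduct.tmul_neg, tmul_zsmul', LinearMap.id_apply,
            LieConformalSuperalgebra.zsmul_tmul']
          abel
        rw [e]
        exact add _ _ (rel _ ((le_iSup (fun i => LinearMap.range (S.affD i)) k) ⟨_, rfl⟩)) (ih _)
      · intro _ f
        rwa [TensorProduct.zero_tmul]
      · intro _ a b ha hb f
        rw [TensorProduct.add_tmul]; exact add _ _ (ha f) (hb f)
      · intro _ c a ha f
        rw [TensorProduct.smul_tmul]; exact ha _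

/-- Only one term of the sum over the parity components of `f` is nonzero. -/
theorem affBracket_tmul_homog (a b : R) {p q : ZMod 2} {f : Series F r s}
    (hf : f ∈ serPar F r s q) (g : Series F r s) (hb : b ∈ S.par p) :
    S.affBracket (a ⊗ₜ f) (b ⊗ₜ g) = koszul q p • S.evalAt f g (S.bracket a b) := by
  rw [affBracket_tmul, affBracketPure, Finset.sum_eq_single q, seriesPart_of_mem hf,
    S.twist_of_mem q hb, map_zsmul, map_zsmul]
  · intro t _ ht
    have h0 : S.evalAt 0 g = 0 := by
      have := S.evalAt_smul_left (0 : F) 0 g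
      simpa using this
    rw [seriesPart_of_mem_ne ht hf, h0, LinearMap.zero_apply]
  · simp

end LieConformalSuperalgebra

/-! ### The passage to vector fields respects brackets -/

section Main

variable {F : Type*} [Field F] {r s : ℕ}

theorem toVF_gen (i : Var r s) (f : Series F r s) (k : Var r s) :
    toVF (rwGen F i ⊗ₜ f) k = if k = i then -seriesTwist (varParity i) f else 0 := by
  rw [toVF_tmul, rwEval_gen]
  split_ifs with h
  · rw [h]; rfl
  · simp

theorem lieDer_gen (i : Var r s) (f g : Series F r s) :
    lieDer (toVF (rwGen F i ⊗ₜ f)) g =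
      -serMul (seriesTwist (varParity i) f) (seriesD i g) := by
  rw [lieDer_apply, Finset.sum_eq_single i]
  · rw [toVF_gen, if_pos rfl, map_neg, LinearMap.neg_apply]
  · intro k _ hk
    rw [toVF_gen, if_neg hk, map_zero, LinearMap.zero_apply]
  · simp

/-- The terms of `[a_i λ a_j]` proportional to `a_j` give one field differentiating the coefficient
of the other, and the term proportional to `a_i` gives the same with the roles exchanged. -/
theorem toVF_affBracket_gen [CharZero F] (i j : Var r s) {p q : ZMod 2} {f g : Series F r s}
    (hf : f ∈ serPar F r s p) (hg : g ∈ serPar F r s q) :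
    toVF ((rwLie F r s).affBracket (rwGen F i ⊗ₜ f) (rwGen F j ⊗ₜ g)) =
      vfBracket (toVF (rwGen F i ⊗ₜ f)) (toVF (rwGen F j ⊗ₜ g)) := by
  have hb : (rwLie F r s).bracket (rwGen F i) (rwGen F j) = _ := rwBracket_gen_eq i j
  have e1 : ∀ f c, (rwLie F r s).evalAt f g (Finsupp.single monOne c) = c ⊗ₜ serMul f g := by
    intro f c
    rw [LieConformalSuperalgebra.evalAt_single, monParity_monOne,
      LieConformalSuperalgebra.twist_zero, monOp_monOne]
    rfl
  have e2 : ∀ x k, (rwLie F r s).evalAt f g (mulVar F r s (RWSpace F r s) x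
      (Finsupp.single monOne (rwGen F k))) =
      koszul (varParity x) (varParity k) • (rwGen F k ⊗ₜ serMul (seriesD x f) g) := by
    intro x k
    rw [LieConformalSuperalgebra.evalAt_mulVar, coeffAct_one, e1,
      (rwLie F r s).twist_of_mem _ (rwGen_par k), LieConformalSuperalgebra.zsmul_tmul']
  rw [(rwLie F r s).affBracket_tmul_homog _ _ hf g (rwGen_par j), hb, map_add, map_add,
    map_zsmul, map_zsmul, e2, e2]
  rw [show (RW F r s).DPoly i = (rwLie F r s).DPoly i from rfl,
    LieConformalSuperalgebra.evalAt_DPoly, e1, TensorProduct.map_tmul, LinearMap.id_apply]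
  funext l
  rw [vfBracket_apply (toVF_par (rwGen_par i) hf) (toVF_par (rwGen_par j) hg), lieDer_gen,
    lieDer_gen]
  simp only [map_zsmul, map_add, Pi.add_apply, Pi.smul_apply]
  have e3 : toVF ((rwLie F r s).D i (rwGen F j) ⊗ₜ serMul f g) l =
      -seriesD i (toVF (rwGen F j ⊗ₜ serMul f g) l) := toVF_D i _ _ l
  rw [e3]
  simp only [toVF_gen]
  have hj : serMul (seriesD j f) g = koszul (p + varParity j) q • serMul g (seriesD j f) :=
    serMul_comm_mem (seriesD_par j hf) hg
  have hjt : seriesTwist (varParity i) (serMul (seriesD j f) g) =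
      koszul (varParity i) (p + varParity j + q) • serMul (seriesD j f) g :=
    seriesTwist_of_mem _ (serMul_par (seriesD_par j hf) hg)
  -- The term `a_i λ_j`: the second field acting on the coefficient of the first.
  have c2 : koszul p (varParity j) • koszul (varParity i) (varParity j) •
      koszul (varParity j) (varParity i) • -seriesTwist (varParity i) (serMul (seriesD j f) g) =
      -(koszul (varParity i + p) (varParity j + q) •
        -serMul (seriesTwist (varParity j) g)
          (seriesD j (-seriesTwist (varParity i) f))) := by
    rw [hjt, hj, seriesTwist_of_mem _ hf, seriesTwist_of_mem _ hg]
    simp only [map_neg, map_zsmul, LinearMap.smul_apply, smul_neg, smul_smul, neg_neg]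
    congr 2
    simp only [koszul_add_left, koszul_add_right, koszul_comm (varParity j) (varParity i)]
    linear_combination (koszul p (varParity j) * koszul (varParity i) p *
      koszul (varParity i) (varParity j) * koszul (varParity i) q * koszul p q *
      koszul (varParity j) q) * koszul_mul_self (varParity i) (varParity j)
  -- The terms `∂_i a_j` and `λ_i a_j`: by the Leibniz rule `∂_i (f g)` minus `(∂_i f) g` leaves `f
  -- ∂_i g`, up to signs.
  have c1 : koszul p (varParity j) •
      (-seriesD i (-seriesTwist (varParity j) (serMul f g)) +
        koszul (varParity i) (varParity j) •
          -seriesTwist (varParity j) (serMul (seriesD i f) g)) =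
      -serMul (seriesTwist (varParity i) f) (seriesD i (-seriesTwist (varParity j) g)) := by
    rw [seriesTwist_mul, seriesTwist_mul, map_neg, neg_neg, seriesD_serMul,
      seriesTwist_of_mem _ hf, seriesTwist_of_mem (varParity i) hf,
      seriesTwist_of_mem _ (seriesD_par i hf)]
    simp only [map_neg, map_zsmul, LinearMap.smul_apply, smul_neg, smul_smul, neg_neg, smul_add,
      seriesTwist_of_mem (varParity i) hf, koszul_add_right]
    rw [koszul_comm (varParity j) p, koszul_comm (varParity j) (varParity i)]
    have h1 := koszul_mul_self p (varParity j)
    have h2 := koszul_mul_self (varParity i) (varParity j)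
    rw [show koszul p (varParity j) * (koszul (varParity i) (varParity j) *
      (koszul p (varParity j) * koszul (varParity i) (varParity j))) = 1 by
        linear_combination (koszul (varParity i) (varParity j)) ^ 2 * h1 + h2,
      show koszul p (varParity j) * (koszul p (varParity j) * koszul (varParity i) p) =
        koszul (varParity i) p by linear_combination koszul (varParity i) p * h1, h1]
    abel
  by_cases hlj : l = j
  · by_cases hli : l = i
    · simp only [if_pos hlj, if_pos hli]
      rw [sub_eq_add_neg, ← c2, ← c1, ← smul_add]
    · simp only [if_pos hlj, if_neg hli, ← c1]
      simp
  · by_cases hli : l = i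
    · simp only [if_neg hlj, if_pos hli]
      rw [sub_eq_add_neg, ← c2]
      simp
    · simp [hli, hlj]

/-- Relations in either argument are killed on both sides, so `aff_induction` reduces the claim to
generators. -/
theorem toVF_affBracket [CharZero F] (x y : RWSpace F r s ⊗[F] Series F r s) :
    toVF ((rwLie F r s).affBracket x y) = vfBracket (toVF x) (toVF y) := by
  have hg : (rwLie F r s).toConformalData.Generates (rwGen F) varParity := rw_generates
  refine (rwLie F r s).aff_induction hg (C := fun x =>
    toVF ((rwLie F r s).affBracket x y) = vfBracket (toVF x) (toVF y)) ?_ ?_ ?_ x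
  · intro x hx
    rw [(rwLie F r s).affBracket_affRel_left hx, toVF_affRel hx, map_zero, LinearMap.zero_apply,
      LinearMap.zero_apply, map_zero]
  · intro x x' h h'
    rw [map_add, LinearMap.add_apply, map_add, h, h', map_add, map_add, LinearMap.add_apply]
  · intro i p f hf
    refine (rwLie F r s).aff_induction hg (C := fun y =>
      toVF ((rwLie F r s).affBracket (rwGen F i ⊗ₜ f) y) =
        vfBracket (toVF (rwGen F i ⊗ₜ f)) (toVF y)) ?_ ?_ ?_ y
    · intro y hy
      rw [toVF_affRel ((rwLie F r s).affBracket_affRel_right _ hy), toVF_affRel hy, map_zero]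
    · intro x x' h h'
      rw [map_add, map_add, h, h', map_add, map_add]
    · intro j q g hg
      exact toVF_affBracket_gen i j hf hg

end Main

/-! ## Prolongations of linear Lie superalgebras -/

section Prolong

variable {F : Type*} [Field F] {r s : ℕ}

/-- The coefficientwise partial derivatives of vector fields. -/
def vfD (i : Var r s) : Module.End F (VF F r s) :=
  LinearMap.pi fun k => (seriesD i).comp (LinearMap.proj k)

theorem vfD_apply (i : Var r s) (v : VF F r s) (k : Var r s) : vfD i v k = seriesD i (v k) := rfl

theorem vfD_par (i : Var r s) {p : ZMod 2} {v : VF F r s} (hv : v ∈ vfPar F r s p) :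
    vfD i v ∈ vfPar F r s (p + varParity i) := by
  intro k
  rw [vfD_apply, add_right_comm]
  exact seriesD_par i (hv k)

/-- The linear part `(h, k) ↦ (∂_h v_k)(0)` of a vector field. -/
def jac : VF F r s →ₗ[F] Var r s → Var r s → F :=
  LinearMap.pi fun h => LinearMap.pi fun k =>
    constTerm.comp ((seriesD h).comp (LinearMap.proj k))

theorem jac_apply (v : VF F r s) (h k : Var r s) : jac v h k = constTerm (seriesD h (v k)) := rfl

/-- Iterated partial derivatives of vector fields. -/
def vfDs : List (Var r s) → Module.End F (VF F r s)
  | [] => 1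
  | i :: l => vfDs l * vfD i

/-- The vector fields all of whose derivatives have linear part in `G`. -/
def prolong (G : Submodule F (Var r s → Var r s → F)) : Submodule F (VF F r s) :=
  ⨅ l : List (Var r s), G.comap (jac.comp (vfDs l))

variable {G : Submodule F (Var r s → Var r s → F)}

theorem mem_prolong {v : VF F r s} : v ∈ prolong G ↔ ∀ l, jac (vfDs l v) ∈ G := by
  simp [prolong, Submodule.mem_iInf]

theorem jac_mem_of_prolong {v : VF F r s} (hv : v ∈ prolong G) : jac v ∈ G :=
  mem_prolong.mp hv []

theorem vfD_mem_prolong (i : Var r s) {v : VF F r s} (hv : v ∈ prolong G) :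
    vfD i v ∈ prolong G :=
  mem_prolong.mpr fun l => mem_prolong.mp hv (i :: l)

theorem mem_prolong_of_stable (W : Set (VF F r s)) (h1 : ∀ v ∈ W, jac v ∈ G)
    (h2 : ∀ i, ∀ v ∈ W, vfD i v ∈ W) {v : VF F r s} (hv : v ∈ W) : v ∈ prolong G := by
  refine mem_prolong.mpr fun l => ?_
  induction l generalizing v with
  | nil => exact h1 v hv
  | cons i l ih => exact ih (h2 i v hv)

/-- Matrices of parity `p`. -/
def MatPar (p : ZMod 2) (M : Var r s → Var r s → F) : Prop :=
  ∀ h k, p + varParity h + varParity k ≠ 0 → M h k = 0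

/-- The bracket of a matrix of parity `p` and a matrix of parity `q`. -/
def matBracket (p q : ZMod 2) (M N : Var r s → Var r s → F) : Var r s → Var r s → F :=
  fun h l => ∑ k, M h k * N k l - koszul p q • ∑ k, N h k * M k l

theorem constTerm_of_mem {p : ZMod 2} (hp : p ≠ 0) {f : Series F r s} (hf : f ∈ serPar F r s p) :
    constTerm f = 0 := by
  rw [constTerm_apply, hf ∅ (by simpa using hp.symm), map_zero]

theorem jac_par {p : ZMod 2} {v : VF F r s} (hv : v ∈ vfPar F r s p) : MatPar p (jac v) := by
  intro h k hk
  refine constTerm_of_mem (p := p + varParity k + varParity h) ?_ (seriesD_par h (hv k))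
  rwa [add_right_comm]

theorem jac_lieDer (v : VF F r s) (f : Series F r s) (h : Var r s) :
    constTerm (seriesD h (lieDer v f)) = ∑ k, jac v h k * constTerm (seriesD k f) +
      ∑ k, constTerm (v k) * constTerm (seriesD h (seriesD k f)) := by
  rw [lieDer_apply, map_sum, map_sum, ← Finset.sum_add_distrib]
  refine Finset.sum_congr rfl fun k _ => ?_
  rw [seriesD_serMul, map_add, constTerm_serMul, constTerm_serMul, constTerm_twist, jac_apply]

/-- Besides the bracket of the linear parts, the constant terms of one field meet the second
derivatives of the other. These corrections are again linear parts, namely of partial derivatives of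
the fields. -/
theorem jac_vfBracket {p q : ZMod 2} {v w : VF F r s} (hv : v ∈ vfPar F r s p)
    (hw : w ∈ vfPar F r s q) : jac (vfBracket v w) = matBracket p q (jac v) (jac w) +
      ∑ k, constTerm (v k) • jac (vfD k w) -
      koszul p q • ∑ k, constTerm (w k) • jac (vfD k v) := by
  funext h l
  rw [jac_apply, vfBracket_apply hv hw, map_sub, map_sub, map_zsmul, map_zsmul, jac_lieDer,
    jac_lieDer]
  simp only [matBracket, Pi.add_apply, Pi.sub_apply, Pi.smul_apply, Finset.sum_apply, smul_eq_mul,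
    jac_apply, vfD_apply, smul_add]
  abel

theorem seriesD_lieDer {p : ZMod 2} {v : VF F r s} (hv : v ∈ vfPar F r s p) (i : Var r s)
    (f : Series F r s) : seriesD i (lieDer v f) =
      lieDer (vfD i v) f + koszul (varParity i) p • lieDer v (seriesD i f) := by
  simp only [lieDer_apply, map_sum, Finset.smul_sum, ← Finset.sum_add_distrib]
  refine Finset.sum_congr rfl fun k _ => ?_
  rw [seriesD_serMul, vfD_apply, seriesTwist_of_mem _ (hv k), seriesD_comm_apply i k]
  simp only [map_zsmul, LinearMap.smul_apply, smul_smul]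
  rw [koszul_add_right, mul_left_comm, koszul_mul_self, mul_one]

/-- Coefficientwise differentiation is bracketing with a constant field, hence a superderivation. -/
theorem vfD_vfBracket {p q : ZMod 2} {v w : VF F r s} (hv : v ∈ vfPar F r s p)
    (hw : w ∈ vfPar F r s q) (i : Var r s) : vfD i (vfBracket v w) =
      vfBracket (vfD i v) w + koszul (varParity i) p • vfBracket v (vfD i w) := by
  funext l
  rw [Pi.add_apply, Pi.smul_apply, vfD_apply, vfBracket_apply hv hw,
    vfBracket_apply (vfD_par i hv) hw, vfBracket_apply hv (vfD_par i hw), map_sub, map_zsmul,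
    seriesD_lieDer hv, seriesD_lieDer hw, vfD_apply, vfD_apply]
  simp only [smul_sub, smul_add, smul_smul, koszul_add_left, koszul_add_right]
  rw [koszul_comm p (varParity i), show koszul (varParity i) p * (koszul p q *
    koszul (varParity i) p) = koszul p q by
      linear_combination koszul p q * koszul_mul_self (varParity i) p]
  abel

/-- Derivatives are distributed over the two fields by `vfD_vfBracket`. When none is left,
`jac_vfBracket` expresses the linear part through elements of `G`. -/
theorem vfBracket_mem_prolong
    (hG : ∀ p q M N, M ∈ G → N ∈ G → MatPar p M → MatPar q N → matBracket p q M N ∈ G)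
    {p q : ZMod 2} {v w : VF F r s} (hv : v ∈ vfPar F r s p) (hw : w ∈ vfPar F r s q)
    (hv' : v ∈ prolong G) (hw' : w ∈ prolong G) : vfBracket v w ∈ prolong G := by
  refine mem_prolong.mpr fun l => ?_
  induction l generalizing p q v w with
  | nil =>
    change jac (vfBracket v w) ∈ G
    rw [jac_vfBracket hv hw]
    refine sub_mem (add_mem (hG p q _ _ (jac_mem_of_prolong hv') (jac_mem_of_prolong hw')
      (jac_par hv) (jac_par hw)) (sum_mem fun k _ => Submodule.smul_mem _ _ ?_))
      (zsmul_mem (sum_mem fun k _ => Submodule.smul_mem _ _ ?_) _)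
    · exact jac_mem_of_prolong (vfD_mem_prolong k hw')
    · exact jac_mem_of_prolong (vfD_mem_prolong k hv')
  | cons i l ih =>
    change jac (vfDs l (vfD i (vfBracket v w))) ∈ G
    rw [vfD_vfBracket hv hw, map_add, map_add, map_zsmul, map_zsmul]
    exact add_mem (ih (vfD_par i hv) hw (vfD_mem_prolong i hv') hw')
      (zsmul_mem (ih hv (vfD_par i hw) hv' (vfD_mem_prolong i hw')) _)

theorem vfD_toVF {p : ZMod 2} {Q : RWSpace F r s} (hQ : Q ∈ rwPar F r s p) (i : Var r s)
    (f : Series F r s) :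
    vfD i (toVF (Q ⊗ₜ[F] f)) = toVF (Q ⊗ₜ[F] (koszul (varParity i) p • seriesD i f)) := by
  funext k
  have h := toVF_affDy i (Q ⊗ₜ[F] f) k
  rw [vfD_apply, ← h]
  have hQ' : Q ∈ (rwLie F r s).par p := hQ
  rw [LieConformalSuperalgebra.affDy, TensorProduct.map_tmul, (rwLie F r s).twist_of_mem _ hQ',
    LieConformalSuperalgebra.zsmul_tmul', ← LieConformalSuperalgebra.tmul_zsmul']

/-- For fixed `Q` the fields of all `Q ⊗ f` are stable under differentiation, since a derivative of
the field is the field of a derivative of `f` up to sign. So only linear parts need checking. -/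
theorem toVF_mem_prolong {p : ZMod 2} {Q : RWSpace F r s} (hQ : Q ∈ rwPar F r s p)
    (h : ∀ f, jac (toVF (Q ⊗ₜ[F] f)) ∈ G) (f : Series F r s) :
    toVF (Q ⊗ₜ[F] f) ∈ prolong G := by
  refine mem_prolong_of_stable (Set.range fun f => toVF (Q ⊗ₜ[F] f)) ?_ ?_ ⟨f, rfl⟩
  · rintro _ ⟨f, rfl⟩
    exact h f
  · rintro i _ ⟨f, rfl⟩
    exact ⟨_, (vfD_toVF hQ i f).symm⟩

theorem seriesTwist_parts (t : ZMod 2) (f : Series F r s) :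
    seriesTwist t f = seriesPart 0 f + koszul t 1 • seriesPart 1 f := rfl

theorem jac_toVF {p : ZMod 2} {Q : RWSpace F r s} (hQ : Q ∈ rwPar F r s p) (f : Series F r s)
    (h k : Var r s) : jac (toVF (Q ⊗ₜ[F] f)) h k =
      koszul (varParity k) (varParity h + p + varParity k) •
        constTerm ((negD F h * rwEval F k Q) f) := by
  have main : ∀ q, ∀ f ∈ serPar F r s q, jac (toVF (Q ⊗ₜ[F] f)) h k =
      koszul (varParity k) (varParity h + p + varParity k) •
        constTerm ((negD F h * rwEval F k Q) f) := by
    intro q f hf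
    rw [jac_apply, toVF_tmul, seriesTwist_of_mem _ hf, Module.End.mul_apply, negD_apply]
    simp only [map_neg, map_zsmul, smul_neg]
    -- Only one parity of `f` can contribute to the constant term, so the twist becomes a sign
    -- independent of `f`.
    by_cases hq : varParity h + p + varParity k = q
    · rw [hq]
    · rw [constTerm_of_mem (p := p + varParity k + q + varParity h) ?_
        (seriesD_par h (rwEval_par hQ k hf))]
      · simp
      · intro e
        apply hq
        rw [← sub_eq_zero, ← e, CharTwo.sub_eq_add]; ring
  rw [series_parts f, TensorProduct.tmul_add]
  simp only [map_add, Pi.add_apply, smul_add]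
  rw [main 0 _ (seriesPart_mem 0 f), main 1 _ (seriesPart_mem 1 f)]

end Prolong

/-! ## The linear Lie superalgebra of `E(4, 4)` -/

section Linear

variable {F : Type*} [Field F]

/-- The pairs of complementary pairs `(h, j, k, l)`, ordered so that `h j k l` is an even
permutation. -/
def evenQuads : List (Fin 4 × Fin 4 × Fin 4 × Fin 4) :=
  [(0, 1, 2, 3), (2, 3, 0, 1), (0, 2, 3, 1), (3, 1, 0, 2), (0, 3, 1, 2), (1, 2, 0, 3)]

/-- The linear parts of the vector fields in `E(4, 4)`. -/
def linE (F : Type*) [Field F] : Submodule F (Var 4 4 → Var 4 4 → F) where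
  carrier := {M |
    (∀ h j : Fin 4, 2 * (M (.inl h) (.inl j) + M (.inr j) (.inr h)) =
      if h = j then ∑ k, M (.inl k) (.inl k) else 0) ∧
    (∀ h j : Fin 4, M (.inr h) (.inl j) + M (.inr j) (.inl h) = 0) ∧
    ∀ z ∈ evenQuads, M (.inl z.1) (.inr z.2.1) - M (.inl z.2.1) (.inr z.1) +
      M (.inr z.2.2.1) (.inl z.2.2.2) = 0}
  zero_mem' := by simp
  add_mem' := by
    rintro M N ⟨h1, h2, h3⟩ ⟨h1', h2', h3'⟩
    refine ⟨fun h j => ?_, fun h j => ?_, fun z hz => ?_⟩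
    · have e1 := h1 h j
      have e2 := h1' h j
      simp only [Pi.add_apply, Finset.sum_add_distrib]
      split_ifs at e1 e2 ⊢ <;> linear_combination e1 + e2
    · simp only [Pi.add_apply]
      linear_combination h2 h j + h2' h j
    · simp only [Pi.add_apply]
      linear_combination h3 z hz + h3' z hz
  smul_mem' := by
    rintro c M ⟨h1, h2, h3⟩
    refine ⟨fun h j => ?_, fun h j => ?_, fun z hz => ?_⟩
    · have e1 := h1 h j
      simp only [Pi.smul_apply, smul_eq_mul, ← Finset.mul_sum]
      split_ifs at e1 ⊢ <;> linear_combination c * e1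
    · simp only [Pi.smul_apply, smul_eq_mul]
      linear_combination c * h2 h j
    · simp only [Pi.smul_apply, smul_eq_mul]
      linear_combination c * h3 z hz

theorem matBracket_comm (p q : ZMod 2) (M N : Var 4 4 → Var 4 4 → F) :
    matBracket q p N M = (-koszul p q) • matBracket p q M N := by
  funext h l
  simp only [matBracket, Pi.smul_apply, smul_sub, smul_smul, neg_mul, koszul_mul_self, neg_smul,
    one_smul, koszul_comm q p]
  abel

/-- The even matrices are `diag(A, t - Aᵀ)` with `t` half the trace of `A`, a copy of `gl_4` in
which `A = 1` gives the identity matrix. -/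
theorem linE_even [CharZero F] {M : Var 4 4 → Var 4 4 → F} (hM : M ∈ linE F) (hp : MatPar 0 M) :
    (∀ h j, M (.inl h) (.inr j) = 0) ∧ (∀ h j, M (.inr h) (.inl j) = 0) ∧
      ∃ t, 2 * t = ∑ k, M (.inl k) (.inl k) ∧
        ∀ h j, M (.inr h) (.inr j) = (if h = j then t else 0) - M (.inl j) (.inl h) := by
  obtain ⟨h1, -, -⟩ := hM
  refine ⟨fun h j => hp _ _ (by simp [varParity]), fun h j => hp _ _ (by simp [varParity]),
    (∑ k, M (.inl k) (.inl k)) / 2, mul_div_cancel₀ _ two_ne_zero, fun h j => ?_⟩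
  have := h1 j h
  by_cases e : h = j
  · subst e
    simp only [if_true] at this ⊢
    linear_combination this / 2
  · simp only [if_neg e, if_neg (Ne.symm e)] at this ⊢
    linear_combination this / 2

/-- The lower left block is antisymmetric, and its dual fixes the antisymmetric part of the upper
right block. Writing it as `C - Cᵀ` makes antisymmetry automatic in later polynomial computations.
-/
theorem linE_odd [CharZero F] {M : Var 4 4 → Var 4 4 → F} (hM : M ∈ linE F) (hp : MatPar 1 M) :
    (∀ h j, M (.inl h) (.inl j) = 0) ∧ (∀ h j, M (.inr h) (.inr j) = 0) ∧
      (∃ C : Fin 4 → Fin 4 → F, ∀ h j, M (.inr h) (.inl j) = C h j - C j h) ∧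
      ∀ z ∈ evenQuads, M (.inl z.2.1) (.inr z.1) = M (.inl z.1) (.inr z.2.1) +
        M (.inr z.2.2.1) (.inl z.2.2.2) := by
  obtain ⟨-, h2, h3⟩ := hM
  refine ⟨fun h j => hp _ _ (by simp [varParity]), fun h j => hp _ _ (by simp [varParity]; decide),
    ⟨fun h j => M (.inr h) (.inl j) / 2, fun h j => ?_⟩, fun z hz => ?_⟩
  · linear_combination h2 h j / 2
  · linear_combination - h3 z hz

theorem matBracket_even_even [CharZero F] {M N : Var 4 4 → Var 4 4 → F} (hM : M ∈ linE F)
    (hN : N ∈ linE F) (pM : MatPar 0 M) (pN : MatPar 0 N) : matBracket 0 0 M N ∈ linE F := by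
  obtain ⟨hB, hC, t, -, hD⟩ := linE_even hM pM
  obtain ⟨hB', hC', t', -, hD'⟩ := linE_even hN pN
  refine ⟨fun h j => ?_, fun h j => ?_, ?_⟩
  · have tr : ∑ k, matBracket 0 0 M N (.inl k) (.inl k) = 0 := by
      simp only [matBracket, Fintype.sum_sum_type, hB, hC, hB', hC', koszul_zero_left, zero_mul,
        Finset.sum_const_zero, add_zero, one_smul, Finset.sum_sub_distrib]
      rw [sub_eq_zero, Finset.sum_comm]
      simp only [mul_comm]
    rw [tr, ite_self]
    simp only [matBracket, Fintype.sum_sum_type, hB, hC, hB', hD', hC', hD, koszul_zero_left,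
      zero_mul, Finset.sum_const_zero, add_zero, zero_add, one_smul, ← Finset.sum_sub_distrib,
      ← Finset.sum_add_distrib, sub_mul, mul_sub]
    simp only [Finset.sum_add_distrib, Finset.sum_sub_distrib, ite_mul, mul_ite, zero_mul, mul_zero,
      Finset.sum_ite_eq, Finset.sum_ite_eq', Finset.mem_univ, if_true, mul_comm (N _ _) (M _ _)]
    split_ifs <;> ring
  · simp [matBracket, hB, hC, hB', hC']
  · simp [matBracket, hB, hC, hB', hC']

set_option maxHeartbeats 1000000 in
-- Dualising an antisymmetric matrix intertwines the action of `A` with its transposed action only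
-- up to the trace of `A`. The shift by `t` in the lower right block compensates for this exactly
-- when `2t` is that trace.
theorem matBracket_even_odd [CharZero F] {M N : Var 4 4 → Var 4 4 → F} (hM : M ∈ linE F)
    (hN : N ∈ linE F) (pM : MatPar 0 M) (pN : MatPar 1 N) : matBracket 0 1 M N ∈ linE F := by
  obtain ⟨hB, hC, t, ht, hD⟩ := linE_even hM pM
  rw [Fin.sum_univ_four] at ht
  obtain ⟨hA', hD', ⟨C, hC'⟩, hB'⟩ := linE_odd hN pN
  simp only [evenQuads, List.forall_mem_cons, List.not_mem_nil, hC', false_imp_iff, implies_true,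
    and_true] at hB'
  obtain ⟨b1, b2, b3, b4, b5, b6⟩ := hB'
  refine ⟨fun h j => ?_, fun h j => ?_, ?_⟩
  · simp [matBracket, hB, hC, hA', hD']
  · simp only [matBracket, Fintype.sum_sum_type, hB, hC, hA', hD', hC', hD, koszul_zero_left,
      zero_mul, mul_zero, Finset.sum_const_zero, add_zero, zero_add, one_smul, sub_mul, ite_mul,
      Finset.sum_sub_distrib, Finset.sum_ite_eq, Finset.mem_univ, if_true, mul_sub]
    simp only [mul_comm (C _ _)]
    ring
  · simp only [evenQuads, List.forall_mem_cons, List.not_mem_nil, false_imp_iff, implies_true,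
      and_true, matBracket, Fintype.sum_sum_type, hB, hC, hA', hD', hC', hD, koszul_zero_left,
      Fin.sum_univ_four, b1, b2, b3, b4, b5, b6, zero_mul, mul_zero, add_zero, zero_add, one_smul,
      Fin.reduceEq, if_true, if_false]
    -- The defect of each relation is a multiple of `2t - tr A`, with the corresponding entry of the
    -- antisymmetric block as factor.
    exact ⟨by linear_combination (C 2 3 - C 3 2) * ht, by linear_combination (C 0 1 - C 1 0) * ht,
      by linear_combination (C 3 1 - C 1 3) * ht, by linear_combination (C 0 2 - C 2 0) * ht,
      by linear_combination (C 1 2 - C 2 1) * ht, by linear_combination (C 0 3 - C 3 0) * ht⟩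

set_option maxHeartbeats 1000000 in
-- An antisymmetric 4×4 matrix times its dual is scalar. Polarising this identity, the upper left
-- block plus the transpose of the lower right one is scalar, as the first relation demands.
theorem matBracket_odd_odd [CharZero F] {M N : Var 4 4 → Var 4 4 → F} (hM : M ∈ linE F)
    (hN : N ∈ linE F) (pM : MatPar 1 M) (pN : MatPar 1 N) : matBracket 1 1 M N ∈ linE F := by
  obtain ⟨hA, hD, ⟨C, hC⟩, hB⟩ := linE_odd hM pM
  obtain ⟨hA', hD', ⟨C', hC'⟩, hB'⟩ := linE_odd hN pN
  simp only [evenQuads, List.forall_mem_cons, List.not_mem_nil, hC', hC, false_imp_iff,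
    implies_true, and_true] at hB hB'
  obtain ⟨a1, a2, a3, a4, a5, a6⟩ := hB
  obtain ⟨b1, b2, b3, b4, b5, b6⟩ := hB'
  refine ⟨fun h j => ?_, fun h j => ?_, ?_⟩
  · simp only [matBracket, Fintype.sum_sum_type, hC, hC', hA, hA', hD', hD, koszul_one_one,
      zero_mul, Finset.sum_const_zero, add_zero, zero_add, neg_smul, one_smul, sub_neg_eq_add,
      Fin.sum_univ_four]
    fin_cases h <;> fin_cases j <;> simp only [Fin.zero_eta, Fin.mk_one, Fin.reduceFinMk,
      a1, a2, a3, a4, a5, a6, b1, b2, b3, b4, b5, b6, Fin.reduceEq, if_true, if_false] <;> ring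
  · simp [matBracket, hA, hD, hA', hD']
  · simp [matBracket, hA, hD, hA', hD']

theorem matBracket_mem_linE [CharZero F] (p q : ZMod 2) (M N : Var 4 4 → Var 4 4 → F)
    (hM : M ∈ linE F) (hN : N ∈ linE F) (pM : MatPar p M) (pN : MatPar q N) :
    matBracket p q M N ∈ linE F := by
  rcases zmod2_cases p with rfl | rfl <;> rcases zmod2_cases q with rfl | rfl
  · exact matBracket_even_even hM hN pM pN
  · exact matBracket_even_odd hM hN pM pN
  · rw [matBracket_comm 0 1]
    exact zsmul_mem (matBracket_even_odd hN hM pN pM) _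
  · exact matBracket_odd_odd hM hN pM pN

/-- The vector fields in `E(4, 4)`. -/
def vfE (F : Type*) [Field F] : Submodule F (VF F 4 4) := prolong (linE F)

/-- Derivatives in even directions vanish at the origin. The relations then leave an antisymmetric
lower left block with zero dual, and a lower right block equal to half a zero trace. -/
theorem jac_eq_zero_of_mem_vfE [CharZero F] {v : VF F 4 4} (hv : v ∈ vfE F)
    (h0 : ∀ k, v k ∅ = 0) : jac v = 0 := by
  have hx : ∀ h k, jac v (.inl h) k = 0 := by
    intro h k
    rw [jac_apply, constTerm_apply]
    have : (seriesD (.inl h) (v k) : Series F 4 4) ∅ = MvPowerSeries.pderiv F h (v k ∅) := rfl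
    rw [this, h0]; simp
  obtain ⟨h1, h2, h3⟩ := jac_mem_of_prolong hv
  simp only [evenQuads, List.forall_mem_cons, List.not_mem_nil, hx, false_imp_iff, implies_true,
      and_true, sub_zero, zero_add] at h3
  obtain ⟨b1, b2, b3, b4, b5, b6⟩ := h3
  simp only [hx, zero_add, Finset.sum_const_zero, ite_self] at h1
  -- Off the diagonal the third relation and antisymmetry suffice; on the diagonal twice the entry
  -- is zero.
  have hC : ∀ h j, jac v (.inr h) (.inl j) = 0 := by
    intro h j
    have := h2 h j
    have d := h2 h h
    rw [← two_mul] at d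
    fin_cases h <;> fin_cases j <;> simp_all
  funext h k
  rcases h with h | h
  · exact hx h k
  · rcases k with k | k
    · exact hC h k
    · simpa using h1 k h

/-- A vector field in `E(4, 4)` is determined by its restriction to the even subspace. -/
theorem eq_zero_of_mem_vfE [CharZero F] {v : VF F 4 4} (hv : v ∈ vfE F)
    (h0 : ∀ k, v k ∅ = 0) : v = 0 := by
  -- The fields to be killed. The aim is stability of `K` under all partial derivatives, after which
  -- Taylor's principle applies.
  let K : Submodule F (VF F 4 4) :=
    vfE F ⊓ ⨅ k, LinearMap.ker ((LinearMap.proj (∅ : Finset (Fin 4))).comp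
      (LinearMap.proj k : VF F 4 4 →ₗ[F] Series F 4 4))
  have memK : ∀ v, v ∈ K ↔ v ∈ vfE F ∧ ∀ k, v k ∅ = 0 := by
    intro v
    simp [K, Submodule.mem_iInf]
  have stabx : ∀ i, ∀ v ∈ K, vfD (.inl i) v ∈ K := by
    intro i v hv
    rw [memK] at hv ⊢
    refine ⟨vfD_mem_prolong _ hv.1, fun k => ?_⟩
    have : vfD (.inl i) v k ∅ = MvPowerSeries.pderiv F i (v k ∅) := rfl
    rw [this, hv.2, map_zero]
  have odd0 : ∀ j k, ∀ v ∈ K, v k {j} = 0 := by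
    intro j k v hv
    -- The coefficient of a single odd variable is placed in the slot `∅`. The resulting series is
    -- free of odd variables, its even derivatives come from `K`, and its constant term is an entry
    -- of the linear part, hence zero.
    let L : VF F 4 4 →ₗ[F] Series F 4 4 := (LinearMap.single F _ ∅).comp
      ((LinearMap.proj ({j} : Finset (Fin 4))).comp
        (LinearMap.proj k : VF F 4 4 →ₗ[F] Series F 4 4))
    have hL : ∀ v, L v = Pi.single ∅ (v k {j}) := fun v => rfl
    have h := taylor (K.map L) ?_ ?_ (Submodule.mem_map_of_mem (f := L) hv)
    · rw [hL] at h
      simpa using congrFun h ∅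
    · rintro (i | i) _ ⟨w, hw, rfl⟩
      · refine ⟨_, stabx i w hw, ?_⟩
        funext T
        have e : seriesD (.inl i) (L w) T = MvPowerSeries.pderiv F i (L w T) := rfl
        rw [e, hL, hL]
        by_cases hT : T = ∅
        · subst hT
          rw [Pi.single_eq_same, Pi.single_eq_same]; rfl
        · rw [Pi.single_eq_of_ne hT, Pi.single_eq_of_ne hT, map_zero]
      · have e : seriesD (.inr i) (L w) = 0 := by
          funext T
          rw [seriesD_inr, hL, Pi.single_eq_of_ne (Finset.insert_ne_empty i T), smul_zero]
          rfl
        rw [e]; exact zero_mem _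
    · rintro _ ⟨w, hw, rfl⟩
      rw [hL, constTerm_apply, Pi.single_eq_same]
      have := congrFun (congrFun (jac_eq_zero_of_mem_vfE ((memK w).mp hw).1 ((memK w).mp hw).2)
        (.inr j)) k
      rw [jac_apply, constTerm_apply, seriesD_inr] at this
      simpa [oddSign] using this
  -- For an odd derivative, the value at odd variables zero is the coefficient of that variable,
  -- which `odd0` kills.
  have stab : ∀ i, ∀ v ∈ K, vfD i v ∈ K := by
    rintro (i | i) v hv
    · exact stabx i v hv
    · have hv' := hv
      rw [memK] at hv ⊢
      refine ⟨vfD_mem_prolong _ hv.1, fun k => ?_⟩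
      rw [vfD_apply, seriesD_inr]
      simpa using Or.inr (odd0 i k v hv')
  funext k
  refine taylor (K.map (LinearMap.proj k : VF F 4 4 →ₗ[F] Series F 4 4)) ?_ ?_
    ⟨v, (memK v).mpr ⟨hv, h0⟩, rfl⟩
  · rintro i _ ⟨w, hw, rfl⟩
    exact ⟨_, stab i w hw, rfl⟩
  · rintro _ ⟨w, hw, rfl⟩
    rw [constTerm_apply, LinearMap.proj_apply, ((memK w).mp hw).2, map_zero]

end Linear

/-! ## The generators `α_i` -/

section Ops

variable {A : Type*} [Ring A] (T : Var 4 4 → A)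

/-- `∑ T_i T_{i+4}`. -/
def opB : A := ∑ i : Fin 4, T (.inl i) * T (.inr i)

/-- The operators `ν_i`. -/
def opNu : Fin 4 → A :=
  ![T (.inr 1) * T (.inr 2) * T (.inr 3), -(T (.inr 0) * T (.inr 2) * T (.inr 3)),
    T (.inr 0) * T (.inr 1) * T (.inr 3), -(T (.inr 0) * T (.inr 1) * T (.inr 2))]

/-- The product of the odd operators. -/
def opTop : A := T (.inr 0) * T (.inr 1) * T (.inr 2) * T (.inr 3)

/-- Relations of supercommuting operators. -/
structure SuperRel : Prop where
  ee : ∀ i j, T (.inl i) * T (.inl j) = T (.inl j) * T (.inl i)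
  oe : ∀ i j, T (.inr i) * T (.inl j) = T (.inl j) * T (.inr i)
  oo : ∀ i j, T (.inr i) * T (.inr j) = -(T (.inr j) * T (.inr i))
  sq : ∀ i, T (.inr i) * T (.inr i) = 0

variable {T}

theorem SuperRel.e_B (h : SuperRel T) (i : Fin 4) : T (.inl i) * opB T = opB T * T (.inl i) := by
  simp only [opB, Finset.mul_sum, Finset.sum_mul]
  refine Finset.sum_congr rfl fun j _ => ?_
  rw [← mul_assoc, h.ee, mul_assoc, ← h.oe, mul_assoc]

theorem SuperRel.o_B (h : SuperRel T) (i : Fin 4) : T (.inr i) * opB T = -(opB T * T (.inr i)) := by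
  simp only [opB, Finset.mul_sum, Finset.sum_mul, ← Finset.sum_neg_distrib]
  refine Finset.sum_congr rfl fun j _ => ?_
  rw [← mul_assoc, h.oe, mul_assoc, h.oo, mul_neg, mul_assoc]

theorem SuperRel.oe' (h : SuperRel T) (i j : Fin 4) (a : A) :
    T (.inr i) * (T (.inl j) * a) = T (.inl j) * (T (.inr i) * a) := by
  rw [← mul_assoc, h.oe, mul_assoc]

theorem SuperRel.ee' (h : SuperRel T) (i j : Fin 4) (a : A) :
    T (.inl i) * (T (.inl j) * a) = T (.inl j) * (T (.inl i) * a) := by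
  rw [← mul_assoc, h.ee, mul_assoc]

theorem SuperRel.oo' (h : SuperRel T) (i j : Fin 4) (a : A) :
    T (.inr i) * (T (.inr j) * a) = -(T (.inr j) * (T (.inr i) * a)) := by
  rw [← mul_assoc, h.oo, neg_mul, mul_assoc]

theorem SuperRel.sq' (h : SuperRel T) (i : Fin 4) (a : A) : T (.inr i) * (T (.inr i) * a) = 0 := by
  rw [← mul_assoc, h.sq, zero_mul]

theorem SuperRel.e_nu (h : SuperRel T) (i j : Fin 4) : opNu T j * T (.inl i) = T (.inl i) * opNu T j := by
  fin_cases j <;> simp [opNu, mul_assoc, h.oe, h.oe']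

/-- `ν_j` is the product of the three odd operators other than the `j`-th, with the sign that makes
multiplication on the left by the missing one give the full product. -/
theorem SuperRel.o_nu (h : SuperRel T) (i j : Fin 4) :
    T (.inr i) * opNu T j = if i = j then opTop T else 0 := by
  have l : ∀ {i j : Fin 4}, i < j → T (.inr j) * T (.inr i) = -(T (.inr i) * T (.inr j)) :=
    fun _ => h.oo _ _
  have l' : ∀ {i j : Fin 4} {a : A}, i < j →
      T (.inr j) * (T (.inr i) * a) = -(T (.inr i) * (T (.inr j) * a)) := fun _ => h.oo' _ _ _
  fin_cases i <;> fin_cases j <;> simp [opNu, opTop, mul_assoc, l, l', h.sq, h.sq']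

theorem SuperRel.nu_o (h : SuperRel T) (i j : Fin 4) :
    opNu T i * T (.inr j) = if i = j then -opTop T else 0 := by
  have l : ∀ {i j : Fin 4}, i < j → T (.inr j) * T (.inr i) = -(T (.inr i) * T (.inr j)) :=
    fun _ => h.oo _ _
  have l' : ∀ {i j : Fin 4} {a : A}, i < j →
      T (.inr j) * (T (.inr i) * a) = -(T (.inr i) * (T (.inr j) * a)) := fun _ => h.oo' _ _ _
  fin_cases i <;> fin_cases j <;> simp [opNu, opTop, mul_assoc, l, l', h.sq, h.sq']

theorem SuperRel.top_o (h : SuperRel T) (j : Fin 4) : opTop T * T (.inr j) = 0 := by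
  have l : ∀ {i j : Fin 4}, i < j → T (.inr j) * T (.inr i) = -(T (.inr i) * T (.inr j)) :=
    fun _ => h.oo _ _
  have l' : ∀ {i j : Fin 4} {a : A}, i < j →
      T (.inr j) * (T (.inr i) * a) = -(T (.inr i) * (T (.inr j) * a)) := fun _ => h.oo' _ _ _
  fin_cases j <;> simp [opTop, mul_assoc, l, l', h.sq, h.sq']

/-- The summands of `B` are odd: they square to zero and anticommute with one another. -/
theorem SuperRel.B_sq (h : SuperRel T) : opB T * opB T = 0 := by
  have l : ∀ {i j : Fin 4}, i < j → T (.inr j) * T (.inr i) = -(T (.inr i) * T (.inr j)) :=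
    fun _ => h.oo _ _
  have e : ∀ {i j : Fin 4} {a : A}, i < j →
      T (.inl j) * (T (.inl i) * a) = T (.inl i) * (T (.inl j) * a) := fun _ => h.ee' _ _ _
  simp only [opB, Fin.sum_univ_four, mul_add, add_mul, mul_assoc, h.oe', h.sq]
  simp [l, e]
  abel

/-- Multiplication by the third and fourth odd operators of the quadruple kills two of the four
summands of `B`; the other two are the terms on the left. This identity underlies the duality
relation in `linE`. -/
theorem SuperRel.e_nu_sub (h : SuperRel T) {z : Fin 4 × Fin 4 × Fin 4 × Fin 4} (hz : z ∈ evenQuads) :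
    T (.inl z.1) * opNu T z.2.1 - T (.inl z.2.1) * opNu T z.1 =
      -(T (.inr z.2.2.1) * T (.inr z.2.2.2) * opB T) := by
  have l : ∀ {i j : Fin 4}, i < j → T (.inr j) * T (.inr i) = -(T (.inr i) * T (.inr j)) :=
    fun _ => h.oo _ _
  have l' : ∀ {i j : Fin 4} {a : A}, i < j →
      T (.inr j) * (T (.inr i) * a) = -(T (.inr i) * (T (.inr j) * a)) := fun _ => h.oo' _ _ _
  simp only [evenQuads, List.mem_cons, List.not_mem_nil, or_false] at hz
  rcases hz with rfl | rfl | rfl | rfl | rfl | rfl <;>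
    simp [opB, opNu, Fin.sum_univ_four, mul_add, mul_assoc, h.oe, h.oe', h.sq, h.sq', l, l'] <;>
    abel

/-- Here and in the identities below, one more derivative multiplies a coefficient of `α_i`, and the
common factor `∂_i B` is brought to the left. What remains are corrections by the full odd product
or by `ν`, to be compared between the blocks. -/
theorem SuperRel.even_diag (h : SuperRel T) (i a b : Fin 4) :
    T (.inl a) * (T (.inl i) * opB T * T (.inr b) -
      (opNu T i * T (.inr b) + opNu T i * T (.inr b))) =
    T (.inl i) * opB T * (T (.inl a) * T (.inr b)) +
      if i = b then T (.inl a) * opTop T + T (.inl a) * opTop T else 0 := by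
  have e : T (.inl a) * (T (.inl i) * opB T * T (.inr b)) =
      T (.inl i) * opB T * (T (.inl a) * T (.inr b)) := by
    rw [← mul_assoc, ← mul_assoc, h.ee, mul_assoc _ _ (opB _), h.e_B]
    simp only [mul_assoc]
  rw [h.nu_o, mul_sub, e]
  split_ifs <;> simp [mul_add]; abel

theorem SuperRel.even_codiag (h : SuperRel T) (i a b : Fin 4) :
    T (.inr b) * (T (.inl i) * opB T * T (.inl a) -
      (opNu T i * T (.inl a) + opNu T i * T (.inl a)) + T (.inl i) * opNu T a) =
    -(T (.inl i) * opB T * (T (.inl a) * T (.inr b))) -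
      (if i = b then T (.inl a) * opTop T + T (.inl a) * opTop T else 0) +
      if a = b then T (.inl i) * opTop T else 0 := by
  have e1 : T (.inr b) * (T (.inl i) * opB T * T (.inl a)) =
      -(T (.inl i) * opB T * (T (.inl a) * T (.inr b))) := by
    rw [← mul_assoc, ← mul_assoc, h.oe, mul_assoc _ _ (opB _), h.o_B, ← h.oe]
    simp [mul_assoc]
  have e2 : T (.inr b) * (opNu T i * T (.inl a)) = if i = b then T (.inl a) * opTop T else 0 := by
    rw [h.e_nu, ← mul_assoc, h.oe, mul_assoc, h.o_nu, mul_ite, mul_zero]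
    simp only [eq_comm]
  have e3 : T (.inr b) * (T (.inl i) * opNu T a) = if a = b then T (.inl i) * opTop T else 0 := by
    rw [← mul_assoc, h.oe, mul_assoc, h.o_nu, mul_ite, mul_zero]
    simp only [eq_comm]
  rw [mul_add, mul_sub, mul_add, e1, e2, e3]
  split_ifs <;> simp

/-- The main terms sum to a multiple of `B²`, which vanishes, so only the correction from `ν_i`
survives. -/
theorem SuperRel.even_trace (h : SuperRel T) (i : Fin 4) :
    ∑ a, T (.inl a) * (T (.inl i) * opB T * T (.inr a) -
      (opNu T i * T (.inr a) + opNu T i * T (.inr a))) =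
    T (.inl i) * opTop T + T (.inl i) * opTop T := by
  simp only [h.even_diag, Finset.sum_add_distrib, Finset.sum_ite_eq, Finset.mem_univ, if_true]
  rw [← Finset.mul_sum, ← opB, mul_assoc, h.B_sq, mul_zero, zero_add]

theorem SuperRel.even_lower (h : SuperRel T) (i a b : Fin 4) :
    T (.inr a) * (T (.inl i) * opB T * T (.inr b) -
      (opNu T i * T (.inr b) + opNu T i * T (.inr b))) =
    -(T (.inl i) * opB T * (T (.inr a) * T (.inr b))) := by
  have e1 : T (.inr a) * (T (.inl i) * opB T * T (.inr b)) =
      -(T (.inl i) * opB T * (T (.inr a) * T (.inr b))) := by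
    rw [← mul_assoc, ← mul_assoc, h.oe, mul_assoc _ _ (opB _), h.o_B]
    simp [mul_assoc]
  have e2 : T (.inr a) * (opNu T i * T (.inr b)) = 0 := by
    rw [← mul_assoc, h.o_nu]
    split_ifs
    · exact h.top_o b
    · exact zero_mul _
  rw [mul_sub, mul_add, e1, e2, add_zero, sub_zero]

theorem SuperRel.even_upper (h : SuperRel T) (i a b : Fin 4) :
    T (.inl a) * (T (.inl i) * opB T * T (.inl b) -
      (opNu T i * T (.inl b) + opNu T i * T (.inl b)) + T (.inl i) * opNu T b) =
    T (.inl i) * opB T * (T (.inl a) * T (.inl b)) -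
      (opNu T i * (T (.inl a) * T (.inl b)) + opNu T i * (T (.inl a) * T (.inl b))) +
      T (.inl i) * (T (.inl a) * opNu T b) := by
  have e1 : T (.inl a) * (T (.inl i) * opB T * T (.inl b)) =
      T (.inl i) * opB T * (T (.inl a) * T (.inl b)) := by
    rw [← mul_assoc, ← mul_assoc, h.ee, mul_assoc _ _ (opB _), h.e_B]
    simp only [mul_assoc]
  have e2 : T (.inl a) * (opNu T i * T (.inl b)) = opNu T i * (T (.inl a) * T (.inl b)) := by
    rw [← mul_assoc, ← h.e_nu, mul_assoc]
  rw [mul_add, mul_sub, mul_add, e1, e2, h.ee']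

theorem SuperRel.odd_diag (h : SuperRel T) (i a b : Fin 4) :
    T (.inl a) * (T (.inr i) * opB T * T (.inr b)) =
      T (.inr i) * opB T * (T (.inl a) * T (.inr b)) := by
  rw [← mul_assoc, ← mul_assoc, ← h.oe, mul_assoc _ _ (opB _), h.e_B]
  simp only [mul_assoc]

theorem SuperRel.odd_codiag (h : SuperRel T) (i a b : Fin 4) :
    T (.inr b) * (T (.inr i) * opB T * T (.inl a) + T (.inr i) * opNu T a) =
      T (.inr i) * opB T * (T (.inl a) * T (.inr b)) := by
  have e1 : T (.inr b) * (T (.inr i) * opB T * T (.inl a)) =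
      T (.inr i) * opB T * (T (.inl a) * T (.inr b)) := by
    rw [← mul_assoc, ← mul_assoc, h.oo, neg_mul, mul_assoc _ _ (opB _), h.o_B, ← h.oe]
    simp [mul_assoc]
  have e2 : T (.inr b) * (T (.inr i) * opNu T a) = 0 := by
    rw [h.oo', h.o_nu]
    split_ifs
    · have := h.top_o i
      have o : T (.inr i) * opTop T = 0 := by
        have e := h.o_nu i i
        rw [if_pos rfl] at e
        rw [← e, h.sq']
      rw [o, neg_zero]
    · simp
  rw [mul_add, e1, e2, add_zero]

theorem SuperRel.odd_lower (h : SuperRel T) (i a b : Fin 4) :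
    T (.inr a) * (T (.inr i) * opB T * T (.inr b)) =
      T (.inr i) * opB T * (T (.inr a) * T (.inr b)) := by
  rw [← mul_assoc, ← mul_assoc, h.oo, neg_mul, mul_assoc _ _ (opB _), h.o_B]
  simp [mul_assoc]

theorem SuperRel.odd_upper (h : SuperRel T) (i a b : Fin 4) :
    T (.inl a) * (T (.inr i) * opB T * T (.inl b) + T (.inr i) * opNu T b) =
      T (.inr i) * opB T * (T (.inl a) * T (.inl b)) + T (.inr i) * (T (.inl a) * opNu T b) := by
  rw [mul_add, ← mul_assoc, ← mul_assoc, ← h.oe, mul_assoc _ _ (opB _), h.e_B, ← h.oe']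
  simp only [mul_assoc]

theorem SuperRel.oo_add (h : SuperRel T) (X : A) (a b : Fin 4) :
    X * (T (.inr a) * T (.inr b)) + X * (T (.inr b) * T (.inr a)) = 0 := by
  rw [h.oo b a, mul_neg, add_neg_cancel]

/-- The form of `e_nu_sub` needed for the linear parts: a product of two odd operators commutes with
`B`, so `B` can be moved to the left. -/
theorem SuperRel.mul_e_nu_sub (h : SuperRel T) (X : A) {z : Fin 4 × Fin 4 × Fin 4 × Fin 4} (hz : z ∈ evenQuads) :
    X * (T (.inl z.1) * opNu T z.2.1) - X * (T (.inl z.2.1) * opNu T z.1) +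
      X * opB T * (T (.inr z.2.2.1) * T (.inr z.2.2.2)) = 0 := by
  have e : T (.inr z.2.2.1) * T (.inr z.2.2.2) * opB T =
      opB T * (T (.inr z.2.2.1) * T (.inr z.2.2.2)) := by
    rw [mul_assoc, h.o_B, mul_neg, ← mul_assoc (T (.inr z.2.2.1)), h.o_B, neg_mul, neg_neg,
      mul_assoc]
  rw [← mul_sub, h.e_nu_sub hz, e, mul_neg, mul_assoc, neg_add_cancel]

end Ops

theorem SuperCommuting.superRel {A : Type*} [Ring A] {T : Var 4 4 → A} (hT : SuperCommuting T) :
    SuperRel T where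
  ee i j := by simpa [varParity, koszul] using hT.comm (.inl i) (.inl j)
  oe i j := by simpa [varParity, koszul] using hT.comm (.inr i) (.inl j)
  oo i j := by simpa [varParity, koszul] using hT.comm (.inr i) (.inr j)
  sq := hT.odd_sq

/-! ### The linear parts of the fields of the `α_i` -/

section Alpha

variable {F : Type*} [Field F]

theorem rwEval_reB (k : Var 4 4) (Q : RWSpace F 4 4) :
    rwEval F k (reB F Q) = opB (negD F) * rwEval F k Q := by
  simp only [reB, LinearMap.sum_apply, map_sum, Module.End.mul_apply, rwEval_D, opB,
    Finset.sum_mul, mul_assoc]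

theorem rwEval_reNu (k : Var 4 4) (i : Fin 4) (Q : RWSpace F 4 4) :
    rwEval F k (reNu F (.inl i) Q) = opNu (negD F) i * rwEval F k Q := by
  refine LinearMap.ext fun f => ?_
  fin_cases i <;> simp [reNu, opNu, rwEval_D, mul_assoc]

theorem rwEval_reC_inl (j : Fin 4) : rwEval F (.inl j) (reC F) = negD F (.inr j) := by
  simp [reC, rwEval_D, rwEval_gen]

theorem rwEval_reC_inr (j : Fin 4) : rwEval F (.inr j) (reC F) = negD F (.inl j) := by
  simp [reC, rwEval_D, rwEval_gen]

theorem rwEval_reBNu_inl (j : Fin 4) : rwEval F (.inl j) (reBNu F) = 0 := by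
  simp [reBNu, rwEval_reNu, rwEval_gen]

theorem rwEval_reBNu_inr (j : Fin 4) : rwEval F (.inr j) (reBNu F) = opNu (negD F) j := by
  simp [reBNu, rwEval_reNu, rwEval_gen]

theorem rwEval_alpha_even_inl (i j : Fin 4) : rwEval F (.inl j) (reAlpha F (.inl i)) =
    negD F (.inl i) * opB (negD F) * negD F (.inr j) -
      (opNu (negD F) i * negD F (.inr j) + opNu (negD F) i * negD F (.inr j)) := by
  rw [reAlpha, map_add, map_sub, map_smul, two_smul, rwEval_D, rwEval_D, rwEval_reB, rwEval_reNu,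
    rwEval_reC_inl, rwEval_reBNu_inl, mul_zero, add_zero, mul_assoc]

theorem rwEval_alpha_even_inr (i j : Fin 4) : rwEval F (.inr j) (reAlpha F (.inl i)) =
    negD F (.inl i) * opB (negD F) * negD F (.inl j) -
      (opNu (negD F) i * negD F (.inl j) + opNu (negD F) i * negD F (.inl j)) +
      negD F (.inl i) * opNu (negD F) j := by
  rw [reAlpha, map_add, map_sub, map_smul, two_smul, rwEval_D, rwEval_D, rwEval_reB, rwEval_reNu,
    rwEval_reC_inr, rwEval_reBNu_inr, mul_assoc]

theorem reNu_inr (i : Fin 4) : reNu F (.inr i) = 0 := rfl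

theorem rwEval_alpha_odd_inl (i j : Fin 4) : rwEval F (.inl j) (reAlpha F (.inr i)) =
    negD F (.inr i) * opB (negD F) * negD F (.inr j) := by
  rw [reAlpha, map_add, map_sub, map_smul, rwEval_D, rwEval_D, rwEval_reB, reNu_inr,
    rwEval_reC_inl, rwEval_reBNu_inl, mul_zero, add_zero, mul_assoc, LinearMap.zero_apply,
    map_zero, smul_zero, sub_zero]

theorem rwEval_alpha_odd_inr (i j : Fin 4) : rwEval F (.inr j) (reAlpha F (.inr i)) =
    negD F (.inr i) * opB (negD F) * negD F (.inl j) + negD F (.inr i) * opNu (negD F) j := by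
  rw [reAlpha, map_add, map_sub, map_smul, rwEval_D, rwEval_D, rwEval_reB, reNu_inr,
    rwEval_reC_inr, rwEval_reBNu_inr, mul_assoc, LinearMap.zero_apply,
    map_zero, smul_zero, sub_zero]

theorem rwD_par_even (i : Fin 4) {p : ZMod 2} {a : RWSpace F 4 4} (ha : a ∈ rwPar F 4 4 p) :
    rwD F (.inl i) a ∈ rwPar F 4 4 p := by
  simpa [varParity] using rwD_par (.inl i) p a ha

theorem rwD_par_odd (i : Fin 4) {p : ZMod 2} {a : RWSpace F 4 4} (ha : a ∈ rwPar F 4 4 p) :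
    rwD F (.inr i) a ∈ rwPar F 4 4 (p + 1) := by
  simpa [varParity] using rwD_par (.inr i) p a ha

theorem reC_par : reC F ∈ rwPar F 4 4 1 :=
  sum_mem fun i _ => add_mem (rwD_par_even i (rwGen_par (.inr i)))
    (by simpa [varParity] using rwD_par_odd i (rwGen_par (F := F) (r := 4) (.inl i)))

theorem reNu_par (i : Fin 4) {p : ZMod 2} {a : RWSpace F 4 4} (ha : a ∈ rwPar F 4 4 p) :
    reNu F (.inl i) a ∈ rwPar F 4 4 (p + 1) := by
  have key : ∀ i j k, rwD F (.inr i) (rwD F (.inr j) (rwD F (.inr k) a)) ∈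
      rwPar F 4 4 (p + 1) := by
    intro i j k
    have := rwD_par_odd i (rwD_par_odd j (rwD_par_odd k ha))
    rwa [add_assoc (p + 1), CharTwo.add_self_eq_zero, add_zero] at this
  fin_cases i
  · exact key 1 2 3
  · exact neg_mem (key 0 2 3)
  · exact key 0 1 3
  · exact neg_mem (key 0 1 2)

theorem reB_par {p : ZMod 2} {a : RWSpace F 4 4} (ha : a ∈ rwPar F 4 4 p) :
    reB F a ∈ rwPar F 4 4 (p + 1) := by
  rw [reB, LinearMap.sum_apply]
  exact sum_mem fun i _ => rwD_par_even i (rwD_par_odd i ha)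

theorem reBNu_par : reBNu F ∈ rwPar F 4 4 0 :=
  sum_mem fun i _ => reNu_par (p := 1) i (rwGen_par (.inr i))

theorem reAlpha_par (i : Var 4 4) : reAlpha F i ∈ rwPar F 4 4 (varParity i) := by
  have e : ∀ {a : RWSpace F 4 4}, a ∈ rwPar F 4 4 0 → rwD F i a ∈ rwPar F 4 4 (varParity i) := by
    intro a ha
    simpa using rwD_par i 0 a ha
  refine add_mem (sub_mem (e (reB_par (p := 1) reC_par)) (Submodule.smul_mem _ _ ?_)) (e reBNu_par)
  rcases i with i | i
  · exact reNu_par (p := 1) i reC_par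
  · rw [reNu_inr]; exact zero_mem _

/-- Entries of the linear part are constant terms of operators applied to `f`, and the relations of
`linE` already hold as identities between these operators. -/
theorem jac_alpha_even [CharZero F] (i : Fin 4) (f : Series F 4 4) :
    jac (toVF (reAlpha F (.inl i) ⊗ₜ[F] f)) ∈ linE F := by
  have h := (superCommuting_negD F (r := 4) (s := 4)).superRel
  have hp := reAlpha_par (F := F) (.inl i)
  -- An additive functional on operators, through which operator identities turn into identities
  -- between matrix entries.
  obtain ⟨c, hc⟩ : ∃ c : Module.End F (Series F 4 4) →+ F, ∀ X, c X = constTerm (X f) :=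
    ⟨(constTerm.comp (LinearMap.applyₗ f)).toAddMonoidHom, fun X => rfl⟩
  have ee : ∀ a b : Fin 4, jac (toVF (reAlpha F (.inl i) ⊗ₜ[F] f)) (.inl a) (.inl b) =
      c (negD F (.inl a) * rwEval F (.inl b) (reAlpha F (.inl i))) := by
    intro a b
    rw [jac_toVF hp, hc]; simp [varParity, koszul]
  have eo : ∀ a b : Fin 4, jac (toVF (reAlpha F (.inl i) ⊗ₜ[F] f)) (.inl a) (.inr b) =
      -c (negD F (.inl a) * rwEval F (.inr b) (reAlpha F (.inl i))) := by
    intro a b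
    rw [jac_toVF hp, hc]; simp [varParity, koszul]
  have oe : ∀ a b : Fin 4, jac (toVF (reAlpha F (.inl i) ⊗ₜ[F] f)) (.inr a) (.inl b) =
      c (negD F (.inr a) * rwEval F (.inl b) (reAlpha F (.inl i))) := by
    intro a b
    rw [jac_toVF hp, hc]; simp [varParity, koszul]
  have oo : ∀ a b : Fin 4, jac (toVF (reAlpha F (.inl i) ⊗ₜ[F] f)) (.inr a) (.inr b) =
      c (negD F (.inr a) * rwEval F (.inr b) (reAlpha F (.inl i))) := by
    intro a b
    rw [jac_toVF hp, hc, varParity, varParity, varParity,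
      show (1 : ZMod 2) + 0 + 1 = 0 by decide, koszul_zero_right, one_smul]
  refine ⟨fun a b => ?_, fun a b => ?_, fun z hz => ?_⟩
  · simp only [ee, oo, rwEval_alpha_even_inl, rwEval_alpha_even_inr]
    -- In the sum of the two entries the `B` terms and the corrections for `i = b` cancel. What is
    -- left on the diagonal is `∂_i` times the full odd product, which is half the trace.
    rw [← map_sum, h.even_trace, h.even_diag, h.even_codiag]
    simp only [map_add, map_sub, map_neg, apply_ite c, map_zero]
    split_ifs <;> ring
  · simp only [oe, rwEval_alpha_even_inl, h.even_lower, map_neg]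
    rw [← neg_add, ← map_add, h.oo_add, map_zero, neg_zero]
  · have e := congrArg c (h.mul_e_nu_sub (negD F (.inl i)) hz)
    simp only [map_add, map_sub, map_zero] at e
    simp only [eo, oe, rwEval_alpha_even_inr, rwEval_alpha_even_inl, h.even_upper, h.even_lower,
      map_add, map_sub, map_neg, h.ee z.2.1 z.1]
    linear_combination -e

/-- As for even `i`, but `ν_i` is zero, so there are no corrections: the trace is a multiple of `B²`
and vanishes, and the diagonal blocks cancel exactly. -/
theorem jac_alpha_odd [CharZero F] (i : Fin 4) (f : Series F 4 4) :
    jac (toVF (reAlpha F (.inr i) ⊗ₜ[F] f)) ∈ linE F := by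
  have h := (superCommuting_negD F (r := 4) (s := 4)).superRel
  have hp := reAlpha_par (F := F) (.inr i)
  obtain ⟨c, hc⟩ : ∃ c : Module.End F (Series F 4 4) →+ F, ∀ X, c X = constTerm (X f) :=
    ⟨(constTerm.comp (LinearMap.applyₗ f)).toAddMonoidHom, fun X => rfl⟩
  have ee : ∀ a b : Fin 4, jac (toVF (reAlpha F (.inr i) ⊗ₜ[F] f)) (.inl a) (.inl b) =
      c (negD F (.inl a) * rwEval F (.inl b) (reAlpha F (.inr i))) := by
    intro a b
    rw [jac_toVF hp, hc]; simp [varParity, koszul]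
  have eo : ∀ a b : Fin 4, jac (toVF (reAlpha F (.inr i) ⊗ₜ[F] f)) (.inl a) (.inr b) =
      c (negD F (.inl a) * rwEval F (.inr b) (reAlpha F (.inr i))) := by
    intro a b
    rw [jac_toVF hp, hc, varParity, varParity, varParity,
      show (0 : ZMod 2) + 1 + 1 = 0 by decide, koszul_zero_right, one_smul]
  have oe : ∀ a b : Fin 4, jac (toVF (reAlpha F (.inr i) ⊗ₜ[F] f)) (.inr a) (.inl b) =
      c (negD F (.inr a) * rwEval F (.inl b) (reAlpha F (.inr i))) := by
    intro a b
    rw [jac_toVF hp, hc]; simp [varParity, koszul]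
  have oo : ∀ a b : Fin 4, jac (toVF (reAlpha F (.inr i) ⊗ₜ[F] f)) (.inr a) (.inr b) =
      -c (negD F (.inr a) * rwEval F (.inr b) (reAlpha F (.inr i))) := by
    intro a b
    rw [jac_toVF hp, hc, varParity, varParity, varParity,
      show (1 : ZMod 2) + 1 + 1 = 1 by decide, koszul_one_one, neg_smul, one_smul]
  refine ⟨fun a b => ?_, fun a b => ?_, fun z hz => ?_⟩
  · simp only [ee, oo, rwEval_alpha_odd_inl, rwEval_alpha_odd_inr, h.odd_diag, h.odd_codiag]
    rw [← map_sum, ← Finset.mul_sum, ← opB, mul_assoc _ (opB _) (opB _), h.B_sq, mul_zero, map_zero,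
      ite_self]
    ring
  · simp only [oe, rwEval_alpha_odd_inl, h.odd_lower]
    rw [← map_add, h.oo_add, map_zero]
  · have e := congrArg c (h.mul_e_nu_sub (negD F (.inr i)) hz)
    simp only [map_add, map_sub, map_zero] at e
    simp only [eo, oe, rwEval_alpha_odd_inr, rwEval_alpha_odd_inl, h.odd_upper, h.odd_lower,
      map_add, h.ee z.2.1 z.1]
    linear_combination e

theorem toVF_alpha_mem [CharZero F] (i : Var 4 4) (f : Series F 4 4) :
    toVF (reAlpha F i ⊗ₜ[F] f) ∈ vfE F := by
  rcases i with i | i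
  · exact toVF_mem_prolong (reAlpha_par _) (jac_alpha_even i) f
  · exact toVF_mem_prolong (reAlpha_par _) (jac_alpha_odd i) f

end Alpha

/-! ## Elements of `RW(4, 4)` acting by vector fields in `E(4, 4)` -/

section Filtrations

variable {F : Type*} [Field F] {r s : ℕ}

/-- The series all of whose monomials have at least `d` odd factors. -/
def oddGE (F : Type*) [Field F] (r s d : ℕ) : Submodule F (Series F r s) where
  carrier := {f | ∀ S : Finset (Fin s), S.card < d → f S = 0}
  zero_mem' := fun _ _ => rfl
  add_mem' := fun {f g} hf hg S h => by simp [hf S h, hg S h]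
  smul_mem' := fun c f hf S h => by simp [hf S h]

theorem oddGE_mono {d d' : ℕ} (h : d' ≤ d) : oddGE F r s d ≤ oddGE F r s d' :=
  fun _ hf S hS => hf S (hS.trans_le h)

theorem negD_even_oddGE {d : ℕ} (i : Fin r) {f : Series F r s} (hf : f ∈ oddGE F r s d) :
    negD F (.inl i) f ∈ oddGE F r s d := by
  refine neg_mem fun S hS => ?_
  rw [seriesD_inl, hf S hS, map_zero]

theorem negD_odd_oddGE {d : ℕ} (j : Fin s) {f : Series F r s} (hf : f ∈ oddGE F r s (d + 1)) :
    negD F (.inr j) f ∈ oddGE F r s d := by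
  refine neg_mem fun S hS => ?_
  rw [seriesD_inr, hf _ ((Finset.card_insert_le j S).trans_lt (by omega)), smul_zero]

theorem monOp_oddGE (m : Mon r s) {d : ℕ} {f : Series F r s}
    (hf : f ∈ oddGE F r s (d + m.2.card)) : monOp (negD F) m f ∈ oddGE F r s d := by
  induction m using mon_induction generalizing d with
  | one => rw [monOp_monOne]; exact hf
  | mul i m h ih =>
    rw [monOp_varMul' _ (superCommuting_negD F).comm (superCommuting_negD F).odd_sq i m h]
    refine zsmul_mem ?_ _
    rcases i with i | j
    · exact negD_even_oddGE i (ih hf)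
    · have hj : j ∉ m.2 := by
        intro hj; apply h; simp [varSign, oddSign, hj]
      refine negD_odd_oddGE j (ih ?_)
      rw [varMul, Finset.card_insert_of_notMem hj] at hf
      rwa [add_right_comm]

theorem monOp_negD (m : Mon r s) : ∃ ε : ℤ, ε ≠ 0 ∧ ∀ f : Series F r s,
    monOp (negD F) m f = ε • monOp seriesD m f := by
  induction m using mon_induction with
  | one => exact ⟨1, one_ne_zero, fun f => by rw [monOp_monOne, monOp_monOne, one_smul]⟩
  | mul i m h ih =>
    obtain ⟨ε, hε, ih⟩ := ih
    refine ⟨-ε, neg_ne_zero.mpr hε, fun f => ?_⟩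
    rw [monOp_varMul' _ (superCommuting_negD F).comm (superCommuting_negD F).odd_sq i m h,
      monOp_varMul' _ seriesD_comm seriesD_odd_sq i m h,
      LinearMap.smul_apply, LinearMap.smul_apply, Module.End.mul_apply, Module.End.mul_apply, ih,
      map_zsmul, negD_apply]
    simp only [smul_neg, mul_neg, neg_smul, smul_smul, mul_comm]

theorem constTerm_monOp_negD [CharZero F] (m : Mon r s) : ∃ u : F, u ≠ 0 ∧ ∀ f : Series F r s,
    constTerm (monOp (negD F) m f) = u * MvPowerSeries.coeff m.1 (f m.2) := by
  obtain ⟨ε, hε, h⟩ := monOp_negD (F := F) m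
  obtain ⟨u, hu, h'⟩ := constTerm_monOp (F := F) m
  refine ⟨ε * u, mul_ne_zero (by exact_mod_cast hε) hu, fun f => ?_⟩
  rw [h, map_zsmul, h', zsmul_eq_mul, mul_assoc]

theorem coeff_seriesMon (m n : Mon r s) :
    MvPowerSeries.coeff m.1 (seriesMon F n m.2) = if m = n then 1 else 0 := by
  classical
  rw [seriesMon]
  by_cases h : m.2 = n.2
  · rw [h, Pi.single_eq_same, MvPowerSeries.coeff_monomial]
    simp only [Prod.ext_iff, h, and_true]
  · rw [Pi.single_eq_of_ne h, map_zero, if_neg]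
    rintro rfl
    exact h rfl

theorem rwEval_apply (k : Var r s) (Q : RWSpace F r s) (f : Series F r s) :
    rwEval F k Q f = Q.sum fun m v => v k • monOp (negD F) m f := by
  simp [rwEval, Finsupp.sum, LinearMap.sum_apply]

/-- Applied to `y^m` and evaluated at the origin, the operator returns the coefficient of `∂^m` up
to a nonzero scalar. -/
theorem eq_zero_of_rwEval [CharZero F] {Q : RWSpace F r s}
    (h : ∀ k f, rwEval F k Q f = 0) : Q = 0 := by
  refine Finsupp.ext fun m => funext fun k => ?_
  have e := congrArg constTerm (h k (seriesMon F m))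
  rw [rwEval_apply, Finsupp.sum, map_sum, map_zero, Finset.sum_eq_single m] at e
  · obtain ⟨u, hu, hm⟩ := constTerm_monOp_negD (F := F) m
    rw [map_smul, hm, coeff_seriesMon, if_pos rfl, smul_eq_mul, mul_one] at e
    exact (mul_eq_zero.mp e).resolve_right hu
  · intro n _ hn
    obtain ⟨u, hu, hm⟩ := constTerm_monOp_negD (F := F) n
    rw [map_smul, hm, coeff_seriesMon, if_neg hn, mul_zero, smul_zero]
  · intro hm
    rw [Finsupp.notMem_support_iff.mp hm]
    simp

theorem seriesTwist_self (t : ZMod 2) (f : Series F r s) : seriesTwist t (seriesTwist t f) = f := by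
  rw [seriesTwist_twist, CharTwo.add_self_eq_zero, seriesTwist_zero]

theorem eq_zero_of_toVF [CharZero F] {Q : RWSpace F r s} (h : ∀ f, toVF (Q ⊗ₜ[F] f) = 0) :
    Q = 0 := by
  refine eq_zero_of_rwEval fun k f => ?_
  have e := congrFun (h (seriesTwist (varParity k) f)) k
  rw [toVF_tmul, seriesTwist_self] at e
  exact neg_eq_zero.mp e

/-- A derivation-stable space of series containing all `f y_{1…s}` is everything. -/
theorem mem_of_seriesD_stable (Z : Submodule F (Series F r s))
    (hD : ∀ j, ∀ f ∈ Z, seriesD (.inr j) f ∈ Z)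
    (h : ∀ f, Pi.single Finset.univ f ∈ Z) (f : Series F r s) : f ∈ Z := by
  have key : ∀ n, ∀ S : Finset (Fin s), Sᶜ.card = n → ∀ f, Pi.single S f ∈ Z := by
    intro n
    induction n with
    | zero =>
      intro S hS f
      rw [Finset.card_eq_zero, Finset.compl_eq_empty_iff] at hS
      subst hS
      exact h f
    | succ n ih =>
      intro S hS f
      obtain ⟨j, hj⟩ := Finset.card_pos.mp (by omega : 0 < Sᶜ.card)
      have hj' : j ∉ S := Finset.mem_compl.mp hj
      have hc : (insert j S)ᶜ.card = n := by
        rw [Finset.compl_insert, Finset.card_erase_of_mem hj, hS, Nat.add_sub_cancel]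
      -- Up to sign `f y_S` is the derivative of `f y_{S ∪ {j}}`, so one descends from the full set.
      have e : Pi.single S f = oddSign j S • seriesD (.inr j)
          (Pi.single (insert j S) f : Series F r s) := by
        funext T
        rw [Pi.smul_apply, seriesD_inr, smul_smul]
        by_cases hT : T = S
        · subst hT
          rw [Pi.single_eq_same, Pi.single_eq_same, oddSign_mul_self j T hj', one_smul]
        · rw [Pi.single_eq_of_ne hT]
          by_cases hjT : j ∈ T
          · simp [oddSign, hjT]
          · rw [Pi.single_eq_of_ne, smul_zero]
            intro e
            apply hT
            rw [← Finset.erase_insert hjT, e, Finset.erase_insert hj']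
      rw [e]
      exact zsmul_mem (hD j _ (ih _ hc f)) _
  rw [← Finset.univ_sum_single f]
  exact sum_mem fun S _ => key _ S rfl _

end Filtrations

/-! ### RE(4,4) as the elements acting through `vfE` -/

section Members

variable {F : Type*} [Field F]

theorem opB_oddGE {d : ℕ} {f : Series F 4 4} (hf : f ∈ oddGE F 4 4 (d + 1)) :
    opB (negD F) f ∈ oddGE F 4 4 d := by
  rw [opB, LinearMap.sum_apply]
  exact sum_mem fun i _ => negD_even_oddGE i (negD_odd_oddGE i hf)

theorem opNu_oddGE (i : Fin 4) {d : ℕ} {f : Series F 4 4} (hf : f ∈ oddGE F 4 4 (d + 3)) :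
    opNu (negD F) i f ∈ oddGE F 4 4 d := by
  have key : ∀ i j k, negD F (.inr i) (negD F (.inr j) (negD F (.inr k) f)) ∈ oddGE F 4 4 d :=
    fun i j k => negD_odd_oddGE i (negD_odd_oddGE j (negD_odd_oddGE k hf))
  fin_cases i
  · exact key 1 2 3
  · exact neg_mem (key 0 2 3)
  · exact key 0 1 3
  · exact neg_mem (key 0 1 2)

/-- The leading coefficient of `α_i`. -/
def alphaLead (F : Type*) [Field F] : Var 4 4 → F
  | .inl _ => 2
  | .inr _ => 1

theorem alphaLead_ne_zero [CharZero F] (i : Var 4 4) : alphaLead F i ≠ 0 := by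
  rcases i with i | i <;> simp [alphaLead]

/-- At odd variables zero, only terms with all four odd derivatives matter on multiples of the top
odd monomial. In `α_i` these come from `-2 ν_i ∂_{i+4} a_i` for even `i`, giving 2, and from `∂_i
B_{νa}` for odd `i`, giving 1; the terms with `B` have too few odd derivatives. -/
theorem rwEval_alpha_lead (k i : Var 4 4) {f : Series F 4 4} (hf : f ∈ oddGE F 4 4 4) :
    rwEval F k (reAlpha F i) f - (if k = i then alphaLead F i • opTop (negD F) f else 0) ∈
      oddGE F 4 4 1 := by
  have h := (superCommuting_negD F (r := 4) (s := 4)).superRel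
  rcases i with i | i <;> rcases k with k | k
  · rw [rwEval_alpha_even_inl, h.nu_o]
    have e := negD_even_oddGE i (oddGE_mono (by norm_num : 1 ≤ 2) (opB_oddGE (negD_odd_oddGE k hf)))
    by_cases hk : i = k
    · subst hk
      simp only [if_true, alphaLead, two_smul]
      convert e using 1
      simp only [LinearMap.sub_apply, LinearMap.add_apply, LinearMap.neg_apply,
        Module.End.mul_apply]
      abel
    · have hk' : Sum.inl k ≠ (Sum.inl i : Var 4 4) := fun h => hk (Sum.inl_injective h).symm
      simpa [hk, Ne.symm hk] using e
  · rw [rwEval_alpha_even_inr, if_neg (by simp), sub_zero]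
    refine add_mem (sub_mem ?_ ?_) ?_
    · exact negD_even_oddGE i (oddGE_mono (by norm_num : 1 ≤ 3) (opB_oddGE (negD_even_oddGE k hf)))
    · have e := opNu_oddGE i (d := 1) (negD_even_oddGE k hf)
      exact add_mem e e
    · exact negD_even_oddGE i (opNu_oddGE k hf)
  · rw [rwEval_alpha_odd_inl, if_neg (by simp), sub_zero]
    exact negD_odd_oddGE i (opB_oddGE (negD_odd_oddGE k hf))
  · rw [rwEval_alpha_odd_inr, h.o_nu]
    have e := oddGE_mono (by norm_num : 1 ≤ 2) 
      (negD_odd_oddGE i (opB_oddGE (negD_even_oddGE k hf)))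
    by_cases hk : i = k
    · subst hk
      simp only [if_true, alphaLead, one_smul]
      simpa using e
    · simpa [hk, Ne.symm hk] using e

theorem monOp_univ (e : Fin 4 →₀ ℕ) : monOp (negD F (r := 4) (s := 4)) (e, Finset.univ) =
    monOp (negD F) (e, ∅) * opTop (negD F) := by
  simp [monOp, opTop, List.finRange_succ, mul_assoc]

/-- The elements of `RW(4, 4)` acting by vector fields in `E(4, 4)`. -/
def reMem (F : Type*) [Field F] : Submodule F (RWSpace F 4 4) where
  carrier := {Q | ∀ f, toVF (Q ⊗ₜ[F] f) ∈ vfE F}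
  zero_mem' := fun f => by rw [TensorProduct.zero_tmul, map_zero]; exact zero_mem _
  add_mem' := fun hP hQ f => by
    rw [TensorProduct.add_tmul, map_add]; exact add_mem (hP f) (hQ f)
  smul_mem' := fun c Q hQ f => by
    rw [TensorProduct.smul_tmul]; exact hQ _

theorem monOp_alpha_mem [CharZero F] (m : Mon 4 4) (i : Var 4 4) :
    monOp (rwD F) m (reAlpha F i) ∈ reMem F := by
  have hD : ∀ i, ∀ Q ∈ reMem F, rwD F i Q ∈ reMem F := by
    intro i Q hQ f
    have : toVF (rwD F i Q ⊗ₜ[F] f) = -vfD i (toVF (Q ⊗ₜ[F] f)) := by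
      funext k
      exact toVF_D i Q f k
    rw [this]
    exact neg_mem (vfD_mem_prolong i (hQ f))
  exact monOp_mem _ (reMem F) superCommuting_rwD.comm superCommuting_rwD.odd_sq hD m
    (toVF_alpha_mem i)

theorem RESpace_le_reMem [CharZero F] : RESpace F ≤ reMem F :=
  Submodule.span_le.mpr (by rintro _ ⟨⟨m, i⟩, rfl⟩; exact monOp_alpha_mem m i)

theorem monOp_rwD_par (m : Mon 4 4) {p : ZMod 2} {Q : RWSpace F 4 4} (hQ : Q ∈ rwPar F 4 4 p) :
    monOp (rwD F) m Q ∈ rwPar F 4 4 (monParity m + p) := by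
  induction m using mon_induction with
  | one => rw [monOp_monOne, monParity_monOne, zero_add]; exact hQ
  | mul i m h ih =>
    rw [monOp_varMul' _ superCommuting_rwD.comm superCommuting_rwD.odd_sq i m h,
      monParity_varMul i m h, add_assoc, add_comm (varParity i)]
    exact zsmul_mem (rwD_par i _ _ ih) _

/-- On multiples of the top odd monomial the field vanishes at odd variables zero, so rigidity kills
it. All other series are reached by odd derivatives. -/
theorem eq_zero_of_reMem [CharZero F] {p : ZMod 2} {Q : RWSpace F 4 4}
    (hQ : Q ∈ rwPar F 4 4 p) (hE : Q ∈ reMem F)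
    (h : ∀ k, ∀ f ∈ oddGE F 4 4 4, rwEval F k Q f ∈ oddGE F 4 4 1) : Q = 0 := by
  refine eq_zero_of_toVF fun f => ?_
  -- The series `f` for which `Q ⊗ f` has zero field; this space is stable under odd derivatives
  -- because `vfD_toVF` moves them onto the field.
  let Z : Submodule F (Series F 4 4) :=
    LinearMap.ker (toVF.comp (TensorProduct.mk F (RWSpace F 4 4) (Series F 4 4) Q))
  have memZ : ∀ f, f ∈ Z ↔ toVF (Q ⊗ₜ[F] f) = 0 := fun f => LinearMap.mem_ker
  rw [← memZ]
  refine mem_of_seriesD_stable Z (fun j f hf => ?_) (fun f => ?_) f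
  · rw [memZ] at hf ⊢
    have e := vfD_toVF hQ (.inr j) f
    rw [hf, map_zero, LieConformalSuperalgebra.tmul_zsmul', map_zsmul] at e
    have e2 := congrArg (koszul (varParity (.inr j : Var 4 4)) p • ·) e
    simp only [smul_zero, smul_smul, koszul_mul_self, one_smul] at e2
    exact e2.symm
  · rw [memZ]
    refine eq_zero_of_mem_vfE (hE _) fun k => ?_
    rw [toVF_tmul]
    have hs : (Pi.single Finset.univ f : Series F 4 4) ∈ oddGE F 4 4 4 := by
      intro S hS
      rw [Pi.single_eq_of_ne]
      rintro rfl
      simp at hS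
    have ht : seriesTwist (varParity k) (Pi.single Finset.univ f : Series F 4 4) ∈ oddGE F 4 4 4 := by
      intro S hS
      rw [seriesTwist_apply, hs S hS, smul_zero]
    rw [Pi.neg_apply, h k _ ht ∅ (by simp), neg_zero]

/-- The span of the `∂_1^{e_1} ⋯ ∂_4^{e_4} α_i`. -/
def reEven (F : Type*) [Field F] : Submodule F (RWSpace F 4 4) :=
  Submodule.span F (Set.range fun z : (Fin 4 →₀ ℕ) × Var 4 4 =>
    monOp (rwD F) (z.1, ∅) (reAlpha F z.2))

theorem reEven_le : reEven F ≤ RESpace F :=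
  Submodule.span_le.mpr (by rintro _ ⟨⟨e, i⟩, rfl⟩; exact Submodule.subset_span ⟨((e, ∅), i), rfl⟩)

/-- A combination of even derivatives of the `α_k` is chosen to agree with `Q` in all monomials
containing the four odd derivatives. The difference still acts through `vfE` but is invisible at odd
variables zero, so `eq_zero_of_reMem` applies. -/
theorem mem_reEven_of_reMem [CharZero F] {p : ZMod 2} {Q : RWSpace F 4 4}
    (hQ : Q ∈ rwPar F 4 4 p) (hE : Q ∈ reMem F) : Q ∈ reEven F := by
  -- Division by the leading coefficient of `α_k` matches the visible coefficients; monomials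
  -- missing an odd derivative get coefficient zero.
  let c : Mon 4 4 → Var 4 4 → F := fun m k =>
    if m.2 = Finset.univ then Q m k * (alphaLead F k)⁻¹ else 0
  let P : RWSpace F 4 4 := ∑ m ∈ Q.support, ∑ k, c m k • monOp (rwD F) (m.1, ∅) (reAlpha F k)
  have hP : P ∈ reEven F := sum_mem fun m _ => sum_mem fun k _ =>
    Submodule.smul_mem _ _ (Submodule.subset_span ⟨(m.1, k), rfl⟩)
  have hPp : P ∈ rwPar F 4 4 p := by
    refine sum_mem fun m _ => sum_mem fun k _ => ?_
    by_cases hm : m.2 = Finset.univ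
    · by_cases hk : varParity k = p
      · subst hk
        have := monOp_rwD_par (m.1, ∅) (reAlpha_par (F := F) k)
        rw [show monParity ((m.1, ∅) : Mon 4 4) = 0 from rfl, zero_add] at this
        exact Submodule.smul_mem _ _ this
      · have : Q m k = 0 := hQ m k (by
          rw [show monParity m = 0 by rw [monParity, hm]; decide, zero_add]; exact hk)
        simp [c, this]
    · simp [c, hm]
  have : Q - P = 0 := by
    refine eq_zero_of_reMem (sub_mem hQ hPp) (sub_mem hE (RESpace_le_reMem (reEven_le hP))) fun k f hf => ?_
    have e1 : rwEval F k (Q - P) f = ∑ m ∈ Q.support,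
        (Q m k • monOp (negD F) m f -
          ∑ i, c m i • monOp (negD F) (m.1, ∅) (rwEval F k (reAlpha F i) f)) := by
      rw [map_sub, LinearMap.sub_apply, rwEval_apply, Finset.sum_sub_distrib]
      simp only [P, map_sum, map_smul, rwEval_monOp, LinearMap.sum_apply, LinearMap.smul_apply,
        Module.End.mul_apply]
      rfl
    rw [e1]
    refine sum_mem fun m _ => ?_
    by_cases hm : m.2 = Finset.univ
    · have hmon : monOp (negD F) m f = monOp (negD F) (m.1, ∅) (opTop (negD F) f) := by
        rw [show m = (m.1, Finset.univ) from Prod.ext rfl hm, monOp_univ]; rfl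
      -- The visible term of `Q` is cancelled by the leading term of `α_k`, and only remainders
      -- controlled by `rwEval_alpha_lead` are left.
      have e2 : Q m k • monOp (negD F) m f -
          ∑ i, c m i • monOp (negD F) (m.1, ∅) (rwEval F k (reAlpha F i) f) =
          -∑ i, c m i • monOp (negD F) (m.1, ∅) (rwEval F k (reAlpha F i) f -
            (if k = i then alphaLead F i • opTop (negD F) f else 0)) := by
        have e3 : ∀ i, c m i • monOp (negD F) (m.1, ∅) (rwEval F k (reAlpha F i) f -
            (if k = i then alphaLead F i • opTop (negD F) f else 0)) =
            c m i • monOp (negD F) (m.1, ∅) (rwEval F k (reAlpha F i) f) -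
              if k = i then (c m i * alphaLead F i) •
                monOp (negD F) (m.1, ∅) (opTop (negD F) f) else 0 := by
          intro i
          split_ifs
          · rw [map_sub, smul_sub, map_smul, smul_smul]
          · rw [sub_zero, sub_zero]
        have e4 : c m k * alphaLead F k = Q m k := by
          simp only [c, if_pos hm]
          rw [mul_assoc, inv_mul_cancel₀ (alphaLead_ne_zero k), mul_one]
        simp only [e3, Finset.sum_sub_distrib, Finset.sum_ite_eq, Finset.mem_univ, if_true]
        rw [hmon, e4]
        abel
      rw [e2]
      exact neg_mem (sum_mem fun i _ => Submodule.smul_mem _ _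
        (monOp_oddGE (m.1, ∅) (rwEval_alpha_lead k i hf)))
    -- With at most three odd derivatives, a multiple of the top odd monomial keeps an odd factor.
    · simp only [c, if_neg hm, zero_smul, Finset.sum_const_zero, sub_zero]
      have : m.2.card < 4 := by
        have h2 := (Finset.card_lt_iff_ne_univ m.2).mpr hm
        simpa using h2
      exact Submodule.smul_mem _ _ (monOp_oddGE m (oddGE_mono (by omega) hf))
  rw [sub_eq_zero] at this
  rwa [this]

/-- The series of degree less than `d`. -/
def degLT (F : Type*) [Field F] (r s d : ℕ) : Submodule F (Series F r s) where
  carrier := {f | ∀ m : Mon r s, d ≤ monLength m → MvPowerSeries.coeff m.1 (f m.2) = 0}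
  zero_mem' := fun _ _ => by simp
  add_mem' := fun {f g} hf hg m h => by simp [hf m h, hg m h]
  smul_mem' := fun c f hf m h => by simp [hf m h]

theorem coeff_seriesD {r s : ℕ} (i : Var r s) (m : Mon r s) (f : Series F r s) : ∃ c : F,
    MvPowerSeries.coeff m.1 (seriesD i f m.2) =
      c * MvPowerSeries.coeff (varMul i m).1 (f (varMul i m).2) ∧ (varSign i m = 0 → c = 0) := by
  rcases i with i | j
  · refine ⟨m.1 i + 1, ?_, fun h => absurd h one_ne_zero⟩
    rw [seriesD_inl, MvPowerSeries.coeff_pderiv, mul_comm]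
    rfl
  · refine ⟨(oddSign j m.2 : ℤ), ?_, fun h => ?_⟩
    · rw [seriesD_inr, map_zsmul, zsmul_eq_mul]; rfl
    · rw [show oddSign j m.2 = 0 from h, Int.cast_zero]

theorem seriesD_degLT {r s d : ℕ} (i : Var r s) {f : Series F r s}
    (hf : f ∈ degLT F r s (d + 1)) : seriesD i f ∈ degLT F r s d := by
  intro m hm
  obtain ⟨c, h, hc⟩ := coeff_seriesD i m f
  rw [h]
  by_cases hs : varSign i m = 0
  · rw [hc hs, zero_mul]
  · rw [hf _ (by rw [monLength_varMul i m hs]; omega), mul_zero]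

theorem seriesD_degLT' {r s d : ℕ} (i : Var r s) {f : Series F r s}
    (hf : f ∈ degLT F r s d) : seriesD i f ∈ degLT F r s (d - 1) := by
  rcases d with _ | d
  · exact seriesD_degLT i fun m _ => hf m (Nat.zero_le _)
  · exact seriesD_degLT i hf

theorem monOp_degLT {r s d : ℕ} (m : Mon r s) {f : Series F r s}
    (hf : f ∈ degLT F r s d) : monOp seriesD m f ∈ degLT F r s (d - monLength m) := by
  induction m using mon_induction with
  | one => rw [monOp_monOne]; exact hf
  | mul i m h ih =>
    rw [monOp_varMul' _ seriesD_comm seriesD_odd_sq i m h, monLength_varMul i m h,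
      show d - (monLength m + 1) = d - monLength m - 1 by omega]
    exact zsmul_mem (seriesD_degLT' i ih) _

theorem seriesMon_degLT {r s : ℕ} (m : Mon r s) :
    seriesMon F m ∈ degLT F r s (monLength m + 1) := by
  intro n hn
  rw [coeff_seriesMon, if_neg]
  rintro rfl
  omega

theorem eq_of_degLT_one {r s : ℕ} {f : Series F r s} (hf : f ∈ degLT F r s 1) :
    f = constTerm f • seriesMon F monOne := by
  funext S
  refine MvPowerSeries.ext fun e => ?_
  rw [Pi.smul_apply, map_smul, coeff_seriesMon (e, S) monOne]
  by_cases h : (e, S) = (monOne : Mon r s)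
  · obtain ⟨rfl, rfl⟩ := Prod.ext_iff.mp h
    rw [if_pos h, smul_eq_mul, mul_one]; rfl
  · rw [if_neg h, smul_zero]
    refine hf (e, S) (Nat.one_le_iff_ne_zero.mpr fun h0 => h ?_)
    have := Nat.add_eq_zero_iff.mp h0
    exact Prod.ext ((Finsupp.degree_eq_zero_iff e).mp this.1) (Finset.card_eq_zero.mp this.2)

theorem serMul_one_left {r s : ℕ} (g : Series F r s) : serMul (seriesMon F monOne) g = g := by
  funext U
  rw [serMul_apply, seriesMul, Finset.sum_eq_single ∅]
  · simp [seriesMon, monOne, crossSign, MvPowerSeries.monomial_zero_one]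
  · intro T _ hT
    rw [seriesMon, Pi.single_eq_of_ne (show T ≠ (monOne : Mon r s).2 from hT), zero_mul, smul_zero]
  · simp

/-- Evaluation at `f = y^m` is triangular with respect to length: shorter monomials of `P` are
treated by induction, and `∂^m y^m` is a nonzero constant, which isolates the coefficient at `m`. -/
theorem coeff_mem_of_evalAt {r s : ℕ} [CharZero F] {R : Type*} [AddCommGroup R] [Module F R]
    (S : LieConformalSuperalgebra F r s R) {V : Type*} [AddCommGroup V] [Module F V]
    (T : R ⊗[F] Series F r s →ₗ[F] V) (W : Submodule F V) {p : ZMod 2} {P : Poly r s R}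
    (hP : ∀ m, P m ∈ S.par (p + monParity m))
    (h : ∀ f g, T (S.evalAt f g P) ∈ W) (m : Mon r s) (g : Series F r s) : T (P m ⊗ₜ g) ∈ W := by
  induction hn : monLength m using Nat.strong_induction_on generalizing m g with
  | _ n ih =>
  have e : ∀ f g, S.evalAt f g P = ∑ k ∈ P.support,
      koszul (monParity k) (p + monParity k) • (P k ⊗ₜ[F] serMul (monOp seriesD k f) g) := by
    intro f g
    conv_lhs => rw [← Finsupp.sum_single P]
    rw [Finsupp.sum, map_sum]
    refine Finset.sum_congr rfl fun k _ => ?_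
    rw [S.evalAt_single, S.twist_of_mem _ (hP k), LieConformalSuperalgebra.zsmul_tmul']
    rfl
  by_cases hm : m ∈ P.support
  · have h1 := h (seriesMon F m) g
    rw [e, map_sum, ← Finset.add_sum_erase _ _ hm] at h1
    have h2 : ∑ k ∈ P.support.erase m, T (koszul (monParity k) (p + monParity k) •
        (P k ⊗ₜ[F] serMul (monOp seriesD k (seriesMon F m)) g)) ∈ W := by
      refine sum_mem fun k hk => ?_
      rw [map_zsmul]
      refine zsmul_mem ?_ _
      -- If `k` is at least as long as `m`, then `∂^k y^m` is constant, and the constant is zero for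
      -- `k ≠ m`.
      by_cases hl : monLength k < n
      · exact ih _ hl k _ rfl
      · have h3 := monOp_degLT k (seriesMon_degLT (F := F) m)
        have h4 : monOp seriesD k (seriesMon F m) = 0 := by
          have h5 : monOp seriesD k (seriesMon F m) ∈ degLT F r s 1 := by
            intro j hj; exact h3 j (by omega)
          obtain ⟨u, hu, hk'⟩ := constTerm_monOp (F := F) k
          rw [eq_of_degLT_one h5, hk', coeff_seriesMon, if_neg (Finset.mem_erase.mp hk).1,
            mul_zero, zero_smul]
        rw [h4, map_zero, LinearMap.zero_apply, TensorProduct.tmul_zero, map_zero]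
        exact zero_mem _
    have h6 := (Submodule.add_mem_iff_left W h2).mp h1
    have h5 : monOp seriesD m (seriesMon F m) ∈ degLT F r s 1 := by
      have h3 := monOp_degLT m (seriesMon_degLT (F := F) m)
      intro j hj; exact h3 j (by omega)
    obtain ⟨u, hu, hk'⟩ := constTerm_monOp (F := F) m
    rw [eq_of_degLT_one h5, hk', coeff_seriesMon, if_pos rfl, mul_one, map_zsmul, map_smul,
      LinearMap.smul_apply, serMul_one_left, TensorProduct.tmul_smul, map_smul,
      ← Int.cast_smul_eq_zsmul F, smul_smul] at h6
    refine (Submodule.smul_mem_iff W (mul_ne_zero ?_ hu)).mp h6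
    exact_mod_cast koszul_ne_zero _ _
  · rw [Finsupp.notMem_support_iff.mp hm, TensorProduct.zero_tmul, map_zero]
    exact zero_mem _

/-- Brackets of fields of `a f` and `b g` stay in `vfE`. By `coeff_mem_of_evalAt` every coefficient
of the λ-bracket then acts through `vfE`, and being homogeneous it lies in RE(4,4). -/
theorem rwBracket_mem_of_reMem [CharZero F] {p q : ZMod 2} {a b : RWSpace F 4 4}
    (ha : a ∈ rwPar F 4 4 p) (hb : b ∈ rwPar F 4 4 q) (ha' : a ∈ reMem F) (hb' : b ∈ reMem F)
    (m : Mon 4 4) : (RW F 4 4).bracket a b m ∈ RESpace F := by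
  have hpar := (rwLie F 4 4).bracket_par p q a ha b hb
  refine reEven_le (mem_reEven_of_reMem (hpar m) fun g =>
    coeff_mem_of_evalAt (rwLie F 4 4) toVF (vfE F) hpar ?_ m g)
  have key : ∀ t u, ∀ f ∈ serPar F 4 4 t, ∀ g ∈ serPar F 4 4 u,
      toVF ((rwLie F 4 4).evalAt f g ((rwLie F 4 4).bracket a b)) ∈ vfE F := by
    intro t u f hf g hg
    have h1 := vfBracket_mem_prolong matBracket_mem_linE (toVF_par ha hf) (toVF_par hb hg)
      (ha' f) (hb' g)
    rw [← toVF_affBracket, (rwLie F 4 4).affBracket_tmul_homog a b hf g hb, map_zsmul] at h1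
    have h2 := zsmul_mem h1 (koszul t q)
    rwa [smul_smul, koszul_mul_self, one_smul] at h2
  intro f g
  rw [series_parts f, series_parts g, LieConformalSuperalgebra.evalAt_add_left,
    LieConformalSuperalgebra.evalAt_add_right, LieConformalSuperalgebra.evalAt_add_right]
  simp only [LinearMap.add_apply, map_add]
  refine add_mem (add_mem ?_ ?_) (add_mem ?_ ?_) <;>
    exact key _ _ _ (seriesPart_mem _ _) _ (seriesPart_mem _ _)

theorem RESpace_induction {C : RWSpace F 4 4 → Prop}
    (gen : ∀ m i, C (monOp (rwD F) m (reAlpha F i))) (zero : C 0)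
    (add : ∀ a b, C a → C b → C (a + b)) (smul : ∀ (c : F) a, C a → C (c • a))
    {a : RWSpace F 4 4} (ha : a ∈ RESpace F) : C a := by
  induction ha using Submodule.span_induction with
  | mem x hx => obtain ⟨⟨m, i⟩, rfl⟩ := hx; exact gen m i
  | zero => exact zero
  | add x y _ _ hx hy => exact add x y hx hy
  | smul c x _ hx => exact smul c x hx

theorem rwBracket_mem_RESpace [CharZero F] {a b : RWSpace F 4 4} (ha : a ∈ RESpace F)
    (hb : b ∈ RESpace F) (m : Mon 4 4) : (RW F 4 4).bracket a b m ∈ RESpace F := by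
  refine RESpace_induction (C := fun a => (RW F 4 4).bracket a b m ∈ RESpace F)
    (fun n i => ?_) ?_ ?_ ?_ ha
  · refine RESpace_induction (C := fun b => (RW F 4 4).bracket (monOp (rwD F) n (reAlpha F i)) b m ∈
      RESpace F) (fun l j => ?_) ?_ ?_ ?_ hb
    · exact rwBracket_mem_of_reMem (monOp_rwD_par n (reAlpha_par i))
        (monOp_rwD_par l (reAlpha_par j)) (monOp_alpha_mem n i) (monOp_alpha_mem l j) m
    · rw [map_zero]; exact zero_mem _
    · intro a b ha hb
      rw [map_add]; exact add_mem ha hb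
    · intro c a ha
      rw [map_smul]; exact Submodule.smul_mem _ _ ha
  · rw [map_zero]; exact zero_mem _
  · intro a b ha hb
    rw [map_add]; exact add_mem ha hb
  · intro c a ha
    rw [map_smul]; exact Submodule.smul_mem _ _ ha

theorem rwD_mem_RESpace (i : Var 4 4) {a : RWSpace F 4 4} (ha : a ∈ RESpace F) :
    rwD F i a ∈ RESpace F := by
  refine RESpace_induction (C := fun a => rwD F i a ∈ RESpace F) (fun n j => ?_) ?_ ?_ ?_ ha
  · have h := congrArg (fun Z : Module.End F (RWSpace F 4 4) => Z (reAlpha F j))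
      ((superCommuting_rwD (F := F) (r := 4) (s := 4)).monOp_varMul i n)
    simp only [Module.End.mul_apply, LinearMap.smul_apply] at h
    rw [h]
    exact zsmul_mem (Submodule.subset_span (Set.mem_range_self (varMul i n, j))) _
  · rw [map_zero]; exact zero_mem _
  · intro a b ha hb
    rw [map_add]; exact add_mem ha hb
  · intro c a ha
    rw [map_smul]; exact Submodule.smul_mem _ _ ha

end Members

/-! ## Substructures of Lie conformal superalgebras -/

section PolyMap

variable {F : Type*} [Field F] {r s : ℕ} {V W : Type*} [AddCommGroup V] [Module F V]
  [AddCommGroup W] [Module F W]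

theorem monOp_intertwine (L : V →ₗ[F] W) {A : Var r s → Module.End F V}
    {B : Var r s → Module.End F W} (h : ∀ i v, L (A i v) = B i (L v)) (m : Mon r s) (v : V) :
    L (monOp A m v) = monOp B m (L v) := by
  have key : ∀ {ι : Type} (l : List ι) (f : ι → Module.End F V) (g : ι → Module.End F W),
      (∀ x v, L (f x v) = g x (L v)) → ∀ v, L ((l.map f).prod v) = (l.map g).prod (L v) := by
    intro ι l f g hfg
    induction l with
    | nil => intro v; rfl
    | cons x l ih =>
      intro v
      rw [List.map_cons, List.prod_cons, List.map_cons, List.prod_cons, Module.End.mul_apply,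
        Module.End.mul_apply, hfg, ih]
  rw [monOp, monOp, Module.End.mul_apply, Module.End.mul_apply, key _ _ _ (fun i v => ?_),
    key _ _ _ (fun j v => ?_)]
  · split_ifs
    · exact h _ v
    · rfl
  · generalize m.1 i = n
    induction n generalizing v with
    | zero => rfl
    | succ n ih => rw [pow_succ, pow_succ, Module.End.mul_apply, Module.End.mul_apply, ih, h]

/-- The map `F[x] ⊗ V → F[x] ⊗ W` induced by `V → W`. -/
def polyMap (r s : ℕ) (φ : V →ₗ[F] W) : Poly r s V →ₗ[F] Poly r s W := Finsupp.mapRange.linearMap φ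

theorem polyMap_single (φ : V →ₗ[F] W) (m : Mon r s) (v : V) :
    polyMap r s φ (Finsupp.single m v) = Finsupp.single m (φ v) := by
  simp [polyMap]

theorem polyMap_apply (φ : V →ₗ[F] W) (P : Poly r s V) (m : Mon r s) :
    polyMap r s φ P m = φ (P m) := rfl

theorem polyMap_injective {φ : V →ₗ[F] W} (h : Function.Injective φ) :
    Function.Injective (polyMap r s φ) :=
  Finsupp.mapRange_injective φ (map_zero φ) h

theorem polyMap_mulVar (φ : V →ₗ[F] W) (i : Var r s) (P : Poly r s V) :
    polyMap r s φ (mulVar F r s V i P) = mulVar F r s W i (polyMap r s φ P) := by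
  induction P using Finsupp.induction_linear with
  | zero => simp
  | add P Q hP hQ => simp only [map_add, hP, hQ]
  | single m v =>
    rw [mulVar_single, polyMap_single, mulVar_single, map_zsmul, polyMap_single]

theorem polyMap_coeffAct (φ : V →ₗ[F] W) (p : ZMod 2) {A : Module.End F V} {B : Module.End F W}
    (h : ∀ v, φ (A v) = B (φ v)) (P : Poly r s V) :
    polyMap r s φ (coeffAct F r s V p A P) = coeffAct F r s W p B (polyMap r s φ P) := by
  induction P using Finsupp.induction_linear with
  | zero => simp
  | add P Q hP hQ => simp only [map_add, hP, hQ]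
  | single m v =>
    rw [coeffAct_single', polyMap_single, coeffAct_single', map_zsmul, polyMap_single, h]

end PolyMap

/-! ### Embeddings of conformal data -/

section Inherit

variable {F : Type*} [Field F] {r s : ℕ} {R N : Type*} [AddCommGroup R] [Module F R]
  [AddCommGroup N] [Module F N]

/-- An injective morphism of conformal data. -/
structure ConformalData.IsEmbedding (S : ConformalData F r s N) (T : ConformalData F r s R)
    (φ : N →ₗ[F] R) : Prop where
  injective : Function.Injective φ
  par : ∀ p a, a ∈ S.par p ↔ φ a ∈ T.par p
  D : ∀ i a, φ (S.D i a) = T.D i (φ a)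
  bracket : ∀ a b, polyMap r s φ (S.bracket a b) = T.bracket (φ a) (φ b)

variable {S : ConformalData F r s N} {T : ConformalData F r s R} {φ : N →ₗ[F] R}

namespace ConformalData.IsEmbedding

theorem DPoly (h : S.IsEmbedding T φ) (i : Var r s) (P : Poly r s N) :
    polyMap r s φ (S.DPoly i P) = T.DPoly i (polyMap r s φ P) :=
  polyMap_coeffAct φ _ (h.D i) P

theorem substNeg (h : S.IsEmbedding T φ) (P : Poly r s N) :
    polyMap r s φ (S.substNeg P) = T.substNeg (polyMap r s φ P) := by
  induction P using Finsupp.induction_linear with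
  | zero => simp
  | add P Q hP hQ => simp only [map_add, hP, hQ]
  | single m v =>
    rw [substNeg_single, polyMap_single, substNeg_single, ← polyMap_single φ monOne v]
    refine monOp_intertwine (polyMap r s φ) (fun i P => ?_) m _
    rw [LinearMap.neg_apply, LinearMap.neg_apply, map_neg, LinearMap.add_apply,
      LinearMap.add_apply, map_add, polyMap_mulVar, h.DPoly]

theorem lam (i : Var r s) (P : Poly r s (PolyG r s N)) :
    polyMap r s (polyMap r s φ) (ConformalData.lam F r s N i P) =
      ConformalData.lam F r s R i (polyMap r s (polyMap r s φ) P) :=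
  polyMap_mulVar _ i P

theorem mu (i : Var r s) (P : Poly r s (PolyG r s N)) :
    polyMap r s (polyMap r s φ) (ConformalData.mu F r s N i P) =
      ConformalData.mu F r s R i (polyMap r s (polyMap r s φ) P) :=
  polyMap_coeffAct _ _ (polyMap_mulVar φ i) P

theorem jacL (h : S.IsEmbedding T φ) (p : ZMod 2) (a : N) (P : Poly r s N) :
    polyMap r s (polyMap r s φ) (S.jacL p a P) = T.jacL p (φ a) (polyMap r s φ P) := by
  induction P using Finsupp.induction_linear with
  | zero => simp
  | add P Q hP hQ => simp only [map_add, hP, hQ]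
  | single m v =>
    rw [ConformalData.jacL_single, polyMap_single, ConformalData.jacL_single, map_zsmul,
      monOp_intertwine _ mu, ← h.bracket]
    congr 2
    generalize S.bracket a v = Q
    induction Q using Finsupp.induction_linear with
    | zero => simp
    | add P Q hP hQ => simp only [map_add, hP, hQ]
    | single n w =>
      rw [ConformalData.inclLam_single, polyMap_single, polyMap_single, polyMap_single,
        ConformalData.inclLam_single]

theorem jacM (h : S.IsEmbedding T φ) (c : N) (P : Poly r s N) :
    polyMap r s (polyMap r s φ) (S.jacM c P) = T.jacM (φ c) (polyMap r s φ P) := by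
  induction P using Finsupp.induction_linear with
  | zero => simp
  | add P Q hP hQ => simp only [map_add, hP, hQ]
  | single m v =>
    rw [ConformalData.jacM_single, polyMap_single, ConformalData.jacM_single,
      monOp_intertwine _ lam, ← h.bracket]
    congr 1
    generalize S.bracket v c = Q
    induction Q using Finsupp.induction_linear with
    | zero => simp
    | add P Q hP hQ => simp only [map_add, hP, hQ]
    | single n w =>
      rw [ConformalData.substAdd_single, polyMap_single, ConformalData.substAdd_single,
        ← polyMap_single φ, ← polyMap_single (polyMap r s φ)]
      refine monOp_intertwine _ (fun i P => ?_) n _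
      rw [LinearMap.add_apply, LinearMap.add_apply, map_add, lam, mu]

theorem jacR (h : S.IsEmbedding T φ) (q : ZMod 2) (b : N) (P : Poly r s N) :
    polyMap r s (polyMap r s φ) (S.jacR q b P) = T.jacR q (φ b) (polyMap r s φ P) := by
  induction P using Finsupp.induction_linear with
  | zero => simp
  | add P Q hP hQ => simp only [map_add, hP, hQ]
  | single m v =>
    rw [ConformalData.jacR_single, polyMap_single, ConformalData.jacR_single, map_zsmul,
      polyMap_single, h.bracket]

end ConformalData.IsEmbedding

/-- A graded subspace closed under the operations of a Lie conformal superalgebra is a Lie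
conformal superalgebra. -/
def LieConformalSuperalgebra.ofEmbedding (T : LieConformalSuperalgebra F r s R)
    (S : ConformalData F r s N) {φ : N →ₗ[F] R} (h : S.IsEmbedding T.toConformalData φ)
    (hS : S.par 0 ⊔ S.par 1 = ⊤) : LieConformalSuperalgebra F r s N where
  toConformalData := S
  par_isCompl := by
    refine ⟨Submodule.disjoint_def.mpr fun a h0 h1 => ?_, codisjoint_iff.mpr hS⟩
    rw [h.par] at h0 h1
    apply h.injective
    rw [map_zero]
    exact Submodule.disjoint_def.mp T.par_isCompl.disjoint _ h0 h1
  D_comm i j a := h.injective (by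
    rw [h.D, h.D, map_zsmul, h.D, h.D, T.D_comm])
  D_odd_sq j a := h.injective (by rw [h.D, h.D, T.D_odd_sq, map_zero])
  D_par i p a ha := by
    rw [h.par] at ha ⊢
    rw [h.D]
    exact T.D_par i p _ ha
  bracket_par p q a ha b hb m := by
    rw [h.par] at ha hb ⊢
    rw [← polyMap_apply, h.bracket]
    exact T.bracket_par p q _ ha _ hb m
  bracket_D_left i a b := polyMap_injective h.injective (by
    rw [h.bracket, h.D, T.bracket_D_left, map_neg, polyMap_mulVar, h.bracket])
  bracket_D_right i p a ha b := polyMap_injective h.injective (by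
    rw [h.par] at ha
    rw [h.bracket, h.D, T.bracket_D_right i p _ ha, map_zsmul, map_add, polyMap_mulVar, h.DPoly,
      h.bracket])
  skew p q a ha b hb := polyMap_injective h.injective (by
    rw [h.par] at ha hb
    rw [h.bracket, T.skew p q _ ha _ hb, map_neg, map_zsmul, h.substNeg, h.bracket])
  jacobi p q a ha b hb c := polyMap_injective (polyMap_injective h.injective) (by
    rw [h.par] at ha hb
    have e := T.jacobi p q _ ha _ hb (φ c)
    rw [ConformalData.jacLeft_eq, ConformalData.jacMid_eq, ConformalData.jacRight_eq] at e ⊢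
    rw [map_add, map_zsmul, h.jacL, h.jacM, h.jacR, h.bracket, h.bracket, h.bracket]
    exact e)

end Inherit

/-! ### RE(4,4) as a Lie conformal superalgebra -/

section RE

variable (F : Type*) [Field F]

/-- Composing with a linear projection restricts the bracket to RE(4,4) and keeps it bilinear. The
choice is immaterial because the coefficients already lie in RE(4,4). -/
theorem exists_projection {V : Type*} [AddCommGroup V] [Module F V] (N : Submodule F V) :
    ∃ g : V →ₗ[F] N, ∀ a ∈ N, (g a : V) = a := by
  obtain ⟨g, hg⟩ := LinearMap.exists_leftInverse_of_injective N.subtype N.ker_subtype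
  exact ⟨g, fun a ha => congrArg Subtype.val (LinearMap.congr_fun hg ⟨a, ha⟩)⟩

/-- A projection of `RW(4, 4)` onto `RE(4, 4)`. -/
def reProj (F : Type*) [Field F] : RWSpace F 4 4 →ₗ[F] RESpace F :=
  (exists_projection F (RESpace F)).choose

theorem reProj_of_mem (F : Type*) [Field F] {a : RWSpace F 4 4} (ha : a ∈ RESpace F) :
    (reProj F a : RWSpace F 4 4) = a :=
  (exists_projection F (RESpace F)).choose_spec a ha

theorem RESpace_le_parts : RESpace F ≤
    (RESpace F ⊓ rwPar F 4 4 0) ⊔ (RESpace F ⊓ rwPar F 4 4 1) := by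
  refine Submodule.span_le.mpr ?_
  rintro _ ⟨⟨m, i⟩, rfl⟩
  have h := monOp_rwD_par m (reAlpha_par (F := F) i)
  have h' : monOp (rwD F) m (reAlpha F i) ∈ RESpace F := Submodule.subset_span ⟨(m, i), rfl⟩
  rcases zmod2_cases (monParity m + varParity i) with e | e <;> rw [e] at h
  · exact Submodule.mem_sup_left ⟨h', h⟩
  · exact Submodule.mem_sup_right ⟨h', h⟩


/-- The conformal data of `RE(4, 4)`. -/
def reData : ConformalData F 4 4 (RESpace F) where
  par p := (rwPar F 4 4 p).comap (RESpace F).subtype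
  D i := (rwD F i).restrict fun _ ha => rwD_mem_RESpace i ha
  bracket := LinearMap.mk₂ F (fun a b => polyMap 4 4 (reProj F) ((RW F 4 4).bracket a b))
    (fun a a' b => by simp) (fun c a b => by simp) (fun a b b' => by simp) (fun c a b => by simp)

theorem reData_isEmbedding [CharZero F] :
    (reData F).IsEmbedding (rwLie F 4 4).toConformalData (RESpace F).subtype where
  injective := Subtype.val_injective
  par p a := Iff.rfl
  D i a := by rfl
  bracket a b := by
    refine Finsupp.ext fun m => ?_
    exact reProj_of_mem F (rwBracket_mem_RESpace a.2 b.2 m)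

theorem reData_par_sup : (reData F).par 0 ⊔ (reData F).par 1 = ⊤ := by
  rw [eq_top_iff]
  rintro ⟨a, ha⟩ -
  obtain ⟨b, hb, c, hc, rfl⟩ := Submodule.mem_sup.mp (RESpace_le_parts F ha)
  have hb' : (⟨b, hb.1⟩ : RESpace F) ∈ (reData F).par 0 := hb.2
  have hc' : (⟨c, hc.1⟩ : RESpace F) ∈ (reData F).par 1 := hc.2
  exact Submodule.mem_sup.mpr ⟨_, hb', _, hc', rfl⟩

/-- `RE(4, 4)`. -/
def reLie [CharZero F] : LieConformalSuperalgebra F 4 4 (RESpace F) :=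
  (rwLie F 4 4).ofEmbedding (reData F) (reData_isEmbedding F) (reData_par_sup F)

theorem reLie_isInherited [CharZero F] : (reLie F).toConformalData.IsInherited (RW F 4 4) where
  par p a := Iff.rfl
  D i a := by rfl
  bracket a b m := reProj_of_mem F (rwBracket_mem_RESpace a.2 b.2 m)

end RE

/-! ## The annihilation algebra of `RE(4, 4)` -/

section EmbeddingAnn

variable {F : Type*} [Field F] {r s : ℕ} {R N : Type*} [AddCommGroup R] [Module F R]
  [AddCommGroup N] [Module F N] (S : LieConformalSuperalgebra F r s N)
  (T : LieConformalSuperalgebra F r s R) {φ : N →ₗ[F] R}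

namespace LieConformalSuperalgebra

theorem map_twist (h : S.toConformalData.IsEmbedding T.toConformalData φ) (t : ZMod 2) (a : N) :
    φ (S.twist t a) = T.twist t (φ a) := by
  induction a using S.hom_induction with
  | add a b ha hb => simp only [map_add, ha, hb]
  | hom p a ha => rw [S.twist_of_mem t ha, T.twist_of_mem t ((h.par p a).mp ha), map_zsmul]

theorem map_affDy (h : S.toConformalData.IsEmbedding T.toConformalData φ) (i : Var r s)
    (x : N ⊗[F] Series F r s) : φ.rTensor (Series F r s) (S.affDy i x) =
      T.affDy i (φ.rTensor (Series F r s) x) := by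
  induction x using TensorProduct.induction_on with
  | zero => simp
  | add x y hx hy => simp only [map_add, hx, hy]
  | tmul a f =>
    rw [affDy, TensorProduct.map_tmul, LinearMap.rTensor_tmul, LinearMap.rTensor_tmul, affDy,
      TensorProduct.map_tmul, map_twist S T h]

theorem map_affD (h : S.toConformalData.IsEmbedding T.toConformalData φ) (i : Var r s)
    (x : N ⊗[F] Series F r s) : φ.rTensor (Series F r s) (S.affD i x) =
      T.affD i (φ.rTensor (Series F r s) x) := by
  rw [affD, affD, LinearMap.add_apply, LinearMap.add_apply, map_add, map_affDy S T h]
  congr 1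
  induction x using TensorProduct.induction_on with
  | zero => simp
  | add x y hx hy => simp only [map_add, hx, hy]
  | tmul a f =>
    rw [TensorProduct.map_tmul, LinearMap.rTensor_tmul, LinearMap.rTensor_tmul,
      TensorProduct.map_tmul, h.D]

theorem map_evalAt (h : S.toConformalData.IsEmbedding T.toConformalData φ) (f g : Series F r s)
    (P : Poly r s N) : φ.rTensor (Series F r s) (S.evalAt f g P) =
      T.evalAt f g (polyMap r s φ P) := by
  induction P using Finsupp.induction_linear with
  | zero => simp
  | add P Q hP hQ => simp only [map_add, hP, hQ]
  | single m v =>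
    rw [evalAt_single, polyMap_single, evalAt_single, LinearMap.rTensor_tmul, map_twist S T h]

theorem map_affBracket (h : S.toConformalData.IsEmbedding T.toConformalData φ)
    (x y : N ⊗[F] Series F r s) : φ.rTensor (Series F r s) (S.affBracket x y) =
      T.affBracket (φ.rTensor (Series F r s) x) (φ.rTensor (Series F r s) y) := by
  induction x using TensorProduct.induction_on with
  | zero => simp
  | add x x' hx hx' => simp only [map_add, LinearMap.add_apply, hx, hx']
  | tmul a f =>
    induction y using TensorProduct.induction_on with
    | zero => simp
    | add x x' hx hx' => simp only [map_add, hx, hx']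
    | tmul b g =>
      induction b using S.hom_induction with
      | add b b' hb hb' => simp only [TensorProduct.add_tmul, map_add, hb, hb']
      | hom p b hb =>
        have key : ∀ q, ∀ f ∈ serPar F r s q,
            φ.rTensor (Series F r s) (S.affBracket (a ⊗ₜ f) (b ⊗ₜ g)) =
              T.affBracket (φ a ⊗ₜ f) (φ b ⊗ₜ g) := by
          intro q f hf
          rw [S.affBracket_tmul_homog a b hf g hb,
            T.affBracket_tmul_homog _ _ hf g ((h.par p b).mp hb), map_zsmul, map_evalAt S T h,
            h.bracket]
        rw [LinearMap.rTensor_tmul, LinearMap.rTensor_tmul, series_parts f]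
        simp only [TensorProduct.tmul_add, map_add, LinearMap.add_apply,
          key _ _ (seriesPart_mem _ f)]

theorem map_affRel (h : S.toConformalData.IsEmbedding T.toConformalData φ)
    {x : N ⊗[F] Series F r s} (hx : x ∈ S.affRel) : φ.rTensor (Series F r s) x ∈ T.affRel := by
  have : S.affRel ≤ T.affRel.comap (φ.rTensor (Series F r s)) := by
    refine iSup_le fun i => ?_
    rintro _ ⟨y, rfl⟩
    rw [Submodule.mem_comap, map_affD S T h]
    exact (le_iSup (fun i => LinearMap.range (T.affD i)) i) ⟨_, rfl⟩
  exact this hx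

end LieConformalSuperalgebra

end EmbeddingAnn

/-! ### Moving derivatives inside the annihilation algebra -/

section AnnGeneral

variable {F : Type*} [Field F] {r s : ℕ} {R : Type*} [AddCommGroup R] [Module F R]
  {S : LieConformalSuperalgebra F r s R}

theorem ann_induction {C : S.Ann → Prop}
    (tmul : ∀ a f, C (S.annMk (a ⊗ₜ f))) (zero : C 0)
    (add : ∀ x y, C x → C y → C (x + y)) (x : S.Ann) : C x := by
  obtain ⟨x, rfl⟩ := S.affRel.mkQ_surjective x
  change C (S.annMk x)
  induction x using TensorProduct.induction_on with
  | zero => rw [map_zero]; exact zero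
  | add x y hx hy => rw [map_add]; exact add _ _ hx hy
  | tmul a f => exact tmul a f

theorem single_univ_mem (g : MvPowerSeries (Fin 4) F) :
    (Pi.single Finset.univ g : Series F 4 4) ∈ oddGE F 4 4 4 := by
  intro S hS
  rw [Pi.single_eq_of_ne]
  rintro rfl
  simp at hS

theorem single_univ_par (g : MvPowerSeries (Fin 4) F) :
    (Pi.single Finset.univ g : Series F 4 4) ∈ serPar F 4 4 0 := by
  intro S hS
  rw [Pi.single_eq_of_ne]
  rintro rfl
  exact hS (by decide)

theorem annMk_D (i : Var r s) {p : ZMod 2} {a : R} (ha : a ∈ S.par p)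
    (f : Series F r s) : S.annMk (S.D i a ⊗ₜ f) =
      S.annMk (a ⊗ₜ (-(koszul (varParity i) p • seriesD i f))) := by
  rw [← sub_eq_zero, ← map_sub]
  refine S.annMk_eq_zero ?_
  have e : S.D i a ⊗ₜ[F] f - a ⊗ₜ[F] (-(koszul (varParity i) p • seriesD i f)) =
      S.affD i (a ⊗ₜ f) := by
    rw [LieConformalSuperalgebra.affD, LieConformalSuperalgebra.affDy, LinearMap.add_apply,
      TensorProduct.map_tmul, TensorProduct.map_tmul, S.twist_of_mem _ ha,
      TensorProduct.tmul_neg, LieConformalSuperalgebra.tmul_zsmul', LinearMap.id_apply,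
      LieConformalSuperalgebra.zsmul_tmul', sub_neg_eq_add]
  rw [e]
  exact (le_iSup (fun i => LinearMap.range (S.affD i)) i) ⟨_, rfl⟩

/-- Iterates `annMk_D`. The sign is left unspecified because only membership in submodules is
deduced from it. -/
theorem annMk_monOp (m : Mon r s) {p : ZMod 2} {a : R} (ha : a ∈ S.par p)
    (f : Series F r s) : ∃ ε : ℤ, S.annMk (monOp S.D m a ⊗ₜ f) =
      S.annMk (a ⊗ₜ (ε • monOp seriesD m f)) := by
  have hD : SuperCommuting S.D := S.isSesquilinear.D_super
  have hp : ∀ m : Mon r s, monOp S.D m a ∈ S.par (monParity m + p) := by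
    intro m
    induction m using mon_induction with
    | one => rw [monOp_monOne, monParity_monOne, zero_add]; exact ha
    | mul i m hs ih =>
      rw [monOp_varMul' _ hD.comm hD.odd_sq i m hs, monParity_varMul i m hs, add_assoc,
        add_comm (varParity i)]
      exact zsmul_mem (S.D_par i _ _ ih) _
  induction m using mon_induction generalizing f with
  | one => exact ⟨1, by rw [monOp_monOne, monOp_monOne, one_smul]; rfl⟩
  | mul i m hs ih =>
    obtain ⟨ε, he⟩ := ih (seriesD i f)
    obtain ⟨δ, hd⟩ : ∃ δ : ℤ, monOp seriesD m (seriesD i f) =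
        δ • monOp seriesD (varMul i m) f := by
      refine ⟨koszul (varParity i) (monParity m) * varSign i m, ?_⟩
      rw [monOp_varMul' _ seriesD_comm seriesD_odd_sq i m hs, LinearMap.smul_apply,
        Module.End.mul_apply, smul_smul, mul_assoc, varSign_mul_self i m hs, mul_one]
      have := monOp_comm_apply (T := seriesD (F := F) (r := r) (s := s)) (varParity i) (seriesD i)
        (seriesD_comm i) m f
      rw [this]
    refine ⟨varSign i m * (-koszul (varParity i) (monParity m + p)) * (ε * δ), ?_⟩
    rw [monOp_varMul' _ hD.comm hD.odd_sq i m hs, LinearMap.smul_apply, Module.End.mul_apply,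
      LieConformalSuperalgebra.zsmul_tmul', map_zsmul, annMk_D i (hp m), TensorProduct.tmul_neg,
      LieConformalSuperalgebra.tmul_zsmul', map_neg, map_zsmul, he, hd, smul_smul,
      LieConformalSuperalgebra.tmul_zsmul', LieConformalSuperalgebra.tmul_zsmul', map_zsmul,
      map_zsmul]
    simp only [smul_smul, smul_neg, mul_neg, neg_mul, neg_smul, mul_assoc]

end AnnGeneral

/-! ### The vector fields of the annihilation algebra -/

section AnnVF

variable {F : Type*} [Field F] [CharZero F] {R : Type*} [AddCommGroup R] [Module F R]

/-- `φ` identifies `S` with the substructure `RE(4, 4)` of `RW(4, 4)`. -/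
structure IsRE (S : LieConformalSuperalgebra F 4 4 R) (φ : R →ₗ[F] RWSpace F 4 4) : Prop where
  emb : S.toConformalData.IsEmbedding (rwLie F 4 4).toConformalData φ
  range : LinearMap.range φ = RESpace F

namespace IsRE

variable {S : LieConformalSuperalgebra F 4 4 R} {φ : R →ₗ[F] RWSpace F 4 4}

/-- The vector field attached to an element of the annihilation algebra. -/
def annVF (h : IsRE S φ) : S.Ann →ₗ[F] VF F 4 4 :=
  S.affRel.liftQ (toVF.comp (φ.rTensor (Series F 4 4))) fun x hx =>
    toVF_affRel (S.map_affRel (rwLie F 4 4) h.emb hx)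

theorem annVF_mk (h : IsRE S φ) (x : R ⊗[F] Series F 4 4) :
    h.annVF (S.annMk x) = toVF (φ.rTensor (Series F 4 4) x) := rfl

theorem annVF_tmul (h : IsRE S φ) (a : R) (f : Series F 4 4) :
    h.annVF (S.annMk (a ⊗ₜ f)) = toVF (φ a ⊗ₜ f) := rfl

theorem annVF_bracket (h : IsRE S φ) (x y : S.Ann) :
    h.annVF (S.ann.bracket x y) = vfBracket (h.annVF x) (h.annVF y) := by
  obtain ⟨x, rfl⟩ := S.affRel.mkQ_surjective x
  obtain ⟨y, rfl⟩ := S.affRel.mkQ_surjective y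
  change h.annVF (S.annMk (S.affBracket x y)) = vfBracket
    (h.annVF (S.annMk x)) (h.annVF (S.annMk y))
  rw [annVF_mk, annVF_mk, annVF_mk, S.map_affBracket (rwLie F 4 4) h.emb, toVF_affBracket]

theorem annVF_annDy (h : IsRE S φ) (i : Var 4 4) (x : S.Ann) :
    h.annVF (S.annDy i x) = vfD i (h.annVF x) := by
  obtain ⟨x, rfl⟩ := S.affRel.mkQ_surjective x
  change h.annVF (S.annMk (S.affDy i x)) = vfD i (h.annVF (S.annMk x))
  rw [annVF_mk, annVF_mk, S.map_affDy (rwLie F 4 4) h.emb]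
  funext k
  rw [toVF_affDy, vfD_apply]

theorem map_mem (h : IsRE S φ) (a : R) : φ a ∈ RESpace F := by
  rw [← h.range]; exact LinearMap.mem_range_self φ a

theorem annVF_mem_vfE (h : IsRE S φ) (x : S.Ann) : h.annVF x ∈ vfE F := by
  refine ann_induction (C := fun x => h.annVF x ∈ vfE F) (fun a f => ?_) ?_ (fun x y hx hy => ?_) x
  · exact RESpace_le_reMem (h.map_mem a) f
  · rw [map_zero]; exact zero_mem _
  · rw [map_add]; exact add_mem hx hy

theorem exists_gen (h : IsRE S φ) (m : Mon 4 4) (i : Var 4 4) :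
    ∃ a, φ a = monOp (rwD F) m (reAlpha F i) := by
  have : monOp (rwD F) m (reAlpha F i) ∈ LinearMap.range φ := by
    rw [h.range]; exact Submodule.subset_span ⟨(m, i), rfl⟩
  exact this

/-- The generator `α_i`. -/
def gen (h : IsRE S φ) (i : Var 4 4) : R := (h.exists_gen monOne i).choose

theorem map_gen (h : IsRE S φ) (i : Var 4 4) : φ (h.gen i) = reAlpha F i := by
  refine (h.exists_gen monOne i).choose_spec.trans ?_
  rw [monOp_monOne]
  rfl

theorem gen_par (h : IsRE S φ) (i : Var 4 4) : h.gen i ∈ S.par (varParity i) := by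
  rw [h.emb.par, map_gen]; exact reAlpha_par i

/-- The elements `∑ α_k f_k y_5 y_6 y_7 y_8` of the annihilation algebra. -/
def annOf (h : IsRE S φ) : (Var 4 4 → MvPowerSeries (Fin 4) F) →ₗ[F] S.Ann :=
  ∑ k, S.annMk.comp (((TensorProduct.mk F R (Series F 4 4) (h.gen k)).comp
    (LinearMap.single F _ Finset.univ)).comp (LinearMap.proj k))

theorem annOf_apply (h : IsRE S φ) (g : Var 4 4 → MvPowerSeries (Fin 4) F) : h.annOf g =
    ∑ k, S.annMk (h.gen k ⊗ₜ[F] (Pi.single Finset.univ (g k) : Series F 4 4)) := by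
  rw [annOf, LinearMap.sum_apply]
  rfl

/-- By `rwEval_alpha_lead` the system is diagonal at odd variables zero: `α_i` contributes only to
the coefficient of `∂_{y_i}`. -/
theorem annVF_annOf (h : IsRE S φ) (g : Var 4 4 → MvPowerSeries (Fin 4) F) (k : Var 4 4) :
    h.annVF (h.annOf g) k ∅ = -(alphaLead F k • g k) := by
  have key : ∀ i, h.annVF (S.annMk (h.gen i ⊗ₜ[F]
      (Pi.single Finset.univ (g i) : Series F 4 4))) k ∅ =
      if k = i then -(alphaLead F i • g i) else 0 := by
    intro i
    have e := rwEval_alpha_lead k i (single_univ_mem (g i)) ∅ (by simp)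
    -- The four minus signs of `negD` cancel, and so do the `3 + 2 + 1` signs from crossing odd
    -- variables.
    have ht : opTop (negD F) (Pi.single Finset.univ (g i) : Series F 4 4) ∅ = g i := by
      have hu : (insert 3 (insert 2 (insert 1 {0})) : Finset (Fin 4)) = Finset.univ := by decide
      have h1 : oddSign (1 : Fin 4) {0} = -1 := by decide
      have h2 : oddSign (2 : Fin 4) {1, 0} = 1 := by decide
      have h3 : oddSign (3 : Fin 4) {2, 1, 0} = -1 := by decide
      have h0 : oddSign (0 : Fin 4) ∅ = 1 := by decide
      simp [opTop, negD_apply, seriesD_inr, h0, h1, h2, h3, hu]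
    rw [annVF_tmul, map_gen, toVF_tmul, seriesTwist_of_mem _ (single_univ_par (g i)),
      koszul_zero_right, one_smul, Pi.neg_apply]
    rw [Pi.sub_apply, sub_eq_zero] at e
    rw [e]
    split_ifs
    · rw [Pi.smul_apply, ht]
    · simp
  rw [annOf_apply, map_sum, Finset.sum_apply, Finset.sum_apply]
  simp only [key, Finset.sum_ite_eq, Finset.mem_univ, if_true]

theorem map_monOp (h : IsRE S φ) (m : Mon 4 4) (a : R) : φ (monOp S.D m a) = monOp (rwD F) m (φ a) :=
  monOp_intertwine φ h.emb.D m a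

end IsRE

end AnnVF

theorem monOp_even_mem {F : Type*} [Field F] {r s : ℕ} {V : Type*} [AddCommGroup V] [Module F V]
    {T : Var r s → Module.End F V} (hT : SuperCommuting T) (W : Submodule F V)
    (hW : ∀ i, ∀ v ∈ W, T (.inl i) v ∈ W) (e : Fin r →₀ ℕ) {v : V} (hv : v ∈ W) :
    monOp T (e, ∅) v ∈ W := by
  have key : ∀ m : Mon r s, m.2 = ∅ → monOp T m v ∈ W := by
    intro m
    induction m using mon_induction with
    | one => intro _; rwa [monOp_monOne]
    | mul i m h ih =>
      intro hm
      rcases i with i | j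
      · rw [monOp_varMul' _ hT.comm hT.odd_sq _ m h]
        exact zsmul_mem (hW i _ (ih hm)) _
      · exact absurd hm (Finset.insert_ne_empty j m.2)
  exact key _ rfl

/-- Every derivative of an `α_i` acts through `vfE`, so odd derivatives of the `α_i` are
combinations of even ones. -/
theorem RESpace_le_reEven {F : Type*} [Field F] [CharZero F] : RESpace F ≤ reEven F :=
  Submodule.span_le.mpr (by
    rintro _ ⟨⟨m, i⟩, rfl⟩
    exact mem_reEven_of_reMem (monOp_rwD_par m (reAlpha_par i)) (monOp_alpha_mem m i))

/-! ### Coordinates on the annihilation algebra -/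

section Coordinates

variable {F : Type*} [Field F] [CharZero F] {R : Type*} [AddCommGroup R] [Module F R]
  {S : LieConformalSuperalgebra F 4 4 R} {φ : R →ₗ[F] RWSpace F 4 4}

namespace IsRE

theorem even_induction (h : IsRE S φ) {C : R → Prop} (gen : ∀ e i, C (monOp S.D (e, ∅) (h.gen i)))
    (zero : C 0) (add : ∀ a b, C a → C b → C (a + b)) (smul : ∀ (c : F) a, C a → C (c • a))
    (a : R) : C a := by
  have ha : φ a ∈ (Submodule.span F (Set.range fun z : (Fin 4 →₀ ℕ) × Var 4 4 =>
      monOp S.D (z.1, ∅) (h.gen z.2))).map φ := by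
    have := RESpace_le_reEven (h.map_mem a)
    rw [Submodule.map_span, ← Set.range_comp]
    have e : (φ ∘ fun z : (Fin 4 →₀ ℕ) × Var 4 4 => monOp S.D (z.1, ∅) (h.gen z.2)) =
        fun z => monOp (rwD F) (z.1, ∅) (reAlpha F z.2) := by
      funext z
      rw [Function.comp_apply, h.map_monOp, h.map_gen]
    rwa [e]
  obtain ⟨b, hb, hab⟩ := ha
  rw [← h.emb.injective hab]
  clear hab
  induction hb using Submodule.span_induction with
  | mem x hx => obtain ⟨z, rfl⟩ := hx; exact gen z.1 z.2
  | zero => exact zero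
  | add x y _ _ hx hy => exact add _ _ hx hy
  | smul c x _ hx => exact smul _ _ hx

/-- A series is obtained from multiples of the top odd monomial by odd derivatives, which the
relations move onto `a`. Then `a` is a combination of even derivatives of the `α_i`, and these move
back onto the series without destroying its top odd monomial. -/
theorem tmul_mem_range_annOf (h : IsRE S φ) (a : R) (f : Series F 4 4) :
    S.annMk (a ⊗ₜ f) ∈ LinearMap.range h.annOf := by
  -- All `a` are treated at once, since moving a derivative across replaces `a` by `∂_j a`.
  let Z : Submodule F (Series F 4 4) :=
    ⨅ a : R, (LinearMap.range h.annOf).comap (S.annMk.comp (TensorProduct.mk F R _ a))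
  have memZ : ∀ f, f ∈ Z ↔ ∀ a : R, S.annMk (a ⊗ₜ f) ∈ LinearMap.range h.annOf := fun f => by
    simp [Z, Submodule.mem_iInf]
  refine (memZ f).mp (mem_of_seriesD_stable Z (fun j f hf => (memZ _).mpr fun a => ?_)
    (fun g => (memZ _).mpr fun a => ?_) f) a
  · induction a using S.hom_induction with
    | add a b ha hb =>
      rw [TensorProduct.add_tmul, map_add]; exact add_mem ha hb
    | hom p a ha =>
      have e := annMk_D (.inr j) ha f
      rw [TensorProduct.tmul_neg, LieConformalSuperalgebra.tmul_zsmul', map_neg, map_zsmul] at e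
      have e' : S.annMk (a ⊗ₜ seriesD (.inr j) f) =
          koszul (varParity (.inr j : Var 4 4)) p • -S.annMk (S.D (.inr j) a ⊗ₜ f) := by
        rw [e, neg_neg, smul_smul, koszul_mul_self, one_smul]
      rw [e']
      exact zsmul_mem (neg_mem ((memZ f).mp hf _)) _
  · refine h.even_induction (C := fun a => S.annMk (a ⊗ₜ[F] (Pi.single Finset.univ g :
      Series F 4 4)) ∈ LinearMap.range h.annOf) (fun e i => ?_) ?_ (fun a b ha hb => ?_)
      (fun c a ha => ?_) a
    · obtain ⟨ε, he⟩ := annMk_monOp (e, ∅) (h.gen_par i) (Pi.single Finset.univ g : Series F 4 4)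
      have hr : ε • monOp seriesD (e, ∅) (Pi.single Finset.univ g : Series F 4 4) ∈
          LinearMap.range (LinearMap.single F (fun _ : Finset (Fin 4) =>
            MvPowerSeries (Fin 4) F) Finset.univ) := by
        refine zsmul_mem (monOp_even_mem superCommuting_seriesD _ ?_ e
          (LinearMap.mem_range_self _ g)) _
        rintro k _ ⟨g, rfl⟩
        refine ⟨MvPowerSeries.pderiv F k g, funext fun T => ?_⟩
        rw [seriesD_inl, LinearMap.single_apply, LinearMap.single_apply]
        by_cases hT : T = Finset.univ
        · subst hT; rw [Pi.single_eq_same, Pi.single_eq_same]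
        · rw [Pi.single_eq_of_ne hT, Pi.single_eq_of_ne hT, map_zero]
      obtain ⟨g', hg'⟩ := hr
      refine ⟨Pi.single i g', ?_⟩
      rw [he, ← hg', annOf_apply, Finset.sum_eq_single i]
      · rw [Pi.single_eq_same]; rfl
      · intro k _ hk
        rw [Pi.single_eq_of_ne hk, Pi.single_zero, TensorProduct.tmul_zero, map_zero]
      · simp
    · rw [TensorProduct.zero_tmul, map_zero]; exact zero_mem _
    · rw [TensorProduct.add_tmul, map_add]; exact add_mem ha hb
    · rw [← TensorProduct.smul_tmul', map_smul]; exact Submodule.smul_mem _ c ha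

theorem annOf_surjective (h : IsRE S φ) : Function.Surjective h.annOf := fun x =>
  ann_induction (C := fun x => x ∈ LinearMap.range h.annOf) h.tmul_mem_range_annOf (zero_mem _)
    (fun _ _ => add_mem) x

/-- The even parts of the coefficients of the vector field of an element. -/
def coord (h : IsRE S φ) : S.Ann →ₗ[F] Var 4 4 → MvPowerSeries (Fin 4) F :=
  LinearMap.pi fun k => (LinearMap.proj ∅).comp ((LinearMap.proj k).comp h.annVF)

theorem coord_apply (h : IsRE S φ) (x : S.Ann) (k : Var 4 4) : h.coord x k = h.annVF x k ∅ := rfl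

/-- The parametrisation `annOf` is onto, and in the coordinates it is multiplication by the nonzero
scalars `-alphaLead`. -/
theorem coord_bijective (h : IsRE S φ) : Function.Bijective h.coord := by
  constructor
  · refine (injective_iff_map_eq_zero _).mpr fun x hx => ?_
    obtain ⟨g, rfl⟩ := h.annOf_surjective x
    have : g = 0 := by
      funext k
      have := congrFun hx k
      rw [coord_apply, annVF_annOf, Pi.zero_apply, neg_eq_zero, smul_eq_zero] at this
      exact this.resolve_left (alphaLead_ne_zero k)
    rw [this, map_zero]
  · intro g
    refine ⟨h.annOf fun k => -((alphaLead F k)⁻¹ • g k), funext fun k => ?_⟩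
    rw [coord_apply, annVF_annOf, smul_neg, neg_neg, smul_smul,
      mul_inv_cancel₀ (alphaLead_ne_zero k), one_smul]

/-- The coordinates of the annihilation algebra. -/
def coordEquiv (h : IsRE S φ) : S.Ann ≃ₗ[F] (Var 4 4 → MvPowerSeries (Fin 4) F) :=
  LinearEquiv.ofBijective h.coord h.coord_bijective

theorem coordEquiv_apply (h : IsRE S φ) (x : S.Ann) (k : Var 4 4) :
    h.coordEquiv x k = h.annVF x k ∅ := rfl

theorem annVF_symm (h : IsRE S φ) (g : Var 4 4 → MvPowerSeries (Fin 4) F) (k : Var 4 4) :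
    h.annVF (h.coordEquiv.symm g) k ∅ = g k := by
  rw [← coordEquiv_apply, LinearEquiv.apply_symm_apply]

theorem symm_eq_annOf (h : IsRE S φ) (g : Var 4 4 → MvPowerSeries (Fin 4) F) :
    h.coordEquiv.symm g = h.annOf fun k => -((alphaLead F k)⁻¹ • g k) := by
  refine h.coordEquiv.injective (funext fun k => ?_)
  rw [LinearEquiv.apply_symm_apply, coordEquiv_apply, annVF_annOf, smul_neg, neg_neg, smul_smul,
    mul_inv_cancel₀ (alphaLead_ne_zero k), one_smul]

theorem annVF_injective (h : IsRE S φ) : Function.Injective h.annVF := fun x y e =>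
  h.coordEquiv.injective (funext fun k => by rw [coordEquiv_apply, coordEquiv_apply, e])

theorem annVF_par (h : IsRE S φ) {p : ZMod 2} {x : S.Ann} (hx : x ∈ S.ann.par p) :
    h.annVF x ∈ vfPar F 4 4 p := by
  have : S.ann.par p ≤ (vfPar F 4 4 p).comap h.annVF := by
    refine Submodule.span_le.mpr ?_
    rintro _ ⟨q, a, ha, f, rfl⟩
    change h.annVF (S.annMk (a ⊗ₜ seriesPart (p - q) f)) ∈ vfPar F 4 4 p
    rw [annVF_tmul]
    have := toVF_par ((h.emb.par q a).mp ha) (seriesPart_mem (p - q) f)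
    rwa [add_sub_cancel] at this
  exact this hx

/-- The top odd monomial has four factors and is even, so `α_k g y_5 y_6 y_7 y_8` has the parity of
`α_k`. -/
theorem mem_par_of_coord (h : IsRE S φ) {p : ZMod 2} {x : S.Ann}
    (hx : ∀ k, varParity k ≠ p → h.coordEquiv x k = 0) : x ∈ S.ann.par p := by
  rw [← h.coordEquiv.symm_apply_apply x, symm_eq_annOf, annOf_apply]
  refine sum_mem fun k _ => ?_
  by_cases hk : varParity k = p
  · refine Submodule.subset_span ⟨p, h.gen k, hk ▸ h.gen_par k,
      Pi.single Finset.univ (-((alphaLead F k)⁻¹ • h.coordEquiv x k)), ?_⟩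
    rw [sub_self, seriesPart_of_mem (single_univ_par _)]
  · rw [hx k hk, smul_zero, neg_zero, Pi.single_zero, TensorProduct.tmul_zero, map_zero]
    exact zero_mem _

theorem mem_par_iff (h : IsRE S φ) {p : ZMod 2} {x : S.Ann} :
    x ∈ S.ann.par p ↔ ∀ k, varParity k ≠ p → h.coordEquiv x k = 0 := by
  refine ⟨fun hx k hk => ?_, h.mem_par_of_coord⟩
  refine h.annVF_par hx k ∅ ?_
  rw [Finset.card_empty, Nat.cast_zero]
  intro e
  apply hk
  rcases zmod2_cases p with rfl | rfl <;> rcases zmod2_cases (varParity k) with e' | e' <;>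
    rw [e'] at e ⊢ <;> revert e <;> decide

theorem mem_par_of_annVF (h : IsRE S φ) {p : ZMod 2} {x : S.Ann}
    (hx : h.annVF x ∈ vfPar F 4 4 p) : x ∈ S.ann.par p := by
  refine h.mem_par_of_coord fun k hk => hx k ∅ ?_
  rw [Finset.card_empty, Nat.cast_zero]
  intro e
  apply hk
  rcases zmod2_cases p with rfl | rfl <;> rcases zmod2_cases (varParity k) with e' | e' <;>
    rw [e'] at e ⊢ <;> revert e <;> decide

/-- Skew-symmetry and Jacobi are pulled back from vector fields along the injective map `annVF`,
which also detects parity. -/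
theorem ann_isLieSuperalgebra (h : IsRE S φ) : S.ann.IsLieSuperalgebra where
  par_isCompl := by
    refine IsCompl.of_eq ?_ ?_
    · refine (Submodule.eq_bot_iff _).mpr fun x hx => ?_
      refine h.coordEquiv.injective (funext fun k => ?_)
      rw [map_zero, Pi.zero_apply]
      by_cases hk : varParity k = 0
      · exact h.mem_par_iff.mp hx.2 k (by rw [hk]; decide)
      · exact h.mem_par_iff.mp hx.1 k hk
    · refine (Submodule.eq_top_iff').mpr fun x => ?_
      let g (p : ZMod 2) : Var 4 4 → MvPowerSeries (Fin 4) F := fun k =>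
        if varParity k = p then h.coordEquiv x k else 0
      have hg : ∀ p, h.coordEquiv.symm (g p) ∈ S.ann.par p := fun p =>
        h.mem_par_of_coord fun k hk => by
          rw [LinearEquiv.apply_symm_apply]; exact if_neg hk
      refine Submodule.mem_sup.mpr ⟨_, hg 0, _, hg 1, ?_⟩
      rw [← map_add, LinearEquiv.symm_apply_eq]
      funext k
      rw [Pi.add_apply]
      rcases zmod2_cases (varParity k) with e | e <;> simp [g, e]
  bracket_par p q x hx y hy := h.mem_par_of_annVF (by
    rw [annVF_bracket]; exact vfBracket_par (h.annVF_par hx) (h.annVF_par hy))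
  skew p q x hx y hy := h.annVF_injective (by
    rw [map_neg, map_zsmul, annVF_bracket, annVF_bracket,
      vfBracket_skew (h.annVF_par hx) (h.annVF_par hy)])
  jacobi p q x hx y hy z := h.annVF_injective (by
    rw [map_add, map_zsmul]
    simp only [annVF_bracket]
    exact vfBracket_jacobi (h.annVF_par hx) (h.annVF_par hy) _)

theorem ad_mem_der (h : IsRE S φ) (x : S.Ann) : S.ann.bracket x ∈ S.ann.der := by
  have hL := h.ann_isLieSuperalgebra
  have hx : x ∈ S.ann.par 0 ⊔ S.ann.par 1 := by
    rw [hL.par_isCompl.sup_eq_top]; exact Submodule.mem_top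
  obtain ⟨y, hy, z, hz, rfl⟩ := Submodule.mem_sup.mp hx
  have key : ∀ p, ∀ x ∈ S.ann.par p, S.ann.bracket x ∈ S.ann.derPar p := fun p x hx =>
    ⟨fun q y hy => hL.bracket_par p q x hx y hy, fun q y hy z => hL.jacobi p q x hx y hy z⟩
  rw [map_add]
  exact Submodule.add_mem_sup (key 0 y hy) (key 1 z hz)

end IsRE

end Coordinates

/-! ## Supports -/

section Supports

variable {F : Type*} [Field F] {r s : ℕ}

/-- The power series all of whose monomials have length in `A`. -/
def suppIn (F : Type*) [Field F] (r s : ℕ) (A : Set ℕ) : Submodule F (Series F r s) where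
  carrier := {f | ∀ m : Mon r s, monLength m ∉ A → MvPowerSeries.coeff m.1 (f m.2) = 0}
  zero_mem' := fun _ _ => by simp
  add_mem' := fun {f g} hf hg m h => by simp [hf m h, hg m h]
  smul_mem' := fun c f hf m h => by simp [hf m h]

theorem suppIn_mono {A B : Set ℕ} (h : A ⊆ B) : suppIn F r s A ≤ suppIn F r s B :=
  fun _ hf m hm => hf m fun hA => hm (h hA)

theorem seriesOrderGE_iff {n : ℕ} {f : Series F r s} :
    seriesOrderGE n f ↔ f ∈ suppIn F r s (Set.Ici n) :=
  ⟨fun h m hm => h m (not_le.mp hm), fun h m hm => h m (not_le.mpr hm)⟩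

theorem seriesMon_suppIn {A : Set ℕ} {m : Mon r s} (hm : monLength m ∈ A) :
    seriesMon F m ∈ suppIn F r s A := by
  intro n hn
  rw [coeff_seriesMon, if_neg]
  rintro rfl
  exact hn hm

theorem seriesD_suppIn {A : Set ℕ} (i : Var r s) {f : Series F r s} (hf : f ∈ suppIn F r s A) :
    seriesD i f ∈ suppIn F r s {l | l + 1 ∈ A} := by
  intro m hm
  obtain ⟨c, h, hc⟩ := coeff_seriesD i m f
  rw [h]
  by_cases hs : varSign i m = 0
  · rw [hc hs, zero_mul]
  · rw [hf _ (by rw [monLength_varMul i m hs]; exact hm), mul_zero]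

theorem monOp_suppIn {A : Set ℕ} (m : Mon r s) {f : Series F r s} (hf : f ∈ suppIn F r s A) :
    monOp seriesD m f ∈ suppIn F r s {l | l + monLength m ∈ A} := by
  induction m using mon_induction with
  | one => rw [monOp_monOne]; exact hf
  | mul i m h ih =>
    rw [monOp_varMul' _ seriesD_comm seriesD_odd_sq i m h, monLength_varMul i m h]
    refine zsmul_mem (suppIn_mono ?_ (seriesD_suppIn i ih)) _
    intro l hl
    change l + 1 + monLength m ∈ A at hl
    change l + (monLength m + 1) ∈ A
    rwa [add_comm (monLength m), ← add_assoc]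

theorem seriesPart_suppIn {A : Set ℕ} (p : ZMod 2) {f : Series F r s}
    (hf : f ∈ suppIn F r s A) : seriesPart p f ∈ suppIn F r s A := by
  intro m hm
  rw [seriesPart_apply]
  split_ifs
  · exact hf m hm
  · exact map_zero _

theorem seriesTwist_suppIn {A : Set ℕ} (t : ZMod 2) {f : Series F r s}
    (hf : f ∈ suppIn F r s A) : seriesTwist t f ∈ suppIn F r s A := by
  rw [seriesTwist_parts]
  exact add_mem (seriesPart_suppIn 0 hf) (zsmul_mem (seriesPart_suppIn 1 hf) _)

theorem serMul_suppIn {A B : Set ℕ} {f g : Series F r s} (hf : f ∈ suppIn F r s A)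
    (hg : g ∈ suppIn F r s B) :
    serMul f g ∈ suppIn F r s {l | ∃ a ∈ A, ∃ b ∈ B, l = a + b} := by
  classical
  rintro ⟨e, U⟩ hm
  rw [serMul_apply, seriesMul, map_sum]
  refine Finset.sum_eq_zero fun T hT => ?_
  rw [map_zsmul, MvPowerSeries.coeff_mul, Finset.sum_eq_zero, smul_zero]
  rintro ⟨a, b⟩ hab
  replace hab : a + b = e := Finset.HasAntidiagonal.mem_antidiagonal.mp hab
  rw [Finset.mem_powerset] at hT
  by_contra hne
  refine hm ⟨monLength (a, T), ?_, monLength (b, U \ T), ?_, ?_⟩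
  · by_contra h; exact hne (by rw [hf (a, T) h, zero_mul])
  · by_contra h; exact hne (by rw [hg (b, U \ T) h, mul_zero])
  · have := Finset.card_sdiff_add_card_eq_card hT
    have hd : e.degree = a.degree + b.degree := by rw [← hab, map_add]
    change e.degree + U.card = a.degree + T.card + (b.degree + (U \ T).card)
    change (U \ T).card + T.card = U.card at this
    omega

theorem rwEval_suppIn {A C : Set ℕ} (k : Var r s) {Q : RWSpace F r s}
    (hQ : ∀ m, Q m ≠ 0 → monLength m ∈ C) {f : Series F r s} (hf : f ∈ suppIn F r s A) :
    rwEval F k Q f ∈ suppIn F r s {l | ∃ c ∈ C, l + c ∈ A} := by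
  rw [rwEval_apply]
  refine sum_mem fun m hm => Submodule.smul_mem _ _ ?_
  obtain ⟨ε, -, h⟩ := monOp_negD (F := F) m
  rw [h]
  refine zsmul_mem (suppIn_mono ?_ (monOp_suppIn m hf)) _
  exact fun l hl => ⟨_, hQ m (Finsupp.mem_support_iff.mp hm), hl⟩

theorem toVF_suppIn {A C : Set ℕ} {Q : RWSpace F r s}
    (hQ : ∀ m, Q m ≠ 0 → monLength m ∈ C) {f : Series F r s} (hf : f ∈ suppIn F r s A)
    (k : Var r s) : toVF (Q ⊗ₜ[F] f) k ∈ suppIn F r s {l | ∃ c ∈ C, l + c ∈ A} := by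
  rw [toVF_tmul]
  exact neg_mem (rwEval_suppIn k hQ (seriesTwist_suppIn _ hf))

theorem lieDer_suppIn {A B : Set ℕ} {v : VF F r s} (hv : ∀ k, v k ∈ suppIn F r s A)
    {f : Series F r s} (hf : f ∈ suppIn F r s B) :
    lieDer v f ∈ suppIn F r s {l | ∃ a ∈ A, ∃ b ∈ B, l + 1 = a + b} := by
  rw [lieDer_apply]
  refine sum_mem fun k _ => suppIn_mono ?_ (serMul_suppIn (hv k) (seriesD_suppIn k hf))
  rintro l ⟨a, ha, b, hb, rfl⟩
  exact ⟨a, ha, b + 1, hb, add_assoc _ _ _⟩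

/-- Every term of the bracket contains exactly one differentiation, which accounts for the `1`. -/
theorem vfBracket_suppIn {A B : Set ℕ} {v w : VF F r s} (hv : ∀ k, v k ∈ suppIn F r s A)
    (hw : ∀ k, w k ∈ suppIn F r s B) (k : Var r s) :
    vfBracket v w k ∈ suppIn F r s {l | ∃ a ∈ A, ∃ b ∈ B, l + 1 = a + b} := by
  have e : vfBracket v w k = lieDer v (w k) -
      ∑ p : ZMod 2, ∑ q : ZMod 2, koszul p q • lieDer (vfPart q w) (vfPart p v k) := rfl
  rw [e]
  refine sub_mem (lieDer_suppIn hv (hw k)) (sum_mem fun p _ => sum_mem fun q _ => zsmul_mem ?_ _)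
  refine suppIn_mono ?_ (lieDer_suppIn (A := B) (B := A) (fun k => seriesPart_suppIn _ (hw k))
    (seriesPart_suppIn _ (hv k)))
  rintro l ⟨b, hb, a, ha, h⟩
  exact ⟨a, ha, b, hb, h.trans (add_comm _ _)⟩

end Supports

/-! ## Gradings of polynomials -/

section PolyGrading

variable {F : Type*} [Field F] {r s : ℕ} {V : Type*} [AddCommGroup V] [Module F V]

/-- The grading of `F[x] ⊗ V` with `deg x_i = -2`. -/
def polyGrading (r s : ℕ) (G : ℤ → Submodule F V) (d : ℤ) : Submodule F (PolyG r s V) where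
  carrier := {P | ∀ m, P m ∈ G (d + 2 * (monLength m : ℤ))}
  zero_mem' := fun _ => zero_mem _
  add_mem' := fun hP hQ m => add_mem (hP m) (hQ m)
  smul_mem' := fun c _ hP m => Submodule.smul_mem _ c (hP m)

variable {G : ℤ → Submodule F V}

theorem single_mem_polyGrading {d : ℤ} {m : Mon r s} {v : V}
    (hv : v ∈ G (d + 2 * (monLength m : ℤ))) :
    (Finsupp.single m v : PolyG r s V) ∈ polyGrading r s G d := by
  classical
  intro n
  rw [Finsupp.single_apply]
  split_ifs with h
  · rwa [← h]
  · exact zero_mem _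

theorem mulVar_polyGrading (i : Var r s) {d : ℤ} {P : PolyG r s V}
    (hP : P ∈ polyGrading r s G d) : mulVar F r s V i P ∈ polyGrading r s G (d - 2) := by
  have e : P = ∑ m ∈ P.support, Finsupp.single m (P m) := (Finsupp.sum_single P).symm
  rw [e, map_sum]
  refine sum_mem fun m _ => ?_
  rw [mulVar_single]
  by_cases h : varSign i m = 0
  · rw [h, zero_smul]; exact zero_mem _
  · refine zsmul_mem (single_mem_polyGrading ?_) _
    rw [monLength_varMul i m h]
    have := hP m
    rwa [show d - 2 + 2 * ((monLength m + 1 : ℕ) : ℤ) = d + 2 * (monLength m : ℤ) by push_cast; ring]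

theorem coeffAct_polyGrading (p : ZMod 2) {T : Module.End F V} {t : ℤ}
    (hT : ∀ d, ∀ v ∈ G d, T v ∈ G (d + t)) {d : ℤ} {P : PolyG r s V}
    (hP : P ∈ polyGrading r s G d) : coeffAct F r s V p T P ∈ polyGrading r s G (d + t) := by
  have e : P = ∑ m ∈ P.support, Finsupp.single m (P m) := (Finsupp.sum_single P).symm
  rw [e, map_sum]
  refine sum_mem fun m _ => ?_
  rw [coeffAct_single']
  refine zsmul_mem (single_mem_polyGrading ?_) _
  rw [add_right_comm]
  exact hT _ _ (hP m)

theorem monOp_lower (W : ℤ → Submodule F V) {T : Var r s → Module.End F V} (hT : SuperCommuting T)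
    (h : ∀ i d, ∀ v ∈ W d, T i v ∈ W (d - 2)) (m : Mon r s) {d : ℤ} {v : V} (hv : v ∈ W d) :
    monOp T m v ∈ W (d - 2 * (monLength m : ℤ)) := by
  induction m using mon_induction with
  | one => rw [monOp_monOne]; simpa [monLength, monOne] using hv
  | mul i m hs ih =>
    rw [monOp_varMul' _ hT.comm hT.odd_sq i m hs, monLength_varMul i m hs]
    have := h i _ _ ih
    rw [show d - 2 * ((monLength m + 1 : ℕ) : ℤ) = d - 2 * (monLength m : ℤ) - 2 by push_cast; ring]
    exact zsmul_mem this _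

/-- This exhibits the grading as a polynomial grading with coefficients in degree `-2`, so that one
set of lemmas serves `∂` and `λ`. -/
theorem rwGrading_eq (d : ℤ) : rwGrading F r s d =
    polyGrading r s (fun c : ℤ => if c = -2 then (⊤ : Submodule F (Var r s → F)) else ⊥) d := by
  ext P
  refine forall_congr' fun m => ?_
  change _ ↔ P m ∈ (if d + 2 * (monLength m : ℤ) = -2 then _ else _)
  by_cases h : d + 2 * (monLength m : ℤ) = -2
  · rw [if_pos h]
    exact ⟨fun _ => trivial, fun _ h' => absurd (by linarith) h'⟩
  · rw [if_neg h, Submodule.mem_bot]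
    exact ⟨fun h' => h' fun e => h (by linarith), fun h' _ => h'⟩

theorem rwD_grading (i : Var r s) {d : ℤ} {Q : RWSpace F r s} (hQ : Q ∈ rwGrading F r s d) :
    rwD F i Q ∈ rwGrading F r s (d - 2) := by
  rw [rwGrading_eq] at hQ ⊢
  exact mulVar_polyGrading i hQ

theorem rwGen_grading (i : Var r s) : rwGen F i ∈ rwGrading F r s (-2) := by
  rw [rwGrading_eq]
  refine single_mem_polyGrading ?_
  rw [if_pos (by simp [monLength, monOne])]
  exact trivial

theorem span_rwBasis {c : ℤ} {Q : RWSpace F r s} (hQ : Q ∈ rwGrading F r s c) :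
    Q ∈ Submodule.span F {P | ∃ m i, -2 - 2 * (monLength m : ℤ) = c ∧ P = rwBasis F m i} := by
  have eQ : Q = ∑ m ∈ Q.support, Finsupp.single m (Q m) := (Finsupp.sum_single Q).symm
  rw [eQ]
  refine sum_mem fun m hm => ?_
  have hc : -2 - 2 * (monLength m : ℤ) = c := by
    by_contra h
    exact Finsupp.mem_support_iff.mp hm (hQ m h)
  have ev : (Finsupp.single m (Q m) : RWSpace F r s) = ∑ i, Q m i • rwBasis F m i := by
    have e : Q m = ∑ i, Q m i • (Pi.single i 1 : Var r s → F) := by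
      funext k
      simp [Finset.sum_apply, Pi.single_apply]
    have e' := congrArg (Finsupp.lsingle (R := F) m) e
    rw [map_sum] at e'
    exact e'.trans (Finset.sum_congr rfl fun i _ => map_smul _ _ _)
  rw [ev]
  exact sum_mem fun i _ => Submodule.smul_mem _ _ (Submodule.subset_span ⟨m, i, hc, rfl⟩)

theorem rwDP_grading (i : Var r s) {c : ℤ} {P : PolyG r s (RWSpace F r s)}
    (hP : P ∈ polyGrading r s (rwGrading F r s) c) :
    rwDP F i P ∈ polyGrading r s (rwGrading F r s) (c - 2) :=
  coeffAct_polyGrading (t := -2) _ (fun _ _ hv => rwD_grading i hv) hP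

theorem rwLam_grading (i : Var r s) {c : ℤ} {P : PolyG r s (RWSpace F r s)}
    (hP : P ∈ polyGrading r s (rwGrading F r s) c) :
    rwLam F i P ∈ polyGrading r s (rwGrading F r s) (c - 2) :=
  mulVar_polyGrading i hP

theorem rwGenBr_grading (i j : Var r s) :
    rwGenBr F i j ∈ polyGrading r s (rwGrading F r s) (-2 - 2) := by
  have hgen : ∀ i : Var r s, (Finsupp.single monOne (rwGen F i) : PolyG r s (RWSpace F r s)) ∈
      polyGrading r s (rwGrading F r s) (-2) := by
    intro i
    refine single_mem_polyGrading ?_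
    rw [show (-2 : ℤ) + 2 * (monLength (monOne : Mon r s) : ℤ) = -2 by simp [monLength, monOne]]
    exact rwGen_grading i
  exact add_mem (add_mem (rwDP_grading i (hgen j)) (rwLam_grading i (hgen j)))
    (zsmul_mem (rwLam_grading j (hgen i)) _)

theorem rwBracket_basis_grading (m n : Mon r s) (i j : Var r s) :
    (RW F r s).bracket (rwBasis F m i) (rwBasis F n j) ∈ polyGrading r s (rwGrading F r s)
      (-2 - 2 - 2 * (monLength n : ℤ) - 2 * (monLength m : ℤ)) := by
  rw [rwBracket_basis]
  refine zsmul_mem ?_ _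
  refine monOp_lower (polyGrading r s (rwGrading F r s)) superCommuting_rwLam.neg
    (fun k c P hP => ?_) m ?_
  · exact neg_mem (rwLam_grading k hP)
  · refine monOp_lower (polyGrading r s (rwGrading F r s)) superCommuting_rwDP_lam
      (fun k c P hP => ?_) n (rwGenBr_grading i j)
    exact add_mem (rwDP_grading k hP) (rwLam_grading k hP)

theorem rwBracket_grading {d e : ℤ} {a b : RWSpace F r s} (ha : a ∈ rwGrading F r s d)
    (hb : b ∈ rwGrading F r s e) :
    (RW F r s).bracket a b ∈ polyGrading r s (rwGrading F r s) (d + e) := by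
  have ha' := span_rwBasis ha
  clear ha
  induction ha' using Submodule.span_induction with
  | zero => rw [map_zero, LinearMap.zero_apply]; exact zero_mem _
  | add x y _ _ hx hy => rw [map_add, LinearMap.add_apply]; exact add_mem hx hy
  | smul c x _ hx => rw [map_smul, LinearMap.smul_apply]; exact Submodule.smul_mem _ c hx
  | mem x hx =>
    obtain ⟨m, i, hm, rfl⟩ := hx
    have hb' := span_rwBasis hb
    clear hb
    induction hb' using Submodule.span_induction with
    | zero => rw [map_zero]; exact zero_mem _
    | add x y _ _ hx hy => rw [map_add]; exact add_mem hx hy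
    | smul c x _ hx => rw [map_smul]; exact Submodule.smul_mem _ c hx
    | mem x hx =>
      obtain ⟨n, j, hn, rfl⟩ := hx
      have := rwBracket_basis_grading (F := F) m n i j
      rwa [show -2 - 2 - 2 * (monLength n : ℤ) - 2 * (monLength m : ℤ) = d + e by
        linarith] at this

theorem reB_grading {d : ℤ} {Q : RWSpace F 4 4} (hQ : Q ∈ rwGrading F 4 4 d) :
    reB F Q ∈ rwGrading F 4 4 (d - 2 - 2) := by
  rw [reB, LinearMap.sum_apply]
  exact sum_mem fun i _ => rwD_grading _ (rwD_grading _ hQ)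

theorem reNu_grading (i : Fin 4) {d : ℤ} {Q : RWSpace F 4 4} (hQ : Q ∈ rwGrading F 4 4 d) :
    reNu F (.inl i) Q ∈ rwGrading F 4 4 (d - 2 - 2 - 2) := by
  have key : ∀ i j k, rwD F (.inr i) (rwD F (.inr j) (rwD F (.inr k) Q)) ∈
      rwGrading F 4 4 (d - 2 - 2 - 2) := fun i j k =>
    rwD_grading _ (rwD_grading _ (rwD_grading _ hQ))
  fin_cases i
  · exact key 1 2 3
  · exact neg_mem (key 0 2 3)
  · exact key 0 1 3
  · exact neg_mem (key 0 1 2)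

/-- Every term of `α_i` applies four derivatives to a generator of degree `-2`. -/
theorem reAlpha_grading (i : Var 4 4) : reAlpha F i ∈ rwGrading F 4 4 (-10) := by
  have hC : reC F ∈ rwGrading F 4 4 (-2 - 2) :=
    sum_mem fun i _ => add_mem (rwD_grading _ (rwGen_grading _)) (rwD_grading _ (rwGen_grading _))
  have hBN : reBNu F ∈ rwGrading F 4 4 (-2 - 2 - 2 - 2) :=
    sum_mem fun i _ => reNu_grading _ (rwGen_grading _)
  rw [show (-10 : ℤ) = -2 - 2 - 2 - 2 - 2 by norm_num]
  refine add_mem (sub_mem (rwD_grading i (reB_grading hC)) (Submodule.smul_mem _ _ ?_))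
    (rwD_grading i hBN)
  rcases i with i | i
  · exact reNu_grading i hC
  · rw [reNu_inr]; exact zero_mem _

end PolyGrading

/-! ## Topology and grading of the annihilation algebra -/

section AnnTopology

universe u w

variable {F : Type u} [Field F] [CharZero F] {R : Type w} [AddCommGroup R] [Module F R]
  {S : LieConformalSuperalgebra F 4 4 R} {φ : R →ₗ[F] RWSpace F 4 4}

namespace IsRE

/-- The elements whose vector field has coefficients supported in lengths in `A`. -/
def annSupp (h : IsRE S φ) (A : Set ℕ) : Submodule F S.Ann where
  carrier := {x | ∀ k, h.annVF x k ∈ suppIn F 4 4 A}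
  zero_mem' := fun k => by rw [map_zero]; exact zero_mem _
  add_mem' := fun hx hy k => by rw [map_add]; exact add_mem (hx k) (hy k)
  smul_mem' := fun c x hx k => by rw [map_smul]; exact Submodule.smul_mem _ c (hx k)

theorem reAlpha_length {i : Var 4 4} {m : Mon 4 4} (hm : reAlpha F i m ≠ 0) :
    monLength m ∈ ({4} : Set ℕ) := by
  by_contra h
  refine hm (reAlpha_grading i m fun e => h ?_)
  rw [Set.mem_singleton_iff]
  omega

theorem single_univ_suppIn {A : Set ℕ} {g : MvPowerSeries (Fin 4) F}
    (hg : ∀ e, e.degree ∉ A → MvPowerSeries.coeff e g = 0) :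
    (Pi.single Finset.univ g : Series F 4 4) ∈ suppIn F 4 4 {l | ∃ a ∈ A, l = a + 4} := by
  rintro ⟨e, T⟩ hm
  by_cases hT : T = Finset.univ
  · subst hT
    change MvPowerSeries.coeff e ((Pi.single Finset.univ g : Series F 4 4) Finset.univ) = 0
    rw [Pi.single_eq_same]
    exact hg e fun he => hm ⟨_, he, rfl⟩
  · change MvPowerSeries.coeff e ((Pi.single Finset.univ g : Series F 4 4) T) = 0
    rw [Pi.single_eq_of_ne hT, map_zero]

/-- The support of the whole field is governed by its part at odd variables zero: the four
derivatives in `α_i` remove exactly the length added by the top odd monomial. -/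
theorem mem_annSupp_iff (h : IsRE S φ) {A : Set ℕ} {x : S.Ann} : x ∈ h.annSupp A ↔
    ∀ k, ∀ e : Fin 4 →₀ ℕ, e.degree ∉ A → MvPowerSeries.coeff e (h.coordEquiv x k) = 0 := by
  refine ⟨fun hx k e he => hx k (e, ∅) he, fun hx => ?_⟩
  rw [← h.coordEquiv.symm_apply_apply x, symm_eq_annOf, annOf_apply]
  refine sum_mem fun i _ k => ?_
  rw [annVF_tmul, map_gen]
  refine suppIn_mono ?_ (toVF_suppIn (fun m => reAlpha_length)
    (single_univ_suppIn (A := A) (fun e he => ?_)) k)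
  · rintro l ⟨c, rfl, a, ha, hl⟩
    rwa [Nat.add_right_cancel hl]
  · rw [map_neg, map_smul, hx i e he, smul_zero, neg_zero]

theorem bracket_mem_annSupp (h : IsRE S φ) {A B : Set ℕ} {x y : S.Ann} (hx : x ∈ h.annSupp A)
    (hy : y ∈ h.annSupp B) :
    S.ann.bracket x y ∈ h.annSupp {l | ∃ a ∈ A, ∃ b ∈ B, l + 1 = a + b} := fun k => by
  rw [annVF_bracket]
  exact vfBracket_suppIn hx hy k

/-- A fixed `a` involves derivatives of bounded order only, so its fields have coefficients of high
order as soon as the series does. -/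
theorem annSupp_isOpenSubspace (h : IsRE S φ) (n : ℕ) :
    S.IsOpenSubspace (h.annSupp (Set.Ici n)) := by
  intro a
  obtain ⟨N, hN⟩ : ∃ N, ∀ m, φ a m ≠ 0 → monLength m ∈ Set.Iic N := by
    refine ⟨(φ a).support.sup monLength, fun m hm => ?_⟩
    exact Finset.le_sup (f := monLength) (Finsupp.mem_support_iff.mpr hm)
  refine ⟨n + N, fun f hf k => ?_⟩
  rw [annVF_tmul]
  refine suppIn_mono ?_ (toVF_suppIn hN (seriesOrderGE_iff.mp hf) k)
  rintro l ⟨c, hc, hl⟩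
  simp only [Set.mem_Iic, Set.mem_Ici] at hc hl ⊢
  omega

/-- Only the eight `α_k` occur in `annOf`, so a common bound exists. The `annSupp (Set.Ici n)` are
thus a basis of neighbourhoods of zero. -/
theorem exists_annSupp_le (h : IsRE S φ) {U : Submodule F S.Ann} (hU : S.IsOpenSubspace U) :
    ∃ n, h.annSupp (Set.Ici n) ≤ U := by
  choose N hN using fun k => hU (h.gen k)
  refine ⟨Finset.univ.sup N, fun x hx => ?_⟩
  rw [← h.coordEquiv.symm_apply_apply x, symm_eq_annOf, annOf_apply]
  refine sum_mem fun k _ => hN k _ (seriesOrderGE_iff.mpr ?_)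
  refine suppIn_mono ?_ (single_univ_suppIn (A := Set.Ici (Finset.univ.sup N)) (fun e he => ?_))
  · rintro l ⟨a, ha, rfl⟩
    have := Finset.le_sup (f := N) (Finset.mem_univ k)
    simp only [Set.mem_Ici] at ha ⊢
    omega
  · rw [map_neg, map_smul, h.mem_annSupp_iff.mp hx k e he, smul_zero, neg_zero]

theorem isOpen_iff (h : IsRE S φ) {s : Set S.Ann} :
    IsOpen s ↔ ∀ x ∈ s, ∃ n, ∀ u ∈ h.annSupp (Set.Ici n), x + u ∈ s := by
  constructor
  · intro hs x hx
    obtain ⟨U, hU, hUs⟩ := hs x hx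
    obtain ⟨n, hn⟩ := h.exists_annSupp_le hU
    exact ⟨n, fun u hu => hUs u (hn hu)⟩
  · intro hs x hx
    obtain ⟨n, hn⟩ := hs x hx
    exact ⟨_, h.annSupp_isOpenSubspace n, hn⟩

theorem isOpen_coset (h : IsRE S φ) (n : ℕ) (x : S.Ann) :
    IsOpen {y | y - x ∈ h.annSupp (Set.Ici n)} := by
  refine h.isOpen_iff.mpr fun y hy => ⟨n, fun u hu => ?_⟩
  change y + u - x ∈ h.annSupp (Set.Ici n)
  rw [add_sub_right_comm]
  exact add_mem hy hu

theorem continuous_bracket (h : IsRE S φ) :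
    Continuous fun z : S.Ann × S.Ann => S.ann.bracket z.1 z.2 := by
  refine continuous_def.mpr fun s hs => isOpen_prod_iff.mpr fun a b hab => ?_
  obtain ⟨n, hn⟩ := h.isOpen_iff.mp hs _ hab
  -- The bound is `n + 1` because the bracket can lower the order by one.
  refine ⟨_, _, h.isOpen_coset (n + 1) a, h.isOpen_coset (n + 1) b, ?_, ?_, ?_⟩
  · change a - a ∈ h.annSupp _; rw [sub_self]; exact zero_mem _
  · change b - b ∈ h.annSupp _; rw [sub_self]; exact zero_mem _
  · rintro ⟨x, y⟩ ⟨hx, hy⟩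
    change x - a ∈ h.annSupp _ at hx
    change y - b ∈ h.annSupp _ at hy
    have mem : ∀ z : S.Ann, z ∈ h.annSupp Set.univ := fun z k m hm =>
      absurd trivial hm
    have h1 : S.ann.bracket (x - a) y ∈ h.annSupp (Set.Ici n) := fun k => by
      refine suppIn_mono ?_ (h.bracket_mem_annSupp hx (mem y) k)
      rintro l ⟨c, hc, d, -, e⟩
      simp only [Set.mem_Ici] at hc ⊢
      omega
    have h2 : S.ann.bracket a (y - b) ∈ h.annSupp (Set.Ici n) := fun k => by
      refine suppIn_mono ?_ (h.bracket_mem_annSupp (mem a) hy k)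
      rintro l ⟨c, -, d, hd, e⟩
      simp only [Set.mem_Ici] at hd ⊢
      omega
    have := hn _ (add_mem h1 h2)
    change S.ann.bracket a b + (S.ann.bracket (x - a) y + S.ann.bracket a (y - b)) ∈ s at this
    rwa [map_sub, map_sub, LinearMap.sub_apply, sub_add_sub_cancel, add_sub_cancel] at this

/-- Indices of the coordinates of the annihilation algebra. -/
abbrev Coord : Type (max u w) := ULift.{max u w} (Var 4 4 × (Fin 4 →₀ ℕ))

/-- The scalar coordinates of the annihilation algebra. -/
def scalarEquiv (h : IsRE S φ) : S.Ann ≃ₗ[F] (Coord.{u, w} → F) :=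
  h.coordEquiv.trans
    { toFun := fun g z => g z.down.1 z.down.2
      invFun := fun c k e => c ⟨(k, e)⟩
      map_add' := fun _ _ => rfl
      map_smul' := fun _ _ => rfl
      left_inv := fun _ => rfl
      right_inv := fun _ => rfl }

theorem scalarEquiv_apply (h : IsRE S φ) (x : S.Ann) (z : Coord.{u, w}) :
    h.scalarEquiv x z = MvPowerSeries.coeff z.down.2 (h.coordEquiv x z.down.1) := rfl

theorem mem_annSupp_iff_scalar (h : IsRE S φ) {A : Set ℕ} {x : S.Ann} : x ∈ h.annSupp A ↔
    ∀ z : Coord.{u, w}, z.down.2.degree ∉ A → h.scalarEquiv x z = 0 :=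
  h.mem_annSupp_iff.trans ⟨fun hx z => hx _ _, fun hx k e => hx ⟨(k, e)⟩⟩

theorem continuous_scalarEquiv [TopologicalSpace F] [DiscreteTopology F] (h : IsRE S φ) :
    Continuous h.scalarEquiv := by
  refine continuous_pi fun z => continuous_def.mpr fun s _ => h.isOpen_iff.mpr fun x hx =>
    ⟨z.down.2.degree + 1, fun u hu => ?_⟩
  change h.scalarEquiv (x + u) z ∈ s
  rw [map_add, Pi.add_apply, h.mem_annSupp_iff_scalar.mp hu z (by simp), add_zero]
  exact hx

theorem continuous_scalarEquiv_symm [TopologicalSpace F] [DiscreteTopology F] (h : IsRE S φ) :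
    Continuous h.scalarEquiv.symm := by
  refine continuous_def.mpr fun s hs => isOpen_iff_forall_mem_open.mpr fun c hc => ?_
  obtain ⟨n, hn⟩ := h.isOpen_iff.mp hs _ hc
  -- Only finitely many coordinates have degree below `n`, so prescribing them is an open condition
  -- in the product topology.
  refine ⟨Set.pi {z : Coord.{u, w} | z.down.2.degree < n} fun z => {c z}, fun c' hc' => ?_,
    isOpen_set_pi ?_ fun _ _ => isOpen_discrete _, fun z _ => rfl⟩
  · have := hn (h.scalarEquiv.symm (c' - c)) (h.mem_annSupp_iff_scalar.mpr fun z hz => by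
      rw [LinearEquiv.apply_symm_apply, Pi.sub_apply, sub_eq_zero]
      exact hc' z (show z.down.2.degree < n from not_le.mp hz))
    rwa [map_sub, add_sub_cancel] at this
  · have : Set.Finite (Set.univ ×ˢ {e : Fin 4 →₀ ℕ | e.degree ≤ n} : Set (Var 4 4 × _)) :=
      Set.finite_univ.prod (Finsupp.finite_of_degree_le n)
    exact (this.preimage ULift.down_injective.injOn).subset fun z hz =>
      ⟨trivial, le_of_lt (a := z.down.2.degree) hz⟩

theorem ann_isLinearlyCompact (h : IsRE S φ) : S.ann.IsLinearlyCompact := by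
  refine ⟨h.ann_isLieSuperalgebra, h.continuous_bracket, ?_⟩
  let _ : TopologicalSpace F := ⊥
  have : DiscreteTopology F := ⟨rfl⟩
  refine ⟨Coord.{u, w}, fun z => varParity z.down.1, h.scalarEquiv, h.continuous_scalarEquiv,
    h.continuous_scalarEquiv_symm, fun p x => ?_⟩
  rw [h.mem_par_iff]
  exact ⟨fun hx z hz => by rw [scalarEquiv_apply, hx _ hz, map_zero],
    fun hx k hk => MvPowerSeries.ext fun e => hx ⟨(k, e)⟩ hk⟩

end IsRE

end AnnTopology

/-- The coefficients of the constant field have zero derivatives, so only its action on the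
coefficients of `w` remains. -/
theorem vfBracket_const {F : Type*} [Field F] {r s : ℕ} (k : Var r s) (w : VF F r s) :
    vfBracket (Pi.single k (seriesMon F monOne)) w = vfD k w := by
  have hv : (Pi.single k (seriesMon F monOne) : VF F r s) ∈ vfPar F r s (varParity k) := by
    intro i
    by_cases hi : i = k
    · subst hi
      rw [Pi.single_eq_same, CharTwo.add_self_eq_zero]
      intro T hT
      rw [seriesMon, Pi.single_eq_of_ne]
      rintro rfl
      exact hT (by simp [monOne])
    · rw [Pi.single_eq_of_ne hi]; exact zero_mem _
  have hD : ∀ i, seriesD i (seriesMon F (monOne : Mon r s)) = 0 := by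
    intro i
    funext T
    refine MvPowerSeries.ext fun e => ?_
    obtain ⟨c, hc, h0⟩ := coeff_seriesD (F := F) i (e, T) (seriesMon F monOne)
    refine hc.trans ?_
    by_cases hs : varSign i (e, T) = 0
    · rw [h0 hs, zero_mul]; rfl
    · rw [coeff_seriesMon, if_neg, mul_zero]
      · rfl
      · intro e1
        have := congrArg monLength e1
        rw [monLength_varMul i _ hs] at this
        simp [monLength, monOne] at this
  have main : ∀ q, ∀ w ∈ vfPar F r s q, vfBracket (Pi.single k (seriesMon F monOne)) w =
      vfD k w := by
    intro q w hw
    funext l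
    have h0 : lieDer w ((Pi.single k (seriesMon F monOne) : VF F r s) l) = 0 := by
      rw [lieDer_apply]
      refine Finset.sum_eq_zero fun i _ => ?_
      by_cases hl : l = k
      · subst hl; rw [Pi.single_eq_same, hD, map_zero]
      · rw [Pi.single_eq_of_ne hl, map_zero, map_zero]
    rw [vfBracket_apply hv hw, h0, smul_zero, sub_zero, vfD_apply, lieDer_apply,
      Finset.sum_eq_single k]
    · rw [Pi.single_eq_same, serMul_one_left]
    · intro i _ hi
      rw [Pi.single_eq_of_ne hi, map_zero, LinearMap.zero_apply]
    · simp
  rw [vf_parts w, map_add, map_add, main 0 _ (vfPart_mem 0 w), main 1 _ (vfPart_mem 1 w)]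

/-! ### The induced grading and its component of degree `-2` -/

section AnnGrading

universe u w

variable {F : Type u} [Field F] [CharZero F] {R : Type w} [AddCommGroup R] [Module F R]
  {S : LieConformalSuperalgebra F 4 4 R} {φ : R →ₗ[F] RWSpace F 4 4}

namespace IsRE

/-- The grading induced by `RW(4, 4)`. -/
def grading (φ : R →ₗ[F] RWSpace F 4 4) (d : ℤ) : Submodule F R := (rwGrading F 4 4 d).comap φ

/-- The lengths of the coefficients in degree `j`. -/
def degSet (j : ℤ) : Set ℕ := {l | 2 * (l : ℤ) - 2 = j}

/-- The element `α_k y^e y_5 y_6 y_7 y_8` has degree `-10 + 2(|e| + 4) = 2|e| - 2`. Conversely `a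
y^m` loses one length for each derivative in `a`. -/
theorem annGrading_eq (h : IsRE S φ) (j : ℤ) :
    S.annGrading (grading φ) j = h.annSupp (degSet j) := by
  apply le_antisymm
  · refine Submodule.span_le.mpr ?_
    rintro _ ⟨d, a, ha, m, hm, rfl⟩ k
    rw [annVF_tmul]
    refine suppIn_mono ?_ (toVF_suppIn (C := {c | -2 - 2 * (c : ℤ) = d}) (fun n hn => ?_)
      (seriesMon_suppIn (A := {monLength m}) rfl) k)
    · rintro l ⟨c, hc, hl⟩
      simp only [Set.mem_ofPred_eq, Set.mem_singleton_iff, degSet] at hc hl ⊢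
      omega
    · by_contra hc
      exact hn (ha n hc)
  · intro x hx
    rw [← h.coordEquiv.symm_apply_apply x, symm_eq_annOf, annOf_apply]
    refine sum_mem fun k _ => ?_
    have hfin : {e : Fin 4 →₀ ℕ | e.degree ∈ degSet j}.Finite :=
      (Finsupp.finite_of_degree_le (j + 2).toNat).subset fun e he => by
        simp only [Set.mem_ofPred_eq, degSet] at he ⊢
        omega
    -- A fixed degree admits finitely many monomials, so the series is a finite sum and the
    -- algebraic span suffices.
    have hg : ∀ g : MvPowerSeries (Fin 4) F,
        (∀ e, e.degree ∉ degSet j → MvPowerSeries.coeff e g = 0) →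
        g = ∑ e ∈ hfin.toFinset, MvPowerSeries.coeff e g • MvPowerSeries.monomial e 1 := by
      classical
      intro g hg
      refine MvPowerSeries.ext fun e => ?_
      rw [map_sum]
      simp only [map_smul, MvPowerSeries.coeff_monomial, smul_eq_mul, mul_ite, mul_one, mul_zero,
        Finset.sum_ite_eq]
      split_ifs with he
      · rfl
      · exact hg e fun h' => he (hfin.mem_toFinset.mpr h')
    rw [hg (-((alphaLead F k)⁻¹ • h.coordEquiv x k)) fun e he => by
      rw [map_neg, map_smul, h.mem_annSupp_iff.mp hx k e he, smul_zero, neg_zero]]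
    have e1 : ∀ g : MvPowerSeries (Fin 4) F,
        S.annMk (h.gen k ⊗ₜ[F] (Pi.single Finset.univ g : Series F 4 4)) =
        (S.annMk.comp ((TensorProduct.mk F R (Series F 4 4) (h.gen k)).comp
          (LinearMap.single F (fun _ : Finset (Fin 4) => MvPowerSeries (Fin 4) F)
            Finset.univ))) g := fun g => rfl
    rw [e1, map_sum]
    refine sum_mem fun e he => ?_
    rw [map_smul]
    refine Submodule.smul_mem _ _ (Submodule.subset_span ⟨-10, h.gen k, ?_, (e, Finset.univ), ?_,
      rfl⟩)
    · change φ (h.gen k) ∈ rwGrading F 4 4 (-10)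
      rw [map_gen]
      exact reAlpha_grading k
    · have hd : 2 * ((e.degree : ℕ) : ℤ) - 2 = j := hfin.mem_toFinset.mp he
      have hl : monLength ((e, Finset.univ) : Mon 4 4) = e.degree + 4 := rfl
      rw [hl]
      push_cast
      linarith

open Classical in
/-- The component of degree `j` of an element of the annihilation algebra. -/
def component (h : IsRE S φ) (j : ℤ) : S.Ann →ₗ[F] S.Ann :=
  h.scalarEquiv.symm.toLinearMap.comp ((LinearMap.pi fun z : Coord.{u, w} =>
    (if z.down.2.degree ∈ degSet j then LinearMap.proj z else 0)).comp h.scalarEquiv.toLinearMap)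

open Classical in
theorem scalar_component (h : IsRE S φ) (j : ℤ) (x : S.Ann) (z : Coord.{u, w}) :
    h.scalarEquiv (h.component j x) z =
      if z.down.2.degree ∈ degSet j then h.scalarEquiv x z else 0 := by
  rw [component, LinearMap.comp_apply, LinearEquiv.coe_coe, LinearEquiv.apply_symm_apply,
    LinearMap.comp_apply, LinearMap.pi_apply]
  split_ifs <;> rfl

/-- In scalar coordinates the components use disjoint sets of coordinates that exhaust all of them,
so the product decomposition is a regrouping of a product of lines. -/
theorem ann_isProductGrading (h : IsRE S φ) :
    S.ann.IsProductGrading (S.annGrading (grading φ)) := by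
  have hG : S.annGrading (grading φ) = fun j => h.annSupp (degSet j) := funext h.annGrading_eq
  rw [hG]
  refine ⟨fun i j x hx y hy k => suppIn_mono ?_ (h.bracket_mem_annSupp hx hy k), ?_⟩
  · rintro l ⟨a, ha, b, hb, e⟩
    simp only [Set.mem_ofPred_eq, degSet] at ha hb ⊢
    omega
  classical
  have memc : ∀ j x, h.component j x ∈ h.annSupp (degSet j) := fun j x =>
    h.mem_annSupp_iff_scalar.mpr fun z hz => by rw [scalar_component, if_neg hz]
  have degc : ∀ z : Coord.{u, w}, z.down.2.degree ∈ degSet (2 * (z.down.2.degree : ℤ) - 2) :=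
    fun z => rfl
  let e : S.Ann ≃ₗ[F] (∀ j, h.annSupp (degSet j)) :=
    { toFun := fun x j => ⟨h.component j x, memc j x⟩
      map_add' := fun x y => funext fun j => Subtype.ext (map_add _ x y)
      map_smul' := fun c x => funext fun j => Subtype.ext (map_smul _ c x)
      -- The coordinate at `y^e` is read from the component of degree `2|e| - 2`, the only one in
      -- which it can be nonzero.
      invFun := fun y => h.scalarEquiv.symm fun z =>
        h.scalarEquiv (y (2 * (z.down.2.degree : ℤ) - 2)) z
      left_inv := fun x => by
        rw [LinearEquiv.symm_apply_eq]
        funext z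
        rw [scalar_component, if_pos (degc z)]
      right_inv := fun y => funext fun j => Subtype.ext (h.scalarEquiv.injective (funext fun z => by
        rw [scalar_component]
        split_ifs with hz
        · rw [LinearEquiv.apply_symm_apply]
          have : 2 * (z.down.2.degree : ℤ) - 2 = j := hz
          rw [this]
        · exact (h.mem_annSupp_iff_scalar.mp (y j).2 z hz).symm)) }
  let _ : TopologicalSpace F := ⊥
  have : DiscreteTopology F := ⟨rfl⟩
  refine ⟨e, ?_, ?_, fun j x => ?_⟩
  · refine continuous_pi fun j => Continuous.subtype_mk ?_ _
    have ec : (fun x => h.component j x) = fun x => h.scalarEquiv.symm fun z =>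
        if z.down.2.degree ∈ degSet j then h.scalarEquiv x z else 0 := by
      funext x
      refine h.scalarEquiv.injective (funext fun z => ?_)
      rw [scalar_component, LinearEquiv.apply_symm_apply]
    change Continuous fun x => h.component j x
    rw [ec]
    refine h.continuous_scalarEquiv_symm.comp (continuous_pi fun z => ?_)
    split_ifs
    · exact (continuous_apply z).comp h.continuous_scalarEquiv
    · exact continuous_const
  · refine h.continuous_scalarEquiv_symm.comp (continuous_pi fun z => ?_)
    exact (continuous_apply z).comp (h.continuous_scalarEquiv.comp
      (continuous_subtype_val.comp (continuous_apply _)))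
  · funext i
    refine Subtype.ext (h.scalarEquiv.injective (funext fun z => ?_))
    change h.scalarEquiv (h.component i x) z = _
    rw [scalar_component]
    by_cases hij : i = j
    · subst hij
      rw [Pi.single_eq_same]
      split_ifs with hz
      · rfl
      · exact (h.mem_annSupp_iff_scalar.mp x.2 z hz).symm
    · rw [Pi.single_eq_of_ne hij]
      have e0 : h.scalarEquiv ((0 : h.annSupp (degSet i)) : S.Ann) z = 0 := by
        rw [Submodule.coe_zero, map_zero, Pi.zero_apply]
      rw [e0]
      split_ifs with hz
      · refine h.mem_annSupp_iff_scalar.mp x.2 z fun hz' => hij ?_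
        exact (show _ = i from hz).symm.trans hz'
      · rfl

/-- Only even degrees from `-2` upwards occur as `2l - 2`. -/
theorem annGrading_eq_bot (h : IsRE S φ) {j : ℤ} (hj : ∀ l : ℕ, 2 * (l : ℤ) - 2 ≠ j) :
    S.annGrading (grading φ) j = ⊥ := by
  rw [h.annGrading_eq, Submodule.eq_bot_iff]
  intro x hx
  refine h.scalarEquiv.injective (funext fun z => ?_)
  rw [h.mem_annSupp_iff_scalar.mp hx z (hj _), map_zero, Pi.zero_apply]

/-! ### The component of degree `-2` -/

theorem mem_degree_neg_two (h : IsRE S φ) {x : S.Ann} :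
    x ∈ S.annGrading (grading φ) (-2) ↔ ∃ c : Var 4 4 → F, ∀ k,
      h.annVF x k = c k • seriesMon F monOne := by
  have hd : degSet (-2) = {0} := by
    ext l
    simp only [degSet, Set.mem_ofPred_eq, Set.mem_singleton_iff]
    omega
  rw [h.annGrading_eq, hd]
  constructor
  · intro hx
    refine ⟨fun k => constTerm (h.annVF x k), fun k => eq_of_degLT_one fun m hm => hx k m ?_⟩
    rw [Set.mem_singleton_iff]
    omega
  · rintro ⟨c, hc⟩ k
    rw [hc]
    exact Submodule.smul_mem _ _ (seriesMon_suppIn (by simp [monLength, monOne]))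

theorem bracket_of_const (h : IsRE S φ) {x : S.Ann} {c : Var 4 4 → F}
    (hc : ∀ k, h.annVF x k = c k • seriesMon F monOne) :
    S.ann.bracket x = ∑ k, c k • S.annDy k := by
  refine LinearMap.ext fun y => h.annVF_injective ?_
  have e : h.annVF x = ∑ k, c k • (Pi.single k (seriesMon F monOne) : VF F 4 4) := by
    funext k
    rw [hc, Finset.sum_apply, Finset.sum_eq_single k]
    · rw [Pi.smul_apply, Pi.single_eq_same]
    · intro i _ hi
      rw [Pi.smul_apply, Pi.single_eq_of_ne hi.symm, smul_zero]
    · simp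
  rw [annVF_bracket, e, LinearMap.sum_apply, map_sum, map_sum, LinearMap.sum_apply]
  refine Finset.sum_congr rfl fun k _ => ?_
  rw [map_smul, LinearMap.smul_apply, vfBracket_const, LinearMap.smul_apply, map_smul,
    annVF_annDy]

/-- The element acting as `∂_{y_k}`. -/
def partialElt (h : IsRE S φ) (k : Var 4 4) : S.Ann := h.coordEquiv.symm (Pi.single k 1)

theorem partialElt_mem (h : IsRE S φ) (k : Var 4 4) :
    h.partialElt k ∈ S.annGrading (grading φ) (-2) := by
  classical
  rw [h.annGrading_eq, mem_annSupp_iff]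
  intro i e he
  rw [partialElt, LinearEquiv.apply_symm_apply]
  by_cases hi : i = k
  · subst hi
    rw [Pi.single_eq_same, MvPowerSeries.coeff_one, if_neg]
    rintro rfl
    exact he (by simp [degSet])
  · rw [Pi.single_eq_of_ne hi, map_zero]

/-- An element of degree `-2` has constant coefficients, which can be read off at odd variables
zero. -/
theorem annVF_partialElt (h : IsRE S φ) (k i : Var 4 4) :
    h.annVF (h.partialElt k) i = (Pi.single k 1 : Var 4 4 → F) i • seriesMon F monOne := by
  obtain ⟨c, hc⟩ := h.mem_degree_neg_two.mp (h.partialElt_mem k)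
  have e := congrFun (hc i) ∅
  rw [partialElt, annVF_symm] at e
  have e' := congrArg (MvPowerSeries.coeff 0) e
  rw [hc]
  congr 1
  rw [Pi.smul_apply, map_smul] at e'
  have e1 : MvPowerSeries.coeff (0 : Fin 4 →₀ ℕ) (seriesMon F (monOne : Mon 4 4) ∅) = 1 := by
    simp [seriesMon, monOne]
  rw [e1, smul_eq_mul, mul_one] at e'
  rw [← e']
  by_cases hi : i = k
  · subst hi; simp
  · rw [Pi.single_eq_of_ne hi, Pi.single_eq_of_ne hi, map_zero]

theorem bracket_partialElt (h : IsRE S φ) (k : Var 4 4) :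
    S.ann.bracket (h.partialElt k) = S.annDy k := by
  rw [h.bracket_of_const (h.annVF_partialElt k), Finset.sum_eq_single k]
  · rw [Pi.single_eq_same, one_smul]
  · intro i _ hi
    rw [Pi.single_eq_of_ne hi, zero_smul]
  · simp

theorem ad_image (h : IsRE S φ) : (S.annGrading (grading φ) (-2)).map S.ann.bracket =
    Submodule.span F (Set.range S.annDy) := by
  apply le_antisymm
  · rintro _ ⟨x, hx, rfl⟩
    obtain ⟨c, hc⟩ := h.mem_degree_neg_two.mp hx
    rw [h.bracket_of_const hc]
    exact sum_mem fun k _ => Submodule.smul_mem _ _ (Submodule.subset_span ⟨k, rfl⟩)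
  · refine Submodule.span_le.mpr ?_
    rintro _ ⟨k, rfl⟩
    exact ⟨_, h.partialElt_mem k, h.bracket_partialElt k⟩

/-- A constant field acting as zero annihilates the linear part of every field. The element with
even restriction `y_i ∂_{y_i}` has linear part `diag(E_ii, 1/2 - E_ii)`, which forces the constants
to vanish. -/
theorem ad_injective (h : IsRE S φ) {x : S.Ann} (hx : x ∈ S.annGrading (grading φ) (-2))
    (h0 : S.ann.bracket x = 0) : x = 0 := by
  obtain ⟨c, hc⟩ := h.mem_degree_neg_two.mp hx
  have hs : ∀ (y : S.Ann) (k : Var 4 4), ∑ i, c i * jac (h.annVF y) i k = 0 := by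
    intro y k
    have e := congrArg (fun T : Module.End F S.Ann => constTerm (h.annVF (T y) k)) h0
    simp only [h.bracket_of_const hc] at e
    rw [LinearMap.sum_apply, map_sum, Finset.sum_apply, map_sum, LinearMap.zero_apply, map_zero,
      Pi.zero_apply, map_zero] at e
    rw [← e]
    refine Finset.sum_congr rfl fun i _ => ?_
    rw [LinearMap.smul_apply, map_smul, Pi.smul_apply, map_smul, annVF_annDy, smul_eq_mul]
    rfl
  -- The coordinates may be prescribed freely; the lower right block then follows from the relations
  -- of `linE`.
  have hy : ∀ i : Fin 4, ∃ y : S.Ann, MatPar 0 (jac (h.annVF y)) ∧ jac (h.annVF y) ∈ linE F ∧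
      ∀ a b, jac (h.annVF y) (.inl a) (.inl b) = if a = i ∧ b = i then 1 else 0 := by
    intro i
    refine ⟨h.coordEquiv.symm (Pi.single (.inl i) (MvPowerSeries.X i)), ?_, ?_, fun a b => ?_⟩
    · refine jac_par (h.annVF_par (h.mem_par_of_coord fun k hk => ?_))
      rw [LinearEquiv.apply_symm_apply, Pi.single_eq_of_ne]
      rintro rfl
      exact hk rfl
    · exact jac_mem_of_prolong (h.annVF_mem_vfE _)
    · rw [jac_apply, constTerm_apply, seriesD_inl, annVF_symm]
      by_cases hb : b = i
      · subst hb
        rw [Pi.single_eq_same, MvPowerSeries.coeff_pderiv, MvPowerSeries.coeff_X, zero_add]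
        by_cases ha : a = b
        · subst ha; simp
        · rw [if_neg, if_neg (fun h' => ha h'.1), zero_mul]
          exact fun h' => ha (Finsupp.single_left_injective one_ne_zero h')
      · rw [Pi.single_eq_of_ne (by simpa using hb), map_zero, map_zero, if_neg fun h' => hb h'.2]
  have he : ∀ i, c (.inl i) = 0 := by
    intro i
    obtain ⟨y, hp, -, h1⟩ := hy i
    have := hs y (.inl i)
    rw [Fintype.sum_sum_type] at this
    have h2 : ∀ a, jac (h.annVF y) (.inr a) (.inl i) = 0 := fun a => hp _ _ (by simp [varParity])
    simpa [h1, h2] using this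
  have ho : ∀ j, c (.inr j) = 0 := by
    intro j
    obtain ⟨y, hp, hE, h1⟩ := hy j
    have := hs y (.inr j)
    rw [Fintype.sum_sum_type] at this
    -- The trace of the upper left block is 1, so the lower right block is `1/2 - E_jj`, with entry
    -- `-1/2` in position `(j, j)`.
    have h2 : ∀ a b, jac (h.annVF y) (.inr b) (.inr a) =
        (if a = b then 1 / 2 else 0) - if a = j ∧ b = j then 1 else 0 := by
      intro a b
      have := hE.1 a b
      rw [h1] at this
      simp only [h1, and_self, Finset.sum_ite_eq', Finset.mem_univ, if_true] at this
      have h3 : (if a = b then (1 : F) / 2 else 0) = (if a = b then 1 else 0) / 2 := by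
        split_ifs <;> simp
      rw [h3]
      linear_combination this / 2
    simp only [he, zero_mul, Finset.sum_const_zero, zero_add, h2] at this
    rw [Finset.sum_eq_single j] at this
    · norm_num at this
      exact this
    · intro b _ hb
      rw [if_neg hb.symm, if_neg fun h' => hb h'.2]
      simp
    · simp
  refine h.annVF_injective ?_
  rw [map_zero]
  funext k
  rw [hc, Pi.zero_apply]
  rcases k with k | k
  · rw [he, zero_smul]
  · rw [ho, zero_smul]

end IsRE

end AnnGrading

/-! ### The grading of RE(4,4) and the D-conformal structure -/

section Grading

universe u w

variable {F : Type u} [Field F] [CharZero F] {R : Type w} [AddCommGroup R] [Module F R]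
  {S : LieConformalSuperalgebra F 4 4 R} {φ : R →ₗ[F] RWSpace F 4 4}

namespace IsRE

theorem isInternal_grading (h : IsRE S φ) : DirectSum.IsInternal (grading φ) := by
  rw [DirectSum.isInternal_submodule_iff_iSupIndep_and_iSup_eq_top]
  constructor
  · intro d
    -- The elements without component of degree `d`; this subspace contains all other graded pieces
    -- and meets degree `d` in zero.
    let N : Submodule F R :=
      { carrier := {a | ∀ m, -2 - 2 * (monLength m : ℤ) = d → φ a m = 0}
        zero_mem' := fun m _ => by rw [map_zero]; rfl
        add_mem' := fun ha hb m hm => by rw [map_add, Finsupp.add_apply, ha m hm, hb m hm, add_zero]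
        smul_mem' := fun c a ha m hm => by rw [map_smul, Finsupp.smul_apply, ha m hm, smul_zero] }
    have hN : ⨆ e, ⨆ (_ : e ≠ d), grading φ e ≤ N := iSup₂_le fun e he a ha m hm =>
      ha m fun h' => he (h'.symm.trans hm)
    rw [disjoint_iff, Submodule.eq_bot_iff]
    rintro a ⟨ha, ha'⟩
    refine h.emb.injective ?_
    rw [map_zero]
    refine Finsupp.ext fun m => ?_
    by_cases hm : -2 - 2 * (monLength m : ℤ) = d
    · exact hN ha' m hm
    · exact ha m hm
  · refine Submodule.eq_top_iff'.mpr fun a => ?_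
    refine h.even_induction (C := fun a => a ∈ ⨆ d, grading φ d) (fun e i => ?_) (zero_mem _)
      (fun _ _ => add_mem) (fun c _ => Submodule.smul_mem _ c) a
    refine Submodule.mem_iSup_of_mem (-10 - 2 * (monLength ((e, ∅) : Mon 4 4) : ℤ)) ?_
    change φ _ ∈ rwGrading F 4 4 _
    rw [h.map_monOp, h.map_gen]
    exact monOp_lower (rwGrading F 4 4) superCommuting_rwD (fun i d v hv => rwD_grading i hv) _
      (reAlpha_grading i)

/-- Parity and degree are both conditions on the basis elements `∂^m a_i`, and no basis element
occurs in both `x` and `y`. -/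
theorem grading_parts (h : IsRE S φ) {d : ℤ} {x y : R} (hx : x ∈ S.par 0) (hy : y ∈ S.par 1)
    (hxy : x + y ∈ grading φ d) : x ∈ grading φ d ∧ y ∈ grading φ d := by
  have hx' : φ x ∈ rwPar F 4 4 0 := (h.emb.par 0 x).mp hx
  have hy' : φ y ∈ rwPar F 4 4 1 := (h.emb.par 1 y).mp hy
  have key : ∀ m, -2 - 2 * (monLength m : ℤ) ≠ d → ∀ i, φ x m i = 0 ∧ φ y m i = 0 := by
    intro m hm i
    have e : φ x m i + φ y m i = 0 := by
      have := congrFun (hxy m hm) i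
      rwa [map_add] at this
    by_cases hp : monParity m + varParity i = 0
    · have h1 : φ y m i = 0 := hy' m i (by rw [hp]; decide)
      rw [h1, add_zero] at e
      exact ⟨e, h1⟩
    · have h1 : φ x m i = 0 := hx' m i hp
      rw [h1, zero_add] at e
      exact ⟨h1, e⟩
  exact ⟨fun m hm => funext fun i => (key m hm i).1, fun m hm => funext fun i => (key m hm i).2⟩

theorem isGrading (h : IsRE S φ) : S.IsGrading (grading φ) where
  isInternal := h.isInternal_grading
  super d := by
    apply le_antisymm
    · intro a ha
      have ha' : a ∈ S.par 0 ⊔ S.par 1 := by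
        rw [S.par_isCompl.sup_eq_top]; exact Submodule.mem_top
      obtain ⟨x, hx, y, hy, rfl⟩ := Submodule.mem_sup.mp ha'
      obtain ⟨h1, h2⟩ := h.grading_parts hx hy ha
      exact Submodule.add_mem_sup ⟨h1, hx⟩ ⟨h2, hy⟩
    · exact sup_le inf_le_left inf_le_left
  deg_D i d a ha := by
    change φ _ ∈ rwGrading F 4 4 _
    rw [h.emb.D]
    exact rwD_grading i ha
  deg_bracket d e a ha b hb m := by
    have := rwBracket_grading ha hb m
    have e' : φ (S.bracket a b m) = (RW F 4 4).bracket (φ a) (φ b) m := by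
      have := congrArg (fun P : PolyG 4 4 (RWSpace F 4 4) => P m) (h.emb.bracket a b)
      exact this
    change φ _ ∈ rwGrading F 4 4 _
    rw [e']
    exact this

theorem isDConformalGrading (h : IsRE S φ) : S.IsDConformalGrading (grading φ) where
  isGrading := h.isGrading
  ann_isProductGrading := h.ann_isProductGrading
  depth j hj := h.annGrading_eq_bot fun l => by omega
  odd_neg_one := by rw [h.annGrading_eq_bot fun l => by omega]; exact bot_le
  odd_neg_three := by rw [h.annGrading_eq_bot fun l => by omega]; exact bot_le
  ad_mem_der x _ := h.ad_mem_der x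
  ad_injective _ := h.ad_injective
  ad_image := h.ad_image

theorem annGrading_neg_two_ne_bot (h : IsRE S φ) : S.annGrading (grading φ) (-2) ≠ ⊥ := by
  intro hb
  have h0 : h.partialElt (.inl 0) = 0 := by
    have := h.partialElt_mem (.inl 0)
    rwa [hb, Submodule.mem_bot] at this
  rw [partialElt, LinearEquiv.map_eq_zero_iff] at h0
  have := congrFun h0 (.inl 0)
  rw [Pi.single_eq_same] at this
  exact one_ne_zero this

theorem injOn_bracket (h : IsRE S φ) :
    Set.InjOn S.ann.bracket (S.annGrading (grading φ) (-2)) := fun x hx y hy e =>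
  sub_eq_zero.mp (h.ad_injective (sub_mem hx hy) (by rw [map_sub, e, sub_self]))

end IsRE

end Grading

theorem reLie_isRE (F : Type*) [Field F] [CharZero F] : IsRE (reLie F) (RESpace F).subtype where
  emb := reData_isEmbedding F
  range := Submodule.range_subtype _

end ConformalSuper

end

theorem mainTheorem3 (F : Type*) [Field F] [CharZero F] :
    ∃ RE : ConformalSuper.LieConformalSuperalgebra F 4 4 (ConformalSuper.RESpace F),
      -- the structure inherited from `RW(4, 4)`
      RE.toConformalData.IsInherited (ConformalSuper.RW F 4 4) ∧
      ConformalSuper.LieConformalSuperalgebra.HasDConformalStructure RE.ann RE ∧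
      -- the grading with `deg α_i = -10` is the required one
      (∀ i, ∃ h : ConformalSuper.reAlpha F i ∈ ConformalSuper.RESpace F,
        (⟨_, h⟩ : ConformalSuper.RESpace F) ∈ ConformalSuper.reGrading F (-10)) ∧
      RE.IsDConformalGrading (ConformalSuper.reGrading F) ∧
      -- the induced grading has depth exactly 2, with zero components in degrees -1 and -3
      RE.annGrading (ConformalSuper.reGrading F) (-2) ≠ ⊥ ∧
      (∀ j < -2, RE.annGrading (ConformalSuper.reGrading F) j = ⊥) ∧
      RE.annGrading (ConformalSuper.reGrading F) (-1) = ⊥ ∧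
      RE.annGrading (ConformalSuper.reGrading F) (-3) = ⊥ ∧
      -- `ad` is injective on degree -2, with image spanned by the derivations `∂_{y_i}`
      Set.InjOn RE.ann.bracket (RE.annGrading (ConformalSuper.reGrading F) (-2)) ∧
      (RE.annGrading (ConformalSuper.reGrading F) (-2)).map RE.ann.bracket =
        Submodule.span F (Set.range RE.annDy) := by
  have h := ConformalSuper.reLie_isRE F
  have hD := h.isDConformalGrading
  -- The linearly compact algebra is the annihilation algebra itself, so the required isomorphism is
  -- the identity.
  refine ⟨ConformalSuper.reLie F, ConformalSuper.reLie_isInherited F,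
    ⟨h.ann_isLinearlyCompact, ⟨LinearEquiv.refl F _, continuous_id, continuous_id,
      fun _ _ => Iff.rfl, fun _ _ => rfl⟩, _, hD⟩, fun i => ⟨?_, ?_⟩, hD,
    h.annGrading_neg_two_ne_bot, fun j hj => h.annGrading_eq_bot fun l => by omega,
    h.annGrading_eq_bot fun l => by omega, h.annGrading_eq_bot fun l => by omega,
    h.injOn_bracket, h.ad_image⟩
  · rw [← h.map_gen i]; exact h.map_mem _
  · exact ConformalSuper.reAlpha_grading i
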